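/- **Setting.** Let $m=2d$ be even, $n\ge 0$, $\theta\in\mathbb R\setminus\{0\}$, $\alpha\in\mathbb R\setminus\{-1,0\}$. Let $\mathcal A=\bigwedge V=\mathcal A_0\oplus\mathcal A_1$ with $V$ an infinite-dimensional real vector space. For $I=\{i_1<\dots<i_k\}\subseteq\{1,\dots,n\}$ write $\xi^I=\xi_{i_1}\cdots\xi_{i_k}$, and let $\varepsilon(I,J)$ be the sign with $\xi^I\xi^J=\varepsilon(I,J)\,\xi^{I\cup J}$ ($\varepsilon(I,J)=0$ if $I\cap J\ne\emptyset$). A superfunction on $\mathbb R^{m|n}$ with values in $E$ is $f(y,\xi)=\sum_I f_I(y)\xi^I$ with $f_I:\mathbb R^m\to E$; a superfunction on $\mathbb R^{m|n}\times\mathbb R^{m|n}$ is described likewise by coefficients in front of $\xi_1^I\xi_2^J$. For a locally convex space $E$, $\mathcal B_E(\mathbb R^{m|n})=\mathcal B_E(\mathbb R^m)\otimes\bigwedge\mathbb R^n$ is the space of those $f$ whose coefficients are smooth with every derivative bounded, with the topology of uniform convergence of all derivatives; it plays the role of the completed tensor product $E\widehat\otimes_\tau\mathcal B(\mathbb R^{m|n})$.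 On $H=\mathcal B(\mathbb R^{m|n})$ (values in $\mathbb C$) the product is the undeformed one $\tilde\mu(f\otimes g)(z)=f(z)g(z)$, the coproduct is $\Delta f(z_1,z_2)=f(z_1+z_2)$, the counit is $\epsilon(f)=f(0)$. Let $(\mathbf A,(|\cdot|_j)_{j\in\mathbb N})$ be a complex Fréchet algebra (complete, Hausdorff, with jointly continuous associative product $\mu_0$), ungraded or $\mathbb Z_2$-graded with continuous parity operator. Let $\rho$ be an action of the supergroup $\mathbb R^{m|n}$ on $\mathbf A$: for $z=(y,\xi)$, $y\in\mathbb R^m$, $\xi\in(\mathcal A_1)^n$, maps $\rho_z:\mathbf A\otimes\mathcal A\to\mathbf A\otimes\mathcal A$ such that * $\rho_0=\mathrm{id}$ and $\rho_{z_1+z_2}=\rho_{z_1}\rho_{z_2}$; * $\rho_z$ is an $\mathcal A$-linear and $\mathbb C$-linear automorphism of the (graded) tensor product algebra $\mathbf A\otimes\mathcal A$, preserving the total parity if $\mathbf A$ is graded; * $\rho_{(y,\xi)}(a)=\sum_I\rho_y(a)_I\,\xi^I$ with $y\mapsto\rho_y(a)_I\in\mathbf A$ continuous for all $a\in\mathbf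 A$ and $I$; * there is $C>0$ such that for all $I,j$ there is $k$ with $|\rho_y(a)_I|_j\le C|a|_k$ for all $a\in\mathbf A$, $y\in\mathbb R^m$. Let $\mathbf A^\infty$ be the space of those $a\in\mathbf A$ for which $\rho^a:z\mapsto\rho_z(a)$ is smooth (all $y\mapsto\rho_y(a)_I$ are $C^\infty$), with the topology of the seminorms $|a|_{j,\beta}=\sup_y\sum_I|D^\beta\rho_y(a)_I|_j$. Let $\widehat\otimes_\pi$ be the completed projective tensor product. Put $\tilde\omega(z_1,z_2)=\omega_0(y_1,y_2)+\frac{(1+\alpha)^2}{2\alpha}\sum_i\xi_1^i\xi_2^i$ with $\omega_0$ the standard symplectic form of $\mathbb R^{2d}$, $\kappa=\frac{(i\theta)^n(-1)^{n(n+1)/2}\alpha^n}{(\pi\theta)^m(1+\alpha)^{2n}}$, and $$F=\kappa\int dz_1\,dz_2\;e^{-\frac{2i}{\theta}\tilde\omega(z_1,z_2)}\,\rho_{z_1}\otimes\rho_{z_2},$$ where the integral is an iterated Berezin integral in the odd variables and an oscillating integral in the even ones. **Proposition.** The parity operator, the product and the action restrict to $\mathbf A^\infty$: the product gives a continuous linear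 map $\mu_0:\mathbf A^\infty\widehat\otimes_\pi\mathbf A^\infty\to\mathbf A^\infty$; the twist $F$ is a continuous endomorphism of $\mathbf A^\infty\widehat\otimes_\pi\mathbf A^\infty$; and $\chi(a)(z):=\rho_z(a)$ defines a continuous linear map $\chi:\mathbf A^\infty\to\mathcal B_{\mathbf A^\infty}(\mathbb R^{m|n})$. With $\mu_F:=\mu_0\circ F$, the pair $(\mathbf A^\infty,\mu_F)$ is again a Fréchet comodule algebra over the undeformed Hopf algebra $(\mathcal B(\mathbb R^{m|n}),\tilde\mu)$ for the coaction $\chi$. That is, $\mathbf A^\infty$ is a Fréchet space, $\mu_F$ is an associative continuous product compatible with the grading, and $$(\mathrm{id}\otimes\Delta)\chi=(\chi\otimes\mathrm{id})\chi,\qquad(\mathrm{id}\otimes\epsilon)\chi=\mathrm{id},\qquad(\mu_F\otimes\tilde\mu)\,\sigma_{23}\,(\chi\otimes\chi)=\chi\,\mu_F,$$ with $\sigma_{23}(a\otimes f\otimes b\otimes g)=(-1)^{|f||b|}\,a\otimes b\otimes f\otimes g$ (no sign if $\mathbf A$ is ungraded). Moreover a unit of $\mathbf A$ lies in $\mathbf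 A^\infty$ and is a unit of $\mu_F$, and $\chi(1)=1\otimes1$ whenever $\mu_F$ has a unit $1$. -/

import Mathlib

open scoped TensorProduct Topology UniformConvergence
open Filter UniformSpace

namespace SuperUDF

noncomputable section

set_option linter.unusedSectionVars false

/-! ### Smooth functions on `ℝ^σ` with values in a topological vector space -/

/-- The body `ℝ^σ` (Euclidean space). -/
abbrev Body (σ : Type) [Fintype σ] : Type := EuclideanSpace ℝ σ

section Smooth

variable {σ : Type} [Fintype σ] [DecidableEq σ]
variable {E : Type*} [AddCommGroup E] [Module ℂ E] [TopologicalSpace E]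

/-- `f` has partial derivative `v` at `x` in the direction of the `i`-th coordinate. -/
def HasPDeriv (f : Body σ → E) (i : σ) (x : Body σ) (v : E) : Prop :=
  Tendsto (fun t : ℝ => ((t⁻¹ : ℝ) : ℂ) • (f (x + t • EuclideanSpace.single i (1 : ℝ)) - f x))
    (𝓝[≠] (0 : ℝ)) (𝓝 v)

open Classical in
/-- The `i`-th partial derivative (`0` where it does not exist). -/
def pderiv (i : σ) (f : Body σ → E) (x : Body σ) : E :=
  if h : ∃ v, HasPDeriv f i x v then h.choose else 0

/-- The iterated partial derivative `D^α f`, where the multi-index `α` is written as the list of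
the coordinates with respect to which one differentiates. -/
def iterD : List σ → (Body σ → E) → Body σ → E
  | [], f => f
  | i :: l, f => pderiv i (iterD l f)

/-- `f` is `C^∞`: all iterated partial derivatives exist and are continuous. -/
def IsSmooth (f : Body σ → E) : Prop :=
  ∀ l : List σ, Continuous (iterD l f) ∧
    ∀ (i : σ) (x : Body σ), ∃ v, HasPDeriv (iterD l f) i x v

theorem HasPDeriv.pderiv_eq [T2Space E] {f : Body σ → E} {i : σ} {x : Body σ} {v : E}
    (h : HasPDeriv f i x v) : pderiv i f x = v := by
  have hex : ∃ v, HasPDeriv f i x v := ⟨v, h⟩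
  rw [pderiv, dif_pos hex]
  exact tendsto_nhds_unique hex.choose_spec h

theorem HasPDeriv.add [ContinuousAdd E] {f g : Body σ → E} {i : σ} {x : Body σ} {v w : E}
    (hf : HasPDeriv f i x v) (hg : HasPDeriv g i x w) : HasPDeriv (f + g) i x (v + w) := by
  have := Tendsto.add hf hg
  refine this.congr fun t => ?_
  simp only [Pi.add_apply, ← smul_add]
  congr 1
  abel

theorem HasPDeriv.const_smul [ContinuousConstSMul ℂ E] {f : Body σ → E} {i : σ} {x : Body σ}
    {v : E} (c : ℂ) (hf : HasPDeriv f i x v) : HasPDeriv (c • f) i x (c • v) := by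
  have := Tendsto.const_smul hf c
  refine this.congr fun t => ?_
  simp only [Pi.smul_apply, ← smul_sub]
  rw [smul_comm]

theorem hasPDeriv_zero (i : σ) (x : Body σ) : HasPDeriv (0 : Body σ → E) i x 0 := by
  simp [HasPDeriv, tendsto_const_nhds]

theorem iterD_zero [T2Space E] (l : List σ) : iterD l (0 : Body σ → E) = 0 := by
  induction l with
  | nil => rfl
  | cons i l ih =>
    funext x
    rw [iterD, ih]
    exact (hasPDeriv_zero i x).pderiv_eq

theorem IsSmooth.zero [T2Space E] : IsSmooth (0 : Body σ → E) := fun l => by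
  rw [iterD_zero]
  exact ⟨continuous_zero, fun i x => ⟨0, hasPDeriv_zero i x⟩⟩

theorem IsSmooth.iterD_add [T2Space E] [ContinuousAdd E] {f g : Body σ → E}
    (hf : IsSmooth f) (hg : IsSmooth g) (l : List σ) :
    iterD l (f + g) = iterD l f + iterD l g := by
  induction l with
  | nil => rfl
  | cons i l ih =>
    funext x
    obtain ⟨v, hv⟩ := (hf l).2 i x
    obtain ⟨w, hw⟩ := (hg l).2 i x
    rw [iterD, ih, (hv.add hw).pderiv_eq, Pi.add_apply, iterD, iterD, hv.pderiv_eq, hw.pderiv_eq]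

theorem IsSmooth.iterD_smul [T2Space E] [ContinuousConstSMul ℂ E] {f : Body σ → E}
    (hf : IsSmooth f) (c : ℂ) (l : List σ) : iterD l (c • f) = c • iterD l f := by
  induction l with
  | nil => rfl
  | cons i l ih =>
    funext x
    obtain ⟨v, hv⟩ := (hf l).2 i x
    rw [iterD, ih, (hv.const_smul c).pderiv_eq, Pi.smul_apply, iterD, hv.pderiv_eq]

theorem IsSmooth.add [T2Space E] [ContinuousAdd E] {f g : Body σ → E}
    (hf : IsSmooth f) (hg : IsSmooth g) : IsSmooth (f + g) := fun l => by
  rw [hf.iterD_add hg]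
  refine ⟨(hf l).1.add (hg l).1, fun i x => ?_⟩
  obtain ⟨v, hv⟩ := (hf l).2 i x
  obtain ⟨w, hw⟩ := (hg l).2 i x
  exact ⟨v + w, hv.add hw⟩

theorem IsSmooth.const_smul [T2Space E] [ContinuousConstSMul ℂ E] {f : Body σ → E}
    (hf : IsSmooth f) (c : ℂ) : IsSmooth (c • f) := fun l => by
  rw [hf.iterD_smul]
  refine ⟨(hf l).1.const_smul c, fun i x => ?_⟩
  obtain ⟨v, hv⟩ := (hf l).2 i x
  exact ⟨c • v, hv.const_smul c⟩

end Smooth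

/-! ### Superfunctions on `ℝ^{σ|n}`

A superfunction `f = ∑_I f_I θ^I` on `ℝ^{σ|n}` with values in `E` is the family of its
coefficients `f_I : ℝ^σ → E`, for `I ⊆ {1, …, n}`. A superfunction on `ℝ^{σ|n} × ℝ^{σ|n}` is the
family of its coefficients `f_{I,J} : ℝ^σ × ℝ^σ → E` in front of `θ₁^I θ₂^J`. -/

/-- Superfunctions on `ℝ^{σ|n}`, without regularity condition. -/
abbrev SuperFun (σ : Type) [Fintype σ] (n : ℕ) (E : Type*) : Type _ :=
  Finset (Fin n) → Body σ → E

/-- Superfunctions on `ℝ^{σ|n} × ℝ^{σ|n}`, without regularity condition. -/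
abbrev SuperFun₂ (σ : Type) [Fintype σ] (n : ℕ) (E : Type*) : Type _ :=
  Finset (Fin n) × Finset (Fin n) → Body σ → Body σ → E

/-- The sign `ε(I, J)`: zero if `I ∩ J ≠ ∅`, otherwise `(-1)` to the number of transpositions
that put `I` followed by `J` into increasing order; thus `θ^I θ^J = ε(I, J) θ^{I ∪ J}`. -/
def eps {n : ℕ} (I J : Finset (Fin n)) : ℤ :=
  if Disjoint I J then (-1) ^ ((I ×ˢ J).filter fun q => q.2 < q.1).card else 0

section BSpace

variable (σ : Type) [Fintype σ] [DecidableEq σ] (n : ℕ)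
variable (E : Type*) [AddCommGroup E] [Module ℂ E] [UniformSpace E] [IsUniformAddGroup E]
  [ContinuousConstSMul ℂ E] [T2Space E]

/-- The smooth superfunctions all of whose derivatives are bounded, as a space of families. -/
def bSubmodule : Submodule ℂ (SuperFun σ n E) where
  carrier := {f | ∀ I, IsSmooth (f I) ∧
    ∀ (l : List σ) (p : Seminorm ℂ E), Continuous p →
      BddAbove (Set.range fun x => p (iterD l (f I) x))}
  zero_mem' := fun I => by
    refine ⟨IsSmooth.zero, fun l p _ => ⟨0, ?_⟩⟩
    rintro _ ⟨x, rfl⟩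
    simp [iterD_zero]
  add_mem' := by
    intro f g hf hg I
    refine ⟨(hf I).1.add (hg I).1, fun l p hp => ?_⟩
    obtain ⟨B, hB⟩ := (hf I).2 l p hp
    obtain ⟨C, hC⟩ := (hg I).2 l p hp
    refine ⟨B + C, ?_⟩
    rintro _ ⟨x, rfl⟩
    have : (f + g) I = f I + g I := rfl
    simp only [this, (hf I).1.iterD_add (hg I).1]
    exact (map_add_le_add p _ _).trans (add_le_add (hB ⟨x, rfl⟩) (hC ⟨x, rfl⟩))
  smul_mem' := by
    intro c f hf I
    refine ⟨(hf I).1.const_smul c, fun l p hp => ?_⟩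
    obtain ⟨B, hB⟩ := (hf I).2 l p hp
    refine ⟨‖c‖ * B, ?_⟩
    rintro _ ⟨x, rfl⟩
    have : (c • f) I = c • f I := rfl
    simp only [this, (hf I).1.iterD_smul, Pi.smul_apply, map_smul_eq_mul]
    exact mul_le_mul_of_nonneg_left (hB ⟨x, rfl⟩) (norm_nonneg c)

/-- The space `𝓑_E(ℝ^{σ|n}) = 𝓑_E(ℝ^σ) ⊗ ⋀ ℝ^n` of smooth `E`-valued superfunctions with every
derivative bounded. -/
def BSuper : Type _ := ↥(bSubmodule σ n E)

instance : AddCommGroup (BSuper σ n E) := inferInstanceAs (AddCommGroup ↥(bSubmodule σ n E))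

instance : Module ℂ (BSuper σ n E) := inferInstanceAs (Module ℂ ↥(bSubmodule σ n E))

variable {σ n E}

/-- The coefficients `f_I` of `f ∈ 𝓑_E(ℝ^{σ|n})`. -/
def BSuper.coeff (f : BSuper σ n E) : SuperFun σ n E := f.1

variable (σ n E)

/-- The topology of `𝓑_E(ℝ^{σ|n})`: uniform convergence of all derivatives of all coefficients,
that is, the topology of the seminorms `f ↦ sup_x ∑_I p (D^α f_I x)`, for `α` a multi-index and
`p` a continuous seminorm of `E`. -/
instance : UniformSpace (BSuper σ n E) :=
  UniformSpace.comap
    (fun (f : BSuper σ n E) (q : List σ × Finset (Fin n)) =>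
      UniformFun.ofFun (iterD q.1 (f.coeff q.2)))
    inferInstance

end BSpace

/-! ### The completed projective tensor product -/

section Proj

variable (E F : Type*) [AddCommGroup E] [Module ℂ E] [TopologicalSpace E]
  [AddCommGroup F] [Module ℂ F] [TopologicalSpace F]

/-- The algebraic tensor product `E ⊗ F`, to be endowed with the projective topology. -/
def ProjTensor : Type _ := E ⊗[ℂ] F

instance : AddCommGroup (ProjTensor E F) := inferInstanceAs (AddCommGroup (E ⊗[ℂ] F))

instance : Module ℂ (ProjTensor E F) := inferInstanceAs (Module ℂ (E ⊗[ℂ] F))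

variable {E F}

/-- The ways to write `c` as a finite sum `∑ a_i ⊗ b_i`. -/
def Decompositions (c : ProjTensor E F) : Set (List (E × F)) :=
  {L | (L.map fun q => (q.1 ⊗ₜ[ℂ] q.2 : E ⊗[ℂ] F)).sum = c}

/-- `∑ p(a_i) q(b_i)`. -/
def decompCost (p : Seminorm ℂ E) (q : Seminorm ℂ F) (L : List (E × F)) : ℝ :=
  (L.map fun r => p r.1 * q r.2).sum

theorem decompCost_nonneg (p : Seminorm ℂ E) (q : Seminorm ℂ F) (L : List (E × F)) :
    0 ≤ decompCost p q L := by
  refine List.sum_nonneg fun a ha => ?_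
  obtain ⟨r, -, rfl⟩ := List.mem_map.1 ha
  exact mul_nonneg (apply_nonneg p _) (apply_nonneg q _)

theorem decompositions_nonempty (c : ProjTensor E F) : (Decompositions c).Nonempty := by
  refine TensorProduct.induction_on (motive := fun c => (Decompositions c).Nonempty) c ?_ ?_ ?_
  · exact ⟨[], rfl⟩
  · exact fun a b => ⟨[(a, b)], by simp [Decompositions]⟩
  · rintro x y ⟨L, hL⟩ ⟨M, hM⟩
    refine ⟨L ++ M, ?_⟩
    simp only [Decompositions, Set.mem_ofPred_eq, List.map_append, List.sum_append] at hL hM ⊢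
    rw [hL, hM]

/-- `π_{p,q}(c) = inf {∑ p(a_i) q(b_i) : c = ∑ a_i ⊗ b_i}`. -/
def projSeminormFun (p : Seminorm ℂ E) (q : Seminorm ℂ F) (c : ProjTensor E F) : ℝ :=
  sInf (decompCost p q '' Decompositions c)

theorem projSeminormFun_le (p : Seminorm ℂ E) (q : Seminorm ℂ F) {c : ProjTensor E F}
    {L : List (E × F)} (hL : L ∈ Decompositions c) :
    projSeminormFun p q c ≤ decompCost p q L :=
  csInf_le ⟨0, by rintro _ ⟨M, -, rfl⟩; exact decompCost_nonneg p q M⟩ ⟨L, hL, rfl⟩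

theorem le_projSeminormFun (p : Seminorm ℂ E) (q : Seminorm ℂ F) {c : ProjTensor E F} {r : ℝ}
    (h : ∀ L ∈ Decompositions c, r ≤ decompCost p q L) : r ≤ projSeminormFun p q c :=
  le_csInf ((decompositions_nonempty c).image _) (by rintro _ ⟨L, hL, rfl⟩; exact h L hL)

/-- The projective seminorm `π_{p,q}`. -/
def projSeminorm (p : Seminorm ℂ E) (q : Seminorm ℂ F) : Seminorm ℂ (ProjTensor E F) :=
  Seminorm.ofSMulLE (projSeminormFun p q)
    (le_antisymm
      ((projSeminormFun_le p q (L := []) rfl).trans (by simp [decompCost]))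
      (le_projSeminormFun p q fun L _ => decompCost_nonneg p q L))
    (fun x y => by
      rw [← sub_le_iff_le_add]
      refine le_projSeminormFun p q fun M hM => ?_
      rw [sub_le_iff_le_add, ← sub_le_iff_le_add']
      refine le_projSeminormFun p q fun L hL => ?_
      rw [sub_le_iff_le_add]
      have hmem : M ++ L ∈ Decompositions (x + y) := by
        simp only [Decompositions, Set.mem_ofPred_eq, List.map_append, List.sum_append] at hL hM ⊢
        rw [hL, hM]
        rfl
      have := projSeminormFun_le p q hmem
      simp only [decompCost, List.map_append, List.sum_append] at this ⊢
      linarith)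
    (fun c x => by
      have key : ∀ L ∈ Decompositions x, projSeminormFun p q (c • x) ≤ ‖c‖ * decompCost p q L := by
        intro L hL
        have hmem : (L.map fun r => (c • r.1, r.2)) ∈ Decompositions (c • x) := by
          simp only [Decompositions, Set.mem_ofPred_eq, List.map_map] at hL ⊢
          rw [← hL]
          refine Eq.trans ?_ (List.smul_sum (r := c)
            (l := L.map fun q => (q.1 ⊗ₜ[ℂ] q.2 : E ⊗[ℂ] F))).symm
          simp [List.map_map, Function.comp_def, TensorProduct.smul_tmul']
        refine (projSeminormFun_le p q hmem).trans (le_of_eq ?_)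
        simp [decompCost, List.map_map, Function.comp_def, map_smul_eq_mul, mul_assoc,
          List.sum_map_mul_left]
      rcases eq_or_ne c 0 with rfl | hc
      · obtain ⟨L, hL⟩ := decompositions_nonempty x
        simpa using key L hL
      · have hpos : 0 < ‖c‖ := norm_pos_iff.2 hc
        rw [← div_le_iff₀' hpos]
        refine le_projSeminormFun p q fun L hL => ?_
        rw [div_le_iff₀' hpos]
        exact key L hL)

variable (E F)

/-- The family of all `π_{p,q}`, for `p`, `q` continuous seminorms of `E`, `F`. -/
def projFamily : SeminormFamily ℂ (ProjTensor E F)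
    ({p : Seminorm ℂ E // Continuous p} × {q : Seminorm ℂ F // Continuous q}) :=
  fun r => projSeminorm r.1.1 r.2.1

instance : Nonempty ({p : Seminorm ℂ E // Continuous p} × {q : Seminorm ℂ F // Continuous q}) :=
  ⟨⟨0, continuous_const⟩, ⟨0, continuous_const⟩⟩

/-- The projective topology. -/
instance : TopologicalSpace (ProjTensor E F) := (projFamily E F).moduleFilterBasis.topology

theorem projTensor_withSeminorms : WithSeminorms (projFamily E F) := ⟨rfl⟩

instance : IsTopologicalAddGroup (ProjTensor E F) :=
  (projTensor_withSeminorms E F).topologicalAddGroup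

instance : ContinuousSMul ℂ (ProjTensor E F) := (projTensor_withSeminorms E F).continuousSMul

instance : UniformSpace (ProjTensor E F) := IsTopologicalAddGroup.rightUniformSpace _

instance : IsUniformAddGroup (ProjTensor E F) := isUniformAddGroup_of_addCommGroup

instance : UniformContinuousConstSMul ℂ (ProjTensor E F) :=
  uniformContinuousConstSMul_of_continuousConstSMul _ _

/-- The completed projective tensor product `E ⊗̂_π F`. -/
abbrev ProjCompl : Type _ := Completion (ProjTensor E F)

variable {E F}

/-- The elementary tensor `a ⊗ b` in `E ⊗̂_π F`. -/
def tens (a : E) (b : F) : ProjCompl E F :=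
  ((show ProjTensor E F from a ⊗ₜ[ℂ] b : ProjTensor E F) : Completion (ProjTensor E F))

end Proj

/-! ### The structure maps of `H = 𝓑(ℝ^{σ|n})` with coefficients

The product of `H` is the undeformed one, `μ̃(f ⊗ g)(z) = f(z) g(z)`, the coproduct is
`Δf(z₁, z₂) = f(z₁ + z₂)` and the counit is `ε(f) = f(0)`. The completed tensor product
`E ⊗̂_τ H` is `𝓑_E(ℝ^{σ|n})`, with `a ⊗ f_I θ^I` corresponding to `a f_I` in front of `θ^I`, and
`E ⊗̂_τ (H ⊗̂_τ H)` consists of superfunctions on `ℝ^{σ|n} × ℝ^{σ|n}`. -/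

section HopfMaps

variable {σ : Type} [Fintype σ] [DecidableEq σ] {n : ℕ}
variable {E : Type*} [AddCommGroup E] [Module ℂ E]

/-- `id ⊗ Δ`. It is `f_L θ^L ↦ ∑_{I ∪ J = L} ε(I, J) f_L(y₁ + y₂) θ₁^I θ₂^J`, the expansion of
`f(z₁ + z₂)`. -/
def idTensorComul (f : SuperFun σ n E) : SuperFun₂ σ n E :=
  fun q y₁ y₂ => eps q.1 q.2 • f (q.1 ∪ q.2) (y₁ + y₂)

/-- `id ⊗ ε`. -/
def idTensorCounit (f : SuperFun σ n E) : E := f ∅ 0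

/-- `χ ⊗ id`, for a map `χ` from `E` to `E`-valued superfunctions; the new tensor factor `H` is
put in front of the old one. -/
def coactTensorId (χ : E → SuperFun σ n E) (f : SuperFun σ n E) : SuperFun₂ σ n E :=
  fun q y₁ y₂ => χ (f q.2 y₂) q.1 y₁

/-- The element `a ⊗ 1` of `E ⊗ H`. -/
def tensorOne (a : E) : SuperFun σ n E := fun I _ => if I = ∅ then a else 0

variable [TopologicalSpace E]

/-- `σ₂₃ (φ ⊗ ψ) ∈ (E ⊗̂_π E) ⊗̂_τ (H ⊗̂_τ H)` for `φ, ψ ∈ E ⊗̂_τ H`: the graded exchange of the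
second and third factors, `a ⊗ θ^I ⊗ b ⊗ θ^J ↦ (-1)^{|I||b|} a ⊗ b ⊗ θ^I ⊗ θ^J`. Here `P` is the
parity operator of `E` (`P b = (-1)^{|b|} b`), so that the sign is `P^{|I|}` applied to `b`. -/
def sigma23 (P : E → E) (φ ψ : SuperFun σ n E) : SuperFun₂ σ n (ProjCompl E E) :=
  fun q y₁ y₂ => tens (φ q.1 y₁) (P^[q.1.card] (ψ q.2 y₂))

/-- `μ ⊗ μ̃ : (E ⊗̂_π E) ⊗̂_τ (H ⊗̂_τ H) → E ⊗̂_τ H`. -/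
def mulTensorMul (μ : ProjCompl E E → E) (Ψ : SuperFun₂ σ n (ProjCompl E E)) : SuperFun σ n E :=
  fun L y => ∑ I ∈ L.powerset, eps I (L \ I) • μ (Ψ (I, L \ I) y y)

end HopfMaps

/-! ### Fréchet spaces and Fréchet comodule algebras -/

/-- `E` is a Fréchet space: a Hausdorff, complete, metrizable, locally convex space. -/
structure IsFrechetSpace (E : Type*) [AddCommGroup E] [Module ℂ E] [UniformSpace E] : Prop where
  uniformAddGroup : IsUniformAddGroup E
  continuousSMul : ContinuousSMul ℂ E
  locallyConvex : LocallyConvexSpace ℝ E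
  t2 : T2Space E
  complete : CompleteSpace E
  countable : (uniformity E).IsCountablyGenerated

/-- `(E, μ)` is a Fréchet algebra, graded by the parity operator `P` (`P = id` for an ungraded
algebra): a Fréchet space with an associative continuous product `μ : E ⊗̂_π E → E`. -/
structure IsFrechetAlgebra {E : Type*} [AddCommGroup E] [Module ℂ E] [UniformSpace E]
    (P : E →L[ℂ] E) (μ : ProjCompl E E →L[ℂ] E) : Prop where
  frechet : IsFrechetSpace E
  assoc : ∀ a b c : E, μ (tens (μ (tens a b)) c) = μ (tens a (μ (tens b c)))
  parity_parity : ∀ a : E, P (P a) = a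
  parity_mul : ∀ a b : E, P (μ (tens a b)) = μ (tens (P a) (P b))

/-- `(E, μ)` is a Fréchet comodule algebra over the Fréchet-Hopf algebra `(𝓑(ℝ^{σ|n}), μ̃)` for
the continuous coaction `χ : E → E ⊗̂_τ 𝓑(ℝ^{σ|n}) = 𝓑_E(ℝ^{σ|n})`. -/
structure IsFrechetComoduleAlgebra {σ : Type} [Fintype σ] [DecidableEq σ] {n : ℕ}
    {E : Type*} [AddCommGroup E] [Module ℂ E] [UniformSpace E] [IsUniformAddGroup E]
    [ContinuousConstSMul ℂ E] [T2Space E]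
    (P : E →L[ℂ] E) (μ : ProjCompl E E →L[ℂ] E) (χ : E →L[ℂ] BSuper σ n E) : Prop where
  algebra : IsFrechetAlgebra P μ
  /-- `(id ⊗ Δ) χ = (χ ⊗ id) χ`. -/
  coassoc : ∀ a : E, idTensorComul (χ a).coeff =
    coactTensorId (fun b => (χ b).coeff) (χ a).coeff
  /-- `(id ⊗ ε) χ = id`. -/
  counit : ∀ a : E, idTensorCounit (χ a).coeff = a
  /-- `(μ ⊗ μ̃) σ₂₃ (χ ⊗ χ) = χ μ`. -/
  mul : ∀ a b : E, mulTensorMul μ (sigma23 P (χ a).coeff (χ b).coeff) = (χ (μ (tens a b))).coeff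
  /-- `χ(1) = 1 ⊗ 1`, if the algebra has a unit. -/
  one : ∀ e : E, (∀ a : E, μ (tens e a) = a ∧ μ (tens a e) = a) → (χ e).coeff = tensorOne e

/-! ### Actions of the supergroup `ℝ^{σ|n}` -/

section Action

/-- The supercommutative algebra `𝒜 = ⋀ V`. -/
abbrev Sup (V : Type*) [AddCommGroup V] [Module ℝ V] : Type _ := ExteriorAlgebra ℝ V

/-- The points `z = (y, ξ)` of `ℝ^{σ|n}` with real even coordinates `y` and with odd
coordinates `ξ` in the odd part `𝒜_1` of `𝒜 = ⋀ V`. -/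
abbrev SuperPoint (σ : Type) [Fintype σ] (n : ℕ) (V : Type*) [AddCommGroup V] [Module ℝ V] :
    Type _ :=
  Body σ × (Fin n → ↥(CliffordAlgebra.evenOdd (0 : QuadraticForm ℝ V) 1))

/-- The ordered product `ξ^I`. -/
def oddMonomial {n : ℕ} {V : Type*} [AddCommGroup V] [Module ℝ V]
    (ξ : Fin n → ↥(CliffordAlgebra.evenOdd (0 : QuadraticForm ℝ V) 1)) (I : Finset (Fin n)) :
    Sup V :=
  (I.sort.map fun i => ((ξ i : CliffordAlgebra (0 : QuadraticForm ℝ V)) : Sup V)).prod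

variable {A : Type*} [NonUnitalRing A] [Module ℂ A]
variable {V : Type*} [AddCommGroup V] [Module ℝ V]

/-- The value `∑_I f_I(y) ξ^I ∈ A ⊗ 𝒜` of an `A`-valued superfunction at a point `z = (y, ξ)`. -/
def superEval {σ : Type} [Fintype σ] {n : ℕ} (f : SuperFun σ n A) (z : SuperPoint σ n V) :
    A ⊗[ℝ] Sup V :=
  ∑ I : Finset (Fin n), f I z.1 ⊗ₜ[ℝ] oddMonomial z.2 I

/-- The projection of `𝒜` onto its even part. -/
def supEven : Sup V →ₗ[ℝ] Sup V :=
  (2⁻¹ : ℝ) • (LinearMap.id + (CliffordAlgebra.involute (Q := (0 : QuadraticForm ℝ V))).toLinearMap)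

/-- The projection of `𝒜` onto its odd part. -/
def supOdd : Sup V →ₗ[ℝ] Sup V :=
  (2⁻¹ : ℝ) • (LinearMap.id - (CliffordAlgebra.involute (Q := (0 : QuadraticForm ℝ V))).toLinearMap)

variable [IsScalarTower ℂ A A] [SMulCommClass ℂ A A] [TopologicalSpace A]

/-- `γ` is the parity operator `a ↦ (-1)^{|a|} a` of a `ℤ/2`-grading of the topological algebra
`A` (with closed homogeneous components). An ungraded algebra is one with `γ = id`. -/
structure IsParity (γ : A →L[ℂ] A) : Prop where
  involutive : ∀ a, γ (γ a) = a
  map_mul : ∀ a b, γ (a * b) = γ a * γ b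

/-- The product of the graded tensor product `A ⊗ 𝒜`:
`(a ⊗ u) (b ⊗ v) = (-1)^{|u| |b|} ab ⊗ uv`. -/
def supMul (γ : A →L[ℂ] A) :
    A ⊗[ℝ] Sup V →ₗ[ℝ] A ⊗[ℝ] Sup V →ₗ[ℝ] A ⊗[ℝ] Sup V :=
  TensorProduct.map₂ (LinearMap.mul ℝ A) ((LinearMap.mul ℝ (Sup V)).comp supEven) +
  TensorProduct.map₂ ((LinearMap.mul ℝ A).compl₂ (γ.toLinearMap.restrictScalars ℝ))
    ((LinearMap.mul ℝ (Sup V)).comp supOdd)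

/-- Right multiplication by `u ∈ 𝒜` on `A ⊗ 𝒜`. -/
def supSmul (u : Sup V) : A ⊗[ℝ] Sup V →ₗ[ℝ] A ⊗[ℝ] Sup V :=
  (LinearMap.mulRight ℝ u).lTensor A

/-- The parity operator of `A ⊗ 𝒜`. -/
def supParity (γ : A →L[ℂ] A) : A ⊗[ℝ] Sup V →ₗ[ℝ] A ⊗[ℝ] Sup V :=
  TensorProduct.map (γ.toLinearMap.restrictScalars ℝ)
    (CliffordAlgebra.involute (Q := (0 : QuadraticForm ℝ V))).toLinearMap

/-- An action `ρ` of the abelian supergroup `ℝ^{σ|n}` on a Fréchet algebra `A` with the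
seminorms `p j` and with the grading `γ`. -/
structure SuperAction (σ : Type) [Fintype σ] (n : ℕ) (V : Type*) [AddCommGroup V] [Module ℝ V]
    (p : ℕ → Seminorm ℂ A) (γ : A →L[ℂ] A) where
  /-- The map `ρ_z` of `A ⊗ 𝒜`. -/
  act : SuperPoint σ n V → A ⊗[ℝ] Sup V →ₗ[ℂ] A ⊗[ℝ] Sup V
  /-- The coefficients `ρ_y(a)_I ∈ A`. -/
  comp : Finset (Fin n) → Body σ → A →ₗ[ℂ] A
  act_zero : act 0 = LinearMap.id
  act_add : ∀ z₁ z₂, act (z₁ + z₂) = act z₁ ∘ₗ act z₂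
  act_mul : ∀ z c c', act z (supMul γ c c') = supMul γ (act z c) (act z c')
  act_smul : ∀ z u c, act z (supSmul u c) = supSmul u (act z c)
  /-- `ρ_z` preserves the grading of `A ⊗ 𝒜`, unless `A` is ungraded. -/
  act_parity : (∀ a, γ a = a) ∨ ∀ z c, act z (supParity γ c) = supParity γ (act z c)
  /-- `ρ_{(y, ξ)}(a) = ∑_I ρ_y(a)_I ξ^I`. -/
  act_expand : ∀ z a, act z (a ⊗ₜ[ℝ] 1) = superEval (fun I y => comp I y a) z
  continuous_comp : ∀ I a, Continuous fun y => comp I y a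
  bounded_comp : ∃ C : ℝ, 0 < C ∧ ∀ I j, ∃ k, ∀ a y, p j (comp I y a) ≤ C * p k a

end Action

/-! ### Smooth vectors -/

section SmoothVectors

variable {A : Type*} [NonUnitalRing A] [Module ℂ A] [IsScalarTower ℂ A A] [SMulCommClass ℂ A A]
  [UniformSpace A] [IsUniformAddGroup A] [ContinuousSMul ℂ A] [T2Space A]
variable {V : Type*} [AddCommGroup V] [Module ℝ V]
variable {σ : Type} [Fintype σ] [DecidableEq σ] {n : ℕ}
variable {p : ℕ → Seminorm ℂ A} {γ : A →L[ℂ] A}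

namespace SuperAction

variable (ρ : SuperAction σ n V p γ)

/-- The superfunction `ρ^a : z ↦ ρ_z(a)`, as the family of its coefficients. -/
def orbit (a : A) : SuperFun σ n A := fun I y => ρ.comp I y a

theorem orbit_zero (I : Finset (Fin n)) : ρ.orbit 0 I = 0 := by
  funext y; simp [orbit]

theorem orbit_add (a b : A) (I : Finset (Fin n)) : ρ.orbit (a + b) I = ρ.orbit a I + ρ.orbit b I := by
  funext y; simp [orbit]

theorem orbit_smul (c : ℂ) (a : A) (I : Finset (Fin n)) : ρ.orbit (c • a) I = c • ρ.orbit a I := by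
  funext y; simp [orbit]

theorem comp_zero (a : A) : ρ.comp ∅ 0 a = a := by
  have h := ρ.act_expand 0 a
  rw [ρ.act_zero] at h
  have h2 : superEval (V := V) (fun I y => ρ.comp I y a) (0 : SuperPoint σ n V)
      = ρ.comp ∅ 0 a ⊗ₜ[ℝ] (1 : Sup V) := by
    unfold superEval
    rw [Finset.sum_eq_single ∅]
    · simp [oddMonomial]
    · intro I _ hI
      have : oddMonomial (0 : SuperPoint σ n V).2 I = 0 := by
        unfold oddMonomial
        apply List.prod_eq_zero
        obtain ⟨i, hi⟩ := Finset.nonempty_iff_ne_empty.2 hI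
        exact List.mem_map.2 ⟨i, by simpa using hi, by simp⟩
      rw [this, TensorProduct.tmul_zero]
    · simp
  rw [h2] at h
  have h3 := congrArg (TensorProduct.rid ℝ A ∘
    (ExteriorAlgebra.algebraMapInv (R := ℝ) (M := V)).toLinearMap.lTensor A) h
  simpa using h3.symm

/-- The smooth vectors, as a subspace of `A`. -/
def smoothSubmodule : Submodule ℂ A where
  carrier := {a | ∀ I, IsSmooth (ρ.orbit a I)}
  zero_mem' := fun I => by rw [orbit_zero]; exact IsSmooth.zero
  add_mem' := fun ha hb I => by rw [orbit_add]; exact (ha I).add (hb I)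
  smul_mem' := fun c a ha I => by rw [orbit_smul]; exact (ha I).const_smul c

/-- The space `A^∞` of smooth vectors: the `a ∈ A` such that `z ↦ ρ_z(a)` is smooth. -/
def SmoothVec : Type _ := ↥ρ.smoothSubmodule

instance : AddCommGroup ρ.SmoothVec := inferInstanceAs (AddCommGroup ↥ρ.smoothSubmodule)

instance : Module ℂ ρ.SmoothVec := inferInstanceAs (Module ℂ ↥ρ.smoothSubmodule)

/-- The inclusion of `A^∞` into `A`. -/
def incl : ρ.SmoothVec →ₗ[ℂ] A := ρ.smoothSubmodule.subtype

/-- All the derivatives of the coefficients of `ρ^a`. -/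
def jet : ρ.SmoothVec →ₗ[ℂ] (List σ × Finset (Fin n) → (Body σ →ᵤ A)) where
  toFun a q := UniformFun.ofFun (iterD q.1 (ρ.orbit (ρ.incl a) q.2))
  map_add' a b := by
    funext q
    have ha : IsSmooth (ρ.orbit (ρ.incl a) q.2) := a.2 q.2
    have hb : IsSmooth (ρ.orbit (ρ.incl b) q.2) := b.2 q.2
    rw [map_add, orbit_add, ha.iterD_add hb]
    rfl
  map_smul' c a := by
    funext q
    have ha : IsSmooth (ρ.orbit (ρ.incl a) q.2) := a.2 q.2
    rw [map_smul, orbit_smul, ha.iterD_smul]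
    rfl

/-- The topology of `A^∞` is the one of the seminorms
`|a|_{j,α} = sup_y ∑_I |D^α ρ_y(a)_I|_j`: uniform convergence of all derivatives of `ρ^a`. -/
instance : UniformSpace ρ.SmoothVec := UniformSpace.comap ρ.jet inferInstance

instance : IsUniformAddGroup ρ.SmoothVec := IsUniformAddGroup.comap ρ.jet

theorem jet_injective : Function.Injective ρ.jet := by
  intro a b h
  have h1 := congrFun (congrArg UniformFun.toFun (congrFun h ([], ∅))) 0
  have h2 : ρ.comp ∅ 0 (ρ.incl a) = ρ.comp ∅ 0 (ρ.incl b) := h1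
  rw [comp_zero, comp_zero] at h2
  exact Subtype.ext h2

instance : T2Space ρ.SmoothVec :=
  T2Space.of_injective_continuous ρ.jet_injective uniformContinuous_comap.continuous

instance : UniformContinuousConstSMul ℂ ρ.SmoothVec where
  uniformContinuous_const_smul c := by
    have : UniformContinuousConstSMul ℂ A :=
      uniformContinuousConstSMul_of_continuousConstSMul _ _
    have : UniformContinuousConstSMul ℂ (Body σ →ᵤ A) := inferInstance
    have : UniformContinuousConstSMul ℂ (List σ × Finset (Fin n) → (Body σ →ᵤ A)) :=
      ⟨fun c => uniformContinuous_pi.2 fun q =>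
        (Pi.uniformContinuous_proj (fun _ : List σ × Finset (Fin n) => (Body σ →ᵤ A)) q).const_smul c⟩
    refine uniformContinuous_comap' ?_
    have : (ρ.jet ∘ fun a : ρ.SmoothVec => c • a) = fun a => c • ρ.jet a := by
      funext a; simp
    rw [this]
    exact uniformContinuous_comap.const_smul c

end SuperAction

end SmoothVectors

/-! ### The twist

The twist is `F = κ ∫ dz₁ dz₂ exp(-(2i/θ) ω̃(z₁, z₂)) ρ_{z₁} ⊗ ρ_{z₂}`, for the even symplectic form
`ω̃(z₁, z₂) = ω₀(y₁, y₂) + ((1+α)²/(2α)) ∑_i ξ₁^i ξ₂^i` of `ℝ^{2d|n}`. -/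

section Twist

/-- The coefficients of an element of `E ⊗ ⋀(ℝ^n ⊕ ℝ^n)` in front of `ξ₁^I ξ₂^J`. -/
abbrev OddPoly (n : ℕ) (E : Type*) : Type _ := Finset (Fin n) × Finset (Fin n) → E

/-- The product of `E ⊗ ⋀(ℝ^n ⊕ ℝ^n)` with `⋀(ℂ^n ⊕ ℂ^n)`, from
`ξ₁^K ξ₂^L ξ₁^{K'} ξ₂^{L'} = (-1)^{|L||K'|} ε(K, K') ε(L, L') ξ₁^{K ∪ K'} ξ₂^{L ∪ L'}`. -/
def oddMul {n : ℕ} {E : Type*} [AddCommGroup E] [Module ℂ E] (f : OddPoly n E) (g : OddPoly n ℂ) :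
    OddPoly n E := fun q =>
  ∑ K ∈ q.1.powerset, ∑ L ∈ q.2.powerset,
    ((-1) ^ (L.card * (q.1 \ K).card) * eps K (q.1 \ K) * eps L (q.2 \ L) : ℤ) •
      (g (q.1 \ K, q.2 \ L) • f (K, L))

/-- Powers in `⋀(ℂ^n ⊕ ℂ^n)`. -/
def oddPow {n : ℕ} (g : OddPoly n ℂ) : ℕ → OddPoly n ℂ
  | 0 => fun q => if q = (∅, ∅) then 1 else 0
  | k + 1 => oddMul (oddPow g k) g

/-- The quadratic element `c ∑_i ξ₁^i ξ₂^i`. -/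
def oddQuad (n : ℕ) (c : ℂ) : OddPoly n ℂ :=
  fun q => ∑ i : Fin n, if q = ({i}, {i}) then c else 0

/-- `exp(c ∑_i ξ₁^i ξ₂^i)`; the powers of order greater than `n` vanish. -/
def oddExp (n : ℕ) (c : ℂ) : OddPoly n ℂ :=
  fun q => ∑ k ∈ Finset.range (n + 1), ((k.factorial : ℂ)⁻¹) * oddPow (oddQuad n c) k q

/-- The iterated Berezin integral `∫ dξ₁ (∫ dξ₂ h)`. Passing `dξ₂`, of parity `n`, through
`ξ₁^{1…n}` gives the sign `(-1)^{n·n}`. -/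
def berezin {n : ℕ} {E : Type*} [AddCommGroup E] (h : OddPoly n E) : E :=
  ((-1) ^ (n * n) : ℤ) • h (Finset.univ, Finset.univ)

/-- The standard symplectic form `ω₀` on `ℝ^{2d}`, with matrix `(0, 1; -1, 0)`. -/
def omega0 {d : ℕ} (y y' : Body (Fin d ⊕ Fin d)) : ℝ :=
  ∑ i : Fin d, (y (Sum.inl i) * y' (Sum.inr i) - y (Sum.inr i) * y' (Sum.inl i))

/-- The operator `O g = (1 - Laplacian) (g / (1 + (4/θ²)(|y₁|² + |y₂|²)))`, which satisfies
`∫ e^{-(2i/θ) ω₀} O g = ∫ e^{-(2i/θ) ω₀} g` for `g` smooth with compact support. -/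
def oscOp {d : ℕ} (θ : ℝ) (g : Body (Fin d ⊕ Fin d) → Body (Fin d ⊕ Fin d) → ℂ) :
    Body (Fin d ⊕ Fin d) → Body (Fin d ⊕ Fin d) → ℂ :=
  let h : Body (Fin d ⊕ Fin d) → Body (Fin d ⊕ Fin d) → ℂ := fun y₁ y₂ =>
    g y₁ y₂ / ((1 + 4 / θ ^ 2 * (‖y₁‖ ^ 2 + ‖y₂‖ ^ 2) : ℝ) : ℂ)
  fun y₁ y₂ => h y₁ y₂ - Laplacian.laplacian (fun y => h y y₂) y₁
    - Laplacian.laplacian (fun y => h y₁ y) y₂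

/-- The oscillating integral of a complex valued function `g` on `ℝ^{2d} × ℝ^{2d}` with all
derivatives bounded: `∫∫ e^{-(2i/θ) ω₀(y₁, y₂)} (O^k g)(y₁, y₂) dy₁ dy₂`, where `k = 2d + 1` is large
enough for `O^k g` to be integrable (and larger `k` give the same value). -/
def oscIntegral {d : ℕ} (θ : ℝ) (g : Body (Fin d ⊕ Fin d) → Body (Fin d ⊕ Fin d) → ℂ) : ℂ :=
  ∫ y : Body (Fin d ⊕ Fin d) × Body (Fin d ⊕ Fin d),
    Complex.exp (-(2 * Complex.I / θ) * omega0 y.1 y.2) * ((oscOp θ)^[2 * d + 1] g) y.1 y.2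

/-- `v` is the oscillating integral of the vector valued function `f`. -/
def IsOscIntegral {d : ℕ} {E : Type*} [AddCommGroup E] [Module ℂ E] [TopologicalSpace E] (θ : ℝ)
    (f : Body (Fin d ⊕ Fin d) → Body (Fin d ⊕ Fin d) → E) (v : E) : Prop :=
  ∀ ℓ : E →L[ℂ] ℂ, ℓ v = oscIntegral θ fun y₁ y₂ => ℓ (f y₁ y₂)

/-- The constant `κ`. -/
def kappa (d n : ℕ) (θ α : ℝ) : ℂ :=
  (Complex.I * θ) ^ n * (-1) ^ (n * (n + 1) / 2) * α ^ n /
    ((Real.pi * θ) ^ (2 * d) * (1 + α) ^ (2 * n))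

/-- `v = κ ∫ dz₁ dz₂ exp(-(2i/θ) ω̃(z₁, z₂)) Ψ(z₁, z₂)` for a superfunction `Ψ` on
`ℝ^{2d|n} × ℝ^{2d|n}`. -/
def IsTwistIntegral {d n : ℕ} {E : Type*} [AddCommGroup E] [Module ℂ E] [TopologicalSpace E]
    (θ α : ℝ) (Ψ : SuperFun₂ (Fin d ⊕ Fin d) n E) (v : E) : Prop :=
  IsOscIntegral θ
    (fun y₁ y₂ => kappa d n θ α • berezin (oddMul (fun q => Ψ q y₁ y₂)
      (oddExp n (-(2 * Complex.I / θ) * ((1 + α) ^ 2 / (2 * α)))))) v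

end Twist

end

end SuperUDF

/-!
Throughout, `ε(I, J)` is the sign `eps I J` with `ξ^I ξ^J = ε(I, J) ξ^{I ∪ J}`, and
`δ_K = ρ_0(·)_K` is the odd derivative of the action at the origin.

**The action in coefficients.** Since `V` is infinite dimensional, the action can be evaluated at
points whose odd coordinates are linearly independent generators of `⋀ V`, where the monomials
`ξ₁^I ξ₂^J` are linearly independent. Comparing coefficients turns the axioms of an action into
`ρ_y(ρ_{y'}(a)_J)_I = ε(I, J) ρ_{y + y'}(a)_{I ∪ J}` (`comp_comp`), a graded Leibniz rule
(`comp_mul`) and the rule for the parity (`parity_comp`). The last one is assumed only for graded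
algebras; in an ungraded one, `δ_i` obeys the Leibniz rule of an even operator while
`δ_i δ_j = -δ_j δ_i`, which forces all products `δ_I(a) δ_J(b)` with `I, J ≠ ∅` to vanish
(`comp_mul_comp_eq_zero`).

**Smooth vectors.** By `comp_comp`, the derivatives of `y ↦ ρ_y(a)_I` at `y` are the images under
`ρ_y` of the derivatives at the origin, and the operators `ρ_y` are equicontinuous. Hence the
topology of the smooth vectors is the one induced by the derivatives at the origin
(`isUniformInducing_germ`). Completeness follows by termwise differentiation, the continuity of the
product from Leibniz's rule, and the continuity of the coaction `a ↦ (y ↦ ρ_y(a)_I)_I` from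
equicontinuity (`der_bound`).

**Oscillating integrals.** For a phase `e` with `(1 - Δ) e = w e`, where `w = 1 + κ |x|²`, the
operator `f ↦ (1 - Δ) (f / w)` does not change the integral of `e f`, and its `k`-th iterate is a
differential operator with coefficients `O(w^{-k})`. So the regularized integral is a finite sum of
absolutely convergent integrals of derivatives of `f` (`exists_osc_expansion`). For vector valued
`f`, these integrals exist in the local Banach spaces of the continuous seminorms, and a Fréchet
space is the limit of its local Banach spaces (`exists_integral`). By cutting off the integrand,
oscillating integrals inherit from ordinary integrals the linear changes of variables
(`osc_comp_linear`), Fubini's theorem (`osc_osc`), and Fourier inversion (`oscIntegral_snd`).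

**The twist.** The exponential of the odd quadratic form is diagonal, so the Berezin integral leaves
only the coefficients in front of `ξ₁^K ξ₂^K`, and the normalization `κ` is the one for which
`F = ∑_K c_{|K|} F_ev (δ_K ⊗ P^{|K|} δ_K)` with `c_0 = 1`
and `c_k = (-1)^{k(k-1)/2} (iθα / (1+α)²)^k` (`kappa_smul_berezin`). Here `F_ev` is the twist in the
even variables and `P` the parity. Thus `μ_F(a, b) = ∑_K c_{|K|} S(δ_K a, P^{|K|} δ_K b)` is an odd
deformation of the even deformed product `S`.

**Associativity.** An identity between the products of translated elements integrates to an identity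
for `S` (`IsEvenProduct.map_eq_sum`). In this way `S` inherits the Leibniz rule for the action, and
both sides of its associativity become iterated oscillating integrals of
`ρ_{y₁}(a) ρ_{y₂}(b) ρ_{y₄}(c)`, exchanged by a shear that preserves the total phase
(`oscIntegral_assoc`). For the odd deformation of a graded algebra, both iterated products are sums
over triples `(I, J, K)` of `δ_{I ∪ J}(a) δ_{I ∪ K}(b) δ_{J ∪ K}(c)`, up to parities, and their signs
agree because `c_{i+j} = (-1)^{ij} c_i c_j` and `ε(J, I) = (-1)^{|I||J|} ε(I, J)`. In the ungraded
case the odd deformation is trivial.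

**Units.** A unit of a product for which the action obeys the Leibniz rule is invariant under the
action (`unit_invariant`). For the original product this makes the unit smooth and, by the
normalization of the integral, a unit of `μ_F`; for `μ_F` it gives `χ(1) = 1 ⊗ 1`.
-/

namespace SuperUDF

noncomputable section

open MeasureTheory
open scoped ContDiff Uniformity

set_option linter.unusedSectionVars false

/-! ### Local Banach spaces -/

section LocalBanach

variable {G : Type*} [AddCommGroup G] [Module ℂ G]

/-- The space `G` with the topology of the single seminorm `q`. -/
def LocalSpace (_ : Seminorm ℂ G) : Type _ := G

instance (q : Seminorm ℂ G) : AddCommGroup (LocalSpace q) := inferInstanceAs (AddCommGroup G)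

instance (q : Seminorm ℂ G) : Module ℂ (LocalSpace q) := inferInstanceAs (Module ℂ G)

instance (q : Seminorm ℂ G) : SeminormedAddCommGroup (LocalSpace q) :=
  AddGroupSeminorm.toSeminormedAddCommGroup (E := LocalSpace q) q.toAddGroupSeminorm

instance (q : Seminorm ℂ G) : NormedSpace ℂ (LocalSpace q) where
  norm_smul_le c x := (map_smul_eq_mul q c (show G from x)).le

/-- The local Banach space of a seminorm: the completion of `G` for `q`. -/
abbrev LocalBanach (q : Seminorm ℂ G) : Type _ := Completion (LocalSpace q)

/-- The canonical map from `G` to the local Banach space of `q`. -/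
def toLocalₗ (q : Seminorm ℂ G) : G →ₗ[ℂ] LocalBanach q where
  toFun x := ((show LocalSpace q from x : LocalSpace q) : Completion (LocalSpace q))
  map_add' x y := Completion.coe_add (show LocalSpace q from x) (show LocalSpace q from y)
  map_smul' c x := Completion.coe_smul c (show LocalSpace q from x)

@[simp]
theorem norm_toLocalₗ (q : Seminorm ℂ G) (x : G) : ‖toLocalₗ q x‖ = q x :=
  Completion.norm_coe (show LocalSpace q from x)

theorem denseRange_toLocalₗ (q : Seminorm ℂ G) : DenseRange (toLocalₗ q) :=
  Completion.denseRange_coe (α := LocalSpace q)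

/-- A linear map that is bounded by the seminorm `q` extends to the local Banach space of `q`. -/
theorem exists_localLift {q : Seminorm ℂ G} {Y : Type*} [NormedAddCommGroup Y] [NormedSpace ℂ Y]
    [CompleteSpace Y] (T : G →ₗ[ℂ] Y) (hT : ∀ x, ‖T x‖ ≤ q x) :
    ∃ S : LocalBanach q →L[ℂ] Y, ∀ x, S (toLocalₗ q x) = T x := by
  let T' : LocalSpace q →L[ℂ] Y :=
    LinearMap.mkContinuous (show LocalSpace q →ₗ[ℂ] Y from T) 1 (fun x => by
      rw [one_mul]; exact hT x)
  refine ⟨T'.extend (Completion.toComplL (𝕜 := ℂ) (E := LocalSpace q)), fun x => ?_⟩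
  exact ContinuousLinearMap.extend_eq T' (e := Completion.toComplL (𝕜 := ℂ) (E := LocalSpace q))
    Completion.denseRange_coe (Completion.isUniformInducing_coe (LocalSpace q)) x

variable [TopologicalSpace G]

/-- A continuous linear functional factors through a local Banach space. -/
theorem exists_dual_factor (ℓ : G →L[ℂ] ℂ) :
    ∃ q : Seminorm ℂ G, Continuous q ∧ ∃ S : LocalBanach q →L[ℂ] ℂ, ∀ x, S (toLocalₗ q x) = ℓ x := by
  refine ⟨(normSeminorm ℂ ℂ).comp ℓ.toLinearMap, ?_, ?_⟩
  · exact continuous_norm.comp ℓ.continuous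
  · exact exists_localLift ℓ.toLinearMap fun x => le_rfl

variable [IsTopologicalAddGroup G]

theorem continuous_toLocalₗ {q : Seminorm ℂ G} (hq : Continuous q) :
    Continuous (toLocalₗ q) := by
  refine continuous_of_continuousAt_zero (toLocalₗ q).toAddMonoidHom ?_
  have h : Tendsto (fun x => ‖toLocalₗ q x‖) (𝓝 0) (𝓝 0) := by
    have := hq.tendsto 0
    simpa using this
  have := tendsto_zero_iff_norm_tendsto_zero.2 h
  simpa [ContinuousAt] using this

/-- The continuous linear functionals separate the points of a Hausdorff polynormable space. -/
theorem eq_of_forall_dual [PolynormableSpace ℂ G] [T1Space G] {x y : G}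
    (h : ∀ ℓ : G →L[ℂ] ℂ, ℓ x = ℓ y) : x = y := by
  by_contra hne
  have h0 : x - y ≠ 0 := sub_ne_zero.2 hne
  obtain ⟨q, hq⟩ := (PolynormableSpace.withSeminorms ℂ G).separating_of_T1 _ h0
  have hj : toLocalₗ q.1 (x - y) ≠ 0 := by
    rw [← norm_ne_zero_iff, norm_toLocalₗ]; exact hq
  obtain ⟨f, hf⟩ := SeparatingDual.exists_ne_zero (R := ℂ) hj
  let ℓ : G →L[ℂ] ℂ := ⟨f.toLinearMap ∘ₗ toLocalₗ q.1, f.continuous.comp (continuous_toLocalₗ q.2)⟩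
  have := h ℓ
  apply hf
  have h2 : ℓ (x - y) = 0 := by rw [map_sub, this, sub_self]
  exact h2

end LocalBanach

/-! ### Continuous seminorms -/

section Seminorms

/-- By homogeneity, an inclusion of open unit balls is an inequality of seminorms. -/
theorem seminorm_le_of_lt_one {G : Type*} [AddCommGroup G] [Module ℂ G] {p q : Seminorm ℂ G}
    (h : ∀ x, q x < 1 → p x < 1) (x : G) : p x ≤ q x := by
  by_contra! hlt
  obtain ⟨r, hr1, hr2⟩ := exists_between hlt
  have hr : 0 < r := (apply_nonneg q x).trans_lt hr1
  have hn : ‖((r⁻¹ : ℝ) : ℂ)‖ = r⁻¹ := by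
    rw [Complex.norm_real, Real.norm_of_nonneg (inv_pos.2 hr).le]
  have := h (((r⁻¹ : ℝ) : ℂ) • x) (by
    rw [map_smul_eq_mul, hn, inv_mul_lt_iff₀ hr]; simpa using hr1)
  rw [map_smul_eq_mul, hn, inv_mul_lt_iff₀ hr] at this
  linarith

/-- The open unit balls of the continuous seminorms form a neighbourhood basis of the origin. -/
theorem exists_seminorm_of_mem_nhds {E : Type*} [AddCommGroup E] [Module ℂ E]
    [TopologicalSpace E] [PolynormableSpace ℂ E] {u : Set E} (hu : u ∈ 𝓝 (0 : E)) :
    ∃ p : Seminorm ℂ E, Continuous p ∧ ∀ x, p x < 1 → x ∈ u := by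
  have hw := PolynormableSpace.withSeminorms ℂ E
  have := hw.topologicalAddGroup
  have := hw.continuousSMul
  obtain ⟨⟨s, r⟩, hr, hs⟩ := hw.hasBasis_zero_ball.mem_iff.1 hu
  have hr : 0 < r := hr
  have hc : Continuous ⇑(s.sup fun p : {p : Seminorm ℂ E // Continuous p} => p.1) := by
    refine Seminorm.continuous (p := s.sup fun p : {p : Seminorm ℂ E // Continuous p} => p.1)
      (r := 1) ?_
    exact hw.hasBasis_zero_ball.mem_of_mem (i := (s, (1 : ℝ))) one_pos
  let c : NNReal := ⟨r⁻¹, (inv_pos.2 hr).le⟩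
  refine ⟨c • s.sup fun p => p.1, hc.const_smul c, fun x hx => hs ?_⟩
  rw [smul_apply] at hx
  have : r⁻¹ * (s.sup fun p : {p : Seminorm ℂ E // Continuous p} => p.1) x < 1 := hx
  rw [Seminorm.mem_ball_zero]
  simpa using (inv_mul_lt_iff₀ hr).1 this

/-- A bilinear map that is continuous at the origin is bounded by a product of seminorms. -/
theorem exists_bilin_bound {E F : Type*} [AddCommGroup E] [Module ℂ E] [TopologicalSpace E]
    [AddCommGroup F] [Module ℂ F] [TopologicalSpace F]
    [PolynormableSpace ℂ E] [PolynormableSpace ℂ F]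
    {G : Type*} [AddCommGroup G] [Module ℂ G] (B : E →ₗ[ℂ] F →ₗ[ℂ] G) (q : Seminorm ℂ G)
    (hB : ContinuousAt (fun x : E × F => q (B x.1 x.2)) (0, 0)) :
    ∃ (p₁ : Seminorm ℂ E) (p₂ : Seminorm ℂ F), Continuous p₁ ∧ Continuous p₂ ∧
      ∀ a b, q (B a b) ≤ p₁ a * p₂ b := by
  have h0 : ∀ᶠ x : E × F in 𝓝 (0, 0), q (B x.1 x.2) < 1 :=
    hB.eventually (gt_mem_nhds (by simp))
  rw [nhds_prod_eq] at h0
  obtain ⟨u, hu, v, hv, huv⟩ := Filter.eventually_prod_iff.1 h0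
  obtain ⟨p₁, hp₁, h₁⟩ := exists_seminorm_of_mem_nhds hu
  obtain ⟨p₂, hp₂, h₂⟩ := exists_seminorm_of_mem_nhds hv
  refine ⟨p₁, p₂, hp₁, hp₂, fun a b => ?_⟩
  have key : ∀ b, p₂ b < 1 → ∀ a, q (B a b) ≤ p₁ a := fun b hb a =>
    seminorm_le_of_lt_one (p := q.comp (B.flip b)) (q := p₁)
      (fun x hx => huv (h₁ x hx) (h₂ b hb)) a
  by_contra! hlt
  have : ∃ r, p₂ b < r ∧ p₁ a * r < q (B a b) := by
    rcases (apply_nonneg p₁ a).eq_or_lt with h | h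
    · exact ⟨p₂ b + 1, by linarith, by rw [← h] at hlt ⊢; simpa using hlt⟩
    · obtain ⟨r, hr1, hr2⟩ := exists_between ((lt_div_iff₀' h).2 hlt)
      exact ⟨r, hr1, (lt_div_iff₀' h).1 hr2⟩
  obtain ⟨r, hr1, hr2⟩ := this
  have hr : 0 < r := (apply_nonneg p₂ b).trans_lt hr1
  have hn : ‖((r⁻¹ : ℝ) : ℂ)‖ = r⁻¹ := by
    rw [Complex.norm_real, Real.norm_of_nonneg (inv_pos.2 hr).le]
  have h3 := key (((r⁻¹ : ℝ) : ℂ) • b) (by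
    rw [map_smul_eq_mul, hn, inv_mul_lt_iff₀ hr]; simpa using hr1) a
  rw [map_smul, map_smul_eq_mul, hn, inv_mul_le_iff₀ hr] at h3
  linarith

/-- The topology of a polynormable space with countably generated uniformity is given by an
increasing sequence of seminorms. -/
theorem exists_seminorm_seq (G : Type*) [AddCommGroup G] [Module ℂ G] [TopologicalSpace G]
    [IsTopologicalAddGroup G] [PolynormableSpace ℂ G] [(𝓝 (0 : G)).IsCountablyGenerated] :
    ∃ Q : ℕ → Seminorm ℂ G, Monotone Q ∧ (∀ k, Continuous (Q k)) ∧
      ∀ q : Seminorm ℂ G, Continuous q → ∃ k, ∀ m, k ≤ m → ∀ x, q x ≤ Q m x := by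
  obtain ⟨U, hU⟩ := (𝓝 (0 : G)).exists_antitone_basis
  have h1 : ∀ k, ∃ q : Seminorm ℂ G, Continuous q ∧ q.ball 0 1 ⊆ U k := by
    intro k
    obtain ⟨q, hq, h⟩ := exists_seminorm_of_mem_nhds (hU.1.mem_of_mem (i := k) trivial)
    exact ⟨q, hq, fun x hx => h x ((q.mem_ball_zero).1 hx)⟩
  choose q hqc hq using h1
  have hmono : Monotone fun k => ∑ i ∈ Finset.range (k + 1), q i := by
    refine monotone_nat_of_le_succ fun k x => ?_
    rw [Finset.sum_range_succ _ (k + 1), add_apply]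
    exact le_add_of_nonneg_right (apply_nonneg _ _)
  refine ⟨fun k => ∑ i ∈ Finset.range (k + 1), q i, hmono, ?_, ?_⟩
  · intro k
    have : ∀ n, Continuous (∑ i ∈ Finset.range n, q i : Seminorm ℂ G) := by
      intro n
      induction n with
      | zero => exact continuous_const (y := (0 : ℝ))
      | succ n ih =>
        rw [Finset.sum_range_succ]
        exact ih.add (hqc n)
    exact this _
  · intro p hp
    have : p.ball 0 1 ∈ 𝓝 (0 : G) := by
      have h := (hp.tendsto 0).eventually (gt_mem_nhds (show p 0 < 1 by simp))
      filter_upwards [h] with x hx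
      simpa [Seminorm.mem_ball_zero] using hx
    obtain ⟨k, -, hk⟩ := hU.1.mem_iff.1 this
    refine ⟨k, fun m hm x => ?_⟩
    refine le_trans ?_ (hmono hm x)
    refine seminorm_le_of_lt_one (fun y hy => ?_) x
    have hle : q k ≤ ∑ i ∈ Finset.range (k + 1), q i :=
      Finset.single_le_sum (f := q) (fun i _ => bot_le) (Finset.mem_range.2 (by omega))
    have h1 : y ∈ U k := hq k ((q k).mem_ball_zero.2 ((hle y).trans_lt hy))
    exact p.mem_ball_zero.1 (hk h1)

end Seminorms

/-! ### Integrals with values in a Fréchet space -/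

section Integral

variable {G : Type*} [AddCommGroup G] [Module ℂ G]

/-- For `q ≤ q'`, the canonical map between the local Banach spaces; it is a contraction. -/
theorem exists_localMap {q q' : Seminorm ℂ G} (h : ∀ x, q x ≤ q' x) :
    ∃ S : LocalBanach q' →L[ℂ] LocalBanach q,
      (∀ x, S (toLocalₗ q' x) = toLocalₗ q x) ∧ ∀ x, ‖S x‖ ≤ ‖x‖ := by
  obtain ⟨S, hS⟩ := exists_localLift (q := q') (toLocalₗ q) (fun x => by simpa using h x)
  refine ⟨S, hS, fun x => ?_⟩
  refine (denseRange_toLocalₗ q').induction_on (p := fun x => ‖S x‖ ≤ ‖x‖) x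
    (isClosed_le (S.continuous.norm) continuous_norm) fun y => ?_
  rw [hS, norm_toLocalₗ, norm_toLocalₗ]
  exact h y

theorem tendsto_of_seminorm [TopologicalSpace G] [PolynormableSpace ℂ G] {ι : Type*} {l : Filter ι} {u : ι → G}
    {y : G} (h : ∀ q : Seminorm ℂ G, Continuous q → Tendsto (fun i => q (u i - y)) l (𝓝 0)) :
    Tendsto u l (𝓝 y) := by
  rw [(PolynormableSpace.withSeminorms ℂ G).tendsto_nhds]
  intro q ε hε
  exact (h q.1 q.2).eventually (gt_mem_nhds hε)

variable [UniformSpace G] [IsUniformAddGroup G]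

theorem tendsto_seminorm_sub {ι : Type*} {l : Filter ι} {u : ι → G} {y : G}
    (h : Tendsto u l (𝓝 y)) {q : Seminorm ℂ G} (hq : Continuous q) :
    Tendsto (fun i => q (u i - y)) l (𝓝 0) := by
  have := (hq.tendsto 0).comp (tendsto_sub_nhds_zero_iff.2 h)
  rwa [map_zero] at this

/-- Integrals of continuous bounded functions against an integrable density exist in Fréchet
spaces: the integrals in the local Banach spaces are compatible, and a point of the projective
limit of the local Banach spaces comes from the complete space itself. -/
theorem exists_integral [PolynormableSpace ℂ G] [CompleteSpace G]
    [(𝓤 G).IsCountablyGenerated] {W : Type*} [TopologicalSpace W] [SecondCountableTopology W]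
    [MeasurableSpace W] [BorelSpace W] {μ : Measure W} {k : W → ℂ} (hk : Integrable k μ)
    {f : W → G} (hf : Continuous f) (hb : ∀ q : Seminorm ℂ G, Continuous q → ∃ C, ∀ x, q (f x) ≤ C) :
    ∃ v : G, (∀ ℓ : G →L[ℂ] ℂ, ℓ v = ∫ x, k x * ℓ (f x) ∂μ) ∧
      ∀ q : Seminorm ℂ G, Continuous q → q v ≤ ∫ x, ‖k x‖ * q (f x) ∂μ := by
  have hcg : (𝓝 (0 : G)).IsCountablyGenerated := UniformSpace.firstCountableTopology G |>.1 0
  obtain ⟨Q, hQm, hQc, hQ⟩ := exists_seminorm_seq G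
  have hint : ∀ q : Seminorm ℂ G, Continuous q →
      Integrable (fun x => k x • toLocalₗ q (f x)) μ := by
    intro q hq
    obtain ⟨C, hC⟩ := hb q hq
    refine hk.smul_bdd C ((continuous_toLocalₗ hq).comp hf).aestronglyMeasurable ?_
    exact ae_of_all _ fun x => by simpa using hC x
  let J : ∀ q : Seminorm ℂ G, LocalBanach q := fun q => ∫ x, k x • toLocalₗ q (f x) ∂μ
  -- Approximate the integral in the `m`-th local Banach space by an element of `G`, up to `2⁻ᵐ`.
  have happ : ∀ m, ∃ v : G, ‖J (Q m) - toLocalₗ (Q m) v‖ < (1 / 2 : ℝ) ^ m := by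
    intro m
    obtain ⟨v, hv⟩ := (denseRange_toLocalₗ (Q m)).exists_dist_lt (J (Q m))
      (show (0 : ℝ) < (1 / 2 : ℝ) ^ m by positivity)
    exact ⟨v, by rwa [dist_eq_norm] at hv⟩
  choose v hv using happ
  -- The approximations converge in every local Banach space, as the integrals are compatible.
  have hlim : ∀ q : Seminorm ℂ G, Continuous q →
      Tendsto (fun m => toLocalₗ q (v m)) atTop (𝓝 (J q)) := by
    intro q hq
    obtain ⟨m₀, hm₀⟩ := hQ q hq
    rw [tendsto_iff_norm_sub_tendsto_zero]
    refine squeeze_zero' (Eventually.of_forall fun _ => norm_nonneg _) ?_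
      (tendsto_pow_atTop_nhds_zero_of_lt_one (r := (1 / 2 : ℝ)) (by norm_num) (by norm_num))
    filter_upwards [eventually_ge_atTop m₀] with m hm
    obtain ⟨S, hS, hSn⟩ := exists_localMap (hm₀ m hm)
    have h1 : S (J (Q m)) = J q := by
      simp only [J]
      rw [← S.integral_comp_comm (hint _ (hQc m))]
      simp only [map_smul, hS]
    rw [← h1, ← hS, ← map_sub, ← norm_neg, ← map_neg, neg_sub]
    exact (hSn _).trans (hv m).le
  have hcau : CauchySeq v := by
    rw [CauchySeq, cauchy_map_iff']
    rw [uniformity_eq_comap_nhds_zero, tendsto_comap_iff]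
    refine tendsto_of_seminorm fun q hq => ?_
    have h1 := (hlim q hq).comp (tendsto_snd (f := atTop (α := ℕ)) (g := atTop (α := ℕ)))
    have h2 := (hlim q hq).comp (tendsto_fst (f := atTop (α := ℕ)) (g := atTop (α := ℕ)))
    have h3 := (h1.sub h2).norm
    rw [sub_self, norm_zero] at h3
    refine h3.congr fun p => ?_
    simp [← map_sub]
  obtain ⟨w, hw⟩ := cauchySeq_tendsto_of_complete hcau
  have hwJ : ∀ q : Seminorm ℂ G, Continuous q → toLocalₗ q w = J q := fun q hq =>
    tendsto_nhds_unique (((continuous_toLocalₗ hq).tendsto w).comp hw) (hlim q hq)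
  refine ⟨w, fun ℓ => ?_, fun q hq => ?_⟩
  · obtain ⟨q, hq, S, hS⟩ := exists_dual_factor ℓ
    rw [← hS, hwJ q hq]
    simp only [J]
    rw [← S.integral_comp_comm (hint q hq)]
    simp [hS]
  · rw [← norm_toLocalₗ, hwJ q hq]
    refine (norm_integral_le_integral_norm _).trans (le_of_eq ?_)
    simp [norm_smul]

end Integral

/-! ### Completions of locally convex spaces -/

section Completion

variable (Z : Type*) [AddCommGroup Z] [Module ℂ Z] [UniformSpace Z] [IsUniformAddGroup Z]
  [UniformContinuousConstSMul ℂ Z]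

/-- The canonical map of a topological vector space into its completion. -/
def complCoe : Z →L[ℂ] Completion Z where
  toFun x := x
  map_add' := Completion.coe_add
  map_smul' := Completion.coe_smul
  cont := Completion.continuous_coe Z

/-- The continuous seminorms extend to the completion, where they still define the topology. -/
theorem polynormable_completion [PolynormableSpace ℂ Z] : PolynormableSpace ℂ (Completion Z) := by
  have hext : ∀ p : {p : Seminorm ℂ Z // Continuous p}, ∃ p' : Seminorm ℂ (Completion Z),
      Continuous p' ∧ ∀ x : Z, p' (x : Completion Z) = p.1 x := by
    intro p
    let j : Z →L[ℂ] LocalBanach p.1 := ⟨toLocalₗ p.1, continuous_toLocalₗ p.2⟩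
    let i : Z →L[ℂ] Completion Z := complCoe Z
    have hi : ∀ x : Z, (j.extend i) (x : Completion Z) = j x := fun x =>
      ContinuousLinearMap.extend_eq j (e := i) Completion.denseRange_coe
        (Completion.isUniformInducing_coe Z) x
    refine ⟨(normSeminorm ℂ _).comp (j.extend i).toLinearMap,
      continuous_norm.comp (j.extend i).continuous, fun x => ?_⟩
    change ‖(j.extend i) (x : Completion Z)‖ = _
    rw [hi]
    exact norm_toLocalₗ _ _
  choose p' hp'c hp' using hext
  refine (((SeminormFamily.withSeminorms_iff_nhds_eq_iInf (𝕜 := ℂ) p').2 ?_)).toPolynormableSpace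
  refine le_antisymm (le_iInf fun p => ?_) fun N hN => ?_
  · have := (hp'c p).tendsto 0
    rw [map_zero] at this
    exact tendsto_iff_comap.1 this
  · have hb := (𝓝 (0 : Z)).basis_sets.hasBasis_of_isDenseInducing
      (Completion.isDenseInducing_coe (α := Z))
    rw [Completion.coe_zero] at hb
    obtain ⟨U, hU, hUN⟩ := hb.mem_iff.1 hN
    obtain ⟨p, hpc, hp⟩ := exists_seminorm_of_mem_nhds (show U ∈ 𝓝 (0 : Z) from hU)
    refine mem_iInf_of_mem ⟨p, hpc⟩ ⟨Set.Iio 1, Iio_mem_nhds one_pos, fun x hx => hUN ?_⟩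
    rw [mem_closure_iff]
    intro O hO hxO
    have ho : IsOpen (O ∩ (p' ⟨p, hpc⟩) ⁻¹' Set.Iio 1) := hO.inter (isOpen_Iio.preimage (hp'c _))
    obtain ⟨z, hz⟩ := Completion.denseRange_coe.exists_mem_open ho ⟨x, hxO, hx⟩
    refine ⟨z, hz.1, z, hp z ?_, rfl⟩
    have := hz.2
    rw [Set.mem_preimage, hp'] at this
    exact this

theorem countablyGenerated_completion [(𝓝 (0 : Z)).IsCountablyGenerated] :
    (𝓤 (Completion Z)).IsCountablyGenerated := by
  obtain ⟨U, hU⟩ := (𝓝 (0 : Z)).exists_antitone_basis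
  have hb := hU.1.hasBasis_of_isDenseInducing (Completion.isDenseInducing_coe (α := Z))
  rw [Completion.coe_zero] at hb
  have : (𝓝 (0 : Completion Z)).IsCountablyGenerated := hb.isCountablyGenerated
  exact IsUniformAddGroup.uniformity_countably_generated

end Completion

/-! ### The completed projective tensor product -/

section Projective

variable (E F : Type*) [AddCommGroup E] [Module ℂ E] [TopologicalSpace E]
  [AddCommGroup F] [Module ℂ F] [TopologicalSpace F]

instance : PolynormableSpace ℂ (ProjTensor E F) :=
  (projTensor_withSeminorms E F).toPolynormableSpace

instance : PolynormableSpace ℂ (ProjCompl E F) := polynormable_completion _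

variable {E F}

theorem projSeminorm_mono {p p' : Seminorm ℂ E} {q q' : Seminorm ℂ F} (hp : ∀ x, p x ≤ p' x)
    (hq : ∀ x, q x ≤ q' x) (c : ProjTensor E F) : projSeminorm p q c ≤ projSeminorm p' q' c := by
  refine le_projSeminormFun p' q' fun L hL => (projSeminormFun_le p q hL).trans ?_
  refine List.sum_le_sum fun r _ => ?_
  exact mul_le_mul (hp _) (hq _) (apply_nonneg _ _) (apply_nonneg _ _)

variable (E F)

/-- The projective tensor product of metrizable spaces is metrizable: cofinal sequences of seminorms
of the factors give a countable family of projective seminorms. -/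
theorem countablyGenerated_projTensor [IsTopologicalAddGroup E] [IsTopologicalAddGroup F]
    [PolynormableSpace ℂ E] [PolynormableSpace ℂ F]
    [(𝓝 (0 : E)).IsCountablyGenerated] [(𝓝 (0 : F)).IsCountablyGenerated] :
    (𝓝 (0 : ProjTensor E F)).IsCountablyGenerated := by
  obtain ⟨Q, -, hQc, hQ⟩ := exists_seminorm_seq E
  obtain ⟨R, -, hRc, hR⟩ := exists_seminorm_seq F
  have hw : WithSeminorms (fun i : ℕ × ℕ => (projSeminorm (Q i.1) (R i.2) :
      Seminorm ℂ (ProjTensor E F))) := by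
    refine (projTensor_withSeminorms E F).congr (fun i => ?_) (fun r => ?_)
    · exact ⟨{(⟨Q i.1, hQc _⟩, ⟨R i.2, hRc _⟩)}, 1, by simp [projFamily]⟩
    · obtain ⟨i, hi⟩ := hQ r.1.1 r.1.2
      obtain ⟨j, hj⟩ := hR r.2.1 r.2.2
      refine ⟨{(i, j)}, 1, fun c => ?_⟩
      simp only [Finset.sup_singleton, one_smul]
      exact projSeminorm_mono (hi i le_rfl) (hj j le_rfl) c
  exact hw.firstCountableTopology.1 0

variable {E F}

/-- The canonical bilinear map into the completed projective tensor product. -/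
def tensₗ : E →ₗ[ℂ] F →ₗ[ℂ] ProjCompl E F :=
  (TensorProduct.mk ℂ E F).compr₂ (complCoe (ProjTensor E F)).toLinearMap

theorem tensₗ_apply (a : E) (b : F) : tensₗ a b = tens a b := rfl

/-- The canonical bilinear map into the completed projective tensor product is continuous. -/
theorem exists_tens_bound {q : Seminorm ℂ (ProjCompl E F)} (hq : Continuous q) :
    ∃ (p₁ : Seminorm ℂ E) (p₂ : Seminorm ℂ F), Continuous p₁ ∧ Continuous p₂ ∧
      ∀ a b, q (tens a b) ≤ p₁ a * p₂ b := by
  let q₀ : Seminorm ℂ (ProjTensor E F) :=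
    q.comp (complCoe (ProjTensor E F)).toLinearMap
  have hq₀ : Continuous q₀ := hq.comp (Completion.continuous_coe _)
  obtain ⟨s, C, -, h⟩ := Seminorm.bound_of_continuous (projTensor_withSeminorms E F) q₀ hq₀
  -- A finite supremum of projective seminorms is dominated by a single one.
  have hs : ∀ s : Finset ({p : Seminorm ℂ E // Continuous p} × {q : Seminorm ℂ F // Continuous q}),
      ∃ (p₁ : Seminorm ℂ E) (p₂ : Seminorm ℂ F), Continuous p₁ ∧ Continuous p₂ ∧
        ∀ r ∈ s, (∀ x, r.1.1 x ≤ p₁ x) ∧ ∀ x, r.2.1 x ≤ p₂ x := by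
    classical
    intro s
    induction s using Finset.induction_on with
    | empty => exact ⟨0, 0, continuous_const, continuous_const, by simp⟩
    | insert r s _ ih =>
      obtain ⟨p₁, p₂, h1, h2, h3⟩ := ih
      refine ⟨r.1.1 + p₁, r.2.1 + p₂, r.1.2.add h1, r.2.2.add h2, fun t ht => ?_⟩
      rcases Finset.mem_insert.1 ht with rfl | ht
      · exact ⟨fun x => le_add_of_nonneg_right (apply_nonneg p₁ x),
          fun x => le_add_of_nonneg_right (apply_nonneg p₂ x)⟩
      · exact ⟨fun x => ((h3 t ht).1 x).trans (le_add_of_nonneg_left (apply_nonneg r.1.1 x)),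
          fun x => ((h3 t ht).2 x).trans (le_add_of_nonneg_left (apply_nonneg r.2.1 x))⟩
  obtain ⟨p₁, p₂, h1, h2, h3⟩ := hs s
  refine ⟨C • p₁, p₂, h1.const_smul C, h2, fun a b => ?_⟩
  have key : ∀ c : ProjTensor E F, (s.sup (projFamily E F)) c ≤ projSeminorm p₁ p₂ c := by
    intro c
    refine Seminorm.finset_sup_apply_le (apply_nonneg _ _) fun r hr => ?_
    exact projSeminorm_mono (h3 r hr).1 (h3 r hr).2 c
  calc q (tens a b) = q₀ (show ProjTensor E F from a ⊗ₜ[ℂ] b) := rfl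
    _ ≤ C * (s.sup (projFamily E F)) (show ProjTensor E F from a ⊗ₜ[ℂ] b) := h _
    _ ≤ C * (p₁ a * p₂ b) := by
        refine mul_le_mul_of_nonneg_left ((key _).trans ?_) C.2
        refine (projSeminormFun_le p₁ p₂ (L := [(a, b)]) ?_).trans (by simp [decompCost])
        simp [Decompositions]
    _ = (C • p₁) a * p₂ b := by rw [← mul_assoc]; rfl

/-- The universal property of the completed projective tensor product. -/
theorem exists_projLift {G : Type*} [AddCommGroup G] [Module ℂ G] [UniformSpace G]
    [IsUniformAddGroup G] [PolynormableSpace ℂ G] [CompleteSpace G] [T2Space G]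
    (B : E →ₗ[ℂ] F →ₗ[ℂ] G)
    (hB : ∀ q : Seminorm ℂ G, Continuous q → ∃ (p₁ : Seminorm ℂ E) (p₂ : Seminorm ℂ F),
      Continuous p₁ ∧ Continuous p₂ ∧ ∀ a b, q (B a b) ≤ p₁ a * p₂ b) :
    ∃ T : ProjCompl E F →L[ℂ] G, ∀ a b, T (tens a b) = B a b := by
  have hG : ContinuousSMul ℂ G := (PolynormableSpace.withSeminorms ℂ G).continuousSMul
  let T₀ : ProjTensor E F →ₗ[ℂ] G := TensorProduct.lift B
  have hT₀ : Continuous T₀ := by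
    refine WithSeminorms.continuous_of_continuous_comp (PolynormableSpace.withSeminorms ℂ G) T₀
      fun q => ?_
    obtain ⟨p₁, p₂, h1, h2, h3⟩ := hB q.1 q.2
    refine Seminorm.continuous_of_le (q := projSeminorm p₁ p₂) ?_ fun c => ?_
    · exact (projTensor_withSeminorms E F).continuous_seminorm (⟨p₁, h1⟩, ⟨p₂, h2⟩)
    · have hsum : ∀ L : List (E × F), (q.1.comp T₀)
          (L.map fun q => (q.1 ⊗ₜ[ℂ] q.2 : E ⊗[ℂ] F)).sum ≤ decompCost p₁ p₂ L := fun L => ?_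
      · refine le_projSeminormFun p₁ p₂ fun L hL => ?_
        have hL : (L.map fun q => (q.1 ⊗ₜ[ℂ] q.2 : E ⊗[ℂ] F)).sum = c := hL
        exact hL ▸ hsum L
      induction L with
      | nil => exact (map_zero (q.1.comp T₀)).le
      | cons r L ih =>
        rw [List.map_cons, List.sum_cons]
        refine (map_add_le_add _ _ _).trans ?_
        have : decompCost p₁ p₂ (r :: L) = p₁ r.1 * p₂ r.2 + decompCost p₁ p₂ L := by
          simp [decompCost]
        rw [this]
        refine add_le_add ?_ ih
        refine le_trans (le_of_eq ?_) (h3 r.1 r.2)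
        exact congrArg q.1 (TensorProduct.lift.tmul (f' := B) r.1 r.2)
  let T₁ : ProjTensor E F →L[ℂ] G := ⟨T₀, hT₀⟩
  refine ⟨T₁.extend (complCoe (ProjTensor E F)), fun a b => ?_⟩
  refine (ContinuousLinearMap.extend_eq T₁ (e := complCoe (ProjTensor E F)) Completion.denseRange_coe
    (Completion.isUniformInducing_coe _) (show ProjTensor E F from a ⊗ₜ[ℂ] b)).trans ?_
  exact TensorProduct.lift.tmul (f' := B) a b

end Projective

/-! ### Maps into spaces of functions with uniform convergence -/

section UniformFunctions

/-- A linear map into a space of functions with the topology of uniform convergence is continuous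
as soon as its evaluations are equicontinuous. -/
theorem continuous_uniformFun {E A Y : Type*} [AddCommGroup E] [Module ℂ E] [TopologicalSpace E]
    [IsTopologicalAddGroup E] [AddCommGroup A] [Module ℂ A] [UniformSpace A] [IsUniformAddGroup A]
    [PolynormableSpace ℂ A] (T : E →+ (Y →ᵤ A))
    (hT : ∀ q : Seminorm ℂ A, Continuous q → ∃ p : Seminorm ℂ E, Continuous p ∧
      ∀ a y, q (UniformFun.toFun (T a) y) ≤ p a) : Continuous T := by
  refine continuous_of_continuousAt_zero T ?_
  rw [ContinuousAt, map_zero]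
  rw [(UniformFun.hasBasis_nhds Y A 0).tendsto_right_iff]
  intro V hV
  rw [uniformity_eq_comap_nhds_zero] at hV
  obtain ⟨u, hu, huV⟩ := hV
  obtain ⟨q, hq, hqu⟩ := exists_seminorm_of_mem_nhds hu
  obtain ⟨p, hp, hpq⟩ := hT q hq
  have : ∀ᶠ a in 𝓝 (0 : E), p a < 1 :=
    (hp.tendsto 0).eventually (gt_mem_nhds (show p 0 < 1 by simp))
  filter_upwards [this] with a ha y
  refine huV ?_
  refine hqu _ ?_
  have : q (UniformFun.toFun (T a) y - 0) < 1 := by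
    rw [sub_zero]
    exact (hpq a y).trans_lt ha
  exact this

end UniformFunctions

/-! ### Iterated directional derivatives -/

section DirD

variable {W : Type*} [NormedAddCommGroup W] [NormedSpace ℝ W]

/-- The iterated directional derivative of `f` along the vectors of a list, the head of the list
being differentiated last. -/
def dirD : List W → (W → ℂ) → W → ℂ
  | [], f => f
  | v :: l, f => fun x => fderiv ℝ (dirD l f) x v

theorem contDiff_dirD {f : W → ℂ} (hf : ContDiff ℝ ∞ f) (l : List W) :
    ContDiff ℝ ∞ (dirD l f) := by
  induction l with
  | nil => exact hf
  | cons v l ih => exact (ih.fderiv_right (m := ∞) (by simp)).clm_apply contDiff_const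

theorem differentiable_dirD {f : W → ℂ} (hf : ContDiff ℝ ∞ f) (l : List W) :
    Differentiable ℝ (dirD l f) := (contDiff_dirD hf l).differentiable (by simp)

theorem continuous_dirD {f : W → ℂ} (hf : ContDiff ℝ ∞ f) (l : List W) :
    Continuous (dirD l f) := (contDiff_dirD hf l).continuous

theorem dirD_append (l l' : List W) (f : W → ℂ) : dirD (l ++ l') f = dirD l (dirD l' f) := by
  induction l with
  | nil => rfl
  | cons v l ih => simp only [List.cons_append, dirD, ih]

theorem dirD_add {f g : W → ℂ} (hf : ContDiff ℝ ∞ f) (hg : ContDiff ℝ ∞ g) (l : List W) :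
    dirD l (f + g) = dirD l f + dirD l g := by
  induction l with
  | nil => rfl
  | cons v l ih =>
    funext x
    simp only [dirD, ih, Pi.add_apply]
    rw [fderiv_add (differentiable_dirD hf l x) (differentiable_dirD hg l x)]
    rfl

theorem dirD_const_mul {f : W → ℂ} (hf : ContDiff ℝ ∞ f) (c : ℂ) (l : List W) :
    dirD l (fun x => c * f x) = fun x => c * dirD l f x := by
  induction l with
  | nil => rfl
  | cons v l ih =>
    funext x
    simp only [dirD, ih]
    rw [fderiv_const_mul (differentiable_dirD hf l x)]
    rfl

theorem dirD_const (c : ℂ) (v : W) (l : List W) : dirD (v :: l) (fun _ : W => c) = 0 := by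
  induction l generalizing v with
  | nil => funext x; simp [dirD]
  | cons u l ih =>
    funext x
    have := ih u
    rw [dirD, this]
    simp

/-- The ways to distribute the elements of a list over two lists. -/
def splits {α : Type*} : List α → List (List α × List α)
  | [] => [([], [])]
  | a :: l => (splits l).map (fun q => (a :: q.1, q.2)) ++ (splits l).map (fun q => (q.1, a :: q.2))

/-- Leibniz's rule, as a sum over the ways to distribute the directions over the two factors. -/
theorem dirD_mul {f g : W → ℂ} (hf : ContDiff ℝ ∞ f) (hg : ContDiff ℝ ∞ g) (l : List W) (x : W) :
    dirD l (fun x => f x * g x) x =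
      ((splits l).map fun q => dirD q.1 f x * dirD q.2 g x).sum := by
  induction l generalizing x with
  | nil => simp [splits, dirD]
  | cons v l ih =>
    have h : dirD l (fun x => f x * g x) =
        fun x => ((splits l).map fun q => dirD q.1 f x * dirD q.2 g x).sum := funext ih
    have hder : ∀ L : List (List W × List W), HasFDerivAt
        (fun x => (L.map fun q => dirD q.1 f x * dirD q.2 g x).sum)
        (L.map fun q => dirD q.1 f x • fderiv ℝ (dirD q.2 g) x +
          dirD q.2 g x • fderiv ℝ (dirD q.1 f) x).sum x := by
      intro L
      induction L with
      | nil => simpa using hasFDerivAt_const (0 : ℂ) x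
      | cons q L ihL =>
        simp only [List.map_cons, List.sum_cons]
        exact ((differentiable_dirD hf q.1 x).hasFDerivAt.mul
          (differentiable_dirD hg q.2 x).hasFDerivAt).add ihL
    have hs : ∀ L : List (List W × List W), (L.map fun q => dirD q.1 f x • fderiv ℝ (dirD q.2 g) x +
          dirD q.2 g x • fderiv ℝ (dirD q.1 f) x).sum v =
        (L.map fun q => dirD (v :: q.1) f x * dirD q.2 g x).sum +
          (L.map fun q => dirD q.1 f x * dirD (v :: q.2) g x).sum := by
      intro L
      induction L with
      | nil => simp
      | cons q L ihL =>
        simp only [List.map_cons, List.sum_cons, add_apply, ihL]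
        simp only [dirD, smul_apply, smul_eq_mul]
        ring
    simp only [dirD, h]
    rw [(hder _).fderiv, hs]
    simp only [splits, List.map_append, List.map_map, List.sum_append, Function.comp_def]

theorem dirD_comp_clm {W' : Type*} [NormedAddCommGroup W'] [NormedSpace ℝ W'] {f : W' → ℂ}
    (hf : ContDiff ℝ ∞ f) (A : W →L[ℝ] W') (l : List W) :
    dirD l (fun x => f (A x)) = fun x => dirD (l.map A) f (A x) := by
  induction l with
  | nil => rfl
  | cons v l ih =>
    funext x
    simp only [dirD, ih]
    have := (differentiable_dirD hf (l.map A) (A x)).hasFDerivAt.comp x A.hasFDerivAt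
    have h2 : fderiv ℝ (fun x => dirD (l.map A) f (A x)) x = _ := this.fderiv
    rw [h2]
    rfl

theorem hasCompactSupport_dirD {f : W → ℂ} (hf : HasCompactSupport f) (l : List W) :
    HasCompactSupport (dirD l f) := by
  induction l with
  | nil => exact hf
  | cons v l ih => exact HasCompactSupport.comp_left (g := fun T : W →L[ℝ] ℂ => T v) (ih.fderiv ℝ) rfl

/-- The smooth functions all of whose derivatives are bounded. -/
structure BB (f : W → ℂ) : Prop where
  smooth : ContDiff ℝ ∞ f
  bound : ∀ m : ℕ, ∃ C : ℝ, 0 ≤ C ∧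
    ∀ l : List W, l.length = m → ∀ x, ‖dirD l f x‖ ≤ C * (l.map fun v => ‖v‖).prod

theorem BB.bound_list {f : W → ℂ} (hf : BB f) (l : List W) : ∃ C : ℝ, ∀ x, ‖dirD l f x‖ ≤ C := by
  obtain ⟨C, -, hC⟩ := hf.bound l.length
  exact ⟨_, hC l rfl⟩

/-- It suffices to bound the derivatives in the directions of a basis. -/
theorem BB.of_basis {ι : Type*} [Fintype ι] [FiniteDimensional ℝ W] (b : Module.Basis ι ℝ W)
    {f : W → ℂ} (hf : ContDiff ℝ ∞ f)
    (h : ∀ l : List ι, ∃ C : ℝ, ∀ x, ‖dirD (l.map b) f x‖ ≤ C) : BB f := by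
  refine ⟨hf, fun m => ?_⟩
  induction m generalizing f with
  | zero =>
    obtain ⟨C, hC⟩ := h []
    refine ⟨|C|, abs_nonneg _, fun l hl x => ?_⟩
    rw [List.length_eq_zero_iff] at hl
    subst hl
    simpa using (hC x).trans (le_abs_self C)
  | succ m ih =>
    have h1 : ∀ i, ∃ C : ℝ, 0 ≤ C ∧ ∀ l : List W, l.length = m → ∀ x,
        ‖dirD l (dirD [b i] f) x‖ ≤ C * (l.map fun v => ‖v‖).prod := fun i =>
      ih (contDiff_dirD hf _) fun l => by
        obtain ⟨C, hC⟩ := h (l ++ [i])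
        refine ⟨C, fun x => ?_⟩
        rw [← dirD_append]
        simpa using hC x
    choose C hC0 hC using h1
    let κ : ι → ℝ := fun i => ‖(LinearMap.toContinuousLinearMap (b.coord i))‖
    refine ⟨∑ i, κ i * C i, Finset.sum_nonneg fun i _ => mul_nonneg (norm_nonneg _) (hC0 i),
      fun l hl x => ?_⟩
    have hne : l ≠ [] := by rintro rfl; simp at hl
    obtain ⟨l', v, rfl⟩ : ∃ l' v, l = l' ++ [v] :=
      ⟨l.dropLast, l.getLast hne, (List.dropLast_append_getLast hne).symm⟩
    have hl' : l'.length = m := by simpa using hl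
    have hlin : ∀ s : Finset ι, dirD l' (fun x => ∑ i ∈ s, ((b.coord i v : ℝ) : ℂ) * dirD [b i] f x) x =
        ∑ i ∈ s, ((b.coord i v : ℝ) : ℂ) * dirD l' (dirD [b i] f) x := by
      classical
      intro s
      induction s using Finset.induction_on generalizing x with
      | empty =>
        have hz : ∀ l : List W, dirD l (fun _ : W => (0 : ℂ)) = fun _ => 0 := by
          intro l
          cases l with
          | nil => rfl
          | cons v l => exact dirD_const 0 v l
        simp [hz]
      | insert i s hi ihs =>
        simp only [Finset.sum_insert hi]
        have := dirD_add (f := fun x => ((b.coord i v : ℝ) : ℂ) * dirD [b i] f x)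
          (g := fun x => ∑ j ∈ s, ((b.coord j v : ℝ) : ℂ) * dirD [b j] f x)
          (contDiff_const.mul (contDiff_dirD hf _))
          (ContDiff.sum fun j _ => contDiff_const.mul (contDiff_dirD hf _)) l'
        have h3 := congrFun this x
        rw [Pi.add_apply, ihs, dirD_const_mul (contDiff_dirD hf _)] at h3
        exact h3
    have hv : dirD [v] f = fun x => ∑ i, ((b.coord i v : ℝ) : ℂ) * dirD [b i] f x := by
      funext x
      simp only [dirD]
      conv_lhs => rw [← b.sum_repr v]
      rw [map_sum]
      refine Finset.sum_congr rfl fun i _ => ?_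
      rw [map_smul, Complex.real_smul]
      rfl
    rw [dirD_append, hv, hlin]
    refine (norm_sum_le _ _).trans ?_
    rw [List.map_append, List.prod_append, Finset.sum_mul]
    refine Finset.sum_le_sum fun i _ => ?_
    rw [norm_mul, Complex.norm_real]
    have h4 : ‖b.coord i v‖ ≤ κ i * ‖v‖ :=
      (LinearMap.toContinuousLinearMap (b.coord i)).le_opNorm v
    calc ‖b.coord i v‖ * ‖dirD l' (dirD [b i] f) x‖
        ≤ (κ i * ‖v‖) * (C i * (l'.map fun v => ‖v‖).prod) :=
          mul_le_mul h4 (hC i l' hl' x) (norm_nonneg _) ((norm_nonneg _).trans h4)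
      _ = κ i * C i * ((l'.map fun v => ‖v‖).prod * ([v].map fun v => ‖v‖).prod) := by
          simp; ring

theorem BB.of_hasCompactSupport [FiniteDimensional ℝ W] {f : W → ℂ} (hf : ContDiff ℝ ∞ f)
    (hc : HasCompactSupport f) : BB f :=
  BB.of_basis (Module.finBasis ℝ W) hf fun _ =>
    (continuous_dirD hf _).bounded_above_of_compact_support (hasCompactSupport_dirD hc _)

theorem BB.mul [FiniteDimensional ℝ W] {f g : W → ℂ} (hf : BB f) (hg : BB g) :
    BB fun x => f x * g x := by
  refine BB.of_basis (Module.finBasis ℝ W) (hf.smooth.mul hg.smooth) fun l => ?_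
  simp only [dirD_mul hf.smooth hg.smooth]
  generalize splits _ = L
  induction L with
  | nil => exact ⟨0, by simp⟩
  | cons q L ih =>
    obtain ⟨C, hC⟩ := ih
    obtain ⟨C₁, h₁⟩ := hf.bound_list q.1
    obtain ⟨C₂, h₂⟩ := hg.bound_list q.2
    refine ⟨C₁ * C₂ + C, fun x => ?_⟩
    rw [List.map_cons, List.sum_cons]
    refine (norm_add_le _ _).trans (add_le_add ?_ (hC x))
    rw [norm_mul]
    exact mul_le_mul (h₁ x) (h₂ x) (norm_nonneg _) ((norm_nonneg _).trans (h₁ x))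

theorem BB.add {f g : W → ℂ} (hf : BB f) (hg : BB g) : BB fun x => f x + g x := by
  refine ⟨hf.smooth.add hg.smooth, fun m => ?_⟩
  obtain ⟨C₁, h₁, h₁'⟩ := hf.bound m
  obtain ⟨C₂, h₂, h₂'⟩ := hg.bound m
  refine ⟨C₁ + C₂, add_nonneg h₁ h₂, fun l hl x => ?_⟩
  have : dirD l (fun x => f x + g x) = dirD l f + dirD l g := dirD_add hf.smooth hg.smooth l
  rw [this, add_mul]
  exact (norm_add_le _ _).trans (add_le_add (h₁' l hl x) (h₂' l hl x))

theorem BB.const_mul {f : W → ℂ} (hf : BB f) (c : ℂ) : BB fun x => c * f x := by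
  refine ⟨contDiff_const.mul hf.smooth, fun m => ?_⟩
  obtain ⟨C, h0, h⟩ := hf.bound m
  refine ⟨‖c‖ * C, mul_nonneg (norm_nonneg _) h0, fun l hl x => ?_⟩
  rw [dirD_const_mul hf.smooth, norm_mul, mul_assoc]
  exact mul_le_mul_of_nonneg_left (h l hl x) (norm_nonneg _)

theorem prod_norm_map_le {W' : Type*} [NormedAddCommGroup W'] [NormedSpace ℝ W'] (A : W →L[ℝ] W')
    (l : List W) : ((l.map A).map fun v => ‖v‖).prod ≤ ‖A‖ ^ l.length * (l.map fun v => ‖v‖).prod := by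
  induction l with
  | nil => simp
  | cons v l ih =>
    simp only [List.map_cons, List.prod_cons, List.length_cons, pow_succ]
    calc ‖A v‖ * ((l.map A).map fun v => ‖v‖).prod
        ≤ (‖A‖ * ‖v‖) * (‖A‖ ^ l.length * (l.map fun v => ‖v‖).prod) :=
          mul_le_mul (A.le_opNorm v) ih (List.prod_nonneg (by simp)) (by positivity)
      _ = _ := by ring

theorem BB.comp_clm {W' : Type*} [NormedAddCommGroup W'] [NormedSpace ℝ W'] {f : W' → ℂ}
    (hf : BB f) (A : W →L[ℝ] W') : BB fun x => f (A x) := by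
  refine ⟨hf.smooth.comp A.contDiff, fun m => ?_⟩
  obtain ⟨C, h0, h⟩ := hf.bound m
  refine ⟨C * ‖A‖ ^ m, by positivity, fun l hl x => ?_⟩
  rw [dirD_comp_clm hf.smooth, mul_assoc]
  refine (h (l.map A) (by simpa using hl) _).trans ?_
  refine mul_le_mul_of_nonneg_left ?_ h0
  simpa [hl] using prod_norm_map_le A l

end DirD

/-! ### The regularizing operator of oscillating integrals -/

section Regularize

variable {W : Type*} [NormedAddCommGroup W] [NormedSpace ℝ W] [FiniteDimensional ℝ W]
variable {ι : Type*} [Fintype ι] (κ : ℝ) (b : Module.Basis ι ℝ W)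

/-- The weight `1 + κ ∑ x_i²`. -/
def wt (x : W) : ℝ := 1 + κ * ∑ i, (b.coord i x) ^ 2

/-- The coordinates with respect to a basis, as continuous linear functionals. -/
def coordL (i : ι) : W →L[ℝ] ℝ := LinearMap.toContinuousLinearMap (b.coord i)

theorem coordL_apply (i : ι) (x : W) : coordL b i x = b.coord i x := rfl

variable {κ}

theorem one_le_wt (hκ : 0 < κ) (x : W) : 1 ≤ wt κ b x :=
  le_add_of_nonneg_right (mul_nonneg hκ.le (Finset.sum_nonneg fun _ _ => sq_nonneg _))

theorem wt_pos (hκ : 0 < κ) (x : W) : 0 < wt κ b x := one_pos.trans_le (one_le_wt b hκ x)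

variable (κ)

theorem contDiff_wt : ContDiff ℝ ∞ (wt κ b) :=
  contDiff_const.add (contDiff_const.mul (ContDiff.sum fun i _ => (coordL b i).contDiff.pow 2))

open Classical in
theorem hasFDerivAt_wt (x : W) : HasFDerivAt (wt κ b)
    (κ • ∑ i, (2 * b.coord i x) • coordL b i) x := by
  refine HasFDerivAt.const_add 1 (HasFDerivAt.const_mul ?_ κ)
  refine HasFDerivAt.fun_sum fun i _ => ?_
  have := ((coordL b i).hasFDerivAt (x := x)).pow 2
  simpa [coordL_apply] using this

theorem fderiv_wt (x : W) (j : ι) : fderiv ℝ (wt κ b) x (b j) = 2 * κ * b.coord j x := by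
  classical
  rw [(hasFDerivAt_wt κ b x).fderiv]
  simp only [smul_apply, sum_apply, coordL_apply, smul_eq_mul, Module.Basis.coord_apply,
    Module.Basis.repr_self]
  rw [Finset.sum_eq_single j]
  · simp; ring
  · intro i _ hi
    rw [Finsupp.single_eq_of_ne hi, mul_zero]
  · simp

/-- The algebra of rational functions generated by the constants, the functions `x_i / w` and
`1 / w`, where `w` is the weight; `k` is an order of decay in powers of `w`. -/
inductive Sym : ℕ → (W → ℂ) → Prop
  | const (z : ℂ) : Sym 0 fun _ => z
  | lin (i : ι) : Sym 0 fun x => ((b.coord i x * (wt κ b x)⁻¹ : ℝ) : ℂ)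
  | inv : Sym 1 fun x => (((wt κ b x)⁻¹ : ℝ) : ℂ)
  | add {k : ℕ} {f g : W → ℂ} : Sym k f → Sym k g → Sym k fun x => f x + g x
  | mul {k k' : ℕ} {f g : W → ℂ} : Sym k f → Sym k' g → Sym (k + k') fun x => f x * g x
  | weaken {k : ℕ} {f : W → ℂ} : Sym (k + 1) f → Sym k f

variable {κ b}

theorem contDiff_wt_inv (hκ : 0 < κ) : ContDiff ℝ ∞ fun x => (wt κ b x)⁻¹ :=
  (contDiff_wt κ b).inv fun x => (wt_pos b hκ x).ne'

theorem contDiff_wt_inv' (hκ : 0 < κ) : ContDiff ℝ ∞ fun x => (((wt κ b x)⁻¹ : ℝ) : ℂ) :=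
  Complex.ofRealCLM.contDiff.comp (contDiff_wt_inv hκ)

theorem Sym.smooth (hκ : 0 < κ) {k : ℕ} {f : W → ℂ} (h : Sym κ b k f) : ContDiff ℝ ∞ f := by
  induction h with
  | const z => exact contDiff_const
  | lin i => exact Complex.ofRealCLM.contDiff.comp ((coordL b i).contDiff.mul (contDiff_wt_inv hκ))
  | inv => exact contDiff_wt_inv' hκ
  | add _ _ h1 h2 => exact h1.add h2
  | mul _ _ h1 h2 => exact h1.mul h2
  | weaken _ h => exact h

/-- A symbol of order `k` decays like the `k`-th inverse power of the weight. -/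
theorem Sym.bound (hκ : 0 < κ) {k : ℕ} {f : W → ℂ} (h : Sym κ b k f) :
    ∃ C : ℝ, 0 ≤ C ∧ ∀ x, ‖f x‖ ≤ C * (wt κ b x)⁻¹ ^ k := by
  have hw : ∀ x, 0 < (wt κ b x)⁻¹ := fun x => inv_pos.2 (wt_pos b hκ x)
  induction h with
  | const z => exact ⟨‖z‖, norm_nonneg _, fun x => by simp⟩
  | lin i =>
    refine ⟨1 + κ⁻¹, by positivity, fun x => ?_⟩
    rw [Complex.norm_real, pow_zero, mul_one, norm_mul, Real.norm_of_nonneg (hw x).le,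
      mul_inv_le_iff₀ (wt_pos b hκ x), Real.norm_eq_abs]
    have h1 : (b.coord i x) ^ 2 ≤ ∑ i, (b.coord i x) ^ 2 :=
      Finset.single_le_sum (f := fun i => (b.coord i x) ^ 2) (fun _ _ => sq_nonneg _)
        (Finset.mem_univ i)
    have h2 : 0 ≤ ∑ i, (b.coord i x) ^ 2 := Finset.sum_nonneg fun _ _ => sq_nonneg _
    have h3 : |b.coord i x| ≤ 1 + (b.coord i x) ^ 2 := by
      rw [← sq_abs]; nlinarith [sq_nonneg (|b.coord i x| - 1)]
    have h4 : (1 + κ⁻¹) * wt κ b x = 1 + κ⁻¹ + (κ + 1) * ∑ i, (b.coord i x) ^ 2 := by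
      rw [wt]; field_simp
    rw [h4]
    have h5 := mul_nonneg hκ.le h2
    have : 0 < κ⁻¹ := inv_pos.2 hκ
    nlinarith
  | inv => exact ⟨1, zero_le_one, fun x => by simp [abs_of_pos (wt_pos b hκ x)]⟩
  | add _ _ h1 h2 =>
    obtain ⟨C₁, h10, h1⟩ := h1
    obtain ⟨C₂, h20, h2⟩ := h2
    exact ⟨C₁ + C₂, add_nonneg h10 h20, fun x => by
      rw [add_mul]; exact (norm_add_le _ _).trans (add_le_add (h1 x) (h2 x))⟩
  | mul _ _ h1 h2 =>
    obtain ⟨C₁, h10, h1⟩ := h1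
    obtain ⟨C₂, h20, h2⟩ := h2
    refine ⟨C₁ * C₂, mul_nonneg h10 h20, fun x => ?_⟩
    rw [norm_mul, pow_add, mul_mul_mul_comm]
    exact mul_le_mul (h1 x) (h2 x) (norm_nonneg _) (by have := hw x; positivity)
  | weaken _ h =>
    obtain ⟨C, h0, h⟩ := h
    refine ⟨C, h0, fun x => (h x).trans ?_⟩
    refine mul_le_mul_of_nonneg_left ?_ h0
    exact pow_le_pow_of_le_one (hw x).le (inv_le_one_of_one_le₀ (one_le_wt b hκ x)) (Nat.le_succ _)

theorem fderiv_ofReal_comp {g : W → ℝ} (hg : ContDiff ℝ ∞ g) (x v : W) :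
    fderiv ℝ (fun x => (g x : ℂ)) x v = ((fderiv ℝ g x v : ℝ) : ℂ) := by
  have := Complex.ofRealCLM.hasFDerivAt.comp x (hg.differentiable (by simp) x).hasFDerivAt
  have h2 : fderiv ℝ (fun x => (g x : ℂ)) x = _ := this.fderiv
  rw [h2]
  rfl

theorem fderiv_wt_inv (hκ : 0 < κ) (x : W) (j : ι) :
    fderiv ℝ (fun x => (wt κ b x)⁻¹) x (b j) =
      -(2 * κ) * (b.coord j x * (wt κ b x)⁻¹) * (wt κ b x)⁻¹ := by
  have h := ((contDiff_wt κ b).differentiable (by simp) x).hasFDerivAt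
  have := (hasDerivAt_inv (wt_pos b hκ x).ne').comp_hasFDerivAt x h
  have h2 : fderiv ℝ (fun x => (wt κ b x)⁻¹) x = _ := this.fderiv
  rw [h2, smul_apply, fderiv_wt, smul_eq_mul]
  have := (wt_pos b hκ x).ne'
  field_simp

/-- The derivatives of a symbol are symbols of the same order, because the derivatives of `1 / w`
are linear combinations of the products `(x_j / w) (1 / w)`. -/
theorem Sym.deriv (hκ : 0 < κ) {k : ℕ} {f : W → ℂ} (h : Sym κ b k f) (j : ι) :
    Sym κ b k (dirD [b j] f) := by
  classical
  have hinv : Sym κ b 1 (dirD [b j] fun x => (((wt κ b x)⁻¹ : ℝ) : ℂ)) := by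
    have := ((Sym.const (κ := κ) (b := b) (-(2 * κ : ℝ) : ℂ)).mul (Sym.lin j)).mul Sym.inv
    convert this using 1
    funext x
    simp only [dirD]
    rw [fderiv_ofReal_comp (contDiff_wt_inv hκ), fderiv_wt_inv hκ]
    push_cast
    ring
  induction h with
  | const z =>
    rw [dirD_const]
    exact Sym.const 0
  | lin i =>
    have h1 := ((Sym.const (κ := κ) (b := b) (b.coord i (b j))).mul (Sym.inv.weaken)).add
      ((Sym.const (κ := κ) (b := b) (-(2 * κ) : ℝ)).mul ((Sym.lin i).mul (Sym.lin j)))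
    convert h1 using 1
    funext x
    simp only [dirD]
    rw [fderiv_ofReal_comp (g := fun x => b.coord i x * (wt κ b x)⁻¹)
      ((coordL b i).contDiff.mul (contDiff_wt_inv hκ))]
    have h2 := ((coordL b i).hasFDerivAt (x := x)).mul
      ((contDiff_wt_inv (b := b) hκ).differentiable (by simp) x).hasFDerivAt
    have h3 : fderiv ℝ (fun x => b.coord i x * (wt κ b x)⁻¹) x = _ := h2.fderiv
    rw [h3, add_apply, smul_apply, smul_apply, fderiv_wt_inv hκ]
    simp only [coordL_apply, smul_eq_mul]
    push_cast
    ring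
  | inv => exact hinv
  | add h1 h2 ih1 ih2 =>
    have := dirD_add (h1.smooth hκ) (h2.smooth hκ) [b j]
    exact (congrArg (Sym κ b _) this).mpr (ih1.add ih2)
  | @mul k k' f g h1 h2 ih1 ih2 =>
    have : dirD [b j] (fun x => f x * g x) = fun x => dirD [b j] f x * g x + f x * dirD [b j] g x := by
      funext x
      rw [dirD_mul (h1.smooth hκ) (h2.smooth hκ)]
      simp [splits, dirD]
    rw [this]
    exact (ih1.mul h2).add (h1.mul ih2)
  | weaken _ ih => exact ih.weaken

variable (κ b)

/-- The operator `f ↦ (1 - Laplacian) (f / w)`. -/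
def oscO (f : W → ℂ) (x : W) : ℂ :=
  f x * (((wt κ b x)⁻¹ : ℝ) : ℂ) -
    ∑ i, dirD [b i, b i] (fun x => f x * (((wt κ b x)⁻¹ : ℝ) : ℂ)) x

/-- A differential operator with coefficients of order `k`. -/
def IsSymOp (k : ℕ) (T : (W → ℂ) → W → ℂ) : Prop :=
  ∃ L : List ((W → ℂ) × List ι), (∀ p ∈ L, Sym κ b k p.1) ∧
    ∀ f, ContDiff ℝ ∞ f → ∀ x, T f x = (L.map fun p => p.1 x * dirD (p.2.map b) f x).sum

variable {κ b}

theorem IsSymOp.id : IsSymOp κ b 0 fun f => f :=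
  ⟨[(fun _ => 1, [])], by simpa using Sym.const 1, fun f _ x => by simp [dirD]⟩

theorem IsSymOp.add {k : ℕ} {T T' : (W → ℂ) → W → ℂ} (h : IsSymOp κ b k T) (h' : IsSymOp κ b k T') :
    IsSymOp κ b k fun f x => T f x + T' f x := by
  obtain ⟨L, h1, h2⟩ := h
  obtain ⟨L', h1', h2'⟩ := h'
  refine ⟨L ++ L', fun p hp => ?_, fun f hf x => ?_⟩
  · rcases List.mem_append.1 hp with hp | hp
    exacts [h1 p hp, h1' p hp]
  · simp only [List.map_append, List.sum_append, h2 f hf, h2' f hf]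

theorem IsSymOp.mul {k k' : ℕ} {T : (W → ℂ) → W → ℂ} (h : IsSymOp κ b k T) {c : W → ℂ}
    (hc : Sym κ b k' c) : IsSymOp κ b (k + k') fun f x => T f x * c x := by
  obtain ⟨L, h1, h2⟩ := h
  refine ⟨L.map fun p => (fun x => p.1 x * c x, p.2), fun p hp => ?_, fun f hf x => ?_⟩
  · obtain ⟨q, hq, rfl⟩ := List.mem_map.1 hp
    exact (h1 q hq).mul hc
  · simp only [h2 f hf]
    rw [← List.sum_map_mul_right, List.map_map]
    congr 1
    refine List.map_congr_left fun p _ => ?_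
    simp only [Function.comp]
    ring

theorem IsSymOp.sum {k : ℕ} {J : Type*} (s : Finset J) {T : J → (W → ℂ) → W → ℂ}
    (h : ∀ j, IsSymOp κ b k (T j)) : IsSymOp κ b k fun f x => ∑ j ∈ s, T j f x := by
  classical
  induction s using Finset.induction_on with
  | empty => exact ⟨[], by simp, by simp⟩
  | insert j s hj ih => simpa only [Finset.sum_insert hj] using (h j).add ih

theorem IsSymOp.smooth (hκ : 0 < κ) {k : ℕ} {T : (W → ℂ) → W → ℂ} (h : IsSymOp κ b k T)
    {f : W → ℂ} (hf : ContDiff ℝ ∞ f) : ContDiff ℝ ∞ (T f) := by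
  obtain ⟨L, h1, h2⟩ := h
  rw [funext (h2 f hf)]
  clear h2
  induction L with
  | nil => simpa using contDiff_const
  | cons p L ih =>
    simp only [List.map_cons, List.sum_cons]
    exact (((h1 p (by simp)).smooth hκ).mul (contDiff_dirD hf _)).add
      (ih fun q hq => h1 q (by simp [hq]))

theorem IsSymOp.deriv (hκ : 0 < κ) {k : ℕ} {T : (W → ℂ) → W → ℂ} (h : IsSymOp κ b k T) (j : ι) :
    IsSymOp κ b k fun f => dirD [b j] (T f) := by
  obtain ⟨L, h1, h2⟩ := h
  refine ⟨(L.map fun p => (dirD [b j] p.1, p.2)) ++ L.map fun p => (p.1, j :: p.2),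
    fun p hp => ?_, fun f hf x => ?_⟩
  · rcases List.mem_append.1 hp with hp | hp
    · obtain ⟨q, hq, rfl⟩ := List.mem_map.1 hp
      exact (h1 q hq).deriv hκ j
    · obtain ⟨q, hq, rfl⟩ := List.mem_map.1 hp
      exact h1 q hq
  · change dirD [b j] (T f) x = _
    rw [funext (h2 f hf), List.map_append, List.sum_append, List.map_map, List.map_map]
    clear h2
    have : ContDiff ℝ ∞ (fun x => (L.map fun p => p.1 x * dirD (p.2.map b) f x).sum) ∧
        dirD [b j] (fun x => (L.map fun p => p.1 x * dirD (p.2.map b) f x).sum) =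
        fun x => (L.map ((fun p : (W → ℂ) × List ι => p.1 x * dirD (p.2.map b) f x) ∘
          fun p => (dirD [b j] p.1, p.2))).sum +
        (L.map ((fun p : (W → ℂ) × List ι => p.1 x * dirD (p.2.map b) f x) ∘ fun p => (p.1, j :: p.2))).sum := by
      induction L with
      | nil =>
        refine ⟨by simpa using contDiff_const, ?_⟩
        simp only [List.map_nil, List.sum_nil, dirD_const]
        funext x
        simp
      | cons p L ih =>
        obtain ⟨ihs, ihd⟩ := ih fun q hq => h1 q (by simp [hq])
        have hp := (h1 p (by simp)).smooth hκ
        have hpf := hp.mul (contDiff_dirD hf (p.2.map b))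
        simp only [List.map_cons, List.sum_cons]
        refine ⟨hpf.add ihs, ?_⟩
        have h3 := dirD_add hpf ihs [b j]
        refine h3.trans ?_
        rw [ihd]
        funext x
        rw [Pi.add_apply, dirD_mul hp (contDiff_dirD hf _)]
        simp [splits, dirD]
        ring
    exact congrFun this.2 x

/-- Each application of the regularizing operator gains one power of the weight. -/
theorem IsSymOp.oscO (hκ : 0 < κ) {k : ℕ} {T : (W → ℂ) → W → ℂ} (h : IsSymOp κ b k T) :
    IsSymOp κ b (k + 1) fun f => oscO κ b (T f) := by
  have h1 : IsSymOp κ b (k + 1) fun f x => T f x * (((wt κ b x)⁻¹ : ℝ) : ℂ) := h.mul Sym.inv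
  have h2 := IsSymOp.sum Finset.univ fun i => (h1.deriv hκ i).deriv hκ i
  have h3 : IsSymOp κ b (k + 1) _ := h2.mul (Sym.const (-1))
  obtain ⟨L, hL, hL'⟩ := h1.add h3
  refine ⟨L, hL, fun f hf x => ?_⟩
  rw [← hL' f hf]
  simp only [SuperUDF.oscO, sub_eq_add_neg, mul_neg_one]
  rfl

theorem isSymOp_iterate (hκ : 0 < κ) (k : ℕ) : IsSymOp κ b k (oscO κ b)^[k] := by
  induction k with
  | zero => exact IsSymOp.id
  | succ k ih =>
    simp only [Function.iterate_succ']
    exact ih.oscO hκ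

end Regularize

/-! ### Oscillating integrals on a finite-dimensional space -/

section Osc

variable {W : Type*} [NormedAddCommGroup W] [NormedSpace ℝ W] [FiniteDimensional ℝ W]
  [MeasurableSpace W] [BorelSpace W]
variable {ι : Type*} [Fintype ι] (κ : ℝ) (b : Module.Basis ι ℝ W)
variable (μ : Measure W) [μ.IsAddHaarMeasure]

/-- Oscillating phases: the functions of modulus `1` with `(1 - Laplacian) e = w e`. -/
structure IsPhase (e : W → ℂ) : Prop where
  smooth : ContDiff ℝ ∞ e
  norm_eq : ∀ x, ‖e x‖ = 1
  eq : ∀ x, ∑ i, dirD [b i, b i] e x = -((wt κ b x - 1 : ℝ) : ℂ) * e x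

/-- The oscillating integral of `f` with the phase `e`, regularized `k` times. -/
def osc (e : W → ℂ) (k : ℕ) (f : W → ℂ) : ℂ := ∫ x, e x * ((oscO κ b)^[k] f) x ∂μ

variable {κ b}

/-- The `k`-th inverse power of the weight decays like `|x|^{-2k}`, hence is integrable for
`2k > dim W`. -/
theorem integrable_wt_pow (hκ : 0 < κ) {k : ℕ} (hk : Module.finrank ℝ W < 2 * k) :
    Integrable (fun x => (wt κ b x)⁻¹ ^ k) μ := by
  let K : ℝ := ∑ i, ‖b i‖ ^ 2
  have hK : 0 ≤ K := Finset.sum_nonneg fun _ _ => sq_nonneg _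
  let C : ℝ := 2 * (1 + K / κ)
  have hC : ∀ x, (1 + ‖x‖) ^ 2 ≤ C * wt κ b x := by
    intro x
    set S := ∑ i, (b.coord i x) ^ 2 with hS
    have hS0 : 0 ≤ S := Finset.sum_nonneg fun _ _ => sq_nonneg _
    have h1 : ‖x‖ ≤ ∑ i, |b.coord i x| * ‖b i‖ := by
      conv_lhs => rw [← b.sum_repr x]
      refine (norm_sum_le _ _).trans (Finset.sum_le_sum fun i _ => ?_)
      rw [norm_smul]
      rfl
    have h2 : ‖x‖ ^ 2 ≤ S * K := by
      refine (pow_le_pow_left₀ (norm_nonneg _) h1 2).trans ?_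
      refine (Finset.sum_mul_sq_le_sq_mul_sq _ _ _).trans (le_of_eq ?_)
      simp [hS, K]
    have h3 : (1 + ‖x‖) ^ 2 ≤ 2 * (1 + ‖x‖ ^ 2) := by nlinarith [sq_nonneg (‖x‖ - 1)]
    have h4 : C * wt κ b x = 2 * (1 + S * K + (K / κ + κ * S)) := by
      rw [wt, ← hS]; simp only [C]; field_simp; ring
    have h5 : 0 ≤ K / κ := div_nonneg hK hκ.le
    nlinarith [mul_nonneg hκ.le hS0]
  have hint := integrable_one_add_norm (E := W) (μ := μ) (r := (2 * k : ℕ)) (by exact_mod_cast hk)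
  refine (hint.const_mul (C ^ k)).mono' ?_ (ae_of_all _ fun x => ?_)
  · exact (((contDiff_wt_inv (b := b) hκ).continuous).pow k).aestronglyMeasurable
  · have hw := wt_pos b hκ x
    have hx : 0 < 1 + ‖x‖ := by positivity
    rw [Real.norm_of_nonneg (by positivity), Real.rpow_neg hx.le, Real.rpow_natCast, pow_mul,
      ← div_eq_mul_inv, ← div_pow, inv_eq_one_div]
    refine pow_le_pow_left₀ (by positivity) ?_ k
    rw [div_le_div_iff₀ hw (by positivity), one_mul]
    exact hC x

variable {μ}

/-- The expansion of the oscillating integral: finitely many derivatives of `f` are integrated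
against fixed integrable densities. -/
theorem exists_osc_expansion (hκ : 0 < κ) {k : ℕ} (hk : Module.finrank ℝ W < 2 * k)
    {e : W → ℂ} (he : IsPhase κ b e) :
    ∃ L : List ((W → ℂ) × List ι), (∀ p ∈ L, Continuous p.1 ∧ Integrable p.1 μ) ∧
      ∀ f, ContDiff ℝ ∞ f → ∀ x, e x * ((oscO κ b)^[k] f) x =
        (L.map fun p => p.1 x * dirD (p.2.map b) f x).sum := by
  obtain ⟨L, h1, h2⟩ := isSymOp_iterate (κ := κ) (b := b) hκ k
  refine ⟨L.map fun p => (fun x => e x * p.1 x, p.2), fun p hp => ?_, fun f hf x => ?_⟩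
  · obtain ⟨q, hq, rfl⟩ := List.mem_map.1 hp
    have hc : Continuous fun x => e x * q.1 x :=
      he.smooth.continuous.mul ((h1 q hq).smooth hκ).continuous
    obtain ⟨C, -, hC⟩ := (h1 q hq).bound hκ
    refine ⟨hc, ((integrable_wt_pow (b := b) μ hκ hk).const_mul C).mono' hc.aestronglyMeasurable
      (ae_of_all _ fun x => ?_)⟩
    rw [norm_mul, he.norm_eq, one_mul]
    exact hC x
  · rw [h2 f hf, List.map_map, ← List.sum_map_mul_left]
    congr 1
    refine List.map_congr_left fun p _ => ?_
    simp only [Function.comp]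
    ring

theorem integral_list_sum {α : Type*} (L : List α) (F : α → W → ℂ)
    (h : ∀ p ∈ L, Integrable (F p) μ) :
    Integrable (fun x => (L.map fun p => F p x).sum) μ ∧
      ∫ x, (L.map fun p => F p x).sum ∂μ = (L.map fun p => ∫ x, F p x ∂μ).sum := by
  induction L with
  | nil => simp
  | cons p L ih =>
    obtain ⟨h1, h2⟩ := ih fun q hq => h q (by simp [hq])
    simp only [List.map_cons, List.sum_cons]
    exact ⟨(h p (by simp)).add h1, by rw [integral_add (h p (by simp)) h1, h2]⟩

theorem integrable_mul_bounded {k f : W → ℂ} (hk : Integrable k μ) (hf : Continuous f) {C : ℝ}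
    (hC : ∀ x, ‖f x‖ ≤ C) : Integrable (fun x => k x * f x) μ :=
  hk.smul_bdd C hf.aestronglyMeasurable (ae_of_all _ hC)

/-- The value of the oscillating integral through the expansion. -/
theorem osc_eq_of_expansion {k : ℕ} {e : W → ℂ} {L : List ((W → ℂ) × List ι)}
    (hL : ∀ p ∈ L, Continuous p.1 ∧ Integrable p.1 μ)
    (hexp : ∀ f, ContDiff ℝ ∞ f → ∀ x, e x * ((oscO κ b)^[k] f) x =
        (L.map fun p => p.1 x * dirD (p.2.map b) f x).sum) {f : W → ℂ} (hf : BB f) :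
    osc κ b μ e k f = (L.map fun p => ∫ x, p.1 x * dirD (p.2.map b) f x ∂μ).sum := by
  rw [osc, funext (hexp f hf.smooth)]
  refine (integral_list_sum L _ fun p hp => ?_).2
  obtain ⟨C, hC⟩ := hf.bound_list (p.2.map b)
  exact integrable_mul_bounded (hL p hp).2 (continuous_dirD hf.smooth _) hC

theorem tendsto_list_sum {α J : Type*} {l : Filter J} (L : List α) {F : J → α → ℂ} {G : α → ℂ}
    (h : ∀ p ∈ L, Tendsto (fun j => F j p) l (𝓝 (G p))) :
    Tendsto (fun j => (L.map fun p => F j p).sum) l (𝓝 (L.map G).sum) := by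
  induction L with
  | nil => exact tendsto_const_nhds
  | cons p L ih =>
    simp only [List.map_cons, List.sum_cons]
    exact (h p (by simp)).add (ih fun q hq => h q (by simp [hq]))

/-- The oscillating integral is continuous for pointwise convergence of all derivatives with
uniform bounds. -/
theorem osc_tendsto (hκ : 0 < κ) {k : ℕ} (hk : Module.finrank ℝ W < 2 * k)
    {e : W → ℂ} (he : IsPhase κ b e) {J : Type*} {l : Filter J} [l.IsCountablyGenerated]
    {F : J → W → ℂ} {f : W → ℂ} (hF : ∀ j, BB (F j)) (hf : BB f)
    (hbd : ∀ L : List W, ∃ C : ℝ, ∀ᶠ j in l, ∀ x, ‖dirD L (F j) x‖ ≤ C)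
    (hlim : ∀ (L : List W) x, Tendsto (fun j => dirD L (F j) x) l (𝓝 (dirD L f x))) :
    Tendsto (fun j => osc κ b μ e k (F j)) l (𝓝 (osc κ b μ e k f)) := by
  obtain ⟨L, hL, hexp⟩ := exists_osc_expansion (μ := μ) hκ hk he
  rw [osc_eq_of_expansion hL hexp hf]
  simp only [osc_eq_of_expansion hL hexp (hF _)]
  refine tendsto_list_sum L fun p hp => ?_
  obtain ⟨C, hC⟩ := hbd (p.2.map b)
  refine tendsto_integral_filter_of_dominated_convergence (fun x => ‖p.1 x‖ * C) ?_ ?_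
    ((hL p hp).2.norm.mul_const C) (ae_of_all _ fun x => (hlim _ x).const_mul _)
  · exact Eventually.of_forall fun j =>
      ((hL p hp).1.mul (continuous_dirD (hF j).smooth _)).aestronglyMeasurable
  · filter_upwards [hC] with j hj
    refine ae_of_all _ fun x => ?_
    rw [norm_mul]
    exact mul_le_mul_of_nonneg_left (hj x) (norm_nonneg _)

/-- The oscillating integral is bounded by the suprema of finitely many derivatives. -/
theorem exists_osc_bound (hκ : 0 < κ) {k : ℕ} (hk : Module.finrank ℝ W < 2 * k)
    {e : W → ℂ} (he : IsPhase κ b e) :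
    ∃ (S : List (List W)) (C : ℝ), 0 ≤ C ∧ ∀ f M, BB f → (∀ l ∈ S, ∀ x, ‖dirD l f x‖ ≤ M) →
      ‖osc κ b μ e k f‖ ≤ C * M := by
  obtain ⟨L, hL, hexp⟩ := exists_osc_expansion (μ := μ) hκ hk he
  refine ⟨L.map fun p => p.2.map b, (L.map fun p => ∫ x, ‖p.1 x‖ ∂μ).sum,
    List.sum_nonneg ?_, fun f M hf hM => ?_⟩
  · intro a ha
    obtain ⟨p, -, rfl⟩ := List.mem_map.1 ha
    exact integral_nonneg fun x => norm_nonneg _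
  · rw [osc_eq_of_expansion hL hexp hf, ← List.sum_map_mul_right]
    have hM' : ∀ p ∈ L, ∀ x, ‖dirD (p.2.map b) f x‖ ≤ M := fun p hp =>
      hM _ (List.mem_map.2 ⟨p, hp, rfl⟩)
    clear hexp hM
    induction L with
    | nil => simp
    | cons p L ih =>
      simp only [List.map_cons, List.sum_cons]
      refine (norm_add_le _ _).trans (add_le_add ?_ (ih (fun q hq => hL q (by simp [hq]))
        fun q hq => hM' q (by simp [hq])))
      rw [← integral_mul_const]
      refine norm_integral_le_of_norm_le ((hL p (by simp)).2.norm.mul_const M)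
        (ae_of_all _ fun x => ?_)
      rw [norm_mul]
      exact mul_le_mul_of_nonneg_left (hM' p (by simp) x) (norm_nonneg _)

/-- Integration by parts twice. -/
theorem integral_mul_dirD_dirD {e g : W → ℂ} (he : ContDiff ℝ ∞ e) (hg : ContDiff ℝ ∞ g)
    (hc : HasCompactSupport g) (v : W) :
    ∫ x, e x * dirD [v, v] g x ∂μ = ∫ x, dirD [v, v] e x * g x ∂μ := by
  have hci : ∀ l l' : List W, Integrable (fun x => dirD l e x * dirD l' g x) μ := fun l l' =>
    ((continuous_dirD he l).mul (continuous_dirD hg l')).integrable_of_hasCompactSupport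
      ((hasCompactSupport_dirD hc l').mul_left)
  have h1 := integral_mul_fderiv_eq_neg_fderiv_mul_of_integrable (μ := μ) (f := e)
    (g := dirD [v] g) (v := v) (hci [v] [v]) (hci [] [v, v]) (hci [] [v])
    (fun x _ => he.differentiable (by simp) x) (fun x _ => differentiable_dirD hg _ x)
  have h2 := integral_mul_fderiv_eq_neg_fderiv_mul_of_integrable (μ := μ) (f := dirD [v] e)
    (g := g) (v := v) (hci [v, v] []) (hci [v] [v]) (hci [v] [])
    (fun x _ => differentiable_dirD he _ x) (fun x _ => hg.differentiable (by simp) x)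
  have h3 : ∫ x, e x * dirD [v, v] g x ∂μ = -∫ x, dirD [v] e x * dirD [v] g x ∂μ := h1
  have h4 : ∫ x, dirD [v] e x * dirD [v] g x ∂μ = -∫ x, dirD [v, v] e x * g x ∂μ := h2
  rw [h3, h4, neg_neg]

/-- The regularizing operator does not change the integral against the phase: integrate by parts and
use `(1 - Laplacian) e = w e`. -/
theorem integral_phase_oscO (hκ : 0 < κ) {e : W → ℂ} (he : IsPhase κ b e) {g : W → ℂ}
    (hg : ContDiff ℝ ∞ g) (hc : HasCompactSupport g) :
    ∫ x, e x * oscO κ b g x ∂μ = ∫ x, e x * g x ∂μ := by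
  set h : W → ℂ := fun x => g x * (((wt κ b x)⁻¹ : ℝ) : ℂ) with hh
  have hs : ContDiff ℝ ∞ h := hg.mul (contDiff_wt_inv' hκ)
  have hhc : HasCompactSupport h := hc.mul_right
  have hci : ∀ l l' : List W, Integrable (fun x => dirD l e x * dirD l' h x) μ := fun l l' =>
    ((continuous_dirD he.smooth l).mul (continuous_dirD hs l')).integrable_of_hasCompactSupport
      ((hasCompactSupport_dirD hhc l').mul_left)
  have h1 : ∀ x, e x * oscO κ b g x = e x * h x - ∑ i, e x * dirD [b i, b i] h x := by
    intro x
    rw [oscO, mul_sub, Finset.mul_sum]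
  have h2 : ∀ x, e x * g x = e x * h x - ∑ i, dirD [b i, b i] e x * h x := by
    intro x
    rw [← Finset.sum_mul, he.eq]
    simp only [hh]
    have := (wt_pos b hκ x).ne'
    have h3 : ((wt κ b x : ℝ) : ℂ) ≠ 0 := by exact_mod_cast this
    push_cast
    field_simp
    ring
  simp only [h1, h2]
  have hi₀ : Integrable (fun x => e x * h x) μ := hci [] []
  have hi₁ : ∀ i, Integrable (fun x => e x * dirD [b i, b i] h x) μ := fun i => hci [] [b i, b i]
  have hi₂ : ∀ i, Integrable (fun x => dirD [b i, b i] e x * h x) μ := fun i => hci [b i, b i] []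
  rw [integral_sub hi₀ (integrable_finsetSum _ fun i _ => hi₁ i),
    integral_sub hi₀ (integrable_finsetSum _ fun i _ => hi₂ i),
    integral_finsetSum _ fun i _ => hi₁ i, integral_finsetSum _ fun i _ => hi₂ i]
  congr 1
  exact Finset.sum_congr rfl fun i _ => integral_mul_dirD_dirD he.smooth hs hhc (b i)

theorem hasCompactSupport_oscO {g : W → ℂ} (hc : HasCompactSupport g) :
    HasCompactSupport (oscO κ b g) := by
  have hhc : HasCompactSupport fun x => g x * (((wt κ b x)⁻¹ : ℝ) : ℂ) := hc.mul_right
  refine hc.mono' ?_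
  intro x hx
  by_contra hn
  apply hx
  have h0 : ∀ l, dirD l (fun x => g x * (((wt κ b x)⁻¹ : ℝ) : ℂ)) x = 0 := by
    intro l
    have hsub : tsupport (fun x => g x * (((wt κ b x)⁻¹ : ℝ) : ℂ)) ⊆ tsupport g :=
      closure_mono fun y hy hgy => hy (by simp [hgy])
    have : tsupport (dirD l fun x => g x * (((wt κ b x)⁻¹ : ℝ) : ℂ)) ⊆ tsupport g := by
      induction l with
      | nil => exact hsub
      | cons v l ih =>
        refine subset_trans ?_ ih
        refine subset_trans (closure_mono ?_) (tsupport_fderiv_subset ℝ)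
        intro y hy hfy
        exact hy (by simp only [dirD]; rw [hfy]; rfl)
    exact image_eq_zero_of_notMem_tsupport fun h => hn (this h)
  rw [oscO]
  have h1 := h0 []
  simp only [dirD] at h1
  rw [h1, Finset.sum_eq_zero fun i _ => h0 _, sub_zero]

/-- On smooth functions with compact support, the oscillating integral is the integral, whatever the
number of regularizations. -/
theorem osc_eq_integral_of_hasCompactSupport (hκ : 0 < κ) {e : W → ℂ} (he : IsPhase κ b e)
    (k : ℕ) {g : W → ℂ} (hg : ContDiff ℝ ∞ g) (hc : HasCompactSupport g) :
    osc κ b μ e k g = ∫ x, e x * g x ∂μ := by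
  rw [osc]
  have : ContDiff ℝ ∞ ((oscO κ b)^[k] g) ∧ HasCompactSupport ((oscO κ b)^[k] g) ∧
      ∫ x, e x * ((oscO κ b)^[k] g) x ∂μ = ∫ x, e x * g x ∂μ := by
    induction k with
    | zero => exact ⟨hg, hc, rfl⟩
    | succ k ih =>
      obtain ⟨h1, h2, h3⟩ := ih
      simp only [Function.iterate_succ']
      refine ⟨?_, hasCompactSupport_oscO h2, ?_⟩
      · exact (IsSymOp.id.oscO hκ).smooth hκ h1
      · exact (integral_phase_oscO hκ he h1 h2).trans h3
  exact this.2.2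

theorem dilate_bound {W' : Type*} [NormedAddCommGroup W'] [NormedSpace ℝ W'] {J : Type*}
    {l : Filter J} {A : J → W →L[ℝ] W'} (hA1 : ∀ᶠ j in l, ‖A j‖ ≤ 1) {χ : W' → ℂ} (hχ : BB χ)
    (L : List W) : ∃ C : ℝ, ∀ᶠ j in l, ∀ x, ‖dirD L (fun x => χ (A j x)) x‖ ≤ C := by
  obtain ⟨C, h0, hC⟩ := hχ.bound L.length
  refine ⟨C * (L.map fun v => ‖v‖).prod, ?_⟩
  filter_upwards [hA1] with j hj x
  rw [dirD_comp_clm hχ.smooth]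
  refine (hC (L.map (A j)) (by simp) _).trans (mul_le_mul_of_nonneg_left ?_ h0)
  refine (prod_norm_map_le (A j) L).trans ?_
  exact mul_le_of_le_one_left (List.prod_nonneg (by simp)) (pow_le_one₀ (norm_nonneg _) hj)

theorem eventually_norm_le_one {W' : Type*} [NormedAddCommGroup W'] [NormedSpace ℝ W'] {J : Type*}
    {l : Filter J} {A : J → W →L[ℝ] W'} (hA : Tendsto A l (𝓝 0)) : ∀ᶠ j in l, ‖A j‖ ≤ 1 := by
  have := hA.norm
  rw [norm_zero] at this
  exact (this.eventually (gt_mem_nhds one_pos)).mono fun j hj => hj.le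

/-- The products `χ (A_j x) f(x)` with `A_j → 0` have all derivatives bounded uniformly in `j`. -/
theorem regularize_bound {W' : Type*} [NormedAddCommGroup W'] [NormedSpace ℝ W'] {J : Type*}
    {l : Filter J} {A : J → W →L[ℝ] W'} (hA : Tendsto A l (𝓝 0)) {χ : W' → ℂ} (hχ : BB χ)
    {f : W → ℂ} (hf : BB f) (L : List W) :
    ∃ C : ℝ, ∀ᶠ j in l, ∀ x, ‖dirD L (fun x => χ (A j x) * f x) x‖ ≤ C := by
  have : ∀ S : List (List W × List W), ∃ C : ℝ, ∀ᶠ j in l, ∀ x,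
      ‖(S.map fun q => dirD q.1 (fun x => χ (A j x)) x * dirD q.2 f x).sum‖ ≤ C := by
    intro S
    induction S with
    | nil => exact ⟨0, by simp⟩
    | cons q S ih =>
      obtain ⟨C, hC⟩ := ih
      obtain ⟨C₁, h₁⟩ := dilate_bound (eventually_norm_le_one hA) hχ q.1
      obtain ⟨C₂, h₂⟩ := hf.bound_list q.2
      refine ⟨C₁ * C₂ + C, ?_⟩
      filter_upwards [hC, h₁] with j hj hj1 x
      rw [List.map_cons, List.sum_cons]
      refine (norm_add_le _ _).trans (add_le_add ?_ (hj x))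
      rw [norm_mul]
      exact mul_le_mul (hj1 x) (h₂ x) (norm_nonneg _) ((norm_nonneg _).trans (hj1 x))
  obtain ⟨C, hC⟩ := this (splits L)
  refine ⟨C, hC.mono fun j hj x => ?_⟩
  rw [dirD_mul (hχ.comp_clm (A j)).smooth hf.smooth]
  exact hj x

/-- Regularization: the dilated functions `χ (A_j x)` with `A_j → 0` may be inserted into an
oscillating integral. -/
theorem osc_regularize (hκ : 0 < κ) {k : ℕ} (hk : Module.finrank ℝ W < 2 * k)
    {e : W → ℂ} (he : IsPhase κ b e) {J : Type*} {l : Filter J} [l.IsCountablyGenerated]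
    {W' : Type*} [NormedAddCommGroup W'] [NormedSpace ℝ W']
    {A : J → W →L[ℝ] W'} (hA : Tendsto A l (𝓝 0)) {χ : W' → ℂ} (hχ : BB χ) {f : W → ℂ} (hf : BB f) :
    Tendsto (fun j => osc κ b μ e k fun x => χ (A j x) * f x) l
      (𝓝 (osc κ b μ e k fun x => χ 0 * f x)) := by
  have hA1 := eventually_norm_le_one hA
  have hχl : ∀ (L : List W) x, Tendsto (fun j => dirD L (fun x => χ (A j x)) x) l
      (𝓝 (dirD L (fun _ => χ 0) x)) := by
    intro L x
    have hAx : ∀ v, Tendsto (fun j => A j v) l (𝓝 0) := fun v => by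
      have := ((ContinuousLinearMap.apply ℝ W' v).continuous.tendsto 0).comp hA
      rwa [map_zero] at this
    cases L with
    | nil =>
      exact (hχ.smooth.continuous.tendsto 0).comp (hAx x)
    | cons v L =>
      rw [dirD_const]
      obtain ⟨C, h0, hC⟩ := hχ.bound (v :: L).length
      refine squeeze_zero_norm' (a := fun j => C * (‖A j v‖ * (L.map fun v => ‖v‖).prod)) ?_ ?_
      · filter_upwards [hA1] with j hj
        rw [dirD_comp_clm hχ.smooth]
        refine (hC ((v :: L).map (A j)) (by simp) _).trans (mul_le_mul_of_nonneg_left ?_ h0)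
        simp only [List.map_cons, List.prod_cons]
        refine mul_le_mul_of_nonneg_left ((prod_norm_map_le (A j) L).trans ?_) (norm_nonneg _)
        exact mul_le_of_le_one_left (List.prod_nonneg (by simp)) (pow_le_one₀ (norm_nonneg _) hj)
      · have := ((hAx v).norm.mul_const (L.map fun v => ‖v‖).prod).const_mul C
        simpa using this
  have hc : BB fun _ : W => χ 0 := by
    have := hχ.comp_clm (0 : W →L[ℝ] W')
    simpa using this
  refine osc_tendsto hκ hk he (fun j => (hχ.comp_clm (A j)).mul hf) (hc.mul hf) ?_ ?_
  · exact regularize_bound hA hχ hf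
  · intro L x
    simp only [dirD_mul (hχ.comp_clm (A _)).smooth hf.smooth, dirD_mul hc.smooth hf.smooth]
    exact tendsto_list_sum _ fun q _ => (hχl q.1 x).mul_const _

theorem tendsto_inv_smul_id (W : Type*) [NormedAddCommGroup W] [NormedSpace ℝ W] :
    Tendsto (fun j : ℕ => ((j : ℝ) + 1)⁻¹ • ContinuousLinearMap.id ℝ W) atTop (𝓝 0) := by
  have h : Tendsto (fun j : ℕ => ((j : ℝ) + 1)⁻¹) atTop (𝓝 0) := by
    simpa using tendsto_one_div_add_atTop_nhds_zero_nat (𝕜 := ℝ)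
  simpa using h.smul_const (ContinuousLinearMap.id ℝ W)

end Osc

/-! ### Families of partial derivatives -/

section Family

variable {W : Type*} [NormedAddCommGroup W] [NormedSpace ℝ W] [FiniteDimensional ℝ W]
variable {ι : Type*} [Fintype ι] (b : Module.Basis ι ℝ W)

/-- A function with continuous partial derivatives is differentiable. -/
theorem hasFDerivAt_of_partials {f : W → ℂ} {g : ι → W → ℂ} (hg : ∀ i, Continuous (g i))
    (h : ∀ i x, HasDerivAt (fun t : ℝ => f (x + t • b i)) (g i x) 0) (x : W) :
    HasFDerivAt f (∑ i, (coordL b i).smulRight (g i x)) x := by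
  -- derivatives along the segments parallel to the axes
  have hline : ∀ i y (c t₀ : ℝ), HasDerivAt (fun t : ℝ => f (y + (t * c) • b i))
      (c * g i (y + (t₀ * c) • b i)) t₀ := by
    intro i y c t₀
    have h1 : HasDerivAt (fun t : ℝ => (t - t₀) * c) c t₀ := by
      simpa using ((hasDerivAt_id t₀).sub_const t₀).mul_const c
    have h0 := h i (y + (t₀ * c) • b i)
    have h2 := HasDerivAt.scomp (h := fun t : ℝ => (t - t₀) * c) t₀ (by simpa using h0) h1
    rw [Complex.real_smul] at h2
    refine h2.congr_of_eventuallyEq (Eventually.of_forall fun t => ?_)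
    simp only [Function.comp]
    rw [add_assoc, ← add_smul]
    congr 3
    ring
  -- The first order expansion, adding one coordinate at a time by the mean value inequality.
  have key : ∀ s : Finset ι, (fun u : ι → ℝ => f (x + ∑ i ∈ s, u i • b i) - f x
      - ∑ i ∈ s, (u i : ℂ) * g i x) =o[𝓝 0] fun u => u := by
    intro s
    classical
    induction s using Finset.induction_on with
    | empty => simp
    | insert j s hj ih =>
      have h1 : (fun u : ι → ℝ => f (x + ∑ i ∈ s, u i • b i + u j • b j)
          - f (x + ∑ i ∈ s, u i • b i) - (u j : ℂ) * g j x) =o[𝓝 0] fun u => u := by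
        rw [Asymptotics.isLittleO_iff]
        intro ε hε
        have hball : ∀ᶠ y in 𝓝 x, ‖g j y - g j x‖ < ε := by
          have : Tendsto (fun y => ‖g j y - g j x‖) (𝓝 x) (𝓝 0) := by
            simpa using ((hg j).sub (continuous_const (y := g j x))).norm.tendsto x
          exact this.eventually (gt_mem_nhds hε)
        obtain ⟨r, hr, hball⟩ := Metric.eventually_nhds_iff_ball.1 hball
        have hsmall : ∀ᶠ u : ι → ℝ in 𝓝 0, ‖∑ i ∈ s, u i • b i‖ + |u j| * ‖b j‖ < r := by
          have hcont : Continuous fun u : ι → ℝ =>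
              ‖∑ i ∈ s, u i • b i‖ + |u j| * ‖b j‖ := by fun_prop
          have := hcont.tendsto 0
          simp only [Pi.zero_apply, zero_smul, Finset.sum_const_zero, norm_zero, abs_zero,
            zero_mul, add_zero] at this
          exact this.eventually (gt_mem_nhds hr)
        filter_upwards [hsmall] with u hu
        set y := x + ∑ i ∈ s, u i • b i with hy
        have := norm_image_sub_le_of_norm_deriv_le_segment_01'
          (f := fun t : ℝ => f (y + (t * u j) • b j) - (t * u j : ℝ) * g j x)
          (f' := fun t => u j * g j (y + (t * u j) • b j) - (u j : ℂ) * g j x) (C := ε * ‖u‖)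
          (fun t _ => by
            refine ((hline j y (u j) t).sub ?_).hasDerivWithinAt
            have : HasDerivAt (fun t : ℝ => t * u j) (u j) t := by
              simpa using (hasDerivAt_id t).mul_const (u j)
            exact this.ofReal_comp.mul_const _)
          (fun t ht => by
            rw [← mul_sub, norm_mul, Complex.norm_real, mul_comm ε]
            refine mul_le_mul (norm_le_pi_norm u j) (hball _ ?_).le (norm_nonneg _) (norm_nonneg _)
            rw [mem_ball_iff_norm, hy, add_assoc, add_sub_cancel_left]
            refine (norm_add_le _ _).trans_lt (lt_of_le_of_lt ?_ hu)
            rw [norm_smul, Real.norm_eq_abs, abs_mul, abs_of_nonneg ht.1]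
            gcongr
            exact mul_le_of_le_one_left (abs_nonneg _) ht.2.le)
        simp only [one_mul, zero_mul, zero_smul, add_zero, Complex.ofReal_zero, sub_zero] at this
        refine le_trans (le_of_eq ?_) this
        congr 1
        ring
      refine (h1.add ih).congr_left fun u => ?_
      rw [Finset.sum_insert hj, Finset.sum_insert hj, add_comm (u j • b j), ← add_assoc]
      ring
  have h0 : HasFDerivAt (fun u : ι → ℝ => f (x + ∑ i, u i • b i))
      (∑ i, (ContinuousLinearMap.proj (R := ℝ) (φ := fun _ : ι => ℝ) i).smulRight (g i x)) 0 := by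
    rw [hasFDerivAt_iff_isLittleO_nhds_zero]
    refine (key Finset.univ).congr_left fun u => ?_
    simp [_root_.sum_apply]
  let A : W →L[ℝ] (ι → ℝ) := ContinuousLinearMap.pi fun i => coordL b i
  have hA : HasFDerivAt (fun y => A (y - x)) A x := by
    have := A.hasFDerivAt.comp x ((hasFDerivAt_id x).sub_const x)
    simpa using this
  have h0' : HasFDerivAt (fun u : ι → ℝ => f (x + ∑ i, u i • b i))
      (∑ i, (ContinuousLinearMap.proj (R := ℝ) (φ := fun _ : ι => ℝ) i).smulRight (g i x))
      (A (x - x)) := by simpa using h0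
  have h1 := h0'.comp x hA
  have e1 : (fun u : ι → ℝ => f (x + ∑ i, u i • b i)) ∘ (fun y => A (y - x)) = f := by
    funext y
    have : ∑ i, A (y - x) i • b i = y - x := b.sum_repr (y - x)
    simp only [Function.comp, this, add_sub_cancel]
  rw [e1] at h1
  refine h1.congr_fderiv ?_
  ext y
  simp [_root_.sum_apply, A]

/-- A family of continuous functions indexed by the lists of directions, each being the partial
derivative of its predecessor, consists of the derivatives of a smooth function. -/
theorem smooth_family {g : List ι → W → ℂ} (hc : ∀ l, Continuous (g l))
    (hd : ∀ l i x, HasDerivAt (fun t : ℝ => g l (x + t • b i)) (g (i :: l) x) 0) :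
    ContDiff ℝ ∞ (g []) ∧ ∀ l : List ι, dirD (l.map b) (g []) = g l := by
  have hF : ∀ l x, HasFDerivAt (g l) (∑ i, (coordL b i).smulRight (g (i :: l) x)) x := fun l x =>
    hasFDerivAt_of_partials b (fun i => hc (i :: l)) (fun i x => hd l i x) x
  refine ⟨?_, fun l => ?_⟩
  · have : ∀ m : ℕ, ∀ l, ContDiff ℝ m (g l) := by
      intro m
      induction m with
      | zero => exact fun l => contDiff_zero.2 (hc l)
      | succ m ih =>
        intro l
        rw [Nat.cast_add, Nat.cast_one, contDiff_succ_iff_hasFDerivAt]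
        refine ⟨_, ?_, hF l⟩
        exact ContDiff.sum fun i _ => ContDiff.smulRight contDiff_const (ih (i :: l))
    exact contDiff_infty.2 fun m => this m []
  · induction l with
    | nil => rfl
    | cons i l ih =>
      funext x
      classical
      rw [List.map_cons, dirD, ih]
      change fderiv ℝ (g l) x (b i) = _
      rw [(hF l x).fderiv, _root_.sum_apply, Finset.sum_eq_single i]
      · simp [coordL_apply]
      · intro j _ hj
        simp [coordL_apply, Finsupp.single_eq_of_ne hj]
      · simp

end Family

/-! ### Iterated oscillating integrals and linear changes of variables -/

section Nested

variable {W : Type*} [NormedAddCommGroup W] [NormedSpace ℝ W]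

theorem dirD_comp_affine {W' : Type*} [NormedAddCommGroup W'] [NormedSpace ℝ W'] {f : W' → ℂ}
    (hf : ContDiff ℝ ∞ f) (A : W →L[ℝ] W') (c : W') (l : List W) :
    dirD l (fun z => f (A z + c)) = fun z => dirD (l.map A) f (A z + c) := by
  induction l with
  | nil => rfl
  | cons v l ih =>
    funext z
    simp only [dirD, ih, List.map_cons]
    have := (differentiable_dirD hf (l.map A) (A z + c)).hasFDerivAt.comp z
      (A.hasFDerivAt.add_const c)
    rw [show (fun z => dirD (l.map A) f (A z + c)) = dirD (l.map A) f ∘ fun z => A z + c from rfl,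
      this.fderiv]
    rfl

theorem dirD_slice {Ψ : W × W → ℂ} (hΨ : ContDiff ℝ ∞ Ψ) (w : W) (l : List W) :
    dirD l (fun z => Ψ (z, w)) = fun z => dirD (l.map (ContinuousLinearMap.inl ℝ W W)) Ψ (z, w) := by
  simpa using dirD_comp_affine hΨ (ContinuousLinearMap.inl ℝ W W) ((0, w) : W × W) l

theorem dirD_slice_right {Ψ : W × W → ℂ} (hΨ : ContDiff ℝ ∞ Ψ) (w : W) (l : List W) :
    dirD l (fun z => Ψ (w, z)) = fun z => dirD (l.map (ContinuousLinearMap.inr ℝ W W)) Ψ (w, z) := by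
  simpa using dirD_comp_affine hΨ (ContinuousLinearMap.inr ℝ W W) ((w, 0) : W × W) l

theorem BB.slice {Ψ : W × W → ℂ} (hΨ : BB Ψ) (w : W) : BB fun z => Ψ (z, w) := by
  refine ⟨hΨ.smooth.comp (contDiff_prodMk_left w), fun m => ?_⟩
  obtain ⟨C, h0, hC⟩ := hΨ.bound m
  refine ⟨C, h0, fun l hl x => ?_⟩
  rw [dirD_slice hΨ.smooth]
  refine (hC _ (by simpa using hl) _).trans (le_of_eq ?_)
  simp [List.map_map, Function.comp_def]

variable [FiniteDimensional ℝ W] [MeasurableSpace W] [BorelSpace W]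
variable {ι : Type*} [Fintype ι] {κ : ℝ} {b : Module.Basis ι ℝ W}
variable {μ : Measure W} [μ.IsAddHaarMeasure]

/-- The weights of a product, without their constant terms, add up. -/
theorem wt_prod (z : W × W) : wt κ (b.prod b) z - 1 = (wt κ b z.1 - 1) + (wt κ b z.2 - 1) := by
  simp only [wt, Module.Basis.coord_apply, Fintype.sum_sum_type, Module.Basis.prod_repr_inl,
    Module.Basis.prod_repr_inr]
  ring

theorem dirD_zero_cons (f : W → ℂ) (l : List W) : dirD (0 :: l) f = 0 := by
  funext x
  simp [dirD]

/-- The product of two copies of a phase is a phase for the product basis, since the Laplacian of a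
product of functions of separate variables has no mixed term. -/
theorem IsPhase.prod {e : W → ℂ} (he : IsPhase κ b e) :
    IsPhase κ (b.prod b) fun z : W × W => e z.1 * e z.2 := by
  have h1 : ContDiff ℝ ∞ fun z : W × W => e z.1 := he.smooth.comp contDiff_fst
  have h2 : ContDiff ℝ ∞ fun z : W × W => e z.2 := he.smooth.comp contDiff_snd
  refine ⟨h1.mul h2, fun x => by simp [he.norm_eq], fun x => ?_⟩
  have d1 : ∀ l : List (W × W), dirD l (fun z : W × W => e z.1) =
      fun x => dirD (l.map (ContinuousLinearMap.fst ℝ W W)) e x.1 :=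
    dirD_comp_clm he.smooth (ContinuousLinearMap.fst ℝ W W)
  have d2 : ∀ l : List (W × W), dirD l (fun z : W × W => e z.2) =
      fun x => dirD (l.map (ContinuousLinearMap.snd ℝ W W)) e x.2 :=
    dirD_comp_clm he.smooth (ContinuousLinearMap.snd ℝ W W)
  simp only [dirD_mul h1 h2, d1, d2, Fintype.sum_sum_type, splits, wt_prod]
  simp [dirD_zero_cons, ← Finset.sum_mul, ← Finset.mul_sum]
  simp only [dirD]
  have e1 := he.eq x.1
  have e2 := he.eq x.2
  simp only [dirD] at e1 e2
  rw [e1, e2]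
  push_cast
  ring

variable (W) in
theorem exists_cutoff : ∃ χ : W → ℂ, BB χ ∧ HasCompactSupport χ ∧ χ 0 = 1 := by
  let β : ContDiffBump (0 : W) := ⟨1, 2, one_pos, one_lt_two⟩
  have hχs : ContDiff ℝ ∞ fun x => (β x : ℂ) := Complex.ofRealCLM.contDiff.comp β.contDiff
  have hχc : HasCompactSupport fun x => (β x : ℂ) :=
    β.hasCompactSupport.comp_left (g := fun r : ℝ => (r : ℂ)) rfl
  refine ⟨_, BB.of_hasCompactSupport hχs hχc, hχc, ?_⟩
  rw [β.one_of_mem_closedBall (Metric.mem_closedBall_self β.rIn_pos.le)]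
  rfl

theorem hasCompactSupport_dilate {χ : W → ℂ} (hχ : HasCompactSupport χ) (j : ℕ) :
    HasCompactSupport fun x => χ ((((j : ℝ) + 1)⁻¹ • ContinuousLinearMap.id ℝ W) x) := by
  have hne : ((j : ℝ) + 1)⁻¹ ≠ 0 := by positivity
  exact hχ.comp_homeomorph (Homeomorph.smulOfNeZero _ hne)

/-- Oscillating integrals are invariant under the linear changes of variables that preserve the
measure and the phase. -/
theorem osc_comp_linear (hκ : 0 < κ) {k : ℕ} (hk : Module.finrank ℝ W < 2 * k)
    {e : W → ℂ} (he : IsPhase κ b e) (L : W ≃L[ℝ] W) (hL : MeasurePreserving L μ μ)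
    (heL : ∀ x, e (L x) = e x) {f : W → ℂ} (hf : BB f) :
    osc κ b μ e k (fun x => f (L x)) = osc κ b μ e k f := by
  obtain ⟨χ, hχ, hχc, hχ0⟩ := exists_cutoff W
  have hA := tendsto_inv_smul_id W
  have hA' : Tendsto (fun j : ℕ => (((j : ℝ) + 1)⁻¹ • ContinuousLinearMap.id ℝ W).comp
      (L : W →L[ℝ] W)) atTop (𝓝 0) := by
    have := ((ContinuousLinearMap.compL ℝ W W W).flip (L : W →L[ℝ] W)).continuous.tendsto 0 |>.comp hA
    simpa [Function.comp_def] using this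
  have hfL : BB fun x => f (L x) := hf.comp_clm (L : W →L[ℝ] W)
  have h1 := osc_regularize (μ := μ) hκ hk he hA hχ hf
  have h2 := osc_regularize (μ := μ) hκ hk he hA' hχ hfL
  simp only [hχ0, one_mul] at h1 h2
  refine tendsto_nhds_unique h2 (h1.congr fun j => ?_)
  have hcj := hasCompactSupport_dilate hχc j
  have hsj : ContDiff ℝ ∞ fun x => χ ((((j : ℝ) + 1)⁻¹ • ContinuousLinearMap.id ℝ W) x) * f x :=
    (hχ.smooth.comp (ContinuousLinearMap.contDiff _)).mul hf.smooth
  have hcj' : HasCompactSupport fun x =>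
      χ ((((j : ℝ) + 1)⁻¹ • ContinuousLinearMap.id ℝ W) x) * f x := hcj.mul_right
  have hsL : ContDiff ℝ ∞ fun x =>
      χ ((((j : ℝ) + 1)⁻¹ • ContinuousLinearMap.id ℝ W) (L x)) * f (L x) :=
    hsj.comp L.contDiff
  have hcL : HasCompactSupport fun x =>
      χ ((((j : ℝ) + 1)⁻¹ • ContinuousLinearMap.id ℝ W) (L x)) * f (L x) :=
    hcj'.comp_homeomorph L.toHomeomorph
  have e1 := osc_eq_integral_of_hasCompactSupport (μ := μ) hκ he k hsj hcj'
  have e2 := osc_eq_integral_of_hasCompactSupport (μ := μ) hκ he k hsL hcL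
  refine e1.trans (Eq.trans ?_ e2.symm)
  rw [← hL.integral_comp L.toHomeomorph.measurableEmbedding]
  simp only [heL]

/-- The iterated oscillating integral is the oscillating integral over the product: both are
computed by cutting off the integrand in the first and then in the second variable. -/
theorem osc_osc (hκ : 0 < κ) {k k' : ℕ} (hk : Module.finrank ℝ W < 2 * k)
    (hk' : Module.finrank ℝ (W × W) < 2 * k') {e : W → ℂ} (he : IsPhase κ b e)
    {Ψ : W × W → ℂ} (hΨ : BB Ψ) (hg : BB fun w => osc κ b μ e k fun z => Ψ (z, w)) :
    osc κ b μ e k (fun w => osc κ b μ e k fun z => Ψ (z, w)) =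
      osc κ (b.prod b) (μ.prod μ) (fun z : W × W => e z.1 * e z.2) k' Ψ := by
  obtain ⟨χ, hχ, hχc, hχ0⟩ := exists_cutoff W
  set g : W → ℂ := fun w => osc κ b μ e k fun z => Ψ (z, w) with hgdef
  let a : ℕ → W →L[ℝ] W := fun j => ((j : ℝ) + 1)⁻¹ • ContinuousLinearMap.id ℝ W
  have ha : Tendsto a atTop (𝓝 0) := tendsto_inv_smul_id W
  have ha1 : Tendsto (fun j => (a j).comp (ContinuousLinearMap.fst ℝ W W)) atTop (𝓝 0) := by
    have := ((ContinuousLinearMap.compL ℝ (W × W) W W).flip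
      (ContinuousLinearMap.fst ℝ W W)).continuous.tendsto 0 |>.comp ha
    simpa [Function.comp_def] using this
  have ha2 : Tendsto (fun j => (a j).comp (ContinuousLinearMap.snd ℝ W W)) atTop (𝓝 0) := by
    have := ((ContinuousLinearMap.compL ℝ (W × W) W W).flip
      (ContinuousLinearMap.snd ℝ W W)).continuous.tendsto 0 |>.comp ha
    simpa [Function.comp_def] using this
  have hχa : ∀ j, BB fun z => χ (a j z) := fun j => hχ.comp_clm (a j)
  have hχac : ∀ j, HasCompactSupport fun z => χ (a j z) := fun j => hasCompactSupport_dilate hχc j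
  -- First cut off in the second variable only; the cut-off in the first variable is removed inside.
  have hstep : ∀ j, osc κ b μ e k (fun w => χ (a j w) * g w) =
      osc κ (b.prod b) (μ.prod μ) (fun z : W × W => e z.1 * e z.2) k'
        fun z => χ (a j z.2) * Ψ z := by
    intro j
    have hΨj : BB fun z : W × W => χ (a j z.2) * Ψ z :=
      (hχ.comp_clm ((a j).comp (ContinuousLinearMap.snd ℝ W W))).mul hΨ
    have hlim := osc_regularize (μ := μ.prod μ) hκ hk' he.prod ha1 hχ hΨj
    simp only [hχ0, one_mul] at hlim
    refine tendsto_nhds_unique ?_ hlim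
    rw [osc_eq_integral_of_hasCompactSupport hκ he k ((hχa j).mul hg).smooth (hχac j).mul_right]
    -- the cut-off double integral, by Fubini's theorem
    have hF : ∀ i, ContDiff ℝ ∞ fun z : W × W => χ (a i z.1) * (χ (a j z.2) * Ψ z) := fun i =>
      ((hχ.comp_clm ((a i).comp (ContinuousLinearMap.fst ℝ W W))).mul hΨj).smooth
    have hFc : ∀ i, HasCompactSupport fun z : W × W => χ (a i z.1) * (χ (a j z.2) * Ψ z) := by
      intro i
      refine HasCompactSupport.intro ((hχac i).isCompact.prod (hχac j).isCompact) fun z hz => ?_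
      by_contra hne
      refine hz ⟨subset_closure ?_, subset_closure ?_⟩ <;> intro h0 <;> apply hne
      · change χ (a i z.1) = 0 at h0
        simp [h0]
      · change χ (a j z.2) = 0 at h0
        simp [h0]
    have hFi : ∀ i, Integrable (fun z : W × W => (e z.1 * e z.2) *
        (χ (a i z.1) * (χ (a j z.2) * Ψ z))) (μ.prod μ) := fun i =>
      ((he.prod.smooth.continuous.mul (hF i).continuous).integrable_of_hasCompactSupport
        (hFc i).mul_left)
    have hFub : ∀ i, osc κ (b.prod b) (μ.prod μ) (fun z : W × W => e z.1 * e z.2) k'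
        (fun z => χ (((a i).comp (ContinuousLinearMap.fst ℝ W W)) z) * (χ (a j z.2) * Ψ z)) =
        ∫ w, e w * χ (a j w) * osc κ b μ e k (fun z => χ (a i z) * Ψ (z, w)) ∂μ := by
      intro i
      refine (osc_eq_integral_of_hasCompactSupport hκ he.prod k' (hF i) (hFc i)).trans ?_
      rw [integral_prod_symm _ (hFi i)]
      refine integral_congr_ae (ae_of_all _ fun w => ?_)
      simp only
      rw [osc_eq_integral_of_hasCompactSupport hκ he k
        ((hχa i).smooth.mul (hΨ.slice w).smooth) (hχac i).mul_right, ← integral_const_mul]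
      refine integral_congr_ae (ae_of_all _ fun z => ?_)
      simp only
      ring
    simp only [hFub]
    obtain ⟨S, C, hC, hbd⟩ := exists_osc_bound (μ := μ) hκ hk he
    have hM : ∃ M : ℝ, ∀ᶠ i in atTop, ∀ l ∈ S, ∀ w z,
        ‖dirD l (fun z => χ (a i z) * Ψ (z, w)) z‖ ≤ M := by
      clear hbd
      induction S with
      | nil => exact ⟨0, by simp⟩
      | cons l S ih =>
        obtain ⟨M, hM⟩ := ih
        obtain ⟨M', hM'⟩ := regularize_bound ha1 hχ hΨ (l.map (ContinuousLinearMap.inl ℝ W W))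
        refine ⟨max M M', ?_⟩
        filter_upwards [hM, hM'] with i h1 h2 l' hl' w z
        rcases List.mem_cons.1 hl' with rfl | hl'
        · refine le_trans (le_of_eq ?_) ((h2 (z, w)).trans (le_max_right _ _))
          have := dirD_slice (Ψ := fun z : W × W => χ (a i z.1) * Ψ z)
            ((hχ.comp_clm ((a i).comp (ContinuousLinearMap.fst ℝ W W))).mul hΨ).smooth w l'
          exact congrArg norm (congrFun this z)
        · exact (h1 l' hl' w z).trans (le_max_left _ _)
    obtain ⟨M, hM⟩ := hM
    have hB : ∀ i w, BB fun z => χ (a i z) * Ψ (z, w) := fun i w => (hχa i).mul (hΨ.slice w)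
    refine tendsto_integral_filter_of_dominated_convergence
      (fun w => ‖χ (a j w)‖ * (C * M)) ?_ ?_ ?_ (ae_of_all _ fun w => ?_)
    · refine Eventually.of_forall fun i => ?_
      refine ((hFi i).integral_prod_right.aestronglyMeasurable).congr (ae_of_all _ fun w => ?_)
      simp only
      rw [osc_eq_integral_of_hasCompactSupport hκ he k
        ((hχa i).smooth.mul (hΨ.slice w).smooth) (hχac i).mul_right, ← integral_const_mul]
      refine integral_congr_ae (ae_of_all _ fun z => ?_)
      simp only
      ring
    · filter_upwards [hM] with i hi
      refine ae_of_all _ fun w => ?_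
      rw [norm_mul, norm_mul, he.norm_eq, one_mul]
      exact mul_le_mul_of_nonneg_left (hbd _ M (hB i w) fun l hl z => hi l hl w z) (norm_nonneg _)
    · exact (((hχa j).smooth.continuous.norm).integrable_of_hasCompactSupport
        (hχac j).norm).mul_const _
    · have := osc_regularize (μ := μ) hκ hk he ha hχ (hΨ.slice w)
      simp only [hχ0, one_mul] at this
      rw [← mul_assoc]
      exact this.const_mul _
  have h1 := osc_regularize (μ := μ) hκ hk he ha hχ hg
  have h2 := osc_regularize (μ := μ.prod μ) hκ hk' he.prod ha2 hχ hΨ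
  simp only [hχ0, one_mul] at h1 h2
  exact tendsto_nhds_unique h1 (h2.congr fun j => (hstep j).symm)

end Nested

/-! ### The oscillating integral of the symplectic phase -/

section Symplectic

variable {d : ℕ}

/-- The complex structure `J` of `ℝ^{2d}`, with `ω₀(y, y') = ⟪y, J y'⟫`. -/
def sympJ (d : ℕ) : Body (Fin d ⊕ Fin d) ≃ₗᵢ[ℝ] Body (Fin d ⊕ Fin d) where
  toFun y := WithLp.toLp 2 (Sum.elim (fun i => y (Sum.inr i)) fun i => -y (Sum.inl i))
  invFun y := WithLp.toLp 2 (Sum.elim (fun i => -y (Sum.inr i)) fun i => y (Sum.inl i))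
  map_add' y y' := by ext i; rcases i with i | i <;> simp [add_comm]
  map_smul' c y := by ext i; rcases i with i | i <;> simp
  left_inv y := by ext i; rcases i with i | i <;> simp
  right_inv y := by ext i; rcases i with i | i <;> simp
  norm_map' y := by
    simp [EuclideanSpace.norm_eq, Fintype.sum_sum_type, add_comm]

theorem omega0_eq_inner (y y' : Body (Fin d ⊕ Fin d)) :
    omega0 y y' = inner ℝ y (sympJ d y') := by
  simp only [omega0, PiLp.inner_apply, Fintype.sum_sum_type, sympJ, LinearIsometryEquiv.coe_mk,
    LinearEquiv.coe_mk, LinearMap.coe_mk, AddHom.coe_mk, Sum.elim_inl, Sum.elim_inr,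
    RCLike.inner_apply, conj_trivial, ← Finset.sum_add_distrib]
  exact Finset.sum_congr rfl fun i _ => by ring

theorem omega0_neg_swap (y y' : Body (Fin d ⊕ Fin d)) : omega0 y' (-y) = omega0 y y' := by
  simp only [omega0, PiLp.neg_apply]
  exact Finset.sum_congr rfl fun i _ => by ring

theorem omega0_add_left (x y z : Body (Fin d ⊕ Fin d)) :
    omega0 (x + y) z = omega0 x z + omega0 y z := by
  simp only [omega0_eq_inner, inner_add_left]

theorem omega0_sub_right (x y z : Body (Fin d ⊕ Fin d)) :
    omega0 x (y - z) = omega0 x y - omega0 x z := by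
  simp only [omega0_eq_inner, map_sub, inner_sub_right]

/-- The standard basis of `ℝ^σ`. -/
def bodyBasis (σ : Type) [Fintype σ] : Module.Basis σ ℝ (Body σ) :=
  (EuclideanSpace.basisFun σ ℝ).toBasis

theorem bodyBasis_apply {σ : Type} [Fintype σ] [DecidableEq σ] (i : σ) :
    bodyBasis σ i = EuclideanSpace.single i (1 : ℝ) := by
  simp [bodyBasis]

/-- The standard basis of `ℝ^{2d}`. -/
abbrev stdB (d : ℕ) : Module.Basis (Fin d ⊕ Fin d) ℝ (Body (Fin d ⊕ Fin d)) :=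
  bodyBasis (Fin d ⊕ Fin d)

theorem wt_stdB (κ : ℝ) (y : Body (Fin d ⊕ Fin d) × Body (Fin d ⊕ Fin d)) :
    wt κ ((stdB d).prod (stdB d)) y = 1 + κ * (‖y.1‖ ^ 2 + ‖y.2‖ ^ 2) := by
  have h := wt_prod (κ := κ) (b := stdB d) y
  have h1 : ∀ z : Body (Fin d ⊕ Fin d), wt κ (stdB d) z - 1 = κ * ‖z‖ ^ 2 := by
    intro z
    rw [wt, EuclideanSpace.real_norm_sq_eq]
    simp [bodyBasis]
  rw [h1, h1] at h
  linarith

/-- The phase `e^{-(2i/θ) ω₀(y₁, y₂)}`. -/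
def symplPhase (d : ℕ) (θ : ℝ) (y : Body (Fin d ⊕ Fin d) × Body (Fin d ⊕ Fin d)) : ℂ :=
  Complex.exp (-(2 * Complex.I / θ) * omega0 y.1 y.2)

theorem contDiff_omega0 : ContDiff ℝ ∞
    fun y : Body (Fin d ⊕ Fin d) × Body (Fin d ⊕ Fin d) => omega0 y.1 y.2 := by
  simp only [omega0_eq_inner]
  exact contDiff_fst.inner ℝ ((sympJ d).contDiff.comp contDiff_snd)

/-- The derivative of the symplectic form as a quadratic form on the product. -/
theorem fderiv_omega0 (x v : Body (Fin d ⊕ Fin d) × Body (Fin d ⊕ Fin d)) :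
    fderiv ℝ (fun y : Body (Fin d ⊕ Fin d) × Body (Fin d ⊕ Fin d) => omega0 y.1 y.2) x v =
      omega0 x.1 v.2 + omega0 v.1 x.2 := by
  simp only [omega0_eq_inner]
  have h2 : HasFDerivAt (fun y : Body (Fin d ⊕ Fin d) × Body (Fin d ⊕ Fin d) => sympJ d y.2)
      (((sympJ d).toContinuousLinearEquiv : _ →L[ℝ] _).comp (ContinuousLinearMap.snd ℝ _ _)) x :=
    ((sympJ d).toContinuousLinearEquiv.hasFDerivAt (x := x.2)).comp x hasFDerivAt_snd
  rw [(hasFDerivAt_fst.inner ℝ h2).fderiv]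
  simp [fderivInnerCLM_apply]

/-- Second derivatives of `e^{c q}` in a direction in which `q` is affine. -/
theorem dirD_exp {W : Type*} [NormedAddCommGroup W] [NormedSpace ℝ W] {q : W → ℝ}
    (hq : ContDiff ℝ ∞ q) (c : ℂ) {v : W} {a : W → ℝ} (h : ∀ x, fderiv ℝ q x v = a x)
    (ha : ∀ x, HasFDerivAt a (fderiv ℝ a x) x ∧ fderiv ℝ a x v = 0) (x : W) :
    dirD [v, v] (fun x => Complex.exp (c * q x)) x = c ^ 2 * (a x) ^ 2 * Complex.exp (c * q x) := by
  have he : ∀ x, HasFDerivAt (fun x => Complex.exp (c * q x))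
      (Complex.exp (c * q x) • (c • (Complex.ofRealCLM.comp (fderiv ℝ q x)))) x := by
    intro x
    have h1 : HasFDerivAt (fun x => (q x : ℂ)) (Complex.ofRealCLM.comp (fderiv ℝ q x)) x :=
      Complex.ofRealCLM.hasFDerivAt.comp x (hq.differentiable (by simp) x).hasFDerivAt
    exact (h1.const_mul c).cexp
  have h1 : dirD [v] (fun x => Complex.exp (c * q x)) =
      fun x => Complex.exp (c * q x) * (c * a x) := by
    funext x
    change fderiv ℝ (fun x => Complex.exp (c * q x)) x v = _
    rw [(he x).fderiv]
    simp [h]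
  change fderiv ℝ (dirD [v] (fun x => Complex.exp (c * q x))) x v = _
  have h2 : HasFDerivAt (fun x => c * (a x : ℂ)) (c • (Complex.ofRealCLM.comp (fderiv ℝ a x))) x :=
    (Complex.ofRealCLM.hasFDerivAt.comp x (ha x).1).const_mul c
  have h3 : HasFDerivAt (fun x => Complex.exp (c * q x) * (c * a x)) _ x := (he x).mul h2
  rw [h1, h3.fderiv]
  simp [h, (ha x).2]
  ring

/-- The complex structure is an isometry; this makes the squared gradient of `ω₀` in each variable
equal to the squared norm of the other one. -/
theorem sum_omega0_sq (y : Body (Fin d ⊕ Fin d)) :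
    ∑ i, omega0 (stdB d i) y ^ 2 = ‖y‖ ^ 2 ∧ ∑ i, omega0 y (stdB d i) ^ 2 = ‖y‖ ^ 2 := by
  have h2 : ∑ i, omega0 y (stdB d i) ^ 2 = ‖y‖ ^ 2 := by
    simp only [omega0_eq_inner]
    have h := OrthonormalBasis.sum_sq_norm_inner_left
      ((EuclideanSpace.basisFun (Fin d ⊕ Fin d) ℝ).map (sympJ d)) y
    rw [← h]
    simp [bodyBasis, OrthonormalBasis.map_apply]
  refine ⟨?_, h2⟩
  rw [← h2]
  refine Finset.sum_congr rfl fun i _ => ?_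
  have : omega0 (stdB d i) y = -omega0 y (stdB d i) := by
    simp only [omega0, ← Finset.sum_neg_distrib]
    exact Finset.sum_congr rfl fun i _ => by ring
  rw [this, neg_sq]

/-- The symplectic phase satisfies `(1 - Laplacian) e = w e` for the weight
`w = 1 + (4/θ²) (|y₁|² + |y₂|²)`: the form `ω₀` is harmonic with `|∇ω₀|² = |y₁|² + |y₂|²`. -/
theorem isPhase_symplPhase {θ : ℝ} (hθ : θ ≠ 0) :
    IsPhase (4 / θ ^ 2) ((stdB d).prod (stdB d)) (symplPhase d θ) := by
  refine ⟨?_, fun y => ?_, fun y => ?_⟩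
  · exact (contDiff_const.mul (Complex.ofRealCLM.contDiff.comp contDiff_omega0)).cexp
  · rw [symplPhase, show -(2 * Complex.I / θ) * (omega0 y.1 y.2 : ℂ) =
      ((-(2 / θ) * omega0 y.1 y.2 : ℝ) : ℂ) * Complex.I by push_cast; ring,
      Complex.norm_exp_ofReal_mul_I]
  · have hlin1 : ∀ u : Body (Fin d ⊕ Fin d), ∀ x : Body (Fin d ⊕ Fin d) × Body (Fin d ⊕ Fin d),
        HasFDerivAt (fun x : Body (Fin d ⊕ Fin d) × Body (Fin d ⊕ Fin d) => omega0 u x.2)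
          ((innerSL ℝ u).comp (((sympJ d).toContinuousLinearEquiv : _ →L[ℝ] _).comp
            (ContinuousLinearMap.snd ℝ _ _))) x := by
      intro u x
      have := ((innerSL ℝ u).comp (((sympJ d).toContinuousLinearEquiv : _ →L[ℝ] _).comp
            (ContinuousLinearMap.snd ℝ (Body (Fin d ⊕ Fin d)) _))).hasFDerivAt (x := x)
      refine this.congr_of_eventuallyEq (Eventually.of_forall fun z => ?_)
      simp [omega0_eq_inner]
    have hlin2 : ∀ u : Body (Fin d ⊕ Fin d), ∀ x : Body (Fin d ⊕ Fin d) × Body (Fin d ⊕ Fin d),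
        HasFDerivAt (fun x : Body (Fin d ⊕ Fin d) × Body (Fin d ⊕ Fin d) => omega0 x.1 u)
          ((innerSL ℝ (sympJ d u)).comp (ContinuousLinearMap.fst ℝ _ _)) x := by
      intro u x
      have := ((innerSL ℝ (sympJ d u)).comp
        (ContinuousLinearMap.fst ℝ (Body (Fin d ⊕ Fin d)) (Body (Fin d ⊕ Fin d)))).hasFDerivAt
          (x := x)
      refine this.congr_of_eventuallyEq (Eventually.of_forall fun z => ?_)
      simp [omega0_eq_inner, real_inner_comm]
    have h0 : ∀ u : Body (Fin d ⊕ Fin d), omega0 u 0 = 0 ∧ omega0 0 u = 0 := fun u => by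
      simp [omega0]
    have e1 : ∀ i, dirD [(stdB d i, 0), (stdB d i, 0)] (symplPhase d θ) y =
        (-(2 * Complex.I / θ)) ^ 2 * (omega0 (stdB d i) y.2 : ℂ) ^ 2 * symplPhase d θ y := by
      intro i
      refine dirD_exp contDiff_omega0 _ (a := fun x => omega0 (stdB d i) x.2) (fun x => ?_)
        (fun x => ⟨?_, ?_⟩) y
      · rw [fderiv_omega0]; simp [h0]
      · rw [(hlin1 _ x).fderiv]; exact hlin1 _ x
      · rw [(hlin1 _ x).fderiv]; simp
    have e2 : ∀ i, dirD [(0, stdB d i), (0, stdB d i)] (symplPhase d θ) y =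
        (-(2 * Complex.I / θ)) ^ 2 * (omega0 y.1 (stdB d i) : ℂ) ^ 2 * symplPhase d θ y := by
      intro i
      refine dirD_exp contDiff_omega0 _ (a := fun x => omega0 x.1 (stdB d i)) (fun x => ?_)
        (fun x => ⟨?_, ?_⟩) y
      · rw [fderiv_omega0]; simp [h0]
      · rw [(hlin2 _ x).fderiv]; exact hlin2 _ x
      · rw [(hlin2 _ x).fderiv]; simp
    rw [Fintype.sum_sum_type]
    simp only [Module.Basis.prod_apply, Sum.elim_inl, Sum.elim_inr, Function.comp,
      LinearMap.coe_inl, LinearMap.coe_inr, e1, e2,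
      ← Finset.sum_mul, ← Finset.mul_sum]
    have s1 := congrArg (fun r : ℝ => (r : ℂ)) (sum_omega0_sq y.2).1
    have s2 := congrArg (fun r : ℝ => (r : ℂ)) (sum_omega0_sq y.1).2
    push_cast at s1 s2
    rw [s1, s2, wt_stdB]
    have hθ' : (θ : ℂ) ≠ 0 := by exact_mod_cast hθ
    push_cast
    field_simp
    simp only [Complex.I_sq]
    ring

variable (d) in
/-- The Lebesgue measure of `ℝ^{2d} × ℝ^{2d}`. -/
abbrev symplVol : Measure (Body (Fin d ⊕ Fin d) × Body (Fin d ⊕ Fin d)) := volume.prod volume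

/-- The `2d + 1` regularizations suffice on `ℝ^{2d} × ℝ^{2d}`. -/
theorem finrank_symplectic (d : ℕ) :
    Module.finrank ℝ (Body (Fin d ⊕ Fin d) × Body (Fin d ⊕ Fin d)) < 2 * (2 * d + 1) := by
  simp
  omega

theorem laplacian_eq_sum_dirD {f : Body (Fin d ⊕ Fin d) → ℂ} (hf : ContDiff ℝ ∞ f)
    (y : Body (Fin d ⊕ Fin d)) :
    Laplacian.laplacian f y = ∑ i, dirD [stdB d i, stdB d i] f y := by
  rw [InnerProductSpace.laplacian_eq_iteratedFDeriv_orthonormalBasis f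
    (EuclideanSpace.basisFun (Fin d ⊕ Fin d) ℝ)]
  refine Finset.sum_congr rfl fun i _ => ?_
  rw [iteratedFDeriv_two_apply]
  change _ = fderiv ℝ (fun x => fderiv ℝ f x (stdB d i)) y (stdB d i)
  have hd : DifferentiableAt ℝ (fderiv ℝ f) y :=
    (hf.fderiv_right (m := ∞) (by simp)).differentiable (by simp) y
  rw [fderiv_clm_apply hd (differentiableAt_const _)]
  simp [bodyBasis]

/-- On smooth functions, the regularizing operator `oscOp` written with Laplacians is the operator
`oscO` written with derivatives along the standard basis. -/
theorem oscOp_iterate {θ : ℝ} (hθ : θ ≠ 0)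
    {g : Body (Fin d ⊕ Fin d) → Body (Fin d ⊕ Fin d) → ℂ}
    (hg : ContDiff ℝ ∞ (Function.uncurry g)) (k : ℕ) :
    Function.uncurry ((oscOp θ)^[k] g) =
      (oscO (4 / θ ^ 2) ((stdB d).prod (stdB d)))^[k] (Function.uncurry g) := by
  have hκ : 0 < 4 / θ ^ 2 := by positivity
  induction k with
  | zero => rfl
  | succ k ih =>
    rw [Function.iterate_succ', Function.iterate_succ', Function.comp, Function.comp, ← ih]
    have hs : ContDiff ℝ ∞ (Function.uncurry ((oscOp θ)^[k] g)) := by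
      rw [ih]
      exact (isSymOp_iterate hκ k).smooth hκ hg
    generalize (oscOp θ)^[k] g = g' at hs
    funext ⟨y₁, y₂⟩
    let h : Body (Fin d ⊕ Fin d) × Body (Fin d ⊕ Fin d) → ℂ := fun x =>
      Function.uncurry g' x * (((wt (4 / θ ^ 2) ((stdB d).prod (stdB d)) x)⁻¹ : ℝ) : ℂ)
    have hh : ContDiff ℝ ∞ h := hs.mul (contDiff_wt_inv' hκ)
    have hval : ∀ y₁ y₂, g' y₁ y₂ / ((1 + 4 / θ ^ 2 * (‖y₁‖ ^ 2 + ‖y₂‖ ^ 2) : ℝ) : ℂ) =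
        h (y₁, y₂) := fun y₁ y₂ => by
      simp only [h, wt_stdB, Function.uncurry, div_eq_mul_inv, Complex.ofReal_inv]
    simp only [Function.uncurry_apply_pair, oscOp, hval]
    rw [laplacian_eq_sum_dirD (f := fun y => h (y, y₂)) (hh.comp (contDiff_prodMk_left y₂)),
      laplacian_eq_sum_dirD (f := fun y => h (y₁, y)) (hh.comp (contDiff_prodMk_right y₁)), oscO,
      Fintype.sum_sum_type (α₁ := Fin d ⊕ Fin d) (α₂ := Fin d ⊕ Fin d), ← sub_sub]
    congr 1
    · congr 1
      refine Finset.sum_congr rfl fun i _ => ?_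
      exact (congrFun (dirD_slice hh y₂ [stdB d i, stdB d i]) y₁).trans (by simp [h])
    · refine Finset.sum_congr rfl fun i _ => ?_
      exact (congrFun (dirD_slice_right hh y₁ [stdB d i, stdB d i]) y₂).trans (by simp [h])

theorem oscIntegral_eq_osc {θ : ℝ} (hθ : θ ≠ 0)
    {g : Body (Fin d ⊕ Fin d) → Body (Fin d ⊕ Fin d) → ℂ} (hg : ContDiff ℝ ∞ (Function.uncurry g)) :
    oscIntegral θ g = osc (4 / θ ^ 2) ((stdB d).prod (stdB d)) (symplVol d)
      (symplPhase d θ) (2 * d + 1) (Function.uncurry g) := by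
  rw [oscIntegral, osc, ← oscOp_iterate hθ hg]
  rfl

theorem BB.oscIntegral_eq_osc {θ : ℝ} (hθ : θ ≠ 0)
    {g : Body (Fin d ⊕ Fin d) × Body (Fin d ⊕ Fin d) → ℂ} (hg : BB g) :
    oscIntegral θ (fun y₁ y₂ => g (y₁, y₂)) = osc (4 / θ ^ 2) ((stdB d).prod (stdB d))
      (symplVol d) (symplPhase d θ) (2 * d + 1) g :=
  SuperUDF.oscIntegral_eq_osc hθ hg.smooth

/-! ### Normalization -/

/-- Integrating the phase over the second variable is a Fourier transform. -/
theorem integral_symplPhase {θ : ℝ} (y : Body (Fin d ⊕ Fin d)) (φ : Body (Fin d ⊕ Fin d) → ℂ) :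
    ∫ y₂, symplPhase d θ (y, y₂) * φ y₂ = FourierTransform.fourier φ (-(1 / (Real.pi * θ)) • sympJ d y) := by
  rw [Real.fourier_eq']
  refine integral_congr_ae (ae_of_all _ fun v => ?_)
  simp only [symplPhase, smul_eq_mul]
  congr 2
  have h : omega0 y v = - inner ℝ v (sympJ d y) := by
    rw [← omega0_eq_inner]
    simp only [omega0, ← Finset.sum_neg_distrib]
    exact Finset.sum_congr rfl fun i _ => by ring
  rw [h, real_inner_smul_right]
  by_cases hθ : θ = 0
  · simp [hθ]
  have hθ' : (θ : ℂ) ≠ 0 := by exact_mod_cast hθ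
  have hpi : (Real.pi : ℂ) ≠ 0 := by exact_mod_cast Real.pi_ne_zero
  push_cast
  field_simp

/-- Fourier inversion at the origin. -/
theorem integral_fourier_sympJ {θ : ℝ} (hθ : θ ≠ 0) {φ : Body (Fin d ⊕ Fin d) → ℂ}
    (hφ : ContDiff ℝ ∞ φ) (hc : HasCompactSupport φ) :
    Integrable (fun y => FourierTransform.fourier φ (-(1 / (Real.pi * θ)) • sympJ d y)) ∧
    ∫ y, FourierTransform.fourier φ (-(1 / (Real.pi * θ)) • sympJ d y) =
      ((Real.pi * θ : ℝ) : ℂ) ^ (2 * d) * φ 0 := by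
  let Φ := hc.toSchwartzMap hφ
  have hΦ : FourierTransform.fourier φ = ⇑(FourierTransform.fourier Φ) := by
    rw [SchwartzMap.fourier_coe]
    rfl
  have hint : Integrable (FourierTransform.fourier φ) := by
    rw [hΦ]
    exact SchwartzMap.integrable _
  have hr : -(1 / (Real.pi * θ)) ≠ 0 := by
    have := Real.pi_ne_zero
    simp [this, hθ]
  have hJ := (sympJ d).measurePreserving
  have hJe := (sympJ d).toHomeomorph.measurableEmbedding
  refine ⟨(hJ.integrable_comp_emb hJe).2 ((integrable_comp_smul_iff volume _ hr).2 hint), ?_⟩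
  rw [hJ.integral_comp hJe fun y => FourierTransform.fourier φ (-(1 / (Real.pi * θ)) • y),
    Measure.integral_comp_smul]
  -- Fourier inversion evaluated at the origin
  have hinv : ∫ y, FourierTransform.fourier φ y = φ 0 := by
    have h1 := congrFun (Continuous.fourierInv_fourier_eq hφ.continuous
      (hφ.continuous.integrable_of_hasCompactSupport hc) hint) 0
    rw [← h1, Real.fourierInv_eq']
    simp
  rw [hinv]
  have hfr : Module.finrank ℝ (Body (Fin d ⊕ Fin d)) = 2 * d := by simp; omega
  have h2 : |((-(1 / (Real.pi * θ))) ^ (2 * d))⁻¹| = (Real.pi * θ) ^ (2 * d) := by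
    rw [pow_mul, pow_mul, neg_sq, one_div, inv_pow, inv_pow, inv_inv]
    exact abs_of_nonneg (by positivity)
  rw [hfr, h2, Complex.real_smul]
  push_cast
  rfl

theorem BB.comp_fst {W W' : Type*} [NormedAddCommGroup W] [NormedSpace ℝ W]
    [NormedAddCommGroup W'] [NormedSpace ℝ W'] {f : W → ℂ} (hf : BB f) :
    BB fun y : W × W' => f y.1 := by
  have := hf.comp_clm (ContinuousLinearMap.fst ℝ W W')
  exact this

theorem BB.comp_snd {W W' : Type*} [NormedAddCommGroup W] [NormedSpace ℝ W]
    [NormedAddCommGroup W'] [NormedSpace ℝ W'] {f : W' → ℂ} (hf : BB f) :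
    BB fun y : W × W' => f y.2 := by
  have := hf.comp_clm (ContinuousLinearMap.snd ℝ W W')
  exact this

/-- The oscillating integral of a function of the second variable only: the integral over the first
variable produces the delta distribution at the origin. -/
theorem oscIntegral_snd {θ : ℝ} (hθ : θ ≠ 0) {f : Body (Fin d ⊕ Fin d) → ℂ} (hf : BB f) :
    oscIntegral θ (fun _ y₂ => f y₂) = ((Real.pi * θ : ℝ) : ℂ) ^ (2 * d) * f 0 := by
  have hκ : 0 < 4 / θ ^ 2 := by positivity
  have hk := finrank_symplectic d
  have he := isPhase_symplPhase (d := d) hθ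
  obtain ⟨χ, hχ, hχc, hχ0⟩ := exists_cutoff (Body (Fin d ⊕ Fin d))
  let a : ℕ → Body (Fin d ⊕ Fin d) →L[ℝ] Body (Fin d ⊕ Fin d) := fun j =>
    ((j : ℝ) + 1)⁻¹ • ContinuousLinearMap.id ℝ _
  have ha : Tendsto a atTop (𝓝 0) := tendsto_inv_smul_id _
  have ha1 : Tendsto (fun j => (a j).comp (ContinuousLinearMap.fst ℝ _ (Body (Fin d ⊕ Fin d))))
      atTop (𝓝 0) := by
    have := ((ContinuousLinearMap.compL ℝ (Body (Fin d ⊕ Fin d) × Body (Fin d ⊕ Fin d))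
      (Body (Fin d ⊕ Fin d)) (Body (Fin d ⊕ Fin d))).flip
      (ContinuousLinearMap.fst ℝ _ (Body (Fin d ⊕ Fin d)))).continuous.tendsto 0 |>.comp ha
    simpa [Function.comp_def] using this
  have ha2 : Tendsto (fun j => (a j).comp (ContinuousLinearMap.snd ℝ (Body (Fin d ⊕ Fin d)) _))
      atTop (𝓝 0) := by
    have := ((ContinuousLinearMap.compL ℝ (Body (Fin d ⊕ Fin d) × Body (Fin d ⊕ Fin d))
      (Body (Fin d ⊕ Fin d)) (Body (Fin d ⊕ Fin d))).flip
      (ContinuousLinearMap.snd ℝ (Body (Fin d ⊕ Fin d)) _)).continuous.tendsto 0 |>.comp ha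
    simpa [Function.comp_def] using this
  have hχa : ∀ j, BB fun z => χ (a j z) := fun j => hχ.comp_clm (a j)
  have hχac : ∀ j, HasCompactSupport fun z => χ (a j z) := fun j => hasCompactSupport_dilate hχc j
  -- the case of a compactly supported function, by Fourier inversion
  have hcomp : ∀ φ : Body (Fin d ⊕ Fin d) → ℂ, BB φ → HasCompactSupport φ →
      osc (4 / θ ^ 2) ((stdB d).prod (stdB d)) (symplVol d) (symplPhase d θ) (2 * d + 1)
        (fun y => φ y.2) = ((Real.pi * θ : ℝ) : ℂ) ^ (2 * d) * φ 0 := by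
    intro φ hφ hφc
    have hφ2 : BB fun y : Body (Fin d ⊕ Fin d) × Body (Fin d ⊕ Fin d) => φ y.2 :=
      hφ.comp_snd
    have hlim := osc_regularize (μ := symplVol d) hκ hk he ha1 hχ hφ2
    simp only [hχ0, one_mul] at hlim
    refine tendsto_nhds_unique hlim ?_
    obtain ⟨hi, hv⟩ := integral_fourier_sympJ hθ hφ.smooth hφc
    have hstep : ∀ i, osc (4 / θ ^ 2) ((stdB d).prod (stdB d)) (symplVol d)
        (symplPhase d θ) (2 * d + 1) (fun y => χ (((a i).comp (ContinuousLinearMap.fst ℝ _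
          (Body (Fin d ⊕ Fin d)))) y) * φ y.2) =
        ∫ y, χ (a i y) * FourierTransform.fourier φ (-(1 / (Real.pi * θ)) • sympJ d y) := by
      intro i
      have hs : ContDiff ℝ ∞ fun y : Body (Fin d ⊕ Fin d) × Body (Fin d ⊕ Fin d) =>
          χ (((a i).comp (ContinuousLinearMap.fst ℝ _ (Body (Fin d ⊕ Fin d)))) y) * φ y.2 :=
        ((hχ.comp_clm _).mul hφ2).smooth
      have hsc : HasCompactSupport fun y : Body (Fin d ⊕ Fin d) × Body (Fin d ⊕ Fin d) =>
          χ (((a i).comp (ContinuousLinearMap.fst ℝ _ (Body (Fin d ⊕ Fin d)))) y) * φ y.2 := by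
        refine HasCompactSupport.intro ((hχac i).isCompact.prod hφc.isCompact) fun z hz => ?_
        by_contra hne
        refine hz ⟨subset_closure ?_, subset_closure ?_⟩ <;> intro h0 <;> apply hne
        · change χ (a i z.1) = 0 at h0
          simp [h0]
        · simp [h0]
      have hint : Integrable (fun y => symplPhase d θ y *
          (χ (((a i).comp (ContinuousLinearMap.fst ℝ _ (Body (Fin d ⊕ Fin d)))) y) * φ y.2))
          (symplVol d) :=
        (he.smooth.continuous.mul hs.continuous).integrable_of_hasCompactSupport hsc.mul_left
      rw [osc_eq_integral_of_hasCompactSupport hκ he _ hs hsc, integral_prod _ hint]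
      refine integral_congr_ae (ae_of_all _ fun y => ?_)
      simp only
      rw [← integral_symplPhase, ← integral_const_mul]
      refine integral_congr_ae (ae_of_all _ fun z => ?_)
      simp only [ContinuousLinearMap.comp_apply, ContinuousLinearMap.coe_fst']
      ring
    simp only [hstep]
    rw [← hv]
    obtain ⟨C, hC⟩ := hχ.bound_list []
    refine tendsto_integral_filter_of_dominated_convergence
      (fun y => C * ‖FourierTransform.fourier φ (-(1 / (Real.pi * θ)) • sympJ d y)‖) ?_ ?_
      (hi.norm.const_mul C) (ae_of_all _ fun y => ?_)
    · exact Eventually.of_forall fun i =>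
        (hχa i).smooth.continuous.aestronglyMeasurable.mul hi.aestronglyMeasurable
    · refine Eventually.of_forall fun i => ae_of_all _ fun y => ?_
      rw [norm_mul]
      exact mul_le_mul_of_nonneg_right (hC _) (norm_nonneg _)
    · have h1 : Tendsto (fun i => a i y) atTop (𝓝 0) := by
        have := ((ContinuousLinearMap.apply ℝ (Body (Fin d ⊕ Fin d)) y).continuous.tendsto 0).comp ha
        rwa [map_zero] at this
      have h2 := (hχ.smooth.continuous.tendsto 0).comp h1
      rw [hχ0] at h2
      simpa using h2.mul_const (FourierTransform.fourier φ (-(1 / (Real.pi * θ)) • sympJ d y))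
  have hf2 : BB fun y : Body (Fin d ⊕ Fin d) × Body (Fin d ⊕ Fin d) => f y.2 :=
    hf.comp_snd
  rw [hf2.oscIntegral_eq_osc hθ]
  have hlim := osc_regularize (μ := symplVol d) hκ hk he ha2 hχ hf2
  simp only [hχ0, one_mul] at hlim
  refine tendsto_nhds_unique hlim ((tendsto_const_nhds (α := ℕ)).congr fun j => ?_)
  refine Eq.trans ?_ (hcomp _ ((hχa j).mul hf) (hχac j).mul_right).symm
  simp [hχ0]

theorem isAddHaarMeasure_prod {W : Type*} [NormedAddCommGroup W] [NormedSpace ℝ W]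
    [FiniteDimensional ℝ W] [MeasurableSpace W] [BorelSpace W] (μ : Measure W) [μ.IsAddHaarMeasure] :
    (μ.prod μ).IsAddHaarMeasure := inferInstance

/-- A shear preserves the measure. -/
theorem measurePreserving_shear {W : Type*} [NormedAddCommGroup W] [NormedSpace ℝ W]
    [FiniteDimensional ℝ W] [MeasurableSpace W] [BorelSpace W] (μ : Measure W) [μ.IsAddHaarMeasure]
    {T : W → W} (hT : Measurable T) :
    MeasurePreserving (fun z : W × W => (z.1, z.2 + T z.1)) (μ.prod μ) (μ.prod μ) :=
  (MeasurePreserving.id μ).skew_product (g := fun z w => w + T z)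
    (measurable_snd.add (hT.comp measurable_fst))
    (ae_of_all _ fun z => (measurePreserving_add_right μ (T z)).map_eq)

variable (d) in
/-- The quarter turn `(y₁, y₂) ↦ (y₂, -y₁)`. -/
def quarterTurn : (Body (Fin d ⊕ Fin d) × Body (Fin d ⊕ Fin d)) ≃L[ℝ]
    (Body (Fin d ⊕ Fin d) × Body (Fin d ⊕ Fin d)) :=
  (ContinuousLinearEquiv.prodComm ℝ _ _).trans
    ((ContinuousLinearEquiv.refl ℝ _).prodCongr (ContinuousLinearEquiv.neg ℝ))

/-- The analogue of `oscIntegral_snd` for the first variable, by symmetry under the quarter turn. -/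
theorem oscIntegral_fst {θ : ℝ} (hθ : θ ≠ 0) {f : Body (Fin d ⊕ Fin d) → ℂ} (hf : BB f) :
    oscIntegral θ (fun y₁ _ => f y₁) = ((Real.pi * θ : ℝ) : ℂ) ^ (2 * d) * f 0 := by
  have hκ : 0 < 4 / θ ^ 2 := by positivity
  rw [← oscIntegral_snd hθ hf]
  have hf1 : BB fun y : Body (Fin d ⊕ Fin d) × Body (Fin d ⊕ Fin d) => f y.1 :=
    hf.comp_fst
  have hf2 : BB fun y : Body (Fin d ⊕ Fin d) × Body (Fin d ⊕ Fin d) => f y.2 :=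
    hf.comp_snd
  rw [hf1.oscIntegral_eq_osc hθ, hf2.oscIntegral_eq_osc hθ]
  have hL : MeasurePreserving (quarterTurn d) (symplVol d) (symplVol d) :=
    ((MeasurePreserving.id volume).prod (Measure.measurePreserving_neg volume)).comp
      Measure.measurePreserving_swap
  refine (osc_comp_linear hκ (finrank_symplectic d) (isPhase_symplPhase hθ) (quarterTurn d) hL
    (fun y => ?_) hf1).symm
  change Complex.exp (-(2 * Complex.I / θ) * omega0 y.2 (-y.1)) = _
  rw [omega0_neg_swap]
  rfl

/-! ### The change of variables behind associativity -/

variable (d) in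
/-- The map `((y₁, y₂), (y₃, y₄)) ↦ ((y₃, y₄ - y₂), (y₁ + y₃, y₂))`; it preserves the form
`ω₀(y₁, y₂) + ω₀(y₃, y₄)`. -/
def assocShear : ((Body (Fin d ⊕ Fin d) × Body (Fin d ⊕ Fin d)) ×
      (Body (Fin d ⊕ Fin d) × Body (Fin d ⊕ Fin d))) ≃L[ℝ]
    ((Body (Fin d ⊕ Fin d) × Body (Fin d ⊕ Fin d)) ×
      (Body (Fin d ⊕ Fin d) × Body (Fin d ⊕ Fin d))) :=
  LinearEquiv.toContinuousLinearEquiv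
    { toFun := fun y => ((y.2.1, y.2.2 - y.1.2), (y.1.1 + y.2.1, y.1.2))
      invFun := fun y => ((y.2.1 - y.1.1, y.2.2), (y.1.1, y.1.2 + y.2.2))
      map_add' := fun x y => by ext1 <;> ext1 <;> simp <;> abel
      map_smul' := fun c y => by ext1 <;> ext1 <;> simp [smul_sub]
      left_inv := fun y => by ext1 <;> ext1 <;> simp
      right_inv := fun y => by ext1 <;> ext1 <;> simp }

theorem measurePreserving_assocShear :
    MeasurePreserving (assocShear d)
      ((symplVol d).prod (symplVol d))
      ((symplVol d).prod (symplVol d)) := by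
  have h1 := measurePreserving_shear
    (symplVol d)
    (T := fun z => (z.1, 0)) (by fun_prop)
  have h2 := measurePreserving_shear
    (symplVol d)
    (T := fun z => (0, -z.2)) (by fun_prop)
  have hs : MeasurePreserving Prod.swap
      ((symplVol d).prod (symplVol d)) _ := Measure.measurePreserving_swap
  -- The map is a composition of two shears and three flips of the factors.
  have h3 := hs.comp (h2.comp (hs.comp (h1.comp hs)))
  convert h3 using 1
  funext y
  ext1 <;> ext1 <;> simp [assocShear, sub_eq_add_neg]

/-- The identity of iterated oscillating integrals behind the associativity of the even deformed
product. Both sides are integrals over the product of the two spaces, and the shear `assocShear`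
transforms one into the other. -/
theorem oscIntegral_assoc {θ : ℝ} (hθ : θ ≠ 0)
    {Φ : Body (Fin d ⊕ Fin d) × Body (Fin d ⊕ Fin d) × Body (Fin d ⊕ Fin d) → ℂ} (hΦ : BB Φ)
    (h₁ : BB fun y : Body (Fin d ⊕ Fin d) × Body (Fin d ⊕ Fin d) =>
      oscIntegral θ fun y₃ y₄ => Φ (y.1, y.2 + y₃, y.2 + y₄))
    (h₂ : BB fun y : Body (Fin d ⊕ Fin d) × Body (Fin d ⊕ Fin d) =>
      oscIntegral θ fun y₁ y₂ => Φ (y₁ + y.1, y₂ + y.1, y.2)) :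
    oscIntegral θ (fun y₁ y₂ => oscIntegral θ fun y₃ y₄ => Φ (y₁, y₂ + y₃, y₂ + y₄)) =
      oscIntegral θ (fun y₃ y₄ => oscIntegral θ fun y₁ y₂ => Φ (y₁ + y₃, y₂ + y₃, y₄)) := by
  have hκ : 0 < 4 / θ ^ 2 := by positivity
  have hk := finrank_symplectic d
  have hk' : Module.finrank ℝ ((Body (Fin d ⊕ Fin d) × Body (Fin d ⊕ Fin d)) ×
      (Body (Fin d ⊕ Fin d) × Body (Fin d ⊕ Fin d))) < 2 * (4 * d + 1) := by
    simp
    omega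
  have he := isPhase_symplPhase (d := d) hθ
  let T := (Body (Fin d ⊕ Fin d) × Body (Fin d ⊕ Fin d)) ×
      (Body (Fin d ⊕ Fin d) × Body (Fin d ⊕ Fin d))
  let z1 : T →L[ℝ] Body (Fin d ⊕ Fin d) :=
    (ContinuousLinearMap.fst ℝ _ _).comp (ContinuousLinearMap.fst ℝ _ _)
  let z2 : T →L[ℝ] Body (Fin d ⊕ Fin d) :=
    (ContinuousLinearMap.snd ℝ _ _).comp (ContinuousLinearMap.fst ℝ _ _)
  let w1 : T →L[ℝ] Body (Fin d ⊕ Fin d) :=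
    (ContinuousLinearMap.fst ℝ _ _).comp (ContinuousLinearMap.snd ℝ _ _)
  let w2 : T →L[ℝ] Body (Fin d ⊕ Fin d) :=
    (ContinuousLinearMap.snd ℝ _ _).comp (ContinuousLinearMap.snd ℝ _ _)
  have hΨ₁ : BB fun y : T => Φ (y.2.1, y.2.2 + y.1.1, y.2.2 + y.1.2) := by
    have := hΦ.comp_clm (w1.prod ((w2 + z1).prod (w2 + z2)))
    exact this
  have hΨ₂ : BB fun y : T => Φ (y.1.1 + y.2.1, y.1.2 + y.2.1, y.2.2) := by
    have := hΦ.comp_clm ((z1 + w1).prod ((z2 + w1).prod w2))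
    exact this
  rw [h₁.oscIntegral_eq_osc hθ, h₂.oscIntegral_eq_osc hθ]
  have s₁ := fun w => (hΨ₁.slice w).oscIntegral_eq_osc hθ
  have s₂ := fun w => (hΨ₂.slice w).oscIntegral_eq_osc hθ
  simp only at s₁ s₂
  rw [funext s₁] at h₁ ⊢
  rw [funext s₂] at h₂ ⊢
  rw [osc_osc hκ hk hk' he hΨ₁ h₁, osc_osc hκ hk hk' he hΨ₂ h₂]
  have := isAddHaarMeasure_prod (symplVol d)
  refine (osc_comp_linear hκ hk' he.prod (assocShear d) measurePreserving_assocShear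
    (fun y => ?_) hΨ₁).symm.trans ?_
  · change symplPhase d θ (y.2.1, y.2.2 - y.1.2) * symplPhase d θ (y.1.1 + y.2.1, y.1.2) = _
    simp only [symplPhase, ← Complex.exp_add, omega0_add_left, omega0_sub_right]
    congr 1
    push_cast
    ring
  · congr 1
    funext y
    change Φ (y.1.1 + y.2.1, y.1.2 + y.2.1, y.1.2 + (y.2.2 - y.1.2)) = _
    rw [add_sub_cancel]

end Symplectic

/-! ### The signs `ε(I, J)` -/

section Signs

variable {n : ℕ}

theorem eps_of_disjoint {I J : Finset (Fin n)} (h : Disjoint I J) :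
    eps I J = (-1) ^ ((I ×ˢ J).filter fun q => q.2 < q.1).card := by
  rw [eps, if_pos h]

theorem eps_of_not_disjoint {I J : Finset (Fin n)} (h : ¬ Disjoint I J) : eps I J = 0 := by
  rw [eps, if_neg h]

@[simp] theorem eps_empty_left (J : Finset (Fin n)) : eps ∅ J = 1 := by simp [eps]

@[simp] theorem eps_empty_right (J : Finset (Fin n)) : eps J ∅ = 1 := by simp [eps]

theorem eps_union_left {I I' : Finset (Fin n)} (h : Disjoint I I') (J : Finset (Fin n)) :
    eps (I ∪ I') J = eps I J * eps I' J := by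
  by_cases h1 : Disjoint I J
  · by_cases h2 : Disjoint I' J
    · rw [eps_of_disjoint h1, eps_of_disjoint h2, eps_of_disjoint (Finset.disjoint_union_left.2 ⟨h1, h2⟩),
        ← pow_add, Finset.union_product, Finset.filter_union, Finset.card_union_of_disjoint]
      refine Finset.disjoint_filter_filter ?_
      exact Finset.disjoint_product.2 (Or.inl h)
    · rw [eps_of_not_disjoint h2, mul_zero, eps_of_not_disjoint]
      exact fun h3 => h2 (Finset.disjoint_union_left.1 h3).2
  · rw [eps_of_not_disjoint h1, zero_mul, eps_of_not_disjoint]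
    exact fun h3 => h1 (Finset.disjoint_union_left.1 h3).1

theorem eps_union_right {J J' : Finset (Fin n)} (h : Disjoint J J') (I : Finset (Fin n)) :
    eps I (J ∪ J') = eps I J * eps I J' := by
  by_cases h1 : Disjoint I J
  · by_cases h2 : Disjoint I J'
    · rw [eps_of_disjoint h1, eps_of_disjoint h2,
        eps_of_disjoint (Finset.disjoint_union_right.2 ⟨h1, h2⟩),
        ← pow_add, Finset.product_union, Finset.filter_union, Finset.card_union_of_disjoint]
      refine Finset.disjoint_filter_filter ?_
      exact Finset.disjoint_product.2 (Or.inr h)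
    · rw [eps_of_not_disjoint h2, mul_zero, eps_of_not_disjoint]
      exact fun h3 => h2 (Finset.disjoint_union_right.1 h3).2
  · rw [eps_of_not_disjoint h1, zero_mul, eps_of_not_disjoint]
    exact fun h3 => h1 (Finset.disjoint_union_right.1 h3).1

/-- Exchanging `ξ^I` and `ξ^J` costs the sign of their parities. -/
theorem eps_comm (I J : Finset (Fin n)) : eps J I = (-1) ^ (I.card * J.card) * eps I J := by
  by_cases h : Disjoint I J
  · rw [eps_of_disjoint h, eps_of_disjoint h.symm, ← pow_add]
    have h1 : ((J ×ˢ I).filter fun q => q.2 < q.1).card =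
        ((I ×ˢ J).filter fun q => ¬ q.2 < q.1).card := by
      refine Finset.card_bij' (fun q _ => q.swap) (fun q _ => q.swap) ?_ ?_ ?_ ?_
      · rintro ⟨a, b⟩ hq
        simp only [Finset.mem_filter, Finset.mem_product, Prod.swap] at hq ⊢
        exact ⟨⟨hq.1.2, hq.1.1⟩, not_lt.2 hq.2.le⟩
      · rintro ⟨a, b⟩ hq
        simp only [Finset.mem_filter, Finset.mem_product, Prod.swap] at hq ⊢
        refine ⟨⟨hq.1.2, hq.1.1⟩, lt_of_le_of_ne (not_lt.1 hq.2) ?_⟩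
        rintro rfl
        exact Finset.disjoint_left.1 h hq.1.1 hq.1.2
      · exact fun _ _ => Prod.swap_swap _
      · exact fun _ _ => Prod.swap_swap _
    have h2 := Finset.card_filter_add_card_filter_not (s := I ×ˢ J) fun q => q.2 < q.1
    rw [Finset.card_product] at h2
    rw [h1, ← h2, add_right_comm, pow_add, ← two_mul, pow_mul]
    simp
  · rw [eps_of_not_disjoint h, eps_of_not_disjoint fun h' => h h'.symm, mul_zero]

theorem eps_mul_self {I J : Finset (Fin n)} (h : Disjoint I J) : eps I J * eps I J = 1 := by
  rw [eps_of_disjoint h, ← mul_pow]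
  simp

theorem eps_singleton_of_lt {m : Fin n} {J : Finset (Fin n)} (h : ∀ j ∈ J, m < j) :
    eps {m} J = 1 := by
  have hd : Disjoint {m} J := Finset.disjoint_singleton_left.2 fun hm => lt_irrefl _ (h m hm)
  rw [eps_of_disjoint hd, Finset.filter_false_of_mem]
  · simp
  · rintro ⟨a, b⟩ hq
    simp only [Finset.mem_product, Finset.mem_singleton] at hq ⊢
    rw [hq.1]
    exact not_lt.2 (h b hq.2).le

/-- Sums over the ways to write a set as a disjoint union. -/
theorem sum_powerset_sdiff {M : Type*} [AddCommMonoid M]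
    (g : Finset (Fin n) → Finset (Fin n) → M) :
    ∑ L : Finset (Fin n), ∑ I ∈ L.powerset, g I (L \ I) =
      ∑ I : Finset (Fin n), ∑ J : Finset (Fin n), if Disjoint I J then g I J else 0 := by
  simp only [← Finset.sum_filter]
  rw [Finset.sum_sigma', Finset.sum_sigma']
  refine Finset.sum_bij' (fun p _ => ⟨p.2, p.1 \ p.2⟩) (fun p _ => ⟨p.1 ∪ p.2, p.1⟩) ?_ ?_ ?_ ?_ ?_
  · rintro ⟨L, I⟩ h
    simp only [Finset.mem_sigma, Finset.mem_univ, Finset.mem_filter, true_and]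
    exact Finset.disjoint_sdiff
  · rintro ⟨I, J⟩ h
    simp only [Finset.mem_sigma, Finset.mem_univ, Finset.mem_powerset, true_and]
    exact Finset.subset_union_left
  · rintro ⟨L, I⟩ h
    simp only [Finset.mem_sigma, Finset.mem_univ, Finset.mem_powerset, true_and] at h
    simp [Finset.union_sdiff_of_subset h]
  · rintro ⟨I, J⟩ h
    simp only [Finset.mem_sigma, Finset.mem_univ, Finset.mem_filter, true_and] at h
    simp [Finset.union_sdiff_cancel_left h]
  · rintro ⟨L, I⟩ h
    rfl

/-- The sign `(-1)^{k(k-1)/2}` of the reversal of `k` odd variables. -/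
def revSign (k : ℕ) : ℤ := (-1) ^ (k * (k - 1) / 2)

theorem revSign_succ (k : ℕ) : revSign (k + 1) = revSign k * (-1) ^ k := by
  rw [revSign, revSign, ← pow_add, Nat.triangle_succ]

theorem revSign_add (a b : ℕ) : revSign (a + b) = revSign a * revSign b * (-1) ^ (a * b) := by
  induction b with
  | zero => simp [revSign]
  | succ b ih =>
    rw [← add_assoc, revSign_succ, ih, revSign_succ, mul_add, mul_one, pow_add, pow_add]
    ring

theorem revSign_mul_self (k : ℕ) : revSign k * revSign k = 1 := by
  rw [revSign, ← mul_pow]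
  simp

end Signs

/-! ### Monomials in an exterior algebra -/

section Monomials

variable {n : ℕ} {V : Type*} [AddCommGroup V] [Module ℝ V]

/-- The ordered product `v^I = v_{i_1} ⋯ v_{i_k}` in the exterior algebra. -/
def mon (v : Fin n → V) (I : Finset (Fin n)) : Sup V :=
  (I.sort.map fun i => ExteriorAlgebra.ι ℝ (v i)).prod

@[simp] theorem mon_empty (v : Fin n → V) : mon v ∅ = 1 := by simp [mon]

theorem mon_insert_of_lt (v : Fin n → V) {m : Fin n} {I : Finset (Fin n)} (h : ∀ i ∈ I, m < i) :
    mon v (insert m I) = ExteriorAlgebra.ι ℝ (v m) * mon v I := by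
  rw [mon, Finset.sort_insert (r := (· ≤ ·)) (fun b hb => (h b hb).le)
    (fun hm => lt_irrefl _ (h m hm)), List.map_cons, List.prod_cons]
  rfl

theorem ι_mul_ι_swap (x y : V) :
    ExteriorAlgebra.ι ℝ x * ExteriorAlgebra.ι ℝ y =
      -(ExteriorAlgebra.ι ℝ y * ExteriorAlgebra.ι ℝ x) :=
  eq_neg_of_add_eq_zero_left (ExteriorAlgebra.ι_add_mul_swap x y)

theorem ι_mul_mon (v : Fin n → V) (m : Fin n) (K : Finset (Fin n)) :
    ExteriorAlgebra.ι ℝ (v m) * mon v K = eps {m} K • mon v (insert m K) := by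
  induction K using Finset.induction_on_min with
  | empty => 
    rw [mon_insert_of_lt v (by simp)]
    simp
  | insert k K hk ih =>
    have hkK : Disjoint {k} K :=
      Finset.disjoint_singleton_left.2 fun hm => lt_irrefl _ (hk k hm)
    rcases lt_trichotomy m k with h | h | h
    · have hm : ∀ i ∈ insert k K, m < i := by
        intro i hi
        rcases Finset.mem_insert.1 hi with rfl | hi
        · exact h
        · exact h.trans (hk i hi)
      rw [eps_singleton_of_lt hm, mon_insert_of_lt v hm, one_smul]
    · subst h
      rw [mon_insert_of_lt v hk, ← mul_assoc, ExteriorAlgebra.ι_sq_zero, zero_mul,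
        eps_of_not_disjoint (by simp), zero_smul]
    · have hk' : ∀ i ∈ insert m K, k < i := by
        intro i hi
        rcases Finset.mem_insert.1 hi with rfl | hi
        · exact h
        · exact hk i hi
      have e1 : eps {m} {k} = -1 := by
        rw [eps_comm {k} {m}, eps_singleton_of_lt (by simpa using h)]
        simp
      rw [mon_insert_of_lt v hk, ← mul_assoc, ι_mul_ι_swap, neg_mul, mul_assoc, ih, mul_smul_comm,
        ← mon_insert_of_lt v hk', Finset.insert_comm, Finset.insert_eq k K,
        eps_union_right hkK, e1]
      simp

/-- Products of monomials; for intersecting `I` and `J` both sides vanish. -/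
theorem mon_mul_mon (v : Fin n → V) (I J : Finset (Fin n)) :
    mon v I * mon v J = eps I J • mon v (I ∪ J) := by
  induction I using Finset.induction_on_min with
  | empty => simp
  | insert m I hm ih =>
    have hmI : Disjoint {m} I :=
      Finset.disjoint_singleton_left.2 fun h => lt_irrefl _ (hm m h)
    rw [mon_insert_of_lt v hm, mul_assoc, ih, mul_smul_comm, ι_mul_mon, smul_smul,
      Finset.insert_eq m I, Finset.insert_eq m (I ∪ J), eps_union_left hmI, Finset.union_assoc]
    by_cases hIJ : Disjoint I J
    · rw [eps_union_right hIJ, eps_singleton_of_lt hm, one_mul, mul_comm]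
    · rw [eps_of_not_disjoint hIJ, zero_mul, mul_zero]

theorem ι_mul_mon_comm (v : Fin n → V) (x : V) (I : Finset (Fin n)) :
    ExteriorAlgebra.ι ℝ x * mon v I = (-1 : ℤ) ^ I.card • (mon v I * ExteriorAlgebra.ι ℝ x) := by
  induction I using Finset.induction_on_min with
  | empty => simp
  | insert m I hm ih =>
    rw [mon_insert_of_lt v hm, ← mul_assoc, ι_mul_ι_swap, neg_mul, mul_assoc, ih,
      Finset.card_insert_of_notMem (fun h => lt_irrefl _ (hm m h)), mul_smul_comm, pow_succ,
      mul_assoc]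
    simp

/-- The expansion of the monomials of a sum of odd coordinates. -/
theorem mon_add (v w : Fin n → V) (L : Finset (Fin n)) :
    mon (v + w) L = ∑ I ∈ L.powerset, eps I (L \ I) • (mon v I * mon w (L \ I)) := by
  induction L using Finset.induction_on_min with
  | empty => simp
  | insert m L hm ih =>
    have hmL : m ∉ L := fun h => lt_irrefl _ (hm m h)
    rw [Finset.sum_powerset_insert hmL, mon_insert_of_lt _ hm, ih, Pi.add_apply, map_add, add_mul,
      Finset.mul_sum, Finset.mul_sum, add_comm]
    congr 1
    · refine Finset.sum_congr rfl fun I hI => ?_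
      have hIL := Finset.mem_powerset.1 hI
      have hmI : m ∉ I := fun h => hmL (hIL h)
      have e1 : insert m L \ I = insert m (L \ I) := Finset.insert_sdiff_of_notMem _ hmI
      have hd : Disjoint {m} (L \ I) := Finset.disjoint_singleton_left.2 fun h =>
        hmL (Finset.mem_sdiff.1 h).1
      have e2 : eps I {m} = (-1) ^ I.card := by
        rw [eps_comm {m} I, eps_singleton_of_lt fun j hj => hm j (hIL hj)]
        simp
      rw [e1, mon_insert_of_lt w (fun i hi => hm i (Finset.mem_sdiff.1 hi).1), mul_smul_comm,
        ← mul_assoc, ι_mul_mon_comm, Finset.insert_eq m (L \ I), eps_union_right hd, e2,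
        mul_comm ((-1 : ℤ) ^ I.card), mul_smul, smul_mul_assoc, mul_assoc]
    · refine Finset.sum_congr rfl fun I hI => ?_
      have hIL := Finset.mem_powerset.1 hI
      have hmI : m ∉ I := fun h => hmL (hIL h)
      have e1 : insert m L \ insert m I = L \ I := by
        rw [Finset.insert_sdiff_insert, Finset.sdiff_insert_of_notMem hmL]
      have hd : Disjoint {m} I := Finset.disjoint_singleton_left.2 hmI
      rw [e1, mon_insert_of_lt v (fun i hi => hm i (hIL hi)), Finset.insert_eq, eps_union_left hd,
        eps_singleton_of_lt (fun j hj => hm j (Finset.mem_sdiff.1 hj).1), one_mul, mul_smul_comm,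
        mul_assoc]

theorem involute_mon (v : Fin n → V) (I : Finset (Fin n)) :
    CliffordAlgebra.involute (Q := (0 : QuadraticForm ℝ V)) (mon v I) =
      (-1 : ℤ) ^ I.card • mon v I := by
  induction I using Finset.induction_on_min with
  | empty => simp
  | insert m I hm ih =>
    rw [mon_insert_of_lt v hm, map_mul, ih, Finset.card_insert_of_notMem fun h =>
      lt_irrefl _ (hm m h)]
    have : CliffordAlgebra.involute (Q := (0 : QuadraticForm ℝ V)) (ExteriorAlgebra.ι ℝ (v m)) =
      -ExteriorAlgebra.ι ℝ (v m) := CliffordAlgebra.involute_ι _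
    rw [this, mul_smul_comm, pow_succ, mul_smul]
    simp

/-- The functionals separating the products of distinct members of a linearly independent
family. -/
theorem exists_dual_mon {ι : Type*} [DecidableEq ι] {v : ι → V} (hv : LinearIndependent ℝ v)
    (l : List ι) (hl : l.Nodup) :
    ∃ φ : Sup V →ₗ[ℝ] ℝ, φ (l.map fun i => ExteriorAlgebra.ι ℝ (v i)).prod = 1 ∧
      ∀ l' : List ι, l'.Nodup → l'.toFinset ≠ l.toFinset →
        φ (l'.map fun i => ExteriorAlgebra.ι ℝ (v i)).prod = 0 := by
  have hdual : ∀ i, ∃ D : Module.Dual ℝ V, D (v i) = 1 ∧ ∀ j, j ≠ i → D (v j) = 0 := by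
    intro i
    obtain ⟨g, hg⟩ := LinearMap.exists_leftInverse_of_injective (Finsupp.linearCombination ℝ v)
      (LinearMap.ker_eq_bot.2 hv)
    have hgv : ∀ j, g (v j) = Finsupp.single j 1 := fun j => by
      have := LinearMap.congr_fun hg (Finsupp.single j 1)
      simpa using this
    refine ⟨(Finsupp.lapply i).comp g, ?_, fun j hj => ?_⟩
    · simp [hgv]
    · simp [hgv, Finsupp.single_eq_of_ne, hj.symm]
  choose D hD1 hD0 using hdual
  have hc : ∀ i x (u : Sup V), CliffordAlgebra.contractLeft (Q := (0 : QuadraticForm ℝ V)) (D i)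
      (ExteriorAlgebra.ι ℝ x * u) = D i x • u - ExteriorAlgebra.ι ℝ x *
        CliffordAlgebra.contractLeft (Q := (0 : QuadraticForm ℝ V)) (D i) u := fun i x u =>
    CliffordAlgebra.contractLeft_ι_mul _ _ _
  have hnot : ∀ i, ∀ l' : List ι, i ∉ l' →
      CliffordAlgebra.contractLeft (Q := (0 : QuadraticForm ℝ V)) (D i)
        (l'.map fun i => ExteriorAlgebra.ι ℝ (v i)).prod = 0 := by
    intro i l' h
    induction l' with
    | nil => exact CliffordAlgebra.contractLeft_one _ _
    | cons j l' ih =>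
      rw [List.map_cons, List.prod_cons, hc, ih (fun h' => h (by simp [h'])),
        hD0 i j (fun h' => h (by simp [h']))]
      simp
  have hmem : ∀ i, ∀ l' : List ι, i ∈ l' → l'.Nodup → ∃ s : ℤ,
      CliffordAlgebra.contractLeft (Q := (0 : QuadraticForm ℝ V)) (D i)
        (l'.map fun i => ExteriorAlgebra.ι ℝ (v i)).prod =
      s • ((l'.erase i).map fun i => ExteriorAlgebra.ι ℝ (v i)).prod := by
    intro i l' h hnd
    induction l' with
    | nil => simp at h
    | cons j l' ih =>
      rw [List.nodup_cons] at hnd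
      rcases eq_or_ne j i with rfl | hji
      · refine ⟨1, ?_⟩
        rw [List.map_cons, List.prod_cons, hc, hnot _ _ hnd.1, hD1, List.erase_cons_head]
        simp
      · obtain ⟨s, hs⟩ := ih (by simpa [hji.symm] using h) hnd.2
        refine ⟨-s, ?_⟩
        rw [List.map_cons, List.prod_cons, hc, hs, hD0 i j hji,
          List.erase_cons_tail (by simpa using hji), List.map_cons, List.prod_cons, zero_smul,
          zero_sub, mul_smul_comm, neg_smul]
  induction l with
  | nil =>
    refine ⟨(ExteriorAlgebra.algebraMapInv (R := ℝ) (M := V)).toLinearMap, by simp, ?_⟩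
    intro l' _ hne
    cases l' with
    | nil => simp at hne
    | cons j l' =>
      rw [AlgHom.toLinearMap_apply, List.map_cons, List.prod_cons, map_mul]
      simp [ExteriorAlgebra.algebraMapInv]
  | cons i l ih =>
    rw [List.nodup_cons] at hl
    obtain ⟨φ, h1, h0⟩ := ih hl.2
    refine ⟨φ.comp (CliffordAlgebra.contractLeft (Q := (0 : QuadraticForm ℝ V)) (D i)), ?_, ?_⟩
    · rw [LinearMap.comp_apply, List.map_cons, List.prod_cons, hc, hnot _ _ hl.1, hD1]
      simpa using h1
    · intro l' hnd hne
      rw [LinearMap.comp_apply]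
      by_cases hi : i ∈ l'
      · obtain ⟨s, hs⟩ := hmem i l' hi hnd
        rw [hs, map_zsmul, h0 _ (hnd.erase i), smul_zero]
        intro heq
        apply hne
        have h2 : (l'.erase i).toFinset = l'.toFinset.erase i := by
          ext x
          simp [hnd.mem_erase_iff]
        rw [h2] at heq
        rw [List.toFinset_cons, ← heq, Finset.insert_erase (by simpa using hi)]
      · rw [hnot _ _ hi, map_zero]

end Monomials

/-! ### The Gaussian in the odd variables -/

section Odd

variable {n : ℕ}

theorem sum_powerset_sdiff_singleton {M : Type*} [AddCommMonoid M] (I : Finset (Fin n)) (i : Fin n)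
    (g : Finset (Fin n) → M) :
    (∑ K ∈ I.powerset, if I \ K = {i} then g K else 0) = if i ∈ I then g (I.erase i) else 0 := by
  split_ifs with hi
  · rw [Finset.sum_eq_single (I.erase i)]
    · rw [if_pos (Finset.sdiff_erase_self hi)]
    · intro K hK hne
      rw [if_neg]
      intro h
      apply hne
      rw [Finset.erase_eq, ← h, Finset.sdiff_sdiff_eq_self (Finset.mem_powerset.1 hK)]
    · intro h
      exact absurd (Finset.mem_powerset.2 (Finset.erase_subset _ _)) h
  · refine Finset.sum_eq_zero fun K hK => if_neg fun h => hi ?_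
    exact (Finset.mem_sdiff.1 (h ▸ Finset.mem_singleton_self i : i ∈ I \ K)).1

/-- Multiplication by the quadratic element adds one index to both exponents. -/
theorem oddMul_oddQuad (f : OddPoly n ℂ) (c : ℂ) (I J : Finset (Fin n)) :
    oddMul f (oddQuad n c) (I, J) = ∑ i : Fin n, if i ∈ I then if i ∈ J then
      ((-1) ^ ((J.erase i).card) * eps (I.erase i) {i} * eps (J.erase i) {i} : ℤ) •
        (c * f (I.erase i, J.erase i)) else 0 else 0 := by
  have h1 : ∀ K L, ((-1) ^ (L.card * (I \ K).card) * eps K (I \ K) * eps L (J \ L) : ℤ) •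
      (oddQuad n c (I \ K, J \ L) • f (K, L)) = ∑ i : Fin n, if I \ K = {i} then
        (if J \ L = {i} then ((-1) ^ (L.card) * eps K {i} * eps L {i} : ℤ) • (c * f (K, L))
          else 0) else 0 := by
    intro K L
    rw [oddQuad, Finset.sum_smul, Finset.smul_sum]
    refine Finset.sum_congr rfl fun i _ => ?_
    by_cases hK : I \ K = {i}
    · by_cases hL : J \ L = {i}
      · rw [hK, hL, if_pos rfl, if_pos rfl, if_pos rfl, Finset.card_singleton, mul_one, smul_eq_mul]
      · rw [if_neg (by simp [hL]), if_pos hK, if_neg hL, zero_smul, smul_zero]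
    · rw [if_neg (by simp [hK]), if_neg hK, zero_smul, smul_zero]
  simp only [oddMul, h1]
  have h2 : ∀ K, (∑ L ∈ J.powerset, ∑ i : Fin n, if I \ K = {i} then
        (if J \ L = {i} then ((-1) ^ (L.card) * eps K {i} * eps L {i} : ℤ) • (c * f (K, L))
          else 0) else 0) = ∑ i : Fin n, if I \ K = {i} then (if i ∈ J then
          ((-1) ^ ((J.erase i).card) * eps K {i} * eps (J.erase i) {i} : ℤ) •
            (c * f (K, J.erase i)) else 0) else 0 := by
    intro K
    rw [Finset.sum_comm]
    refine Finset.sum_congr rfl fun i _ => ?_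
    split_ifs with h3 h4
    · rw [sum_powerset_sdiff_singleton J i fun L =>
        ((-1) ^ (L.card) * eps K {i} * eps L {i} : ℤ) • (c * f (K, L)), if_pos h4]
    · rw [sum_powerset_sdiff_singleton J i fun L =>
        ((-1) ^ (L.card) * eps K {i} * eps L {i} : ℤ) • (c * f (K, L)), if_neg h4]
    · simp
  simp only [h2]
  rw [Finset.sum_comm]
  refine Finset.sum_congr rfl fun i _ => ?_
  rw [sum_powerset_sdiff_singleton I i fun K => if i ∈ J then
          ((-1) ^ ((J.erase i).card) * eps K {i} * eps (J.erase i) {i} : ℤ) •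
            (c * f (K, J.erase i)) else 0]

/-- The powers of `c ∑ ξ₁^i ξ₂^i`: bringing `ξ₁^{i₁} ξ₂^{i₁} ⋯ ξ₁^{i_k} ξ₂^{i_k}` into the normal
order `ξ₁^I ξ₂^I` gives the sign of a reversal, and the set `I` of order `k` arises `k!` times. -/
theorem oddPow_oddQuad (c : ℂ) (k : ℕ) (I J : Finset (Fin n)) :
    oddPow (oddQuad n c) k (I, J) =
      if I = J ∧ I.card = k then (k.factorial : ℂ) * c ^ k * (revSign k : ℂ) else 0 := by
  induction k generalizing I J with
  | zero =>
    simp only [oddPow, Prod.mk.injEq, Finset.card_eq_zero]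
    by_cases h : I = ∅ ∧ J = ∅
    · rw [if_pos h, if_pos ⟨h.1.trans h.2.symm, h.1⟩]
      simp [revSign]
    · rw [if_neg h, if_neg]
      rintro ⟨rfl, h2⟩
      exact h ⟨h2, h2⟩
  | succ k ih =>
    rw [oddPow, oddMul_oddQuad]
    simp only [ih]
    by_cases h : I = J ∧ I.card = k + 1
    · obtain ⟨rfl, hc⟩ := h
      rw [if_pos ⟨rfl, hc⟩]
      have : ∀ i, (if i ∈ I then if i ∈ I then
          ((-1) ^ ((I.erase i).card) * eps (I.erase i) {i} * eps (I.erase i) {i} : ℤ) •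
          (c * if I.erase i = I.erase i ∧ (I.erase i).card = k then
            (k.factorial : ℂ) * c ^ k * (revSign k : ℂ) else 0) else 0 else 0) =
          if i ∈ I then ((k.factorial : ℂ) * c ^ (k + 1) * (revSign (k + 1) : ℂ)) else 0 := by
        intro i
        by_cases hi : i ∈ I
        · have hk : (I.erase i).card = k := by rw [Finset.card_erase_of_mem hi, hc]; rfl
          have hd : Disjoint (I.erase i) {i} := by simp
          rw [if_pos hi, if_pos hi, if_pos ⟨rfl, hk⟩, if_pos hi, mul_assoc, eps_mul_self hd, hk,
            revSign_succ, zsmul_eq_mul]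
          push_cast
          ring
        · rw [if_neg hi, if_neg hi]
      rw [Finset.sum_congr rfl fun i _ => this i, ← Finset.sum_filter, Finset.sum_const,
        Finset.filter_mem_eq_inter, Finset.univ_inter, hc, nsmul_eq_mul, Nat.factorial_succ]
      push_cast
      ring
    · rw [if_neg h]
      refine Finset.sum_eq_zero fun i _ => ?_
      by_cases hi : i ∈ I
      · by_cases hj : i ∈ J
        · rw [if_pos hi, if_pos hj, if_neg, mul_zero, smul_zero]
          rintro ⟨h1, h2⟩
          apply h
          have h3 : I = J := by rw [← Finset.insert_erase hi, h1, Finset.insert_erase hj]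
          refine ⟨h3, ?_⟩
          rw [← h2, Finset.card_erase_of_mem hi]
          have := Finset.card_pos.2 ⟨i, hi⟩
          omega
        · rw [if_pos hi, if_neg hj]
      · rw [if_neg hi]

/-- The odd Gaussian has diagonal coefficients only. -/
theorem oddExp_eq (c : ℂ) (I J : Finset (Fin n)) :
    oddExp n c (I, J) = if I = J then c ^ I.card * (revSign I.card : ℂ) else 0 := by
  simp only [oddExp, oddPow_oddQuad]
  by_cases h : I = J
  · subst h
    rw [if_pos rfl, Finset.sum_eq_single I.card]
    · have : ((I.card).factorial : ℂ) ≠ 0 := by exact_mod_cast Nat.factorial_ne_zero _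
      rw [if_pos ⟨rfl, rfl⟩]
      field_simp
    · intro k _ hk
      rw [if_neg fun h => hk h.2.symm, mul_zero]
    · intro h
      exact absurd (Finset.mem_range.2 (Nat.lt_succ_of_le (by simpa using I.card_le_univ))) h
  · rw [if_neg h]
    exact Finset.sum_eq_zero fun k _ => by rw [if_neg fun h' => h h'.1, mul_zero]

variable {E : Type*} [AddCommGroup E] [Module ℂ E]

/-- The Berezin integral against the odd Gaussian: the coefficient of `f` at `(K, K)` is paired with
the one of the Gaussian at the complement of `K`. -/
theorem berezin_oddMul_oddExp (f : OddPoly n E) (c : ℂ) :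
    berezin (oddMul f (oddExp n c)) = ∑ K : Finset (Fin n),
      (((-1) ^ (n + K.card * (n - K.card)) * revSign (n - K.card) : ℤ) * c ^ (n - K.card) : ℂ) •
        f (K, K) := by
  simp only [berezin, oddMul, oddExp_eq, Finset.powerset_univ, Finset.smul_sum]
  refine Finset.sum_congr rfl fun K _ => ?_
  rw [Finset.sum_eq_single K]
  · have hc : (Finset.univ \ K).card = n - K.card := by
      rw [Finset.card_sdiff_of_subset (Finset.subset_univ K)]
      simp
    have hd : Disjoint K (Finset.univ \ K) := Finset.disjoint_sdiff
    have hn : (-1 : ℤ) ^ (n * n) = (-1) ^ n := by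
      rcases Nat.even_or_odd n with h | h
      · rw [h.neg_one_pow, (h.mul_left n).neg_one_pow]
      · rw [h.neg_one_pow, (h.mul h).neg_one_pow]
    rw [if_pos rfl, mul_assoc, eps_mul_self hd, mul_one, hc, hn, smul_smul, ← pow_add,
      ← Int.cast_smul_eq_zsmul ℂ, smul_smul]
    congr 1
    push_cast
    ring
  · intro L _ hL
    rw [if_neg, zero_smul, smul_zero, smul_zero]
    intro h
    apply hL
    rw [← Finset.sdiff_sdiff_eq_self (Finset.subset_univ L), ← h,
      Finset.sdiff_sdiff_eq_self (Finset.subset_univ K)]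
  · simp

/-- The coefficient in front of `δ_K ⊗ δ_K` in the odd part of the twist. -/
def oddCoeff (θ α : ℝ) (k : ℕ) : ℂ :=
  (revSign k : ℂ) * (Complex.I * θ * α / (1 + α) ^ 2) ^ k

/-- The odd coefficients are multiplicative up to the sign that makes the odd deformation
associative. -/
theorem oddCoeff_add (θ α : ℝ) (a b : ℕ) :
    oddCoeff θ α (a + b) = (-1) ^ (a * b) * (oddCoeff θ α a * oddCoeff θ α b) := by
  simp only [oddCoeff, revSign_add, pow_add]
  push_cast
  ring

@[simp] theorem oddCoeff_zero (θ α : ℝ) : oddCoeff θ α 0 = 1 := by simp [oddCoeff, revSign]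

/-- The odd part of the twist. The constant `κ` contains the inverse of the top coefficient of the
odd Gaussian, so that the term of `K = ∅` is normalized. -/
theorem kappa_smul_berezin {d : ℕ} {θ α : ℝ} (hθ : θ ≠ 0) (hα₀ : α ≠ 0) (hα₁ : α ≠ -1)
    (f : OddPoly n E) :
    kappa d n θ α • berezin (oddMul f
      (oddExp n (-(2 * Complex.I / θ) * ((1 + α) ^ 2 / (2 * α))))) =
      ∑ K : Finset (Fin n),
        ((((Real.pi * θ : ℝ) : ℂ) ^ (2 * d))⁻¹ * oddCoeff θ α K.card) • f (K, K) := by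
  rw [berezin_oddMul_oddExp, Finset.smul_sum]
  refine Finset.sum_congr rfl fun K _ => ?_
  rw [smul_smul]
  congr 1
  obtain ⟨m, hm⟩ : ∃ m, n = K.card + m :=
    Nat.exists_eq_add_of_le (by simpa using K.card_le_univ)
  generalize K.card = k at hm
  subst hm
  have hθ' : (θ : ℂ) ≠ 0 := by exact_mod_cast hθ
  have hα₀' : (α : ℂ) ≠ 0 := by exact_mod_cast hα₀
  have hα₁' : (1 + α : ℂ) ≠ 0 := by
    have : (1 + α : ℝ) ≠ 0 := fun h => hα₁ (by linarith)
    exact_mod_cast this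
  have hpi : (Real.pi : ℂ) ≠ 0 := by exact_mod_cast Real.pi_ne_zero
  set h : ℂ := Complex.I * θ * α / (1 + α) ^ 2 with hh
  set c : ℂ := -(2 * Complex.I / θ) * ((1 + α) ^ 2 / (2 * α)) with hc
  -- `h` is the odd parameter of the deformation and `c` the constant of the odd Gaussian.
  have hhc : h * c = 1 := by
    rw [hh, hc]
    field_simp
    simp
  have hsign : (((-1 : ℤ) ^ ((k + m) * (k + m + 1) / 2) : ℤ)) *
      ((-1) ^ (k + m + k * m) * revSign m) = revSign k := by
    have h1 : ((-1 : ℤ) ^ ((k + m) * (k + m + 1) / 2) : ℤ) = revSign (k + m + 1) := by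
      rw [revSign, Nat.add_sub_cancel, mul_comm (k + m)]
    rw [h1, revSign_succ, revSign_add]
    have h2 := revSign_mul_self m
    have h3 : ((-1 : ℤ) ^ (k + m)) * (-1) ^ (k + m) = 1 := by rw [← mul_pow]; simp
    have h4 : ((-1 : ℤ) ^ (k * m)) * (-1) ^ (k * m) = 1 := by rw [← mul_pow]; simp
    calc revSign k * revSign m * (-1) ^ (k * m) * (-1) ^ (k + m) *
          ((-1) ^ (k + m + k * m) * revSign m)
        = revSign k * (revSign m * revSign m) * ((-1) ^ (k * m) * (-1) ^ (k * m)) *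
          ((-1) ^ (k + m) * (-1) ^ (k + m)) := by rw [pow_add _ (k + m) (k * m)]; ring
      _ = revSign k := by rw [h2, h3, h4]; ring
  have hk : kappa d (k + m) θ α = (((Real.pi * θ : ℝ) : ℂ) ^ (2 * d))⁻¹ *
      (((-1 : ℤ) ^ ((k + m) * (k + m + 1) / 2) : ℤ) : ℂ) * h ^ (k + m) := by
    rw [kappa, hh, div_pow, mul_pow (Complex.I * θ), ← pow_mul]
    push_cast
    field_simp
  rw [hk, oddCoeff, ← hh, ← hsign, Nat.add_sub_cancel_left]
  have h5 : h ^ (k + m) * c ^ m = h ^ k := by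
    rw [pow_add, mul_assoc, ← mul_pow, hhc, one_pow, mul_one]
  rw [← h5]
  push_cast
  ring

end Odd

/-! ### The coefficients of an action -/

section Independent

variable {n : ℕ} {V : Type*} [AddCommGroup V] [Module ℝ V]

/-- An infinite dimensional `V` contains any number of linearly independent odd coordinates for two
points. -/
theorem exists_independent_pair (hV : ¬ FiniteDimensional ℝ V) (n : ℕ) :
    ∃ v w : Fin n → V, LinearIndependent ℝ (Sum.elim v w) := by
  have hr : ((n + n : ℕ) : Cardinal) ≤ Module.rank ℝ V := by
    have : Cardinal.aleph0 ≤ Module.rank ℝ V := by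
      by_contra h
      exact hV (Module.rank_lt_aleph0_iff.1 (not_le.1 h))
    exact (Cardinal.natCast_lt_aleph0).le.trans this
  obtain ⟨f, hf⟩ := exists_linearIndependent_of_le_rank hr
  refine ⟨fun i => f (Fin.castAdd n i), fun i => f (Fin.natAdd n i), ?_⟩
  have h := hf.comp _ (finSumFinEquiv (m := n) (n := n)).injective
  convert h using 1
  funext i
  rcases i with i | i <;> simp

/-- For independent generators, the coefficient of `ξ₁^{I₀} ξ₂^{J₀}` is extracted by a functional.
-/
theorem exists_dual_mon₂ {v w : Fin n → V} (h : LinearIndependent ℝ (Sum.elim v w))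
    (I₀ J₀ : Finset (Fin n)) : ∃ φ : Sup V →ₗ[ℝ] ℝ, ∀ I J,
      φ (mon v I * mon w J) = if I = I₀ ∧ J = J₀ then 1 else 0 := by
  let l : Finset (Fin n) → Finset (Fin n) → List (Fin n ⊕ Fin n) := fun I J =>
    I.sort.map Sum.inl ++ J.sort.map Sum.inr
  have hprod : ∀ I J, ((l I J).map fun i => ExteriorAlgebra.ι ℝ (Sum.elim v w i)).prod =
      mon v I * mon w J := by
    intro I J
    simp [l, mon, List.map_map, Function.comp_def]
  have hnd : ∀ I J, (l I J).Nodup := by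
    intro I J
    refine List.Nodup.append ((Finset.sort_nodup _ _).map Sum.inl_injective)
      ((Finset.sort_nodup _ _).map Sum.inr_injective) ?_
    intro x hx hy
    obtain ⟨i, -, rfl⟩ := List.mem_map.1 hx
    obtain ⟨j, -, hj⟩ := List.mem_map.1 hy
    cases hj
  obtain ⟨φ, h1, h0⟩ := exists_dual_mon h (l I₀ J₀) (hnd _ _)
  refine ⟨φ, fun I J => ?_⟩
  split_ifs with hIJ
  · rw [hIJ.1, hIJ.2, ← hprod, h1]
  · rw [← hprod]
    refine h0 _ (hnd _ _) fun heq => hIJ ⟨?_, ?_⟩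
    · ext i
      have := Finset.ext_iff.1 heq (Sum.inl i)
      simpa [l] using this
    · ext i
      have := Finset.ext_iff.1 heq (Sum.inr i)
      simpa [l] using this

/-- The odd coordinates given by vectors of `V`. -/
def oddPt (v : Fin n → V) : Fin n → ↥(CliffordAlgebra.evenOdd (0 : QuadraticForm ℝ V) 1) :=
  fun i => ⟨ExteriorAlgebra.ι ℝ (v i), CliffordAlgebra.ι_mem_evenOdd_one _ _⟩

theorem oddPt_add (v w : Fin n → V) : oddPt v + oddPt w = oddPt (v + w) := by
  funext i
  refine Subtype.ext ?_
  change ExteriorAlgebra.ι ℝ (v i) + ExteriorAlgebra.ι ℝ (w i) = ExteriorAlgebra.ι ℝ (v i + w i)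
  rw [map_add]

variable {A : Type*} [NonUnitalRing A] [Module ℂ A]

/-- The contraction of the second tensor factor with a functional. -/
def contract (A : Type*) [NonUnitalRing A] [Module ℂ A] (φ : Sup V →ₗ[ℝ] ℝ) :
    A ⊗[ℝ] Sup V →ₗ[ℝ] A :=
  (TensorProduct.rid ℝ A).toLinearMap ∘ₗ φ.lTensor A

theorem contract_tmul (φ : Sup V →ₗ[ℝ] ℝ) (a : A) (u : Sup V) :
    contract A φ (a ⊗ₜ[ℝ] u) = φ u • a := by
  simp [contract]

end Independent

section Relations

variable {A : Type*} [NonUnitalRing A] [Module ℂ A] [IsScalarTower ℂ A A] [SMulCommClass ℂ A A]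
  [UniformSpace A] [IsUniformAddGroup A] [ContinuousSMul ℂ A] [T2Space A]
variable {V : Type*} [AddCommGroup V] [Module ℝ V]
variable {σ : Type} [Fintype σ] [DecidableEq σ] {n : ℕ}
variable {p : ℕ → Seminorm ℂ A} {γ : A →L[ℂ] A}

namespace SuperAction

variable (ρ : SuperAction σ n V p γ)

/-- The action at odd coordinates in `V`, on all of `A ⊗ 𝒜` by `𝒜`-linearity. -/
theorem act_tmul (y : Body σ) (v : Fin n → V) (a : A) (u : Sup V) :
    ρ.act (y, oddPt v) (a ⊗ₜ[ℝ] u) = ∑ I, ρ.comp I y a ⊗ₜ[ℝ] (mon v I * u) := by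
  have h := ρ.act_smul (y, oddPt v) u (a ⊗ₜ[ℝ] 1)
  rw [ρ.act_expand, superEval, map_sum] at h
  simp only [supSmul, LinearMap.lTensor_tmul, LinearMap.mulRight_apply, one_mul] at h
  exact h

/-- The composition law `ρ_{z₁} ρ_{z₂} = ρ_{z₁ + z₂}` in coefficients. -/
theorem comp_comp (hV : ¬ FiniteDimensional ℝ V) (I J : Finset (Fin n)) (y₁ y₂ : Body σ) (a : A) :
    ρ.comp I y₁ (ρ.comp J y₂ a) = eps I J • ρ.comp (I ∪ J) (y₁ + y₂) a := by
  obtain ⟨v, w, hvw⟩ := exists_independent_pair hV n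
  obtain ⟨φ, hφ⟩ := exists_dual_mon₂ hvw I J
  have h1 : ρ.act (y₁, oddPt v) (ρ.act (y₂, oddPt w) (a ⊗ₜ[ℝ] 1)) =
      ∑ J, ∑ I, ρ.comp I y₁ (ρ.comp J y₂ a) ⊗ₜ[ℝ] (mon v I * mon w J) := by
    rw [act_tmul, map_sum]
    simp only [mul_one, act_tmul]
  have h2 : ρ.act (y₁, oddPt v) (ρ.act (y₂, oddPt w) (a ⊗ₜ[ℝ] 1)) =
      ∑ L, ∑ I ∈ L.powerset, eps I (L \ I) •
        (ρ.comp (I ∪ (L \ I)) (y₁ + y₂) a ⊗ₜ[ℝ] (mon v I * mon w (L \ I))) := by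
    have h3 : ((y₁, oddPt v) : SuperPoint σ n V) + (y₂, oddPt w) = (y₁ + y₂, oddPt (v + w)) := by
      rw [Prod.mk_add_mk, oddPt_add]
    rw [← LinearMap.comp_apply, ← ρ.act_add, h3, act_tmul]
    refine Finset.sum_congr rfl fun L _ => ?_
    rw [mul_one, mon_add, TensorProduct.tmul_sum]
    refine Finset.sum_congr rfl fun I hI => ?_
    rw [Finset.union_sdiff_of_subset (Finset.mem_powerset.1 hI), TensorProduct.tmul_smul]
  rw [sum_powerset_sdiff fun I J => eps I J •
    (ρ.comp (I ∪ J) (y₁ + y₂) a ⊗ₜ[ℝ] (mon v I * mon w J))] at h2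
  have h3 := congrArg (contract A φ) (h1.symm.trans h2)
  simp only [map_sum, contract_tmul, hφ, apply_ite (contract A φ), map_zero, map_zsmul] at h3
  rw [Finset.sum_eq_single J, Finset.sum_eq_single I, if_pos ⟨rfl, rfl⟩, one_smul,
    Finset.sum_eq_single I, Finset.sum_eq_single J, if_pos (And.intro rfl rfl), one_smul] at h3
  · rw [h3]
    split_ifs with hd
    · rfl
    · rw [eps_of_not_disjoint hd, zero_smul]
  all_goals simp +contextual [eq_comm]

theorem supMul_tmul (a b : A) (u w : Sup V) :
    supMul γ (a ⊗ₜ[ℝ] u) (b ⊗ₜ[ℝ] w) =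
      (a * b) ⊗ₜ[ℝ] (supEven u * w) + (a * γ b) ⊗ₜ[ℝ] (supOdd u * w) := by
  simp [supMul]

theorem iterate_parity (hγ : IsParity γ) (k : ℕ) (a : A) :
    (γ^[k]) a = if Even k then a else γ a := by
  induction k with
  | zero => simp
  | succ k ih =>
    rw [Function.iterate_succ_apply', ih]
    by_cases h : Even k
    · rw [if_pos h, if_neg (by simpa [Nat.even_add_one] using h)]
    · rw [if_neg h, if_pos (Nat.even_add_one.2 h), hγ.involutive]

/-- In the graded tensor product, passing the odd monomial `ξ^I` across `b` applies the parity to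
`b` `|I|` times. -/
theorem supMul_mon (hγ : IsParity γ) (a b : A) (v : Fin n → V) (I : Finset (Fin n)) (w : Sup V) :
    supMul γ (a ⊗ₜ[ℝ] mon v I) (b ⊗ₜ[ℝ] w) =
      (a * (γ^[I.card]) b) ⊗ₜ[ℝ] (mon v I * w) := by
  have he : supEven (mon v I) = if Even I.card then mon v I else 0 := by
    simp only [supEven, LinearMap.smul_apply, LinearMap.add_apply, LinearMap.id_apply,
      AlgHom.toLinearMap_apply, involute_mon]
    split_ifs with h
    · rw [h.neg_one_pow, one_smul, ← two_smul ℝ, smul_smul]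
      norm_num
    · rw [(Nat.not_even_iff_odd.1 h).neg_one_pow]
      simp
  have ho : supOdd (mon v I) = if Even I.card then 0 else mon v I := by
    simp only [supOdd, LinearMap.smul_apply, LinearMap.sub_apply, LinearMap.id_apply,
      AlgHom.toLinearMap_apply, involute_mon]
    split_ifs with h
    · rw [h.neg_one_pow, one_smul, sub_self, smul_zero]
    · rw [(Nat.not_even_iff_odd.1 h).neg_one_pow, neg_smul, one_smul, sub_neg_eq_add,
        ← two_smul ℝ, smul_smul]
      norm_num
  rw [supMul_tmul, he, ho, iterate_parity hγ]
  split_ifs <;> simp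

/-- The automorphism property of `ρ_z` in coefficients. -/
theorem comp_mul (hV : ¬ FiniteDimensional ℝ V) (hγ : IsParity γ) (L : Finset (Fin n))
    (y : Body σ) (a b : A) :
    ρ.comp L y (a * b) = ∑ I ∈ L.powerset, eps I (L \ I) •
      (ρ.comp I y a * (γ^[I.card]) (ρ.comp (L \ I) y b)) := by
  obtain ⟨v, w, hvw⟩ := exists_independent_pair hV n
  obtain ⟨φ, hφ⟩ := exists_dual_mon₂ hvw L ∅
  have hφ' : ∀ I, φ (mon v I) = if I = L then 1 else 0 := fun I => by
    simpa using hφ I ∅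
  have h := ρ.act_mul (y, oddPt v) (a ⊗ₜ[ℝ] 1) (b ⊗ₜ[ℝ] 1)
  have h0 : supMul γ (a ⊗ₜ[ℝ] (1 : Sup V)) (b ⊗ₜ[ℝ] 1) = (a * b) ⊗ₜ[ℝ] 1 := by
    have := supMul_mon hγ a b v ∅ 1
    simpa using this
  rw [h0, act_tmul, act_tmul, act_tmul, map_sum] at h
  simp only [map_sum, LinearMap.sum_apply, mul_one, supMul_mon hγ, mon_mul_mon,
    TensorProduct.tmul_smul] at h
  have h1 := congrArg (contract A φ) h
  simp only [map_sum, contract_tmul, hφ', map_zsmul] at h1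
  rw [Finset.sum_eq_single L (by simp +contextual) (by simp), if_pos rfl, one_smul] at h1
  rw [h1, Finset.sum_comm]
  have h2 := sum_powerset_sdiff fun I J => eps I J • ((if I ∪ J = L then (1 : ℝ) else 0) •
    (ρ.comp I y a * (γ^[I.card]) (ρ.comp J y b)))
  have h3 : ∀ I J : Finset (Fin n), (if Disjoint I J then eps I J •
      ((if I ∪ J = L then (1 : ℝ) else 0) • (ρ.comp I y a * (γ^[I.card]) (ρ.comp J y b))) else 0) =
      eps I J • ((if I ∪ J = L then (1 : ℝ) else 0) •
        (ρ.comp I y a * (γ^[I.card]) (ρ.comp J y b))) := by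
    intro I J
    split_ifs with hd
    · rfl
    · rfl
    · rw [eps_of_not_disjoint hd, zero_smul]
    · rw [zero_smul, smul_zero]
  simp only [h3] at h2
  rw [← h2, Finset.sum_eq_single L]
  · refine Finset.sum_congr rfl fun I hI => ?_
    rw [if_pos (Finset.union_sdiff_of_subset (Finset.mem_powerset.1 hI)), one_smul]
  · intro L' _ hne
    refine Finset.sum_eq_zero fun I hI => ?_
    rw [Finset.union_sdiff_of_subset (Finset.mem_powerset.1 hI), if_neg hne, zero_smul, smul_zero]
  · simp

/-- The compatibility of `ρ_z` with the grading in coefficients. -/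
theorem parity_comp (hV : ¬ FiniteDimensional ℝ V) :
    (∀ a, γ a = a) ∨ ∀ I y a, γ (ρ.comp I y a) = (-1 : ℤ) ^ I.card • ρ.comp I y (γ a) := by
  refine ρ.act_parity.imp_right fun h I y a => ?_
  obtain ⟨v, w, hvw⟩ := exists_independent_pair hV n
  obtain ⟨φ, hφ⟩ := exists_dual_mon₂ hvw I ∅
  have hφ' : ∀ J, φ (mon v J) = if J = I then 1 else 0 := fun J => by
    simpa using hφ J ∅
  have h1 := h (y, oddPt v) (a ⊗ₜ[ℝ] 1)
  have h2 : supParity γ (a ⊗ₜ[ℝ] (1 : Sup V)) = γ a ⊗ₜ[ℝ] 1 := by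
    simp [supParity]
  rw [h2, act_tmul, act_tmul, map_sum] at h1
  have h3 : ∀ (b : A) J, supParity γ (b ⊗ₜ[ℝ] (mon v J)) =
      γ b ⊗ₜ[ℝ] ((-1 : ℤ) ^ J.card • mon v J) := by
    intro b J
    rw [← involute_mon]
    simp [supParity]
  simp only [mul_one, h3, TensorProduct.tmul_smul] at h1
  have h4 := congrArg (contract A φ) h1
  simp only [map_sum, contract_tmul, hφ', map_zsmul] at h4
  rw [Finset.sum_eq_single I (by simp +contextual) (by simp), if_pos rfl, one_smul,
    Finset.sum_eq_single I (by simp +contextual) (by simp), if_pos rfl, one_smul] at h4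
  rw [h4, smul_smul, ← mul_pow]
  simp

/-- In an ungraded algebra the odd derivations have vanishing products: an odd derivation of an
ungraded algebra satisfies both the Leibniz rules of even and of odd operators. -/
theorem comp_mul_comp_eq_zero (hV : ¬ FiniteDimensional ℝ V) (hγ : ∀ a, γ a = a)
    {I J : Finset (Fin n)} (hI : I.Nonempty) (hJ : J.Nonempty) (y : Body σ) (a b : A) :
    ρ.comp I y a * ρ.comp J y b = 0 := by
  have hpar : IsParity γ := ⟨fun a => by rw [hγ, hγ], fun a b => by rw [hγ, hγ, hγ]⟩
  have hid : ∀ k a, (γ^[k]) a = a := fun k a => by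
    rw [iterate_parity hpar, hγ, ite_self]
  have h2 : ∀ x : A, x + x = 0 → x = 0 := fun x hx => by
    have : (2 : ℂ) • x = 0 := by rw [two_smul, hx]
    exact (smul_eq_zero.1 this).resolve_left two_ne_zero
  -- The Leibniz rule without sign, as the parity is trivial.
  have hleib : ∀ i a b, ρ.comp {i} 0 (a * b) = a * ρ.comp {i} 0 b + ρ.comp {i} 0 a * b := by
    intro i a b
    rw [ρ.comp_mul hV hpar, ← insert_empty_eq i, Finset.sum_powerset_insert (by simp)]
    simp [hid, comp_zero]
  have hD : ∀ i j a b, ρ.comp {i} 0 a * ρ.comp {j} 0 b = 0 := by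
    intro i j a b
    by_cases hij : i = j
    · subst hij
      have h0 : ∀ a, ρ.comp {i} 0 (ρ.comp {i} 0 a) = 0 := fun a => by
        rw [ρ.comp_comp hV, eps_of_not_disjoint (by simp), zero_smul]
      -- Applying `δ_i² = 0` to a product leaves twice the product of the derivatives.
      have := h0 (a * b)
      rw [hleib, map_add, hleib, hleib, h0, h0, mul_zero, zero_add, zero_mul, add_zero] at this
      exact h2 _ this
    · have hd : Disjoint ({j} : Finset (Fin n)) {i} := by simpa using Ne.symm hij
      have hc : ∀ a, ρ.comp {j} 0 (ρ.comp {i} 0 a) = eps {j} {i} • ρ.comp ({j} ∪ {i}) 0 a :=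
        fun a => by rw [ρ.comp_comp hV, add_zero]
      -- Expand `δ_j δ_i (a b) = ε δ_{ji} (a b)` by the Leibniz rules on both sides and compare.
      have e1 := hc (a * b)
      rw [hleib, map_add, hleib, hleib, hc, hc, ρ.comp_mul hV hpar, ← Finset.insert_eq,
        Finset.sum_powerset_insert (by simpa using Ne.symm hij), ← insert_empty_eq i,
        Finset.sum_powerset_insert (by simp), Finset.sum_powerset_insert (by simp)] at e1
      have s1 : ({j, i} : Finset (Fin n)) \ {i} = {j} := by
        ext x; simp; grind
      have s2 : ({j, i} : Finset (Fin n)) \ {j} = {i} := by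
        ext x; simp; grind
      have s3 : ({j, i} : Finset (Fin n)) \ {j, i} = ∅ := by simp
      simp only [Finset.powerset_empty, Finset.sum_singleton, s1, s2, s3, Finset.sdiff_empty, hid,
        eps_empty_left, eps_empty_right, one_smul, comp_zero, insert_empty_eq, smul_add,
        smul_smul] at e1
      rw [eps_comm {j} {i}] at e1
      simp only [Finset.card_singleton, mul_one, pow_one] at e1
      have hs := eps_mul_self hd
      simp only [mul_neg, neg_mul, one_mul, hs, neg_smul, one_smul, mul_smul_comm,
        smul_mul_assoc] at e1
      apply h2
      rw [← sub_eq_zero] at e1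
      rw [← e1]
      abel
  obtain ⟨i, hi⟩ := hI
  obtain ⟨j, hj⟩ := hJ
  -- A coefficient `ρ_y(·)_K` with `K ≠ ∅` factors through one of the odd derivatives.
  have hsplit : ∀ (K : Finset (Fin n)) k, k ∈ K → ∀ a,
      ρ.comp K y a = eps {k} (K.erase k) • ρ.comp {k} 0 (ρ.comp (K.erase k) y a) := by
    intro K k hk a
    rw [ρ.comp_comp hV, smul_smul, eps_mul_self (by simp), one_smul, zero_add,
      ← Finset.insert_eq, Finset.insert_erase hk]
  rw [hsplit I i hi, hsplit J j hj, smul_mul_assoc, mul_smul_comm, hD, smul_zero, smul_zero]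

end SuperAction

end Relations

/-! ### Calculus for functions with values in a locally convex space -/

section VectorCalculus

theorem dirD_swap {W : Type*} [NormedAddCommGroup W] [NormedSpace ℝ W] {f : W → ℂ}
    (hf : ContDiff ℝ ∞ f) (v w : W) : dirD [v, w] f = dirD [w, v] f := by
  funext x
  have h : ∀ v w : W, dirD [v, w] f x = fderiv ℝ (fderiv ℝ f) x v w := by
    intro v w
    change fderiv ℝ (fun x => fderiv ℝ f x w) x v = _
    have hd : DifferentiableAt ℝ (fderiv ℝ f) x :=
      (hf.fderiv_right (m := ∞) (by simp)).differentiable (by simp) x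
    rw [fderiv_clm_apply hd (differentiableAt_const _)]
    simp
  rw [h, h]
  exact second_derivative_symmetric (f := f) (f' := fderiv ℝ f)
    (fun y => (hf.differentiable (by simp) y).hasFDerivAt)
    ((hf.fderiv_right (m := ∞) (by simp)).differentiable (by simp) x).hasFDerivAt v w

/-- A direction may be moved to any place of an iterated derivative. -/
theorem dirD_middle {W : Type*} [NormedAddCommGroup W] [NormedSpace ℝ W] {f : W → ℂ}
    (hf : ContDiff ℝ ∞ f) (v : W) (m l : List W) :
    dirD (v :: (m ++ l)) f = dirD (m ++ v :: l) f := by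
  induction m with
  | nil => rfl
  | cons w m ih =>
    have h1 : dirD (v :: (w :: m ++ l)) f = dirD [v, w] (dirD (m ++ l) f) := rfl
    have h2 : dirD (w :: m ++ v :: l) f = dirD [w] (dirD (m ++ v :: l) f) := rfl
    rw [h1, h2, ← ih, dirD_swap (contDiff_dirD hf _)]
    rfl

variable {σ : Type} [Fintype σ] [DecidableEq σ]
variable {G : Type*} [AddCommGroup G] [Module ℂ G] [TopologicalSpace G]

theorem HasPDeriv.clm {H : Type*} [AddCommGroup H] [Module ℂ H] [TopologicalSpace H]
    {f : Body σ → G} {i : σ} {x : Body σ} {v : G} (h : HasPDeriv f i x v) (T : G →L[ℂ] H) :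
    HasPDeriv (fun x => T (f x)) i x (T v) := by
  refine ((T.continuous.tendsto v).comp h).congr fun t => ?_
  simp

theorem HasPDeriv.comp_add_right {f : Body σ → G} {i : σ} {x y : Body σ} {v : G}
    (h : HasPDeriv f i (x + y) v) : HasPDeriv (fun x => f (x + y)) i x v := by
  refine Tendsto.congr (fun t => ?_) h
  rw [add_right_comm]

/-- A family of continuous functions, each being the partial derivative of its predecessor,
consists of the iterated derivatives of a smooth function. -/
theorem isSmooth_of_family [T2Space G] {g : List σ → Body σ → G} (hc : ∀ l, Continuous (g l))
    (hd : ∀ l i x, HasPDeriv (g l) i x (g (i :: l) x)) :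
    IsSmooth (g []) ∧ ∀ l, iterD l (g []) = g l := by
  have h : ∀ l, iterD l (g []) = g l := by
    intro l
    induction l with
    | nil => rfl
    | cons i l ih =>
      funext x
      rw [iterD, ih]
      exact (hd l i x).pderiv_eq
  exact ⟨fun l => ⟨by rw [h]; exact hc l, fun i x => by rw [h]; exact ⟨_, hd l i x⟩⟩, h⟩

theorem IsSmooth.hasPDeriv [T2Space G] {f : Body σ → G} (hf : IsSmooth f) (l : List σ) (i : σ)
    (x : Body σ) : HasPDeriv (iterD l f) i x (iterD (i :: l) f x) := by
  obtain ⟨v, hv⟩ := (hf l).2 i x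
  rw [iterD, hv.pderiv_eq]
  exact hv

theorem IsSmooth.iterD_clm [T2Space G] {H : Type*} [AddCommGroup H] [Module ℂ H]
    [TopologicalSpace H] [T2Space H] {f : Body σ → G} (hf : IsSmooth f) (T : G →L[ℂ] H) :
    IsSmooth (fun x => T (f x)) ∧ ∀ l, iterD l (fun x => T (f x)) = fun x => T (iterD l f x) :=
  isSmooth_of_family (g := fun l x => T (iterD l f x)) (fun l => T.continuous.comp (hf l).1)
    fun l i x => (hf.hasPDeriv l i x).clm T

theorem IsSmooth.iterD_translate [T2Space G] {f : Body σ → G} (hf : IsSmooth f) (y : Body σ) :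
    IsSmooth (fun x => f (x + y)) ∧
      ∀ l, iterD l (fun x => f (x + y)) = fun x => iterD l f (x + y) :=
  isSmooth_of_family (g := fun l x => iterD l f (x + y))
    (fun l => (hf l).1.comp (continuous_id.add continuous_const))
    fun l i x => (hf.hasPDeriv l i (x + y)).comp_add_right

theorem iterD_append (m l : List σ) (f : Body σ → G) : iterD (m ++ l) f = iterD m (iterD l f) := by
  induction m with
  | nil => rfl
  | cons i m ih => simp only [List.cons_append, iterD, ih]

theorem IsSmooth.iterD_isSmooth {f : Body σ → G} (hf : IsSmooth f) (l : List σ) :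
    IsSmooth (iterD l f) := fun m => by
  rw [← iterD_append]
  exact hf (m ++ l)

theorem HasPDeriv.hasDerivAt {f : Body σ → ℂ} {i : σ} {x : Body σ} {v : ℂ}
    (h : HasPDeriv f i x v) : HasDerivAt (fun t : ℝ => f (x + t • bodyBasis σ i)) v 0 := by
  rw [hasDerivAt_iff_tendsto_slope_zero]
  refine Tendsto.congr (fun t => ?_) h
  simp [bodyBasis_apply]

/-- A smooth vector valued function is smooth after composition with a functional. -/
theorem IsSmooth.contDiff [T2Space G] {f : Body σ → G} (hf : IsSmooth f) (ℓ : G →L[ℂ] ℂ) :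
    ContDiff ℝ ∞ (fun x => ℓ (f x)) ∧
      ∀ l : List σ, dirD (l.map (bodyBasis σ)) (fun x => ℓ (f x)) = fun x => ℓ (iterD l f x) :=
  smooth_family (bodyBasis σ) (g := fun l x => ℓ (iterD l f x))
    (fun l => ℓ.continuous.comp (hf l).1) fun l i x => ((hf.hasPDeriv l i x).clm ℓ).hasDerivAt

/-- The partial derivatives of a smooth function commute. -/
theorem IsSmooth.iterD_middle [T2Space G] [IsTopologicalAddGroup G] [PolynormableSpace ℂ G]
    {f : Body σ → G} (hf : IsSmooth f) (i : σ) (m l : List σ) :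
    iterD (i :: (m ++ l)) f = iterD (m ++ i :: l) f := by
  funext x
  refine eq_of_forall_dual fun ℓ => ?_
  obtain ⟨h1, h2⟩ := hf.contDiff ℓ
  have e1 := congrFun (h2 (i :: (m ++ l))) x
  have e2 := congrFun (h2 (m ++ i :: l)) x
  rw [← e1, ← e2]
  simp only [List.map_cons, List.map_append]
  rw [dirD_middle h1]

/-- The mean value inequality for a continuous seminorm. -/
theorem seminorm_sub_le [IsTopologicalAddGroup G] {h h' : ℝ → G}
    (hd : ∀ s, Tendsto (fun t : ℝ => ((t⁻¹ : ℝ) : ℂ) • (h (s + t) - h s)) (𝓝[≠] 0) (𝓝 (h' s)))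
    {q : Seminorm ℂ G} (hq : Continuous q) {t M : ℝ} (hM : ∀ s, |s| ≤ |t| → q (h' s) ≤ M) :
    q (h t - h 0) ≤ M * |t| := by
  have hder : ∀ s, HasDerivAt (fun s => toLocalₗ q (h s)) (toLocalₗ q (h' s)) s := by
    intro s
    rw [hasDerivAt_iff_tendsto_slope_zero]
    refine (((continuous_toLocalₗ hq).tendsto _).comp (hd s)).congr fun t => ?_
    simp only [Function.comp, map_smul, map_sub]
    rw [← Complex.coe_smul]
  have := (convex_Icc (-|t|) |t|).norm_image_sub_le_of_norm_hasDerivWithin_le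
    (f := fun s => toLocalₗ q (h s)) (f' := fun s => toLocalₗ q (h' s)) (C := M) (x := 0) (y := t)
    (fun s _ => (hder s).hasDerivWithinAt)
    (fun s hs => by rw [norm_toLocalₗ]; exact hM s (abs_le.2 hs))
    ⟨by simp, by simp⟩ ⟨neg_abs_le t, le_abs_self t⟩
  simpa only [← map_sub, norm_toLocalₗ, sub_zero, Real.norm_eq_abs] using this

/-- The product rule. -/
theorem HasPDeriv.mul {R : Type*} [NonUnitalRing R] [Module ℂ R] [IsScalarTower ℂ R R]
    [SMulCommClass ℂ R R] [TopologicalSpace R] [IsTopologicalAddGroup R] [ContinuousMul R]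
    {f g : Body σ → R} {i : σ} {x : Body σ} {v w : R} (hf : HasPDeriv f i x v)
    (hg : HasPDeriv g i x w) (hgc : Continuous g) :
    HasPDeriv (fun x => f x * g x) i x (v * g x + f x * w) := by
  have hline : Tendsto (fun t : ℝ => g (x + t • EuclideanSpace.single i (1 : ℝ))) (𝓝[≠] 0)
      (𝓝 (g x)) := by
    have hc : Continuous fun t : ℝ => g (x + t • EuclideanSpace.single i (1 : ℝ)) :=
      hgc.comp (by fun_prop)
    have := hc.tendsto 0
    simp only [zero_smul, add_zero] at this
    exact this.mono_left nhdsWithin_le_nhds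
  have := (Tendsto.mul hf hline).add ((tendsto_const_nhds (x := f x)).mul hg)
  refine this.congr fun t => ?_
  rw [smul_mul_assoc, mul_smul_comm, ← smul_add, sub_mul, mul_sub]
  congr 1
  abel

theorem HasPDeriv.list_sum [ContinuousAdd G] {α : Type*} (L : List α) {F : α → Body σ → G}
    {i : σ} {x : Body σ} {v : α → G} (h : ∀ a ∈ L, HasPDeriv (F a) i x (v a)) :
    HasPDeriv (fun x => (L.map fun a => F a x).sum) i x (L.map v).sum := by
  induction L with
  | nil => exact hasPDeriv_zero i x
  | cons a L ih =>
    simp only [List.map_cons, List.sum_cons]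
    exact (h a (by simp)).add (ih fun a ha => h a (by simp [ha]))

theorem continuous_list_map_sum [ContinuousAdd G] {X α : Type*} [TopologicalSpace X] (L : List α)
    {F : α → X → G} (h : ∀ a ∈ L, Continuous (F a)) :
    Continuous fun x => (L.map fun a => F a x).sum := by
  induction L with
  | nil => exact continuous_const
  | cons a L ih =>
    simp only [List.map_cons, List.sum_cons]
    exact (h a (by simp)).add (ih fun a ha => h a (by simp [ha]))

/-- Leibniz's rule. -/
theorem IsSmooth.mul {R : Type*} [NonUnitalRing R] [Module ℂ R] [IsScalarTower ℂ R R]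
    [SMulCommClass ℂ R R] [TopologicalSpace R] [IsTopologicalAddGroup R] [ContinuousMul R]
    [T2Space R] {f g : Body σ → R} (hf : IsSmooth f) (hg : IsSmooth g) :
    IsSmooth (fun x => f x * g x) ∧ ∀ l, iterD l (fun x => f x * g x) = fun x =>
      ((splits l).map fun q => iterD q.1 f x * iterD q.2 g x).sum := by
  have h := isSmooth_of_family
    (g := fun l x => ((splits l).map fun q => iterD q.1 f x * iterD q.2 g x).sum)
    (fun l => continuous_list_map_sum _ fun q _ => (hf q.1).1.mul (hg q.2).1)
    (fun l i x => by
      have h1 := HasPDeriv.list_sum (splits l)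
        (F := fun q x => iterD q.1 f x * iterD q.2 g x) (i := i) (x := x)
        (fun q _ => (hf.hasPDeriv q.1 i x).mul (hg.hasPDeriv q.2 i x) (hg q.2).1)
      convert h1 using 1
      simp only [splits, List.map_append, List.map_map, List.sum_append, Function.comp_def]
      rw [← List.sum_map_add])
  simpa [splits, iterD] using h

end VectorCalculus

/-! ### Equicontinuity and termwise differentiation -/

section Bounds

variable {E G : Type*} [AddCommGroup E] [Module ℂ E] [TopologicalSpace E]
variable [AddCommGroup G] [Module ℂ G] [TopologicalSpace G]

theorem seminorm_zsmul (q : Seminorm ℂ G) (k : ℤ) (v : G) : q (k • v) = |(k : ℝ)| * q v := by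
  rw [← Int.cast_smul_eq_zsmul ℂ, map_smul_eq_mul, Complex.norm_intCast]

/-- A linear map is continuous if its composition with each continuous seminorm is bounded by a
continuous seminorm. -/
theorem continuous_of_bound [IsTopologicalAddGroup E] [IsTopologicalAddGroup G]
    [PolynormableSpace ℂ G] (T : E →ₗ[ℂ] G)
    (hT : ∀ q : Seminorm ℂ G, Continuous q → ∃ p : Seminorm ℂ E, Continuous p ∧
      ∀ a, q (T a) ≤ p a) : Continuous T := by
  refine continuous_of_continuousAt_zero T.toAddMonoidHom ?_
  rw [ContinuousAt, map_zero]
  refine tendsto_of_seminorm fun q hq => ?_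
  obtain ⟨p, hp, h⟩ := hT q hq
  have h0 : Tendsto p (𝓝 0) (𝓝 0) := by simpa using hp.tendsto 0
  refine squeeze_zero (fun _ => apply_nonneg q _) (fun a => ?_) h0
  rw [sub_zero]
  exact h a

/-- Termwise differentiation: the limit of functions whose derivatives converge uniformly. -/
theorem hasPDeriv_of_tendsto [IsTopologicalAddGroup G] [PolynormableSpace ℂ G]
    {σ : Type} [Fintype σ] [DecidableEq σ] {i : σ}
    {f f' : ℕ → Body σ → G} {g g' : Body σ → G} (hd : ∀ k x, HasPDeriv (f k) i x (f' k x))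
    (hf : ∀ x, Tendsto (fun k => f k x) atTop (𝓝 (g x)))
    (hf' : ∀ q : Seminorm ℂ G, Continuous q → ∀ ε > 0, ∀ᶠ k in atTop, ∀ x, q (f' k x - g' x) ≤ ε)
    (hg' : Continuous g') (x : Body σ) : HasPDeriv g i x (g' x) := by
  have hsm : ContinuousSMul ℂ G := (PolynormableSpace.withSeminorms ℂ G).continuousSMul
  set e : Body σ := EuclideanSpace.single i (1 : ℝ) with he
  refine tendsto_of_seminorm fun q hq => ?_
  rw [Metric.tendsto_nhds]
  intro ε hε
  have hline : Continuous fun s : ℝ => q (g' (x + s • e) - g' x) := by fun_prop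
  have hev : ∀ᶠ s in 𝓝 (0 : ℝ), q (g' (x + s • e) - g' x) < ε / 4 := by
    refine (hline.tendsto 0).eventually (gt_mem_nhds ?_)
    simp only [zero_smul, add_zero, sub_self, map_zero]
    positivity
  obtain ⟨δ, hδ, hball⟩ := Metric.eventually_nhds_iff.1 hev
  have hnear : ∀ᶠ t in 𝓝[≠] (0 : ℝ), |t| < δ := by
    refine Filter.Eventually.filter_mono nhdsWithin_le_nhds ?_
    have := Metric.ball_mem_nhds (0 : ℝ) hδ
    filter_upwards [this] with t ht
    simpa using ht
  filter_upwards [hnear, self_mem_nhdsWithin] with t ht ht0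
  have ht0 : t ≠ 0 := ht0
  have hpos : 0 < |t| := abs_pos.2 ht0
  have hk : ∀ᶠ k in atTop,
      q (f k (x + t • e) - f k x - (t : ℂ) • f' k x) ≤ 3 * (ε / 4) * |t| := by
    filter_upwards [hf' q hq (ε / 4) (by positivity)] with k hk
    have h := seminorm_sub_le (q := q) (h := fun s : ℝ => f k (x + s • e) - (s : ℂ) • f' k x)
      (h' := fun s => f' k (x + s • e) - f' k x) (fun s => ?_) hq (t := t) (M := 3 * (ε / 4))
      (fun s hs => ?_)
    · refine le_trans (le_of_eq ?_) h
      simp only [zero_smul, add_zero, Complex.ofReal_zero, sub_zero]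
      congr 1
      abel
    · have h1 := (hd k (x + s • e)).sub (tendsto_const_nhds (x := f' k x))
      refine h1.congr' ?_
      filter_upwards [self_mem_nhdsWithin] with r hr
      have hr : (r : ℂ) ≠ 0 := Complex.ofReal_ne_zero.2 hr
      rw [show x + (s + r) • e = x + s • e + r • e by rw [add_smul, add_assoc]]
      have h2 : f' k x = ((r⁻¹ : ℝ) : ℂ) • ((r : ℂ) • f' k x) := by
        rw [smul_smul, Complex.ofReal_inv, inv_mul_cancel₀ hr, one_smul]
      conv_lhs => rw [h2]
      rw [← smul_sub]
      congr 1
      rw [Complex.ofReal_add, add_smul]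
      abel
    · have h1 : f' k (x + s • e) - f' k x = (f' k (x + s • e) - g' (x + s • e)) +
          (g' (x + s • e) - g' x) - (f' k x - g' x) := by abel
      have h2 : q (g' (x + s • e) - g' x) < ε / 4 :=
        hball (by simpa using hs.trans_lt ht)
      have h3 := hk (x + s • e)
      have h4 := hk x
      rw [h1]
      have h5 := map_sub_le_add q ((f' k (x + s • e) - g' (x + s • e)) +
          (g' (x + s • e) - g' x)) (f' k x - g' x)
      have h6 := map_add_le_add q (f' k (x + s • e) - g' (x + s • e)) (g' (x + s • e) - g' x)
      linarith
  have hf'x : Tendsto (fun k => f' k x) atTop (𝓝 (g' x)) := by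
    refine tendsto_of_seminorm fun r hr => ?_
    rw [Metric.tendsto_nhds]
    intro η hη
    filter_upwards [hf' r hr (η / 2) (by positivity)] with k hk
    rw [Real.dist_eq, sub_zero, abs_of_nonneg (apply_nonneg r _)]
    linarith [hk x]
  have hlim : q (g (x + t • e) - g x - (t : ℂ) • g' x) ≤ 3 * (ε / 4) * |t| :=
    le_of_tendsto ((hq.tendsto _).comp
      (((hf _).sub (hf _)).sub (hf'x.const_smul (t : ℂ)))) hk
  have htc : (t : ℂ) ≠ 0 := Complex.ofReal_ne_zero.2 ht0
  have h1 : ((t⁻¹ : ℝ) : ℂ) • (g (x + t • e) - g x) - g' x =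
      ((t⁻¹ : ℝ) : ℂ) • (g (x + t • e) - g x - (t : ℂ) • g' x) := by
    rw [smul_sub _ _ ((t : ℂ) • g' x), smul_smul, Complex.ofReal_inv, inv_mul_cancel₀ htc, one_smul]
  rw [Real.dist_eq, sub_zero, abs_of_nonneg (apply_nonneg q _), h1, map_smul_eq_mul,
    Complex.norm_real, Real.norm_eq_abs, abs_inv]
  rw [inv_mul_lt_iff₀ hpos]
  nlinarith

end Bounds

/-! ### The smooth vectors -/

section SmoothVectors

variable {A : Type*} [NonUnitalRing A] [Module ℂ A] [IsScalarTower ℂ A A] [SMulCommClass ℂ A A]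
  [UniformSpace A] [IsUniformAddGroup A] [ContinuousSMul ℂ A] [T2Space A]
variable {V : Type*} [AddCommGroup V] [Module ℝ V]
variable {σ : Type} [Fintype σ] [DecidableEq σ] {n : ℕ}
variable {p : ℕ → Seminorm ℂ A} {γ : A →L[ℂ] A}

namespace SuperAction

variable (ρ : SuperAction σ n V p γ)

/-- The operators `ρ_y(·)_I` are equicontinuous. -/
theorem comp_bound (hp : WithSeminorms p) (I : Finset (Fin n)) {q : Seminorm ℂ A}
    (hq : Continuous q) : ∃ q' : Seminorm ℂ A, Continuous q' ∧ ∀ y a, q (ρ.comp I y a) ≤ q' a := by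
  obtain ⟨C, hC, h⟩ := ρ.bounded_comp
  choose k hk using h I
  obtain ⟨s, D, -, hs⟩ := Seminorm.bound_of_continuous hp q hq
  refine ⟨∑ j ∈ s, (D * C.toNNReal) • p (k j), Seminorm.continuous_finsetSum fun j _ =>
    (hp.continuous_seminorm (k j)).const_smul (D * C.toNNReal), fun y a => ?_⟩
  · have h1 := hs (ρ.comp I y a)
    have h2 : (s.sup p) (ρ.comp I y a) ≤ ∑ j ∈ s, p j (ρ.comp I y a) := by
      have := Seminorm.finset_sup_le_sum p s (ρ.comp I y a)
      rwa [_root_.sum_apply] at this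
    have h3 : ∑ j ∈ s, p j (ρ.comp I y a) ≤ ∑ j ∈ s, C * p (k j) a :=
      Finset.sum_le_sum fun j _ => hk j a y
    rw [_root_.sum_apply]
    calc q (ρ.comp I y a) ≤ D * (s.sup p) (ρ.comp I y a) := h1
      _ ≤ D * ∑ j ∈ s, C * p (k j) a := by gcongr; exact h2.trans h3
      _ = _ := by
        rw [Finset.mul_sum]
        refine Finset.sum_congr rfl fun j _ => ?_
        rw [_root_.smul_apply, NNReal.smul_def, smul_eq_mul, NNReal.coe_mul,
          Real.coe_toNNReal _ hC.le, mul_assoc]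

variable [hp : Fact (WithSeminorms p)] [PolynormableSpace ℂ A]

/-- `ρ_y(·)_I` as a continuous operator. -/
def compL (I : Finset (Fin n)) (y : Body σ) : A →L[ℂ] A :=
  ⟨ρ.comp I y, continuous_of_bound _ fun _ hq =>
    let ⟨q', h, h'⟩ := ρ.comp_bound hp.out I hq; ⟨q', h, h' y⟩⟩

theorem compL_apply (I : Finset (Fin n)) (y : Body σ) (a : A) : ρ.compL I y a = ρ.comp I y a := rfl

variable [hV : Fact (¬ FiniteDimensional ℝ V)]

theorem isSmooth_orbit (a : ρ.SmoothVec) (I : Finset (Fin n)) : IsSmooth (ρ.orbit (ρ.incl a) I) :=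
  a.2 I

theorem incl_injective : Function.Injective ρ.incl := Subtype.val_injective

/-- The orbit of a derivative of an orbit. -/
theorem orbit_iterD (a : ρ.SmoothVec) (l : List σ) (I J : Finset (Fin n)) (y : Body σ) :
    ρ.orbit (iterD l (ρ.orbit (ρ.incl a) I) y) J =
      fun x => eps J I • iterD l (ρ.orbit (ρ.incl a) (J ∪ I)) (x + y) := by
  funext x
  have h1 := congrFun (((ρ.isSmooth_orbit a I).iterD_clm (ρ.compL J x)).2 l) y
  have h2 : (fun y => ρ.compL J x (ρ.orbit (ρ.incl a) I y)) =
      (eps J I : ℂ) • fun y => ρ.orbit (ρ.incl a) (J ∪ I) (y + x) := by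
    funext y
    rw [Pi.smul_apply, Int.cast_smul_eq_zsmul, add_comm y x]
    exact ρ.comp_comp hV.out J I x y (ρ.incl a)
  have h3 := (ρ.isSmooth_orbit a (J ∪ I)).iterD_translate x
  rw [h2, h3.1.iterD_smul, Pi.smul_apply, h3.2, Int.cast_smul_eq_zsmul] at h1
  change ρ.comp J x _ = _
  rw [add_comm x y]
  exact h1.symm

/-- The derivatives of the orbit of a smooth vector are smooth vectors. -/
theorem iterD_orbit_mem (a : ρ.SmoothVec) (l : List σ) (I : Finset (Fin n)) (y : Body σ) :
    iterD l (ρ.orbit (ρ.incl a) I) y ∈ ρ.smoothSubmodule := by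
  intro J
  rw [ρ.orbit_iterD]
  have h := (((ρ.isSmooth_orbit a (J ∪ I)).iterD_isSmooth l).iterD_translate y).1.const_smul
    (eps J I : ℂ)
  convert h using 1
  funext x
  rw [Pi.smul_apply, Int.cast_smul_eq_zsmul]

/-- The operator `a ↦ D^l ρ_y(a)_I` on the smooth vectors. -/
def der (l : List σ) (I : Finset (Fin n)) (y : Body σ) : ρ.SmoothVec →ₗ[ℂ] ρ.SmoothVec where
  toFun a := ⟨iterD l (ρ.orbit (ρ.incl a) I) y, ρ.iterD_orbit_mem a l I y⟩
  map_add' a b := by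
    refine Subtype.ext ?_
    change iterD l (ρ.orbit (ρ.incl a + ρ.incl b) I) y = _
    rw [orbit_add, (ρ.isSmooth_orbit a I).iterD_add (ρ.isSmooth_orbit b I)]
    rfl
  map_smul' c a := by
    refine Subtype.ext ?_
    change iterD l (ρ.orbit (c • ρ.incl a) I) y = _
    rw [orbit_smul, (ρ.isSmooth_orbit a I).iterD_smul]
    rfl

theorem incl_der (l : List σ) (I : Finset (Fin n)) (y : Body σ) (a : ρ.SmoothVec) :
    ρ.incl (ρ.der l I y a) = iterD l (ρ.orbit (ρ.incl a) I) y := rfl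

theorem incl_der_nil (I : Finset (Fin n)) (y : Body σ) (a : ρ.SmoothVec) :
    ρ.incl (ρ.der [] I y a) = ρ.comp I y (ρ.incl a) := rfl

theorem orbit_der (l : List σ) (I J : Finset (Fin n)) (y : Body σ) (a : ρ.SmoothVec) :
    ρ.orbit (ρ.incl (ρ.der l I y a)) J =
      fun x => eps J I • iterD l (ρ.orbit (ρ.incl a) (J ∪ I)) (x + y) :=
  ρ.orbit_iterD a l I J y

/-- The composition law of the derivatives of the action. -/
theorem der_der (m l : List σ) (J I : Finset (Fin n)) (x y : Body σ) (a : ρ.SmoothVec) :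
    ρ.der m J x (ρ.der l I y a) = eps J I • ρ.der (m ++ l) (J ∪ I) (x + y) a := by
  refine ρ.incl_injective ?_
  rw [incl_der, orbit_der, map_zsmul, incl_der]
  have h := ((ρ.isSmooth_orbit a (J ∪ I)).iterD_isSmooth l).iterD_translate y
  have h2 : (fun x => eps J I • iterD l (ρ.orbit (ρ.incl a) (J ∪ I)) (x + y)) =
      (eps J I : ℂ) • fun x => iterD l (ρ.orbit (ρ.incl a) (J ∪ I)) (x + y) := by
    funext x
    rw [Pi.smul_apply, Int.cast_smul_eq_zsmul]
  rw [h2, h.1.iterD_smul, Pi.smul_apply, h.2, ← iterD_append, Int.cast_smul_eq_zsmul]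

theorem der_nil_empty_zero (a : ρ.SmoothVec) : ρ.der [] ∅ 0 a = a :=
  ρ.incl_injective (ρ.comp_zero _)

/-- All the derivatives at the origin of the coefficients of `ρ^a`. -/
def germ : ρ.SmoothVec →ₗ[ℂ] (List σ × Finset (Fin n) → A) :=
  LinearMap.pi fun s => ρ.incl ∘ₗ ρ.der s.1 s.2 0

theorem germ_apply (a : ρ.SmoothVec) (s : List σ × Finset (Fin n)) :
    ρ.germ a s = ρ.incl (ρ.der s.1 s.2 0 a) := rfl

/-- The derivatives of the orbit of `a` are determined by their values at the origin. -/
theorem incl_der_eq (l : List σ) (I : Finset (Fin n)) (y : Body σ) (a : ρ.SmoothVec) :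
    ρ.incl (ρ.der l I y a) = ρ.comp ∅ y (ρ.germ a (l, I)) := by
  rw [germ_apply, ← incl_der_nil, der_der, eps_empty_left, one_smul, List.nil_append,
    Finset.empty_union, add_zero]

/-- The topology of the smooth vectors is induced by the derivatives at the origin: the
derivatives at any other point are their images under the equicontinuous operators `ρ_y`. -/
theorem isUniformInducing_germ : IsUniformInducing ρ.germ := by
  let Ξ : A →+ (Body σ →ᵤ A) :=
    { toFun := fun v => UniformFun.ofFun fun y => ρ.comp ∅ y v
      map_zero' := by funext y; exact map_zero (ρ.comp ∅ y)
      map_add' := fun v w => by funext y; exact map_add (ρ.comp ∅ y) v w }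
  have hΞ : UniformContinuous Ξ := uniformContinuous_addMonoidHom_of_continuous
    (continuous_uniformFun Ξ fun q hq => by
      obtain ⟨q', h, h'⟩ := ρ.comp_bound hp.out ∅ hq
      exact ⟨q', h, fun a y => h' y a⟩)
  have hjet : IsUniformInducing ρ.jet := ⟨rfl⟩
  have hΞ' : UniformContinuous fun (v : List σ × Finset (Fin n) → A) s => Ξ (v s) :=
    uniformContinuous_pi.2 fun s => hΞ.comp (Pi.uniformContinuous_proj _ s)
  have hcomp : (fun (v : List σ × Finset (Fin n) → A) s => Ξ (v s)) ∘ ρ.germ = ρ.jet := by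
    funext a s y
    exact (ρ.incl_der_eq s.1 s.2 y a).symm
  refine IsUniformInducing.of_comp ?_ hΞ' (by rw [hcomp]; exact hjet)
  refine uniformContinuous_pi.2 fun s => ?_
  exact (UniformFun.uniformContinuous_eval A (0 : Body σ)).comp
    ((Pi.uniformContinuous_proj (fun _ : List σ × Finset (Fin n) => (Body σ →ᵤ A)) s).comp
      hjet.uniformContinuous)

instance : PolynormableSpace ℂ ρ.SmoothVec :=
  ρ.isUniformInducing_germ.isInducing.polynormableSpace

instance [(uniformity A).IsCountablyGenerated] :
    (uniformity ρ.SmoothVec).IsCountablyGenerated := by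
  rw [← ρ.isUniformInducing_germ.comap_uniformity]
  infer_instance

theorem tendsto_iff_germ {ι : Type*} {f : Filter ι} {u : ι → ρ.SmoothVec} {a : ρ.SmoothVec} :
    Tendsto u f (𝓝 a) ↔ ∀ s, Tendsto (fun k => ρ.germ (u k) s) f (𝓝 (ρ.germ a s)) := by
  rw [ρ.isUniformInducing_germ.isInducing.tendsto_nhds_iff, tendsto_pi_nhds]
  rfl

theorem continuous_germ (s : List σ × Finset (Fin n)) : Continuous fun a => ρ.germ a s :=
  (continuous_apply s).comp ρ.isUniformInducing_germ.uniformContinuous.continuous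

/-- A continuous seminorm of the germ, as a continuous seminorm of the smooth vectors. -/
def germSeminorm (s : List σ × Finset (Fin n)) (q : Seminorm ℂ A) : Seminorm ℂ ρ.SmoothVec :=
  q.comp (LinearMap.proj s ∘ₗ ρ.germ)

theorem germSeminorm_apply (s : List σ × Finset (Fin n)) (q : Seminorm ℂ A) (a : ρ.SmoothVec) :
    ρ.germSeminorm s q a = q (ρ.germ a s) := rfl

theorem continuous_germSeminorm (s : List σ × Finset (Fin n)) {q : Seminorm ℂ A}
    (hq : Continuous q) : Continuous (ρ.germSeminorm s q) :=
  hq.comp (ρ.continuous_germ s)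

/-- Every continuous seminorm of the smooth vectors is bounded by finitely many seminorms of
derivatives. -/
theorem exists_seminorm_le_sum {q : Seminorm ℂ ρ.SmoothVec} (hq : Continuous q) :
    ∃ (S : Finset (List σ × Finset (Fin n))) (r : List σ × Finset (Fin n) → Seminorm ℂ A),
      (∀ s, Continuous (r s)) ∧ ∀ a, q a ≤ ∑ s ∈ S, r s (ρ.germ a s) := by
  have h0 : {a | q a < 1} ∈ 𝓝 (0 : ρ.SmoothVec) :=
    (hq.tendsto 0).eventually (gt_mem_nhds (by simp))
  rw [ρ.isUniformInducing_germ.isInducing.nhds_eq_comap, map_zero] at h0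
  obtain ⟨t, ht, hsub⟩ := h0
  rw [nhds_pi, Filter.mem_pi] at ht
  obtain ⟨S, hS, u, hu, hut⟩ := ht
  choose r hr hru using fun s => exists_seminorm_of_mem_nhds (hu s)
  refine ⟨hS.toFinset, r, hr, fun a => ?_⟩
  have key := seminorm_le_of_lt_one (p := q) (q := ∑ s ∈ hS.toFinset, ρ.germSeminorm s (r s))
    (fun a ha => ?_) a
  · rwa [_root_.sum_apply] at key
  · refine hsub (hut fun s hs => hru s _ ?_)
    refine lt_of_le_of_lt ?_ ha
    rw [_root_.sum_apply]
    exact Finset.single_le_sum (f := fun s => ρ.germSeminorm s (r s) a)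
      (fun s _ => apply_nonneg _ _) (hS.mem_toFinset.2 hs)

/-- A family of maps into the smooth vectors is bounded by a continuous seminorm if its germs
are. -/
theorem bound_of_germ {ι G : Type*} [AddCommGroup G] [Module ℂ G] [TopologicalSpace G]
    {T : ι → G → ρ.SmoothVec}
    (hT : ∀ s, ∀ q : Seminorm ℂ A, Continuous q → ∃ r : Seminorm ℂ G, Continuous r ∧
      ∀ i a, q (ρ.germ (T i a) s) ≤ r a)
    {q : Seminorm ℂ ρ.SmoothVec} (hq : Continuous q) :
    ∃ r : Seminorm ℂ G, Continuous r ∧ ∀ i a, q (T i a) ≤ r a := by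
  obtain ⟨S, r, hr, h⟩ := ρ.exists_seminorm_le_sum hq
  choose r' hr' h' using fun s => hT s (r s) (hr s)
  refine ⟨∑ s ∈ S, r' s, Seminorm.continuous_finsetSum fun s _ => hr' s, fun i a => (h _).trans ?_⟩
  rw [_root_.sum_apply]
  exact Finset.sum_le_sum fun s _ => h' s i a

/-- The operators `a ↦ D^l ρ_y(a)_I` on the smooth vectors are equicontinuous. -/
theorem der_bound (l : List σ) (I : Finset (Fin n)) {q : Seminorm ℂ ρ.SmoothVec}
    (hq : Continuous q) : ∃ r : Seminorm ℂ ρ.SmoothVec, Continuous r ∧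
      ∀ y a, q (ρ.der l I y a) ≤ r a := by
  refine ρ.bound_of_germ (T := fun y a => ρ.der l I y a) (fun s q hq => ?_) hq
  obtain ⟨q', hq', h⟩ := ρ.comp_bound hp.out ∅ hq
  refine ⟨|(eps s.2 I : ℝ)|.toNNReal • ρ.germSeminorm (s.1 ++ l, s.2 ∪ I) q',
    (ρ.continuous_germSeminorm _ hq').const_smul _, fun y a => ?_⟩
  rw [germ_apply, der_der, map_zsmul, seminorm_zsmul, zero_add, incl_der_eq, _root_.smul_apply,
    NNReal.smul_def, smul_eq_mul, Real.coe_toNNReal _ (abs_nonneg _), germSeminorm_apply]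
  exact mul_le_mul_of_nonneg_left (h _ _) (abs_nonneg _)

theorem germ_der (l : List σ) (I : Finset (Fin n)) (y : Body σ) (a : ρ.SmoothVec)
    (s : List σ × Finset (Fin n)) :
    ρ.germ (ρ.der l I y a) s =
      (eps s.2 I : ℂ) • iterD (s.1 ++ l) (ρ.orbit (ρ.incl a) (s.2 ∪ I)) y := by
  rw [germ_apply, der_der, map_zsmul, zero_add, incl_der, Int.cast_smul_eq_zsmul]

theorem continuous_der (l : List σ) (I : Finset (Fin n)) (a : ρ.SmoothVec) :
    Continuous fun y => ρ.der l I y a := by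
  rw [continuous_iff_continuousAt]
  intro y
  refine ρ.tendsto_iff_germ.2 fun s => ?_
  simp only [germ_der]
  exact (((ρ.isSmooth_orbit a _) _).1.const_smul _).tendsto y

theorem hasPDeriv_der (l : List σ) (I : Finset (Fin n)) (a : ρ.SmoothVec) (i : σ) (y : Body σ) :
    HasPDeriv (fun y => ρ.der l I y a) i y (ρ.der (i :: l) I y a) := by
  refine ρ.tendsto_iff_germ.2 fun s => ?_
  have h := ((ρ.isSmooth_orbit a (s.2 ∪ I)).hasPDeriv (s.1 ++ l) i y).const_smul (eps s.2 I : ℂ)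
  rw [(ρ.isSmooth_orbit a (s.2 ∪ I)).iterD_middle, ← germ_der] at h
  refine Tendsto.congr (fun t => ?_) h
  simp only [map_smul, map_sub, Pi.smul_apply, Pi.sub_apply, germ_der]

/-- The smooth vectors are complete: the limits of the derivatives at the origin of the orbits of
a Cauchy sequence are the derivatives of the orbit of the limit, by termwise differentiation. -/
instance [CompleteSpace A] [(uniformity A).IsCountablyGenerated] :
    CompleteSpace ρ.SmoothVec := by
  refine UniformSpace.complete_of_cauchySeq_tendsto fun u hu => ?_
  have hcau : ∀ s, ∃ v, Tendsto (fun k => ρ.germ (u k) s) atTop (𝓝 v) := fun s =>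
    cauchySeq_tendsto_of_complete <|
      ((Pi.uniformContinuous_proj (fun _ : List σ × Finset (Fin n) => A) s).comp
        ρ.isUniformInducing_germ.uniformContinuous).comp_cauchySeq hu
  choose v hv using hcau
  -- The candidates `ρ_y(v(l, I))` for the derivatives of the orbit of the limit.
  have hfam : ∀ I, IsSmooth (fun y => ρ.comp ∅ y (v ([], I))) ∧
      ∀ l, iterD l (fun y => ρ.comp ∅ y (v ([], I))) = fun y => ρ.comp ∅ y (v (l, I)) := by
    intro I
    refine isSmooth_of_family (g := fun l y => ρ.comp ∅ y (v (l, I)))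
      (fun l => ρ.continuous_comp ∅ _) fun l i x => ?_
    refine hasPDeriv_of_tendsto (f := fun k y => ρ.comp ∅ y (ρ.germ (u k) (l, I)))
      (f' := fun k y => ρ.comp ∅ y (ρ.germ (u k) (i :: l, I)))
      (g' := fun y => ρ.comp ∅ y (v (i :: l, I))) (fun k x => ?_) (fun x => ?_)
      (fun q hq ε hε => ?_) (ρ.continuous_comp ∅ _) x
    · simp only [← incl_der_eq]
      exact (ρ.isSmooth_orbit (u k) I).hasPDeriv l i x
    · exact ((ρ.compL ∅ x).continuous.tendsto _).comp (hv (l, I))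
    · obtain ⟨q', hq', h⟩ := ρ.comp_bound hp.out ∅ hq
      have h1 := (tendsto_seminorm_sub (hv (i :: l, I)) hq').eventually (gt_mem_nhds hε)
      filter_upwards [h1] with k hk x
      rw [← map_sub]
      exact (h x _).trans hk.le
  -- The candidate with `l = []` is the orbit of the limit itself.
  have hv0 : ∀ I y, ρ.comp ∅ y (v ([], I)) = ρ.comp I y (v ([], ∅)) := by
    intro I y
    refine tendsto_nhds_unique (((ρ.compL ∅ y).continuous.tendsto _).comp (hv ([], I))) ?_
    refine (((ρ.compL I y).continuous.tendsto _).comp (hv ([], ∅))).congr fun k => ?_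
    simp only [Function.comp, compL_apply]
    rw [← incl_der_eq, germ_apply, der_nil_empty_zero]
    rfl
  let a : ρ.SmoothVec := ⟨v ([], ∅), fun I => by
    have := (hfam I).1
    simp only [hv0] at this
    exact this⟩
  refine ⟨a, ρ.tendsto_iff_germ.2 fun s => ?_⟩
  have h1 : ρ.germ a s = v s := by
    have h2 := congrFun ((hfam s.2).2 s.1) 0
    simp only [hv0] at h2
    rw [germ_apply, incl_der]
    refine Eq.trans h2 ?_
    exact ρ.comp_zero _
  rw [h1]
  exact hv s

theorem isFrechetSpace_smoothVec [CompleteSpace A] [(uniformity A).IsCountablyGenerated] :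
    IsFrechetSpace ρ.SmoothVec where
  uniformAddGroup := inferInstance
  continuousSMul := (PolynormableSpace.withSeminorms ℂ ρ.SmoothVec).continuousSMul
  locallyConvex := (PolynormableSpace.withSeminorms ℂ ρ.SmoothVec).toLocallyConvexSpace
  t2 := inferInstance
  complete := inferInstance
  countable := inferInstance

/-- The coaction `χ(a)(z) = ρ_z(a)`. -/
def coact : ρ.SmoothVec →ₗ[ℂ] BSuper σ n ρ.SmoothVec where
  toFun a := ⟨fun I y => ρ.der [] I y a, fun I => by
    have h := isSmooth_of_family (g := fun l y => ρ.der l I y a)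
      (fun l => ρ.continuous_der l I a) fun l i x => ρ.hasPDeriv_der l I a i x
    refine ⟨h.1, fun l q hq => ?_⟩
    obtain ⟨r, -, hr⟩ := ρ.der_bound l I hq
    rw [h.2]
    exact ⟨r a, by rintro _ ⟨y, rfl⟩; exact hr y a⟩⟩
  map_add' a b := Subtype.ext <| by funext I y; exact map_add (ρ.der [] I y) a b
  map_smul' c a := Subtype.ext <| by funext I y; exact map_smul (ρ.der [] I y) c a

theorem iterD_coeff_coact (a : ρ.SmoothVec) (I : Finset (Fin n)) (l : List σ) :
    iterD l ((ρ.coact a).coeff I) = fun y => ρ.der l I y a :=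
  (isSmooth_of_family (g := fun l y => ρ.der l I y a)
      (fun l => ρ.continuous_der l I a) fun l i x => ρ.hasPDeriv_der l I a i x).2 l

/-- The coaction is continuous, since the derivatives `D^l ρ_y(·)_I` are equicontinuous in `y`. -/
theorem continuous_coact : Continuous ρ.coact := by
  refine continuous_induced_rng.2 (continuous_pi fun s => ?_)
  let T : ρ.SmoothVec →+ (Body σ →ᵤ ρ.SmoothVec) :=
    { toFun := fun a => UniformFun.ofFun fun y => ρ.der s.1 s.2 y a
      map_zero' := by funext y; exact map_zero (ρ.der s.1 s.2 y)
      map_add' := fun v w => by funext y; exact map_add (ρ.der s.1 s.2 y) v w }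
  have hT : Continuous T := continuous_uniformFun T fun q hq => by
    obtain ⟨r, hr, h⟩ := ρ.der_bound s.1 s.2 hq
    exact ⟨r, hr, fun a y => h y a⟩
  refine hT.congr fun a => ?_
  change _ = UniformFun.ofFun (iterD s.1 ((ρ.coact a).coeff s.2))
  rw [iterD_coeff_coact]
  rfl

end SuperAction

end SmoothVectors

/-! ### The parity operator and the product on the smooth vectors -/

section SmoothProduct

theorem IsSmooth.sum {σ : Type} [Fintype σ] [DecidableEq σ] {G : Type*} [AddCommGroup G]
    [Module ℂ G] [TopologicalSpace G] [T2Space G] [ContinuousAdd G] {ι : Type*} (S : Finset ι)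
    {f : ι → Body σ → G} (hf : ∀ i, IsSmooth (f i)) :
    IsSmooth (fun x => ∑ i ∈ S, f i x) ∧
      ∀ l, iterD l (fun x => ∑ i ∈ S, f i x) = fun x => ∑ i ∈ S, iterD l (f i) x := by
  induction S using Finset.cons_induction with
  | empty => exact ⟨IsSmooth.zero, fun l => iterD_zero l⟩
  | cons i S hi ih =>
    simp only [Finset.sum_cons]
    exact ⟨(hf i).add ih.1, fun l => ((hf i).iterD_add ih.1 l).trans (by rw [ih.2]; rfl)⟩

variable {A : Type*} [NonUnitalRing A] [Module ℂ A] [IsScalarTower ℂ A A] [SMulCommClass ℂ A A]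
  [UniformSpace A] [IsUniformAddGroup A] [ContinuousSMul ℂ A] [T2Space A]
variable {V : Type*} [AddCommGroup V] [Module ℝ V]
variable {σ : Type} [Fintype σ] [DecidableEq σ] {n : ℕ}
variable {p : ℕ → Seminorm ℂ A} {γ : A →L[ℂ] A}

namespace SuperAction

variable (ρ : SuperAction σ n V p γ)
variable [hp : Fact (WithSeminorms p)] [PolynormableSpace ℂ A]
variable [hV : Fact (¬ FiniteDimensional ℝ V)]

/-- Parity commutes with the coefficients of the action up to a sign. -/
theorem exists_parity_sign : ∃ c : Finset (Fin n) → ℂ,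
    ∀ I y a, ρ.comp I y (γ a) = c I • γ (ρ.comp I y a) := by
  rcases ρ.parity_comp hV.out with h | h
  · exact ⟨1, fun I y a => by simp [h]⟩
  · refine ⟨fun I => (-1) ^ I.card, fun I y a => ?_⟩
    rw [h, ← Int.cast_smul_eq_zsmul ℂ, smul_smul]
    push_cast
    rw [← mul_pow, mul_neg_one, neg_neg, one_pow, one_smul]

theorem orbit_parity {c : Finset (Fin n) → ℂ}
    (hc : ∀ I y a, ρ.comp I y (γ a) = c I • γ (ρ.comp I y a)) (a : ρ.SmoothVec)
    (I : Finset (Fin n)) : IsSmooth (ρ.orbit (γ (ρ.incl a)) I) ∧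
      ∀ l, iterD l (ρ.orbit (γ (ρ.incl a)) I) =
        c I • fun y => γ (iterD l (ρ.orbit (ρ.incl a) I) y) := by
  have h : ρ.orbit (γ (ρ.incl a)) I = c I • fun y => γ (ρ.orbit (ρ.incl a) I y) := by
    funext y
    exact hc I y _
  have hs := (ρ.isSmooth_orbit a I).iterD_clm γ
  rw [h]
  exact ⟨hs.1.const_smul _, fun l => by rw [hs.1.iterD_smul, hs.2]⟩

/-- The parity operator of the smooth vectors. -/
def parity : ρ.SmoothVec →L[ℂ] ρ.SmoothVec where
  toFun a := ⟨γ (ρ.incl a), by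
    obtain ⟨c, hc⟩ := ρ.exists_parity_sign
    exact fun I => (ρ.orbit_parity hc a I).1⟩
  map_add' a b := Subtype.ext (map_add γ (ρ.incl a) (ρ.incl b))
  map_smul' c a := Subtype.ext (map_smul γ c (ρ.incl a))
  cont := by
    obtain ⟨c, hc⟩ := ρ.exists_parity_sign
    refine ρ.isUniformInducing_germ.isInducing.continuous_iff.2 (continuous_pi fun s => ?_)
    have h : ∀ a : ρ.SmoothVec, ρ.germ (⟨γ (ρ.incl a), fun I => (ρ.orbit_parity hc a I).1⟩ :
        ρ.SmoothVec) s = c s.2 • γ (ρ.germ a s) := fun a =>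
      congrFun ((ρ.orbit_parity hc a s.2).2 s.1) 0
    exact ((γ.continuous.comp (ρ.continuous_germ s)).const_smul (c s.2)).congr
      fun a => (h a).symm

theorem incl_parity (a : ρ.SmoothVec) : ρ.incl (ρ.parity a) = γ (ρ.incl a) := rfl

theorem incl_parity_iterate (k : ℕ) (a : ρ.SmoothVec) :
    ρ.incl ((ρ.parity^[k]) a) = (γ^[k]) (ρ.incl a) := by
  induction k with
  | zero => rfl
  | succ k ih => rw [Function.iterate_succ_apply', Function.iterate_succ_apply', incl_parity, ih]

theorem parity_eq_self (h : ∀ a, γ a = a) (a : ρ.SmoothVec) : ρ.parity a = a :=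
  ρ.incl_injective (h _)

theorem parity_der : (∀ a, γ a = a) ∨ ∀ I y a,
    ρ.parity (ρ.der [] I y a) = (-1 : ℤ) ^ I.card • ρ.der [] I y (ρ.parity a) := by
  rcases ρ.parity_comp hV.out with h | h
  · exact Or.inl h
  · refine Or.inr fun I y a => ρ.incl_injective ?_
    rw [map_zsmul]
    exact h I y _

variable [hγ : Fact (IsParity γ)]

theorem parity_parity (a : ρ.SmoothVec) : ρ.parity (ρ.parity a) = a :=
  ρ.incl_injective (hγ.out.involutive _)

variable [ContinuousMul A]

/-- The derivatives of the orbit of a product. -/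
theorem orbit_mul (a b : ρ.SmoothVec) (L : Finset (Fin n)) :
    IsSmooth (ρ.orbit (ρ.incl a * ρ.incl b) L) ∧
      ∀ l, iterD l (ρ.orbit (ρ.incl a * ρ.incl b) L) = fun y => ∑ I ∈ L.powerset,
        (eps I (L \ I) : ℂ) • ((splits l).map fun q => iterD q.1 (ρ.orbit (ρ.incl a) I) y *
          (γ ^ I.card) (iterD q.2 (ρ.orbit (ρ.incl b) (L \ I)) y)).sum := by
  have h : ρ.orbit (ρ.incl a * ρ.incl b) L = fun y => ∑ I ∈ L.powerset,
      ((eps I (L \ I) : ℂ) • fun y => ρ.orbit (ρ.incl a) I y *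
        (γ ^ I.card) (ρ.orbit (ρ.incl b) (L \ I) y)) y := by
    funext y
    refine (ρ.comp_mul hV.out hγ.out L y _ _).trans (Finset.sum_congr rfl fun I _ => ?_)
    rw [Pi.smul_apply, Int.cast_smul_eq_zsmul, show ⇑(γ ^ I.card) = γ^[I.card] from hom_coe_pow _ rfl (fun _ _ => rfl) _ _]
    rfl
  have hs : ∀ I, IsSmooth (fun y => ρ.orbit (ρ.incl a) I y *
        (γ ^ I.card) (ρ.orbit (ρ.incl b) (L \ I) y)) ∧ ∀ l, iterD l (fun y =>
          ρ.orbit (ρ.incl a) I y * (γ ^ I.card) (ρ.orbit (ρ.incl b) (L \ I) y)) = fun y =>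
        ((splits l).map fun q => iterD q.1 (ρ.orbit (ρ.incl a) I) y *
          (γ ^ I.card) (iterD q.2 (ρ.orbit (ρ.incl b) (L \ I)) y)).sum := fun I => by
    have h1 := (ρ.isSmooth_orbit b (L \ I)).iterD_clm (γ ^ I.card)
    have h2 := (ρ.isSmooth_orbit a I).mul h1.1
    refine ⟨h2.1, fun l => ?_⟩
    rw [h2.2]
    simp only [h1.2]
  have hsum := IsSmooth.sum L.powerset fun I => (hs I).1.const_smul (eps I (L \ I) : ℂ)
  rw [h]
  refine ⟨hsum.1, fun l => ?_⟩
  rw [hsum.2]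
  funext y
  refine Finset.sum_congr rfl fun I _ => ?_
  rw [(hs I).1.iterD_smul, (hs I).2]
  rfl

/-- The product of the smooth vectors. -/
def mul : ρ.SmoothVec →ₗ[ℂ] ρ.SmoothVec →ₗ[ℂ] ρ.SmoothVec :=
  LinearMap.mk₂ ℂ (fun a b => ⟨ρ.incl a * ρ.incl b, fun L => (ρ.orbit_mul a b L).1⟩)
    (fun _ _ _ => Subtype.ext (add_mul (ρ.incl _) (ρ.incl _) (ρ.incl _)))
    (fun _ _ _ => Subtype.ext (smul_mul_assoc _ (ρ.incl _) (ρ.incl _)))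
    (fun _ _ _ => Subtype.ext (mul_add (ρ.incl _) (ρ.incl _) (ρ.incl _)))
    (fun _ _ _ => Subtype.ext (mul_smul_comm _ (ρ.incl _) (ρ.incl _)))

theorem incl_mul (a b : ρ.SmoothVec) : ρ.incl (ρ.mul a b) = ρ.incl a * ρ.incl b := rfl

theorem germ_mul (a b : ρ.SmoothVec) (s : List σ × Finset (Fin n)) :
    ρ.germ (ρ.mul a b) s = ∑ I ∈ s.2.powerset, (eps I (s.2 \ I) : ℂ) •
      ((splits s.1).map fun q => ρ.germ a (q.1, I) *
        (γ ^ I.card) (ρ.germ b (q.2, s.2 \ I))).sum :=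
  congrFun ((ρ.orbit_mul a b s.2).2 s.1) 0

theorem continuous_mul : Continuous fun x : ρ.SmoothVec × ρ.SmoothVec => ρ.mul x.1 x.2 := by
  refine ρ.isUniformInducing_germ.isInducing.continuous_iff.2 (continuous_pi fun s => ?_)
  simp only [Function.comp_def, germ_mul]
  refine continuous_finsetSum _ fun I _ => Continuous.const_smul ?_ _
  refine continuous_list_map_sum _ fun q _ => ?_
  exact ((ρ.continuous_germ _).comp continuous_fst).mul
    ((γ ^ I.card).continuous.comp ((ρ.continuous_germ _).comp continuous_snd))

/-- The product is jointly continuous: the derivatives at the origin of a product are sums of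
products of the derivatives of its factors. -/
theorem mul_bound {q : Seminorm ℂ ρ.SmoothVec} (hq : Continuous q) :
    ∃ (p₁ p₂ : Seminorm ℂ ρ.SmoothVec), Continuous p₁ ∧ Continuous p₂ ∧
      ∀ a b, q (ρ.mul a b) ≤ p₁ a * p₂ b :=
  exists_bilin_bound ρ.mul q (hq.comp ρ.continuous_mul).continuousAt

theorem mul_mul (a b c : ρ.SmoothVec) : ρ.mul (ρ.mul a b) c = ρ.mul a (ρ.mul b c) :=
  ρ.incl_injective (mul_assoc _ _ _)

theorem parity_mul (a b : ρ.SmoothVec) :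
    ρ.parity (ρ.mul a b) = ρ.mul (ρ.parity a) (ρ.parity b) :=
  ρ.incl_injective (hγ.out.map_mul _ _)

/-- The graded Leibniz rule for the action on the smooth vectors. -/
theorem der_mul (L : Finset (Fin n)) (y : Body σ) (a b : ρ.SmoothVec) :
    ρ.der [] L y (ρ.mul a b) = ∑ I ∈ L.powerset, eps I (L \ I) •
      ρ.mul (ρ.der [] I y a) ((ρ.parity^[I.card]) (ρ.der [] (L \ I) y b)) := by
  refine ρ.incl_injective ?_
  rw [map_sum]
  refine (ρ.comp_mul hV.out hγ.out L y _ _).trans (Finset.sum_congr rfl fun I _ => ?_)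
  rw [map_zsmul, incl_mul, incl_parity_iterate]
  rfl

theorem mul_der_eq_zero (h : ∀ a, γ a = a) {I J : Finset (Fin n)} (hI : I.Nonempty)
    (hJ : J.Nonempty) (y : Body σ) (a b : ρ.SmoothVec) :
    ρ.mul (ρ.der [] I y a) (ρ.der [] J y b) = 0 :=
  ρ.incl_injective (ρ.comp_mul_comp_eq_zero hV.out h hI hJ y _ _)

end SuperAction

end SmoothProduct

/-! ### Oscillating integrals of vector valued functions -/

section VectorOsc

variable {E F G : Type*} [AddCommGroup E] [Module ℂ E] [TopologicalSpace E]
  [AddCommGroup F] [Module ℂ F] [TopologicalSpace F]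
  [AddCommGroup G] [Module ℂ G] [TopologicalSpace G]

/-- A bilinear map is continuous in the sense of seminorms. -/
def BilinBound (B : E →ₗ[ℂ] F →ₗ[ℂ] G) : Prop :=
  ∀ q : Seminorm ℂ G, Continuous q → ∃ (p₁ : Seminorm ℂ E) (p₂ : Seminorm ℂ F),
    Continuous p₁ ∧ Continuous p₂ ∧ ∀ a b, q (B a b) ≤ p₁ a * p₂ b

theorem BilinBound.continuous [IsTopologicalAddGroup E] [IsTopologicalAddGroup F]
    [PolynormableSpace ℂ G] {B : E →ₗ[ℂ] F →ₗ[ℂ] G} (hB : BilinBound B) :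
    Continuous fun x : E × F => B x.1 x.2 := by
  rw [continuous_iff_continuousAt]
  rintro ⟨u, v⟩
  refine tendsto_of_seminorm fun q hq => ?_
  obtain ⟨p₁, p₂, h₁, h₂, h⟩ := hB q hq
  have hc : Continuous fun x : E × F => p₁ (x.1 - u) * p₂ x.2 + p₁ u * p₂ (x.2 - v) := by
    fun_prop
  have h0 := hc.tendsto (u, v)
  simp only [sub_self, map_zero, zero_mul, mul_zero, add_zero] at h0
  refine squeeze_zero (fun _ => apply_nonneg q _) (fun x => ?_) h0
  have : B x.1 x.2 - B u v = B (x.1 - u) x.2 + B u (x.2 - v) := by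
    rw [map_sub, map_sub, LinearMap.sub_apply]
    abel
  change q (B x.1 x.2 - B u v) ≤ _
  rw [this]
  exact (map_add_le_add q _ _).trans (add_le_add (h _ _) (h _ _))

variable {W : Type*} [NormedAddCommGroup W] [NormedSpace ℝ W]
variable {ι : Type*} (b : Module.Basis ι ℝ W)

/-- `g l` is the derivative, in the directions of the basis listed by `l`, of the smooth function
`g []` with values in `G`, and all these derivatives are bounded. -/
structure BoundedJet (g : List ι → W → G) : Prop where
  cont : ∀ l, Continuous (g l)
  deriv : ∀ l i x, Tendsto (fun t : ℝ => ((t⁻¹ : ℝ) : ℂ) • (g l (x + t • b i) - g l x)) (𝓝[≠] 0)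
    (𝓝 (g (i :: l) x))
  bdd : ∀ l, ∀ q : Seminorm ℂ G, Continuous q → ∃ C, ∀ x, q (g l x) ≤ C

variable {b}

/-- Functionals turn vector valued smooth bounded functions into complex valued ones. -/
theorem BoundedJet.functional [FiniteDimensional ℝ W] [Fintype ι] {g : List ι → W → G}
    (hg : BoundedJet b g)
    (ℓ : G →L[ℂ] ℂ) : BB (fun x => ℓ (g [] x)) ∧
      ∀ l : List ι, dirD (l.map b) (fun x => ℓ (g [] x)) = fun x => ℓ (g l x) := by
  have h := smooth_family b (g := fun l x => ℓ (g l x)) (fun l => ℓ.continuous.comp (hg.cont l))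
    fun l i x => by
      rw [hasDerivAt_iff_tendsto_slope_zero]
      refine ((ℓ.continuous.tendsto _).comp (hg.deriv l i x)).congr fun t => ?_
      simp
  refine ⟨BB.of_basis b h.1 fun l => ?_, h.2⟩
  obtain ⟨C, hC⟩ := hg.bdd l ((normSeminorm ℂ ℂ).comp ℓ.toLinearMap)
    (continuous_norm.comp ℓ.continuous)
  exact ⟨C, fun x => by rw [h.2]; exact hC x⟩

/-- The directions of the first factor in a list of directions of a product. -/
def lefts {α β : Type*} (l : List (α ⊕ β)) : List α := l.filterMap Sum.getLeft?

/-- The directions of the second factor in a list of directions of a product. -/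
def rights {α β : Type*} (l : List (α ⊕ β)) : List β := l.filterMap Sum.getRight?

/-- A continuous bilinear map takes smooth bounded functions of two variables to a smooth bounded
function. -/
theorem BoundedJet.bilin [IsTopologicalAddGroup E] [IsTopologicalAddGroup F]
    [PolynormableSpace ℂ G] {W' : Type*} [NormedAddCommGroup W'] [NormedSpace ℝ W'] {ι' : Type*}
    {b' : Module.Basis ι' ℝ W'} {g : List ι → W → E} {g' : List ι' → W' → F}
    (hg : BoundedJet b g) (hg' : BoundedJet b' g') {B : E →ₗ[ℂ] F →ₗ[ℂ] G} (hB : BilinBound B) :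
    BoundedJet (b.prod b') fun l x => B (g (lefts l) x.1) (g' (rights l) x.2) := by
  have hBc := hB.continuous
  refine ⟨fun l => ?_, fun l i x => ?_, fun l q hq => ?_⟩
  · exact hBc.comp (((hg.cont _).comp continuous_fst).prodMk ((hg'.cont _).comp continuous_snd))
  · rcases i with i | i
    · have hc : Continuous fun u => B u (g' (rights l) x.2) :=
        hBc.comp (continuous_id.prodMk continuous_const)
      refine ((hc.tendsto _).comp (hg.deriv (lefts l) i x.1)).congr fun t => ?_
      simp [Module.Basis.prod_apply]
    · have hc : Continuous fun v => B (g (lefts l) x.1) v :=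
        hBc.comp (continuous_const.prodMk continuous_id)
      refine ((hc.tendsto _).comp (hg'.deriv (rights l) i x.2)).congr fun t => ?_
      simp [Module.Basis.prod_apply]
  · obtain ⟨p₁, p₂, h₁, h₂, h⟩ := hB q hq
    obtain ⟨C₁, hC₁⟩ := hg.bdd (lefts l) p₁ h₁
    obtain ⟨C₂, hC₂⟩ := hg'.bdd (rights l) p₂ h₂
    refine ⟨C₁ * C₂, fun x => (h _ _).trans ?_⟩
    exact mul_le_mul (hC₁ _) (hC₂ _) (apply_nonneg _ _) ((apply_nonneg _ _).trans (hC₁ x.1))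

section Linear

variable [FiniteDimensional ℝ W] [MeasurableSpace W] [BorelSpace W]
  {μ : Measure W} [μ.IsAddHaarMeasure] [Fintype ι] {κ : ℝ}

theorem osc_add (hκ : 0 < κ) {k : ℕ} (hk : Module.finrank ℝ W < 2 * k) {e : W → ℂ}
    (he : IsPhase κ b e) {f g : W → ℂ} (hf : BB f) (hg : BB g) :
    osc κ b μ e k (fun x => f x + g x) = osc κ b μ e k f + osc κ b μ e k g := by
  obtain ⟨L, hL, hexp⟩ := exists_osc_expansion (μ := μ) hκ hk he
  rw [osc_eq_of_expansion hL hexp (hf.add hg), osc_eq_of_expansion hL hexp hf,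
    osc_eq_of_expansion hL hexp hg, ← List.sum_map_add]
  congr 1
  refine List.map_congr_left fun p hp => ?_
  obtain ⟨C, hC⟩ := hf.bound_list (p.2.map b)
  obtain ⟨D, hD⟩ := hg.bound_list (p.2.map b)
  rw [← integral_add (integrable_mul_bounded (hL p hp).2 (continuous_dirD hf.smooth _) hC)
    (integrable_mul_bounded (hL p hp).2 (continuous_dirD hg.smooth _) hD)]
  refine integral_congr_ae (ae_of_all _ fun x => ?_)
  have := congrFun (dirD_add hf.smooth hg.smooth (p.2.map b)) x
  change p.1 x * dirD (p.2.map b) (f + g) x = _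
  rw [this, Pi.add_apply, mul_add]

theorem osc_const_mul (hκ : 0 < κ) {k : ℕ} (hk : Module.finrank ℝ W < 2 * k) {e : W → ℂ}
    (he : IsPhase κ b e) {f : W → ℂ} (hf : BB f) (c : ℂ) :
    osc κ b μ e k (fun x => c * f x) = c * osc κ b μ e k f := by
  obtain ⟨L, hL, hexp⟩ := exists_osc_expansion (μ := μ) hκ hk he
  rw [osc_eq_of_expansion hL hexp (hf.const_mul c), osc_eq_of_expansion hL hexp hf,
    ← List.sum_map_mul_left]
  congr 1
  refine List.map_congr_left fun p _ => ?_
  rw [← integral_const_mul]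
  refine integral_congr_ae (ae_of_all _ fun x => ?_)
  change p.1 x * dirD (p.2.map b) (fun x => c * f x) x = c * (p.1 x * dirD (p.2.map b) f x)
  rw [dirD_const_mul hf.smooth]
  ring

end Linear

/-- The oscillating integral of a smooth bounded function with values in a Fréchet space exists,
and it is bounded by finitely many derivatives of the function. -/
theorem exists_osc_value {G : Type*} [AddCommGroup G] [Module ℂ G] [UniformSpace G]
    [IsUniformAddGroup G] [PolynormableSpace ℂ G] [CompleteSpace G]
    [(uniformity G).IsCountablyGenerated]
    [FiniteDimensional ℝ W] [MeasurableSpace W] [BorelSpace W]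
    (μ : Measure W) [μ.IsAddHaarMeasure] [Fintype ι] {κ : ℝ} (hκ : 0 < κ) {k : ℕ}
    (hk : Module.finrank ℝ W < 2 * k) {e : W → ℂ} (he : IsPhase κ b e) :
    ∃ L : List ((W → ℂ) × List ι), (∀ r ∈ L, Integrable r.1 μ) ∧
      ∀ g : List ι → W → G, BoundedJet b g → ∃ v : G,
        (∀ ℓ : G →L[ℂ] ℂ, ℓ v = osc κ b μ e k fun x => ℓ (g [] x)) ∧
        ∀ q : Seminorm ℂ G, Continuous q →
          q v ≤ (L.map fun r => ∫ x, ‖r.1 x‖ * q (g r.2 x) ∂μ).sum := by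
  obtain ⟨L, hL, hexp⟩ := exists_osc_expansion (μ := μ) hκ hk he
  refine ⟨L, fun r hr => (hL r hr).2, fun g hg => ?_⟩
  have hv : ∀ r : (W → ℂ) × List ι, ∃ v : G, r ∈ L →
      (∀ ℓ : G →L[ℂ] ℂ, ℓ v = ∫ x, r.1 x * ℓ (g r.2 x) ∂μ) ∧
      ∀ q : Seminorm ℂ G, Continuous q → q v ≤ ∫ x, ‖r.1 x‖ * q (g r.2 x) ∂μ := by
    intro r
    by_cases hr : r ∈ L
    · obtain ⟨v, h1, h2⟩ := exists_integral (hL r hr).2 (hg.cont r.2) (hg.bdd r.2)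
      exact ⟨v, fun _ => ⟨h1, h2⟩⟩
    · exact ⟨0, fun h => absurd h hr⟩
  choose v hv using hv
  refine ⟨(L.map v).sum, fun ℓ => ?_, fun q hq => ?_⟩
  · obtain ⟨h1, h2⟩ := hg.functional ℓ
    rw [osc_eq_of_expansion hL hexp h1, map_list_sum, List.map_map]
    congr 1
    refine List.map_congr_left fun r hr => ?_
    rw [Function.comp, (hv r hr).1 ℓ, h2]
  · clear hexp
    induction L with
    | nil => simp
    | cons r L ih =>
      simp only [List.map_cons, List.sum_cons]
      refine (map_add_le_add q _ _).trans (add_le_add ((hv r (by simp)).2 q hq) ?_)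
      exact ih (fun s hs => hL s (by simp [hs])) fun s hs => hv s (by simp [hs])

end VectorOsc

/-! ### The twist -/

section BilinBounds

variable {E F G : Type*} [AddCommGroup E] [Module ℂ E] [TopologicalSpace E]
  [AddCommGroup F] [Module ℂ F] [TopologicalSpace F]
  [AddCommGroup G] [Module ℂ G] [TopologicalSpace G]

theorem BilinBound.zero : BilinBound (0 : E →ₗ[ℂ] F →ₗ[ℂ] G) := fun q _ =>
  ⟨0, 0, continuous_const, continuous_const, fun a b => by simp⟩

theorem BilinBound.add {B B' : E →ₗ[ℂ] F →ₗ[ℂ] G} (hB : BilinBound B) (hB' : BilinBound B') :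
    BilinBound (B + B') := fun q hq => by
  obtain ⟨p₁, p₂, h₁, h₂, h⟩ := hB q hq
  obtain ⟨r₁, r₂, k₁, k₂, k⟩ := hB' q hq
  refine ⟨p₁ + r₁, p₂ + r₂, h₁.add k₁, h₂.add k₂, fun a b => ?_⟩
  refine (map_add_le_add q _ _).trans ((add_le_add (h a b) (k a b)).trans ?_)
  rw [_root_.add_apply, _root_.add_apply]
  have := mul_nonneg (apply_nonneg p₁ a) (apply_nonneg r₂ b)
  have := mul_nonneg (apply_nonneg r₁ a) (apply_nonneg p₂ b)
  nlinarith

theorem BilinBound.const_smul {B : E →ₗ[ℂ] F →ₗ[ℂ] G} (hB : BilinBound B) (c : ℂ) :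
    BilinBound (c • B) := fun q hq => by
  obtain ⟨p₁, p₂, h₁, h₂, h⟩ := hB q hq
  refine ⟨‖c‖₊ • p₁, p₂, h₁.const_smul _, h₂, fun a b => ?_⟩
  rw [LinearMap.smul_apply, LinearMap.smul_apply, map_smul_eq_mul, _root_.smul_apply,
    NNReal.smul_def, smul_eq_mul, mul_assoc]
  exact mul_le_mul_of_nonneg_left (h a b) (norm_nonneg c)

theorem BilinBound.sum {ι : Type*} (S : Finset ι) {B : ι → E →ₗ[ℂ] F →ₗ[ℂ] G}
    (hB : ∀ i, BilinBound (B i)) : BilinBound (∑ i ∈ S, B i) := by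
  induction S using Finset.cons_induction with
  | empty => exact BilinBound.zero
  | cons i S hi ih =>
    rw [Finset.sum_cons]
    exact (hB i).add ih

theorem BilinBound.compl₁₂ {B : E →ₗ[ℂ] F →ₗ[ℂ] G} (hB : BilinBound B) (S : E →L[ℂ] E)
    (T : F →L[ℂ] F) : BilinBound (B.compl₁₂ S.toLinearMap T.toLinearMap) := fun q hq => by
  obtain ⟨p₁, p₂, h₁, h₂, h⟩ := hB q hq
  exact ⟨p₁.comp S.toLinearMap, p₂.comp T.toLinearMap, h₁.comp S.continuous, h₂.comp T.continuous,
    fun a b => h _ _⟩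

/-- A finite sum of products of seminorms is bounded by a product of seminorms. -/
theorem exists_prod_bound {α : Type*} (L : List α) {f : α → E → F → ℝ}
    (h : ∀ r ∈ L, ∃ (p₁ : Seminorm ℂ E) (p₂ : Seminorm ℂ F), Continuous p₁ ∧ Continuous p₂ ∧
      ∀ a b, f r a b ≤ p₁ a * p₂ b) :
    ∃ (p₁ : Seminorm ℂ E) (p₂ : Seminorm ℂ F), Continuous p₁ ∧ Continuous p₂ ∧
      ∀ a b, (L.map fun r => f r a b).sum ≤ p₁ a * p₂ b := by
  induction L with
  | nil => exact ⟨0, 0, continuous_const, continuous_const, fun a b => by simp⟩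
  | cons r L ih =>
    obtain ⟨p₁, p₂, h₁, h₂, hp⟩ := h r (by simp)
    obtain ⟨r₁, r₂, k₁, k₂, hr⟩ := ih fun s hs => h s (by simp [hs])
    refine ⟨p₁ + r₁, p₂ + r₂, h₁.add k₁, h₂.add k₂, fun a b => ?_⟩
    rw [List.map_cons, List.sum_cons, _root_.add_apply, _root_.add_apply]
    have := mul_nonneg (apply_nonneg p₁ a) (apply_nonneg r₂ b)
    have := mul_nonneg (apply_nonneg r₁ a) (apply_nonneg p₂ b)
    nlinarith [hp a b, hr a b]

end BilinBounds

section OscLinear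

variable {d : ℕ}

theorem BB.zero (W : Type*) [NormedAddCommGroup W] [NormedSpace ℝ W] [FiniteDimensional ℝ W]
    [MeasurableSpace W] [BorelSpace W] :
    BB (fun _ : W => (0 : ℂ)) := by
  obtain ⟨χ, hχ, -⟩ := exists_cutoff W
  simpa only [zero_mul] using hχ.const_mul 0

/-- The oscillating integral is linear. -/
theorem oscIntegral_sum {θ : ℝ} (hθ : θ ≠ 0) {ι : Type*} (S : Finset ι) (c : ι → ℂ)
    {f : ι → Body (Fin d ⊕ Fin d) × Body (Fin d ⊕ Fin d) → ℂ} (hf : ∀ i, BB (f i)) :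
    BB (fun y => ∑ i ∈ S, c i * f i y) ∧
    oscIntegral θ (fun y₁ y₂ => ∑ i ∈ S, c i * f i (y₁, y₂)) =
      ∑ i ∈ S, c i * oscIntegral θ fun y₁ y₂ => f i (y₁, y₂) := by
  have hκ : 0 < 4 / θ ^ 2 := by positivity
  have hk := finrank_symplectic d
  have he := isPhase_symplPhase (d := d) hθ
  suffices h : BB (fun y => ∑ i ∈ S, c i * f i y) ∧
      osc (4 / θ ^ 2) ((stdB d).prod (stdB d)) (symplVol d) (symplPhase d θ) (2 * d + 1)
        (fun y => ∑ i ∈ S, c i * f i y) = ∑ i ∈ S, c i * osc (4 / θ ^ 2) ((stdB d).prod (stdB d))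
          (symplVol d) (symplPhase d θ) (2 * d + 1) (f i) by
    refine ⟨h.1, ?_⟩
    rw [h.1.oscIntegral_eq_osc hθ, h.2]
    exact Finset.sum_congr rfl fun i _ => by rw [(hf i).oscIntegral_eq_osc hθ]
  induction S using Finset.cons_induction with
  | empty =>
    have h0 := osc_const_mul (μ := symplVol d) hκ hk he (BB.zero _) 0
    simp only [zero_mul] at h0
    exact ⟨BB.zero _, h0⟩
  | cons i S hi ih =>
    simp only [Finset.sum_cons]
    have h1 := (hf i).const_mul (c i)
    exact ⟨h1.add ih.1, by
      rw [osc_add hκ hk he h1 ih.1, osc_const_mul hκ hk he (hf i), ih.2]⟩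

end OscLinear

section Twist

variable {A : Type*} [NonUnitalRing A] [Module ℂ A] [IsScalarTower ℂ A A] [SMulCommClass ℂ A A]
  [UniformSpace A] [IsUniformAddGroup A] [ContinuousSMul ℂ A] [T2Space A]
variable {V : Type*} [AddCommGroup V] [Module ℝ V]
variable {d n : ℕ}
variable {p : ℕ → Seminorm ℂ A} {γ : A →L[ℂ] A}

namespace SuperAction

variable (ρ : SuperAction (Fin d ⊕ Fin d) n V p γ)
variable [hp : Fact (WithSeminorms p)] [PolynormableSpace ℂ A]
variable [hV : Fact (¬ FiniteDimensional ℝ V)]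

/-- `ρ_y` as an operator on the smooth vectors. -/
abbrev even (y : Body (Fin d ⊕ Fin d)) : ρ.SmoothVec →ₗ[ℂ] ρ.SmoothVec := ρ.der [] ∅ y

/-- `ρ_y(·)_K` as a continuous operator on the smooth vectors. -/
def derL (K : Finset (Fin n)) (y : Body (Fin d ⊕ Fin d)) : ρ.SmoothVec →L[ℂ] ρ.SmoothVec :=
  ⟨ρ.der [] K y, continuous_of_bound _ fun _ hq =>
    let ⟨r, h, h'⟩ := ρ.der_bound [] K hq; ⟨r, h, h' y⟩⟩

theorem derL_apply (K : Finset (Fin n)) (y : Body (Fin d ⊕ Fin d)) (a : ρ.SmoothVec) :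
    ρ.derL K y a = ρ.der [] K y a := rfl

/-- The odd derivative of the action at the origin, as an operator on the smooth vectors. -/
abbrev odd (K : Finset (Fin n)) : ρ.SmoothVec →L[ℂ] ρ.SmoothVec := ρ.derL K 0

theorem odd_apply (K : Finset (Fin n)) (a : ρ.SmoothVec) : ρ.odd K a = ρ.der [] K 0 a := rfl

theorem even_odd (y : Body (Fin d ⊕ Fin d)) (K : Finset (Fin n)) (a : ρ.SmoothVec) :
    ρ.even y (ρ.odd K a) = ρ.der [] K y a := by
  rw [odd_apply, der_der, eps_empty_left, one_smul, Finset.empty_union, add_zero, List.nil_append]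

theorem parity_even (y : Body (Fin d ⊕ Fin d)) (a : ρ.SmoothVec) :
    ρ.parity (ρ.even y a) = ρ.even y (ρ.parity a) := by
  rcases ρ.parity_der with h | h
  · rw [ρ.parity_eq_self h, ρ.parity_eq_self h]
  · rw [h, Finset.card_empty, pow_zero, one_smul]

theorem parity_iterate_even (k : ℕ) (y : Body (Fin d ⊕ Fin d)) (a : ρ.SmoothVec) :
    (ρ.parity^[k]) (ρ.even y a) = ρ.even y ((ρ.parity^[k]) a) := by
  induction k with
  | zero => rfl
  | succ k ih => rw [Function.iterate_succ_apply', Function.iterate_succ_apply', ih, parity_even]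

theorem boundedJet_even (a : ρ.SmoothVec) :
    BoundedJet (stdB d) fun l y => ρ.der l ∅ y a where
  cont l := ρ.continuous_der l ∅ a
  deriv l i x := by
    simp only [bodyBasis_apply]
    exact ρ.hasPDeriv_der l ∅ a i x
  bdd l q hq := by
    obtain ⟨r, -, h⟩ := ρ.der_bound l ∅ hq
    exact ⟨r a, fun y => h y a⟩

theorem bilinBound_tens : BilinBound (tensₗ : ρ.SmoothVec →ₗ[ℂ] ρ.SmoothVec →ₗ[ℂ] _) :=
  fun _ hq => exists_tens_bound hq

/-- The function `(y₁, y₂) ↦ ρ_{y₁}(a) ⊗ ρ_{y₂}(b)` is smooth with bounded derivatives. -/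
theorem boundedJet_tens (a b : ρ.SmoothVec) : BoundedJet ((stdB d).prod (stdB d))
    fun l y => tens (ρ.der (lefts l) ∅ y.1 a) (ρ.der (rights l) ∅ y.2 b) :=
  (ρ.boundedJet_even a).bilin (ρ.boundedJet_even b) ρ.bilinBound_tens

theorem bb_tens (ℓ : ProjCompl ρ.SmoothVec ρ.SmoothVec →L[ℂ] ℂ) (a b : ρ.SmoothVec) :
    BB fun y : Body (Fin d ⊕ Fin d) × Body (Fin d ⊕ Fin d) =>
      ℓ (tens (ρ.even y.1 a) (ρ.even y.2 b)) :=
  ((ρ.boundedJet_tens a b).functional ℓ).1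

/-- The even part of the twist: the oscillating integral of `ρ_{y₁} ⊗ ρ_{y₂}`, as a continuous
bilinear map. -/
theorem exists_evenTwist [CompleteSpace A] [(uniformity A).IsCountablyGenerated] {θ : ℝ}
    (hθ : θ ≠ 0) :
    ∃ F₀ : ρ.SmoothVec →ₗ[ℂ] ρ.SmoothVec →ₗ[ℂ] ProjCompl ρ.SmoothVec ρ.SmoothVec,
      BilinBound F₀ ∧ ∀ a b (ℓ : ProjCompl ρ.SmoothVec ρ.SmoothVec →L[ℂ] ℂ), ℓ (F₀ a b) =
        oscIntegral θ fun y₁ y₂ => ℓ (tens (ρ.even y₁ a) (ρ.even y₂ b)) := by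
  have hκ : 0 < 4 / θ ^ 2 := by positivity
  have hk := finrank_symplectic d
  have he := isPhase_symplPhase (d := d) hθ
  have hcg : (𝓝 (0 : ρ.SmoothVec)).IsCountablyGenerated :=
    (UniformSpace.firstCountableTopology ρ.SmoothVec).1 0
  have hcg' := countablyGenerated_projTensor ρ.SmoothVec ρ.SmoothVec
  have hcg'' : (uniformity (ProjCompl ρ.SmoothVec ρ.SmoothVec)).IsCountablyGenerated :=
    countablyGenerated_completion _
  obtain ⟨L, hL, h⟩ := exists_osc_value (G := ProjCompl ρ.SmoothVec ρ.SmoothVec) (symplVol d)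
    hκ hk he
  choose v hv hvq using fun a b => h _ (ρ.boundedJet_tens a b)
  have hdual : ∀ a b (ℓ : ProjCompl ρ.SmoothVec ρ.SmoothVec →L[ℂ] ℂ), ℓ (v a b) =
      osc (4 / θ ^ 2) ((stdB d).prod (stdB d)) (symplVol d) (symplPhase d θ) (2 * d + 1)
        fun y => ℓ (tens (ρ.even y.1 a) (ρ.even y.2 b)) := fun a b ℓ => hv a b ℓ
  let F₀ : ρ.SmoothVec →ₗ[ℂ] ρ.SmoothVec →ₗ[ℂ] ProjCompl ρ.SmoothVec ρ.SmoothVec :=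
    LinearMap.mk₂ ℂ v
      (fun a a' b => eq_of_forall_dual fun ℓ => by
        rw [map_add, hdual, hdual, hdual, ← osc_add hκ hk he (ρ.bb_tens ℓ a b) (ρ.bb_tens ℓ a' b)]
        simp only [← tensₗ_apply, map_add, LinearMap.add_apply])
      (fun c a b => eq_of_forall_dual fun ℓ => by
        rw [map_smul, hdual, hdual, smul_eq_mul, ← osc_const_mul hκ hk he (ρ.bb_tens ℓ a b)]
        simp only [← tensₗ_apply, map_smul, LinearMap.smul_apply, smul_eq_mul])
      (fun a b b' => eq_of_forall_dual fun ℓ => by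
        rw [map_add, hdual, hdual, hdual, ← osc_add hκ hk he (ρ.bb_tens ℓ a b) (ρ.bb_tens ℓ a b')]
        simp only [← tensₗ_apply, map_add])
      (fun c a b => eq_of_forall_dual fun ℓ => by
        rw [map_smul, hdual, hdual, smul_eq_mul, ← osc_const_mul hκ hk he (ρ.bb_tens ℓ a b)]
        simp only [← tensₗ_apply, map_smul, smul_eq_mul])
  refine ⟨F₀, fun q hq => ?_, fun a b ℓ => ?_⟩
  · obtain ⟨p₁, p₂, h₁, h₂, hb⟩ := exists_prod_bound L (f := fun r a b =>
      ∫ y, ‖r.1 y‖ * q (tens (ρ.der (lefts r.2) ∅ y.1 a) (ρ.der (rights r.2) ∅ y.2 b)) ∂symplVol d)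
      (fun r hr => by
        obtain ⟨s₁, s₂, k₁, k₂, hs⟩ := ρ.bilinBound_tens q hq
        obtain ⟨t₁, m₁, ht₁⟩ := ρ.der_bound (lefts r.2) ∅ k₁
        obtain ⟨t₂, m₂, ht₂⟩ := ρ.der_bound (rights r.2) ∅ k₂
        let C : NNReal := ⟨∫ y, ‖r.1 y‖ ∂symplVol d, integral_nonneg fun _ => norm_nonneg _⟩
        refine ⟨C • t₁, t₂, m₁.const_smul _, m₂, fun a b => ?_⟩
        have hle : ∀ y : Body (Fin d ⊕ Fin d) × Body (Fin d ⊕ Fin d), ‖r.1 y‖ *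
            q (tens (ρ.der (lefts r.2) ∅ y.1 a) (ρ.der (rights r.2) ∅ y.2 b)) ≤
            ‖r.1 y‖ * (t₁ a * t₂ b) := fun y => by
          refine mul_le_mul_of_nonneg_left ((hs _ _).trans ?_) (norm_nonneg _)
          exact mul_le_mul (ht₁ _ _) (ht₂ _ _) (apply_nonneg _ _) (apply_nonneg _ _)
        refine (integral_mono_of_nonneg (ae_of_all _ fun y => mul_nonneg (norm_nonneg _)
          (apply_nonneg _ _)) ((hL r hr).norm.mul_const _) (ae_of_all _ hle)).trans (le_of_eq ?_)
        rw [integral_mul_const, _root_.smul_apply, NNReal.smul_def, smul_eq_mul, mul_assoc]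
        rfl)
    exact ⟨p₁, p₂, h₁, h₂, fun a b => (hvq a b q hq).trans (hb a b)⟩
  · exact (hdual a b ℓ).trans ((ρ.bb_tens ℓ a b).oscIntegral_eq_osc hθ).symm

end SuperAction

end Twist

/-! ### The even deformed product -/

section Deformed

variable {A : Type*} [NonUnitalRing A] [Module ℂ A] [IsScalarTower ℂ A A] [SMulCommClass ℂ A A]
  [UniformSpace A] [IsUniformAddGroup A] [ContinuousSMul ℂ A] [T2Space A]
variable {V : Type*} [AddCommGroup V] [Module ℝ V]
variable {d n : ℕ}
variable {p : ℕ → Seminorm ℂ A} {γ : A →L[ℂ] A}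

namespace SuperAction

variable (ρ : SuperAction (Fin d ⊕ Fin d) n V p γ)
variable [hp : Fact (WithSeminorms p)] [PolynormableSpace ℂ A]
variable [hV : Fact (¬ FiniteDimensional ℝ V)]

theorem der_even (K : Finset (Fin n)) (x y : Body (Fin d ⊕ Fin d)) (a : ρ.SmoothVec) :
    ρ.der [] K y (ρ.even x a) = ρ.even x (ρ.der [] K y a) := by
  rw [der_der, der_der, eps_empty_left, eps_empty_right, Finset.union_empty, Finset.empty_union,
    add_comm x y]

theorem odd_odd (I K : Finset (Fin n)) (a : ρ.SmoothVec) :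
    ρ.odd I (ρ.odd K a) = (eps I K : ℂ) • ρ.odd (I ∪ K) a := by
  rw [odd_apply, odd_apply, der_der, List.nil_append, add_zero, Int.cast_smul_eq_zsmul]
  rfl

theorem odd_empty (a : ρ.SmoothVec) : ρ.odd ∅ a = a := ρ.der_nil_empty_zero a

variable [hγ : Fact (IsParity γ)]

theorem parity_iterate_even_add (k j : ℕ) (a : ρ.SmoothVec) :
    (ρ.parity^[2 * k + j]) a = (ρ.parity^[j]) a := by
  rw [Function.iterate_add_apply, Function.Involutive.iterate_two_mul ρ.parity_parity]
  rfl

theorem parity_iterate_add (k : ℕ) (a b : ρ.SmoothVec) :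
    (ρ.parity^[k]) (a + b) = (ρ.parity^[k]) a + (ρ.parity^[k]) b := by
  induction k with
  | zero => rfl
  | succ k ih => simp only [Function.iterate_succ_apply', ih, map_add]

theorem parity_iterate_smul (k : ℕ) (c : ℂ) (a : ρ.SmoothVec) :
    (ρ.parity^[k]) (c • a) = c • (ρ.parity^[k]) a := by
  induction k with
  | zero => rfl
  | succ k ih => simp only [Function.iterate_succ_apply', ih, map_smul]

theorem parity_iterate_sum {ι : Type*} (k : ℕ) (s : Finset ι) (f : ι → ρ.SmoothVec) :
    (ρ.parity^[k]) (∑ i ∈ s, f i) = ∑ i ∈ s, (ρ.parity^[k]) (f i) := by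
  induction k with
  | zero => rfl
  | succ k ih => simp only [Function.iterate_succ_apply', ih, map_sum]

/-- In the graded case, `ρ_y(·)_J` supercommutes with the parity. -/
theorem der_parity_iterate (h : ∀ I y a, ρ.parity (ρ.der [] I y a) =
      (-1 : ℤ) ^ I.card • ρ.der [] I y (ρ.parity a)) (J : Finset (Fin n))
    (y : Body (Fin d ⊕ Fin d)) (k : ℕ) (a : ρ.SmoothVec) :
    ρ.der [] J y ((ρ.parity^[k]) a) =
      ((-1 : ℂ) ^ (J.card * k)) • (ρ.parity^[k]) (ρ.der [] J y a) := by
  have h1 : ∀ a, ρ.der [] J y (ρ.parity a) = ((-1 : ℂ) ^ J.card) • ρ.parity (ρ.der [] J y a) := by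
    intro a
    rw [h, ← Int.cast_smul_eq_zsmul ℂ, smul_smul]
    push_cast
    rw [← mul_pow, mul_neg_one, neg_neg, one_pow, one_smul]
  induction k with
  | zero => simp
  | succ k ih =>
    rw [Function.iterate_succ_apply', h1, ih, Function.iterate_succ_apply', map_smul, smul_smul,
      ← pow_add]
    congr 2
    ring

variable [ContinuousMul A]

/-- `S` is the deformation of the product by the even variables, that is, the normalized
oscillating integral of `ρ_{y₁}(a) ρ_{y₂}(b)`. As the dual separates points, this determines `S`. -/
def IsEvenProduct (θ : ℝ) (S : ρ.SmoothVec →ₗ[ℂ] ρ.SmoothVec →ₗ[ℂ] ρ.SmoothVec) : Prop :=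
  ∀ a b (ℓ : ρ.SmoothVec →L[ℂ] ℂ), ℓ (S a b) = (((Real.pi * θ : ℝ) : ℂ) ^ (2 * d))⁻¹ *
    oscIntegral θ fun y₁ y₂ => ℓ (ρ.mul (ρ.even y₁ a) (ρ.even y₂ b))

theorem bilinBound_mul : BilinBound ρ.mul := fun _ hq => ρ.mul_bound hq

theorem bb_mul (ℓ : ρ.SmoothVec →L[ℂ] ℂ) (a b : ρ.SmoothVec) :
    BB fun y : Body (Fin d ⊕ Fin d) × Body (Fin d ⊕ Fin d) =>
      ℓ (ρ.mul (ρ.even y.1 a) (ρ.even y.2 b)) :=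
  (((ρ.boundedJet_even a).bilin (ρ.boundedJet_even b) ρ.bilinBound_mul).functional ℓ).1

variable {ρ} {θ : ℝ} {S : ρ.SmoothVec →ₗ[ℂ] ρ.SmoothVec →ₗ[ℂ] ρ.SmoothVec}

/-- Identities between products of translated elements integrate to identities for the even
deformed product. -/
theorem IsEvenProduct.map_eq_sum (hS : ρ.IsEvenProduct θ S) (hθ : θ ≠ 0)
    (T : ρ.SmoothVec →L[ℂ] ρ.SmoothVec) {ι : Type*} (s : Finset ι) (c : ι → ℂ)
    {a b : ρ.SmoothVec} (a' b' : ι → ρ.SmoothVec)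
    (h : ∀ y₁ y₂, T (ρ.mul (ρ.even y₁ a) (ρ.even y₂ b)) =
      ∑ i ∈ s, c i • ρ.mul (ρ.even y₁ (a' i)) (ρ.even y₂ (b' i))) :
    T (S a b) = ∑ i ∈ s, c i • S (a' i) (b' i) := by
  refine eq_of_forall_dual fun ℓ => ?_
  have h1 := hS a b (ℓ.comp T)
  simp only [ContinuousLinearMap.comp_apply, h, map_sum, map_smul, smul_eq_mul] at h1 ⊢
  rw [h1, (oscIntegral_sum hθ s c
    (f := fun i y => ℓ (ρ.mul (ρ.even y.1 (a' i)) (ρ.even y.2 (b' i))))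
    fun i => ρ.bb_mul ℓ (a' i) (b' i)).2, Finset.mul_sum]
  refine Finset.sum_congr rfl fun i _ => ?_
  rw [hS]
  ring

/-- The even deformed product inherits the graded Leibniz rule of the undeformed one. -/
theorem IsEvenProduct.der (hS : ρ.IsEvenProduct θ S) (hθ : θ ≠ 0) (L : Finset (Fin n))
    (y : Body (Fin d ⊕ Fin d)) (a b : ρ.SmoothVec) :
    ρ.der [] L y (S a b) = ∑ I ∈ L.powerset, (eps I (L \ I) : ℂ) •
      S (ρ.der [] I y a) ((ρ.parity^[I.card]) (ρ.der [] (L \ I) y b)) := by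
  refine hS.map_eq_sum hθ (ρ.derL L y) L.powerset (fun I => (eps I (L \ I) : ℂ))
    (fun I => ρ.der [] I y a) (fun I => (ρ.parity^[I.card]) (ρ.der [] (L \ I) y b))
    fun y₁ y₂ => ?_
  rw [derL_apply, der_mul]
  refine Finset.sum_congr rfl fun I _ => ?_
  rw [der_even, der_even, parity_iterate_even, Int.cast_smul_eq_zsmul]

theorem IsEvenProduct.even (hS : ρ.IsEvenProduct θ S) (hθ : θ ≠ 0)
    (y : Body (Fin d ⊕ Fin d)) (a b : ρ.SmoothVec) :
    ρ.even y (S a b) = S (ρ.even y a) (ρ.even y b) := by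
  rw [SuperAction.even, hS.der hθ, Finset.powerset_empty, Finset.sum_singleton, eps_empty_left]
  simp

theorem IsEvenProduct.parity (hS : ρ.IsEvenProduct θ S) (hθ : θ ≠ 0) (a b : ρ.SmoothVec) :
    ρ.parity (S a b) = S (ρ.parity a) (ρ.parity b) := by
  have := hS.map_eq_sum hθ ρ.parity {()} (fun _ => 1) (a := a) (b := b) (fun _ => ρ.parity a)
    (fun _ => ρ.parity b) fun y₁ y₂ => by
      rw [parity_mul, Finset.sum_singleton, one_smul, parity_even, parity_even]
  simpa using this

theorem IsEvenProduct.parity_iterate (hS : ρ.IsEvenProduct θ S) (hθ : θ ≠ 0) (k : ℕ)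
    (a b : ρ.SmoothVec) :
    (ρ.parity^[k]) (S a b) = S ((ρ.parity^[k]) a) ((ρ.parity^[k]) b) := by
  induction k with
  | zero => rfl
  | succ k ih => simp only [Function.iterate_succ_apply', ih, hS.parity hθ]

/-- If the algebra is ungraded, the products of two odd derivatives vanish. -/
theorem IsEvenProduct.odd_odd_eq_zero (hS : ρ.IsEvenProduct θ S) (hθ : θ ≠ 0)
    (hid : ∀ a, γ a = a) {I J : Finset (Fin n)} (hI : I.Nonempty) (hJ : J.Nonempty)
    (a b : ρ.SmoothVec) : S (ρ.odd I a) (ρ.odd J b) = 0 := by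
  have := hS.map_eq_sum hθ (ContinuousLinearMap.id ℂ _) (∅ : Finset Unit) (fun _ => 1)
    (a := ρ.odd I a) (b := ρ.odd J b) (fun _ => 0) (fun _ => 0) fun y₁ y₂ => by
      rw [odd_apply, odd_apply, ← der_even, ← der_even, Finset.sum_empty]
      exact ρ.mul_der_eq_zero hid hI hJ 0 _ _
  simpa using this

/-- The even deformed product is associative. -/
theorem IsEvenProduct.assoc (hS : ρ.IsEvenProduct θ S) (hθ : θ ≠ 0) (a b c : ρ.SmoothVec) :
    S (S a b) c = S a (S b c) := by
  refine eq_of_forall_dual fun ℓ => ?_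
  have hC : (((Real.pi * θ : ℝ) : ℂ) ^ (2 * d)) ≠ 0 :=
    pow_ne_zero _ (Complex.ofReal_ne_zero.2 (mul_ne_zero Real.pi_ne_zero hθ))
  set C := ((Real.pi * θ : ℝ) : ℂ) ^ (2 * d) with hCdef
  let Φ : Body (Fin d ⊕ Fin d) × Body (Fin d ⊕ Fin d) × Body (Fin d ⊕ Fin d) → ℂ := fun x =>
    ℓ (ρ.mul (ρ.even x.1 a) (ρ.mul (ρ.even x.2.1 b) (ρ.even x.2.2 c)))
  have hΦ : BB Φ := (((ρ.boundedJet_even a).bilin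
    ((ρ.boundedJet_even b).bilin (ρ.boundedJet_even c) ρ.bilinBound_mul)
      ρ.bilinBound_mul).functional ℓ).1
  have hmulr : ∀ u : ρ.SmoothVec, ∃ T : ρ.SmoothVec →L[ℂ] ρ.SmoothVec, ∀ v, T v = ρ.mul u v :=
    fun u => ⟨⟨ρ.mul u, ρ.continuous_mul.comp (continuous_const.prodMk continuous_id)⟩,
      fun _ => rfl⟩
  have hmull : ∀ v : ρ.SmoothVec, ∃ T : ρ.SmoothVec →L[ℂ] ρ.SmoothVec, ∀ u, T u = ρ.mul u v :=
    fun v => ⟨⟨ρ.mul.flip v, ρ.continuous_mul.comp (continuous_id.prodMk continuous_const)⟩,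
      fun _ => rfl⟩
  have heven : ∀ x y (u : ρ.SmoothVec), ρ.even x (ρ.even y u) = ρ.even (x + y) u := fun x y u => by
    rw [SuperAction.even, der_der, eps_empty_left, one_smul, List.nil_append, Finset.empty_union]
  -- The inner integrals are products with a translated deformed product.
  have k₁ : ∀ x y, oscIntegral θ (fun y₃ y₄ => Φ (x, y + y₃, y + y₄)) =
      C * ℓ (ρ.mul (ρ.even x a) (ρ.even y (S b c))) := by
    intro x y
    obtain ⟨T, hT⟩ := hmulr (ρ.even x a)
    have h := hS (ρ.even y b) (ρ.even y c) (ℓ.comp T)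
    simp only [ContinuousLinearMap.comp_apply, hT, heven] at h
    rw [hS.even hθ, h, ← hCdef, ← mul_assoc, mul_inv_cancel₀ hC, one_mul]
    simp only [Φ, add_comm y]
  have k₂ : ∀ x y, oscIntegral θ (fun y₁ y₂ => Φ (y₁ + x, y₂ + x, y)) =
      C * ℓ (ρ.mul (ρ.even x (S a b)) (ρ.even y c)) := by
    intro x y
    obtain ⟨T, hT⟩ := hmull (ρ.even y c)
    have h := hS (ρ.even x a) (ρ.even x b) (ℓ.comp T)
    simp only [ContinuousLinearMap.comp_apply, hT, heven, mul_mul] at h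
    rw [hS.even hθ, h, ← hCdef, ← mul_assoc, mul_inv_cancel₀ hC, one_mul]
  have h := oscIntegral_assoc hθ hΦ
    (by simp only [k₁]; exact (ρ.bb_mul ℓ a (S b c)).const_mul C)
    (by simp only [k₂]; exact (ρ.bb_mul ℓ (S a b) c).const_mul C)
  simp only [k₁, k₂] at h
  have e : ∀ u v, oscIntegral θ (fun y₁ y₂ => C * ℓ (ρ.mul (ρ.even y₁ u) (ρ.even y₂ v))) =
      C * (C * ℓ (S u v)) := by
    intro u v
    have := (oscIntegral_sum hθ {()} (fun _ => C)
      (f := fun _ y => ℓ (ρ.mul (ρ.even y.1 u) (ρ.even y.2 v)))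
      fun _ => ρ.bb_mul ℓ u v).2
    simp only [Finset.sum_singleton] at this
    rw [this, hS u v ℓ, ← hCdef, mul_inv_cancel_left₀ hC]
  rw [e, e] at h
  exact (mul_left_cancel₀ hC (mul_left_cancel₀ hC h)).symm

end SuperAction

end Deformed

/-! ### The deformation by the odd variables -/

section OddDeformation

variable {A : Type*} [NonUnitalRing A] [Module ℂ A] [IsScalarTower ℂ A A] [SMulCommClass ℂ A A]
  [UniformSpace A] [IsUniformAddGroup A] [ContinuousSMul ℂ A] [T2Space A]
variable {V : Type*} [AddCommGroup V] [Module ℝ V]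
variable {d n : ℕ}
variable {p : ℕ → Seminorm ℂ A} {γ : A →L[ℂ] A}

/-- The sign allows summing over all pairs of sets instead of the disjoint ones. -/
theorem sum_powerset_eps {M : Type*} [AddCommGroup M] [Module ℂ M]
    (g : Finset (Fin n) → Finset (Fin n) → M) :
    ∑ L : Finset (Fin n), ∑ I ∈ L.powerset, (eps I (L \ I) : ℂ) • g I (L \ I) =
      ∑ I : Finset (Fin n), ∑ J : Finset (Fin n), (eps I J : ℂ) • g I J := by
  rw [sum_powerset_sdiff fun I J => (eps I J : ℂ) • g I J]
  refine Finset.sum_congr rfl fun I _ => Finset.sum_congr rfl fun J _ => ?_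
  split_ifs with h
  · rfl
  · rw [eps_of_not_disjoint h, Int.cast_zero, zero_smul]

theorem eps_comm_cast (I J : Finset (Fin n)) :
    (eps J I : ℂ) = (-1) ^ (I.card * J.card) * (eps I J : ℂ) := by
  rw [eps_comm I J]
  push_cast
  rfl

namespace SuperAction

variable (ρ : SuperAction (Fin d ⊕ Fin d) n V p γ)
variable [hp : Fact (WithSeminorms p)] [PolynormableSpace ℂ A]
variable [hV : Fact (¬ FiniteDimensional ℝ V)]

/-- The deformation by the odd variables of a product `S`. -/
def oddDeform (θ α : ℝ) (S : ρ.SmoothVec →ₗ[ℂ] ρ.SmoothVec →ₗ[ℂ] ρ.SmoothVec)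
    (a b : ρ.SmoothVec) : ρ.SmoothVec :=
  ∑ K : Finset (Fin n), oddCoeff θ α K.card • S (ρ.odd K a) ((ρ.parity^[K.card]) (ρ.odd K b))

/-- The action supercommutes with the parity. -/
def ParityGraded : Prop := ∀ I y a, ρ.parity (ρ.der [] I y a) =
  (-1 : ℤ) ^ I.card • ρ.der [] I y (ρ.parity a)

variable [hγ : Fact (IsParity γ)] [ContinuousMul A]
variable {ρ} {θ : ℝ} {S : ρ.SmoothVec →ₗ[ℂ] ρ.SmoothVec →ₗ[ℂ] ρ.SmoothVec}

/-- If the algebra is ungraded, the odd deformation is trivial. -/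
theorem IsEvenProduct.oddDeform_of_ungraded (hS : ρ.IsEvenProduct θ S) (hθ : θ ≠ 0)
    (hid : ∀ a, γ a = a) (α : ℝ) (a b : ρ.SmoothVec) : ρ.oddDeform θ α S a b = S a b := by
  have hpar : ∀ k a, (ρ.parity^[k]) a = a := fun k a => by
    refine ρ.incl_injective ?_
    rw [incl_parity_iterate, iterate_parity hγ.out, hid, ite_self]
  rw [oddDeform, Finset.sum_eq_single ∅]
  · rw [Finset.card_empty, oddCoeff_zero, one_smul, odd_empty, hpar, odd_empty]
  · intro K _ hK
    have hne := Finset.nonempty_iff_ne_empty.2 hK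
    rw [hpar, hS.odd_odd_eq_zero hθ hid hne hne, smul_zero]
  · simp

/-- The graded Leibniz rule for the odd deformation: the operators `ρ_y(·)_L` supercommute with the
`δ_K` and with the parity, and the two signs cancel. -/
theorem IsEvenProduct.oddDeform_der_of_graded (hS : ρ.IsEvenProduct θ S) (hθ : θ ≠ 0)
    (hgr : ρ.ParityGraded) (α : ℝ) (L : Finset (Fin n)) (y : Body (Fin d ⊕ Fin d))
    (a b : ρ.SmoothVec) :
    ρ.der [] L y (ρ.oddDeform θ α S a b) = ∑ I ∈ L.powerset, (eps I (L \ I) : ℂ) •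
      ρ.oddDeform θ α S (ρ.der [] I y a) ((ρ.parity^[I.card]) (ρ.der [] (L \ I) y b)) := by
  have hcomm : ∀ I K (u : ρ.SmoothVec), ρ.der [] I y (ρ.odd K u) =
      ((-1 : ℂ) ^ (I.card * K.card)) • ρ.odd K (ρ.der [] I y u) := by
    intro I K u
    rw [odd_apply, odd_apply, der_der, der_der, Finset.union_comm K I, add_comm y 0,
      ← Int.cast_smul_eq_zsmul ℂ, ← Int.cast_smul_eq_zsmul ℂ, smul_smul, eps_comm_cast K I,
      mul_comm K.card]
  simp only [oddDeform, map_sum, map_smul, Finset.smul_sum, hS.der hθ]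
  rw [Finset.sum_comm]
  refine Finset.sum_congr rfl fun I _ => Finset.sum_congr rfl fun K _ => ?_
  have h1 : ρ.odd K ((ρ.parity^[I.card]) (ρ.der [] (L \ I) y b)) =
      ((-1 : ℂ) ^ (K.card * I.card)) • (ρ.parity^[I.card]) (ρ.odd K (ρ.der [] (L \ I) y b)) :=
    ρ.der_parity_iterate hgr K 0 I.card _
  rw [hcomm, ρ.der_parity_iterate hgr, hcomm, h1]
  simp only [parity_iterate_smul, map_smul, LinearMap.smul_apply, smul_smul,
    ← Function.iterate_add_apply]
  rw [add_comm K.card I.card]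
  congr 1
  have h2 : ((-1 : ℂ) ^ ((L \ I).card * K.card)) * (-1) ^ ((L \ I).card * K.card) = 1 := by
    rw [← mul_pow, mul_neg_one, neg_neg, one_pow]
  rw [mul_comm K.card I.card]
  linear_combination (oddCoeff θ α K.card * (eps I (L \ I) : ℂ) * (-1) ^ (I.card * K.card)) * h2

/-- Associativity of the odd deformation. By the Leibniz rule, both sides are sums over triples
`(I, J, K)` of the terms `δ_{I ∪ J}(a) δ_{I ∪ K}(b) δ_{J ∪ K}(c)`, up to parities; the signs `ε` and
the coefficients `oddCoeff` agree by `eps_comm` and `oddCoeff_add`. -/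
theorem IsEvenProduct.oddDeform_assoc_of_graded (hS : ρ.IsEvenProduct θ S) (hθ : θ ≠ 0)
    (hgr : ρ.ParityGraded) (α : ℝ) (a b c : ρ.SmoothVec) :
    ρ.oddDeform θ α S (ρ.oddDeform θ α S a b) c =
      ρ.oddDeform θ α S a (ρ.oddDeform θ α S b c) := by
  have hodd : ∀ L (u v : ρ.SmoothVec), ρ.odd L (S u v) = ∑ I ∈ L.powerset,
      (eps I (L \ I) : ℂ) • S (ρ.odd I u) ((ρ.parity^[I.card]) (ρ.odd (L \ I) v)) :=
    fun L u v => hS.der hθ L 0 u v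
  have hpar : ∀ J k (u : ρ.SmoothVec), ρ.odd J ((ρ.parity^[k]) u) =
      ((-1 : ℂ) ^ (J.card * k)) • (ρ.parity^[k]) (ρ.odd J u) :=
    fun J k u => ρ.der_parity_iterate hgr J 0 k u
  let o : Finset (Fin n) → ℂ := fun K => oddCoeff θ α K.card
  -- The summands of both sides, indexed by triples of sets.
  let X : Finset (Fin n) → Finset (Fin n) → Finset (Fin n) → ρ.SmoothVec := fun I J K =>
    S (ρ.odd (I ∪ K) a) (S ((ρ.parity^[I.card + K.card]) (ρ.odd (J ∪ K) b))
      ((ρ.parity^[I.card + J.card]) (ρ.odd (I ∪ J) c)))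
  have hl : ρ.oddDeform θ α S (ρ.oddDeform θ α S a b) c = ∑ I, ∑ J, ∑ K,
      ((eps I J : ℂ) * (oddCoeff θ α (I.card + J.card) * (o K * (eps I K * (eps J K *
        (-1) ^ (J.card * K.card)))))) • X I J K := by
    have h1 := sum_powerset_eps fun I J : Finset (Fin n) => ∑ K, (oddCoeff θ α (I.card + J.card) *
      (o K * (eps I K * (eps J K * (-1) ^ (J.card * K.card))))) • X I J K
    simp only [Finset.smul_sum, smul_smul] at h1
    rw [← h1, oddDeform]
    refine Finset.sum_congr rfl fun L _ => ?_
    simp only [oddDeform, map_sum, map_smul, hodd, Finset.smul_sum, LinearMap.sum_apply,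
      LinearMap.smul_apply, smul_smul]
    rw [Finset.sum_comm]
    refine Finset.sum_congr rfl fun I hI => Finset.sum_congr rfl fun K _ => ?_
    have hIL := Finset.mem_powerset.1 hI
    have hcard : I.card + (L \ I).card = L.card := by
      rw [add_comm]; exact Finset.card_sdiff_add_card_eq_card hIL
    simp only [X, hpar, odd_odd, parity_iterate_smul, map_smul, LinearMap.smul_apply, smul_smul,
      hS.assoc hθ, ← Function.iterate_add_apply, hcard, Finset.union_sdiff_of_subset hIL]
    congr 1
    simp only [o]
    ring
  have hr : ρ.oddDeform θ α S a (ρ.oddDeform θ α S b c) = ∑ K, ∑ I, ∑ J,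
      ((eps K I : ℂ) * (oddCoeff θ α (K.card + I.card) * (o J * (eps K J * (eps I J *
        (-1) ^ (I.card * J.card)))))) • X I J K := by
    have h1 := sum_powerset_eps fun K I : Finset (Fin n) => ∑ J, (oddCoeff θ α (K.card + I.card) *
      (o J * (eps K J * (eps I J * (-1) ^ (I.card * J.card))))) • X I J K
    simp only [Finset.smul_sum, smul_smul] at h1
    rw [← h1, oddDeform]
    refine Finset.sum_congr rfl fun L _ => ?_
    simp only [oddDeform, map_sum, map_smul, hodd, Finset.smul_sum, parity_iterate_sum,
      parity_iterate_smul, smul_smul]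
    rw [Finset.sum_comm]
    refine Finset.sum_congr rfl fun K hK => Finset.sum_congr rfl fun J _ => ?_
    have hKL := Finset.mem_powerset.1 hK
    have hcard : K.card + (L \ K).card = L.card := by
      rw [add_comm]; exact Finset.card_sdiff_add_card_eq_card hKL
    have hexp : L.card + (K.card + J.card) = 2 * K.card + ((L \ K).card + J.card) := by omega
    simp only [X, hpar, odd_odd, parity_iterate_smul, map_smul, LinearMap.smul_apply, smul_smul,
      hS.parity_iterate hθ, ← Function.iterate_add_apply, hcard]
    rw [hexp, parity_iterate_even_add, Finset.union_comm (L \ K) K,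
      Finset.union_sdiff_of_subset hKL, Finset.union_comm J K, add_comm (L \ K).card K.card, hcard]
    congr 1
    simp only [o]
    ring
  rw [hl, (hr.trans Finset.sum_comm).trans (Finset.sum_congr rfl fun I _ => Finset.sum_comm)]
  refine Finset.sum_congr rfl fun I _ => Finset.sum_congr rfl fun J _ =>
    Finset.sum_congr rfl fun K _ => ?_
  congr 1
  rw [oddCoeff_add, oddCoeff_add, eps_comm_cast I K, eps_comm_cast J K, mul_comm K.card I.card]
  have h1 : ((-1 : ℂ) ^ (I.card * K.card)) * (-1) ^ (I.card * K.card) = 1 := by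
    rw [← mul_pow, mul_neg_one, neg_neg, one_pow]
  simp only [o]
  linear_combination (-(eps I J : ℂ) * eps I K * eps J K * (-1) ^ (I.card * J.card) *
    (-1) ^ (J.card * K.card) * oddCoeff θ α I.card * oddCoeff θ α J.card * oddCoeff θ α K.card) * h1

theorem IsEvenProduct.oddDeform_parity (hS : ρ.IsEvenProduct θ S) (hθ : θ ≠ 0) (α : ℝ)
    (a b : ρ.SmoothVec) : ρ.parity (ρ.oddDeform θ α S a b) =
      ρ.oddDeform θ α S (ρ.parity a) (ρ.parity b) := by
  rcases ρ.parity_der with h | hgr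
  · simp only [ρ.parity_eq_self h]
  · simp only [oddDeform, map_sum, map_smul]
    refine Finset.sum_congr rfl fun K _ => ?_
    have h1 : ∀ u : ρ.SmoothVec, ρ.odd K (ρ.parity u) =
        ((-1 : ℂ) ^ K.card) • ρ.parity (ρ.odd K u) := fun u => by
      have := ρ.der_parity_iterate hgr K 0 1 u
      simp only [mul_one, Function.iterate_one] at this
      exact this
    have h2 : ((-1 : ℂ) ^ K.card) * (-1) ^ K.card = 1 := by
      rw [← mul_pow, mul_neg_one, neg_neg, one_pow]
    simp only [h1, parity_iterate_smul, map_smul, LinearMap.smul_apply, smul_smul, h2, mul_one]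
    rw [hS.parity hθ, ← Function.iterate_succ_apply (⇑ρ.parity),
      Function.iterate_succ_apply']

/-- The action is compatible with the deformed product in the same way as with the undeformed
one. -/
theorem IsEvenProduct.oddDeform_der (hS : ρ.IsEvenProduct θ S) (hθ : θ ≠ 0) (α : ℝ)
    (L : Finset (Fin n)) (y : Body (Fin d ⊕ Fin d)) (a b : ρ.SmoothVec) :
    ρ.der [] L y (ρ.oddDeform θ α S a b) = ∑ I ∈ L.powerset, (eps I (L \ I) : ℂ) •
      ρ.oddDeform θ α S (ρ.der [] I y a) ((ρ.parity^[I.card]) (ρ.der [] (L \ I) y b)) := by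
  rcases ρ.parity_der with h | h
  · simp only [hS.oddDeform_of_ungraded hθ h]
    exact hS.der hθ L y a b
  · exact hS.oddDeform_der_of_graded hθ h α L y a b

theorem IsEvenProduct.oddDeform_assoc (hS : ρ.IsEvenProduct θ S) (hθ : θ ≠ 0) (α : ℝ)
    (a b c : ρ.SmoothVec) :
    ρ.oddDeform θ α S (ρ.oddDeform θ α S a b) c =
      ρ.oddDeform θ α S a (ρ.oddDeform θ α S b c) := by
  rcases ρ.parity_der with h | h
  · simp only [hS.oddDeform_of_ungraded hθ h]
    exact hS.assoc hθ a b c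
  · exact hS.oddDeform_assoc_of_graded hθ h α a b c

end SuperAction

end OddDeformation

/-! ### Units -/

section Units

variable {A : Type*} [NonUnitalRing A] [Module ℂ A] [IsScalarTower ℂ A A] [SMulCommClass ℂ A A]
  [UniformSpace A] [IsUniformAddGroup A] [ContinuousSMul ℂ A] [T2Space A]
variable {V : Type*} [AddCommGroup V] [Module ℝ V]
variable {d n : ℕ}
variable {p : ℕ → Seminorm ℂ A} {γ : A →L[ℂ] A}

/-- A unit is invariant under a family of operators that satisfies the rule of an action of the
supergroup by automorphisms. -/
theorem unit_invariant {X : Type*} [AddCommGroup X] {M : X →+ X →+ X} {P : X →+ X}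
    (hP : ∀ a, P (P a) = a) {T : Finset (Fin n) → X →+ X} (hsurj : Function.Surjective (T ∅))
    (hmul : ∀ L a b, T L (M a b) = ∑ I ∈ L.powerset, eps I (L \ I) •
      M (T I a) ((P^[I.card]) (T (L \ I) b)))
    {e : X} (he : ∀ a, M e a = a ∧ M a e = a) (L : Finset (Fin n)) :
    T L e = if L = ∅ then e else 0 := by
  have h0 : T ∅ e = e := by
    obtain ⟨u, hu⟩ := hsurj e
    have h := hmul ∅ e u
    rw [Finset.powerset_empty, Finset.sum_singleton, eps_empty_left, one_smul, Finset.card_empty,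
      Function.iterate_zero_apply, Finset.empty_sdiff, (he u).1, hu, (he _).2] at h
    exact h.symm
  induction hk : L.card using Nat.strong_induction_on generalizing L with
  | _ k ih =>
  split_ifs with hL
  · rw [hL, h0]
  · -- In the expansion of `T L (e * a)`, the factors `T I e` with `I` a proper subset vanish.
    have key : ∀ a, M (T L e) ((P^[L.card]) (T ∅ a)) = 0 := by
      intro a
      have h := hmul L e a
      have hterm : ∀ I ∈ L.powerset.erase L, eps I (L \ I) •
          M (T I e) ((P^[I.card]) (T (L \ I) a)) = if I = ∅ then T L a else 0 := by
        intro I hI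
        have hIL := Finset.mem_powerset.1 (Finset.mem_of_mem_erase hI)
        have hlt : I.card < L.card :=
          Finset.card_lt_card (Finset.ssubset_iff_subset_ne.2 ⟨hIL, Finset.ne_of_mem_erase hI⟩)
        rw [ih I.card (hk ▸ hlt) I rfl]
        split_ifs with hI0
        · rw [hI0, eps_empty_left, one_smul, Finset.card_empty, Function.iterate_zero_apply,
            Finset.sdiff_empty, (he _).1]
        · simp
      rw [(he a).1, ← Finset.add_sum_erase _ _ (Finset.mem_powerset_self L),
        Finset.sum_congr rfl hterm, Finset.sum_ite_eq', if_pos (Finset.mem_erase.2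
          ⟨fun h => hL h.symm, Finset.empty_mem_powerset L⟩), Finset.sdiff_self, eps_empty_right,
        one_smul] at h
      exact add_eq_right.1 h.symm
    obtain ⟨u, hu⟩ := hsurj ((P^[L.card]) e)
    have h := key u
    have hPP : ∀ k a, (P^[k]) ((P^[k]) a) = a := fun k a => by
      rw [← Function.iterate_add_apply, ← two_mul, Function.Involutive.iterate_two_mul hP]
      rfl
    rwa [hu, hPP, (he _).2] at h

theorem isSmooth_const {σ : Type} [Fintype σ] [DecidableEq σ] {G : Type*} [AddCommGroup G]
    [Module ℂ G] [TopologicalSpace G] [T2Space G] (v : G) : IsSmooth fun _ : Body σ => v := by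
  refine (isSmooth_of_family (g := fun l _ => if l = [] then v else 0)
    (fun l => continuous_const) fun l i x => ?_).1
  simp [HasPDeriv]

namespace SuperAction

variable (ρ : SuperAction (Fin d ⊕ Fin d) n V p γ)
variable [hp : Fact (WithSeminorms p)] [PolynormableSpace ℂ A]
variable [hV : Fact (¬ FiniteDimensional ℝ V)] [hγ : Fact (IsParity γ)]

/-- A unit of the algebra is invariant under the action. -/
theorem comp_unit {e : A} (he : ∀ a : A, e * a = a ∧ a * e = a) (L : Finset (Fin n))
    (y : Body (Fin d ⊕ Fin d)) : ρ.comp L y e = if L = ∅ then e else 0 := by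
  refine unit_invariant (M := AddMonoidHom.mul) (P := γ.toLinearMap.toAddMonoidHom)
    (T := fun I => (ρ.comp I y).toAddMonoidHom) hγ.out.involutive (fun a => ⟨ρ.comp ∅ (-y) a, ?_⟩)
    (fun L a b => ρ.comp_mul hV.out hγ.out L y a b) he L
  refine (ρ.comp_comp hV.out ∅ ∅ y (-y) a).trans ?_
  rw [eps_empty_left, one_smul, add_neg_cancel, Finset.empty_union, comp_zero]

/-- A unit of the algebra is a smooth vector. -/
theorem exists_smooth_unit {e : A} (he : ∀ a : A, e * a = a ∧ a * e = a) :
    ∃ e' : ρ.SmoothVec, ρ.incl e' = e ∧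
      ∀ L y, ρ.der [] L y e' = if L = ∅ then e' else 0 := by
  have h : e ∈ ρ.smoothSubmodule := fun I => by
    have : ρ.orbit e I = fun _ => if I = ∅ then e else 0 := funext fun y => ρ.comp_unit he I y
    rw [this]
    exact isSmooth_const _
  let e' : ρ.SmoothVec := ⟨e, h⟩
  refine ⟨e', rfl, fun L y => ρ.incl_injective ((ρ.comp_unit he L y).trans ?_)⟩
  by_cases hL : L = ∅
  · rw [if_pos hL, if_pos hL]
    rfl
  · rw [if_neg hL, if_neg hL, map_zero]

variable [ContinuousMul A] {ρ} {θ α : ℝ}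
  {S : ρ.SmoothVec →ₗ[ℂ] ρ.SmoothVec →ₗ[ℂ] ρ.SmoothVec}

/-- An invariant unit is a unit of the deformed product: only the term `K = ∅` survives, and it is
computed by the normalization of the oscillating integral. -/
theorem IsEvenProduct.oddDeform_unit (hS : ρ.IsEvenProduct θ S) (hθ : θ ≠ 0) {e : ρ.SmoothVec}
    (he : ∀ a, ρ.mul e a = a ∧ ρ.mul a e = a)
    (hinv : ∀ L y, ρ.der [] L y e = if L = ∅ then e else 0) (a : ρ.SmoothVec) :
    ρ.oddDeform θ α S e a = a ∧ ρ.oddDeform θ α S a e = a := by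
  have hC : (((Real.pi * θ : ℝ) : ℂ) ^ (2 * d)) ≠ 0 :=
    pow_ne_zero _ (Complex.ofReal_ne_zero.2 (mul_ne_zero Real.pi_ne_zero hθ))
  have hodd : ∀ K : Finset (Fin n), K ≠ ∅ → ρ.odd K e = 0 := fun K hK => by
    rw [odd_apply, hinv, if_neg hK]
  have heven : ∀ y, ρ.even y e = e := fun y => by rw [SuperAction.even, hinv, if_pos rfl]
  have hzero : ∀ k, (ρ.parity^[k]) 0 = 0 := fun k => by
    have := ρ.parity_iterate_smul k 0 0
    rwa [zero_smul, zero_smul] at this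
  have hbb := fun ℓ : ρ.SmoothVec →L[ℂ] ℂ => ((ρ.boundedJet_even a).functional ℓ).1
  constructor
  · rw [oddDeform, Finset.sum_eq_single ∅ (fun K _ hK => by
      rw [hodd K hK, map_zero, LinearMap.zero_apply, smul_zero]) (by simp), odd_empty, odd_empty,
      Finset.card_empty, oddCoeff_zero, one_smul]
    refine eq_of_forall_dual fun ℓ => ?_
    rw [Function.iterate_zero_apply, hS]
    simp only [heven, (he _).1]
    rw [oscIntegral_snd hθ (hbb ℓ), inv_mul_cancel_left₀ hC, der_nil_empty_zero]
  · rw [oddDeform, Finset.sum_eq_single ∅ (fun K _ hK => by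
      rw [hodd K hK, hzero, map_zero, smul_zero]) (by simp), odd_empty, odd_empty,
      Finset.card_empty, oddCoeff_zero, one_smul]
    refine eq_of_forall_dual fun ℓ => ?_
    rw [Function.iterate_zero_apply, hS]
    simp only [heven, (he _).2]
    rw [oscIntegral_fst hθ (hbb ℓ), inv_mul_cancel_left₀ hC, der_nil_empty_zero]

/-- A unit of the deformed product is invariant under the action. -/
theorem IsEvenProduct.der_unit (hS : ρ.IsEvenProduct θ S) (hθ : θ ≠ 0)
    {e : ρ.SmoothVec}
    (he : ∀ a, ρ.oddDeform θ α S e a = a ∧ ρ.oddDeform θ α S a e = a) (L : Finset (Fin n))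
    (y : Body (Fin d ⊕ Fin d)) : ρ.der [] L y e = if L = ∅ then e else 0 := by
  let M : ρ.SmoothVec →+ ρ.SmoothVec →+ ρ.SmoothVec :=
    AddMonoidHom.mk' (fun a => AddMonoidHom.mk' (fun b => ρ.oddDeform θ α S a b) fun b b' => by
      simp only [oddDeform, map_add, parity_iterate_add, smul_add, Finset.sum_add_distrib])
      fun a a' => by
        ext b
        simp only [oddDeform, map_add, LinearMap.add_apply, smul_add, Finset.sum_add_distrib,
          AddMonoidHom.mk'_apply, AddMonoidHom.add_apply]
  refine unit_invariant (M := M) (P := ρ.parity.toLinearMap.toAddMonoidHom)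
    (T := fun I => (ρ.der [] I y).toAddMonoidHom) ρ.parity_parity
    (fun a => ⟨ρ.der [] ∅ (-y) a, ?_⟩) (fun L a b => ?_) he L
  · refine (ρ.der_der [] [] ∅ ∅ y (-y) a).trans ?_
    rw [eps_empty_left, one_smul, add_neg_cancel, Finset.empty_union, List.nil_append,
      der_nil_empty_zero]
  · refine (hS.oddDeform_der hθ α L y a b).trans (Finset.sum_congr rfl fun I _ => ?_)
    rw [Int.cast_smul_eq_zsmul]
    rfl

end SuperAction

end Units

/-! ### The product deformed by the twist -/

section TwistedComoduleAlgebra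

variable {A : Type*} [NonUnitalRing A] [Module ℂ A] [IsScalarTower ℂ A A] [SMulCommClass ℂ A A]
  [UniformSpace A] [IsUniformAddGroup A] [ContinuousSMul ℂ A] [T2Space A]
variable {V : Type*} [AddCommGroup V] [Module ℝ V]
variable {d n : ℕ}
variable {p : ℕ → Seminorm ℂ A} {γ : A →L[ℂ] A}

namespace SuperAction

variable (ρ : SuperAction (Fin d ⊕ Fin d) n V p γ)
variable [hp : Fact (WithSeminorms p)] [PolynormableSpace ℂ A]
variable [hV : Fact (¬ FiniteDimensional ℝ V)] [hγ : Fact (IsParity γ)]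

/-- The twist exists as a continuous operator, and composing it with the product gives the odd
deformation of an even deformed product. -/
theorem exists_twist [ContinuousMul A] [CompleteSpace A] [(uniformity A).IsCountablyGenerated]
    {θ α : ℝ} (hθ : θ ≠ 0) (hα₀ : α ≠ 0) (hα₁ : α ≠ -1)
    (μ₀ : ProjCompl ρ.SmoothVec ρ.SmoothVec →L[ℂ] ρ.SmoothVec)
    (hμ₀ : ∀ a b, μ₀ (tens a b) = ρ.mul a b) :
    ∃ F : ProjCompl ρ.SmoothVec ρ.SmoothVec →L[ℂ] ProjCompl ρ.SmoothVec ρ.SmoothVec,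
      (∀ a b, IsTwistIntegral θ α
        (sigma23 ρ.parity (ρ.coact a).coeff (ρ.coact b).coeff) (F (tens a b))) ∧
      ∃ S, ρ.IsEvenProduct θ S ∧ ∀ a b, μ₀ (F (tens a b)) = ρ.oddDeform θ α S a b := by
  obtain ⟨F₀, hF₀, hdual⟩ := ρ.exists_evenTwist hθ
  let C : ℂ := (((Real.pi * θ : ℝ) : ℂ) ^ (2 * d))⁻¹
  let P : ℕ → ρ.SmoothVec →L[ℂ] ρ.SmoothVec := fun k => ρ.parity ^ k
  have hP : ∀ k a, P k a = (ρ.parity^[k]) a := fun k a =>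
    congrFun (hom_coe_pow (fun f : ρ.SmoothVec →L[ℂ] ρ.SmoothVec => ⇑f) rfl (fun _ _ => rfl)
      ρ.parity k) a
  obtain ⟨F, hF⟩ := exists_projLift (∑ K : Finset (Fin n), (C * oddCoeff θ α K.card) •
      F₀.compl₁₂ (ρ.odd K).toLinearMap ((P K.card).comp (ρ.odd K)).toLinearMap)
    (BilinBound.sum _ fun K => (hF₀.compl₁₂ _ _).const_smul _)
  have hF' : ∀ a b, F (tens a b) = ∑ K : Finset (Fin n), (C * oddCoeff θ α K.card) •
      F₀ (ρ.odd K a) ((ρ.parity^[K.card]) (ρ.odd K b)) := fun a b => by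
    rw [hF]
    simp only [LinearMap.sum_apply, LinearMap.smul_apply, LinearMap.compl₁₂_apply,
      ContinuousLinearMap.coe_coe, ContinuousLinearMap.comp_apply, hP]
  refine ⟨F, fun a b ℓ => ?_, C • F₀.compr₂ μ₀.toLinearMap, fun a b ℓ => ?_, fun a b => ?_⟩
  · have h1 : ∀ y₁ y₂, ℓ (kappa d n θ α • berezin (oddMul (fun q =>
        sigma23 ρ.parity (ρ.coact a).coeff (ρ.coact b).coeff q y₁ y₂)
        (oddExp n (-(2 * Complex.I / θ) * ((1 + α) ^ 2 / (2 * α)))))) =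
        ∑ K : Finset (Fin n), (C * oddCoeff θ α K.card) * ℓ (tens (ρ.even y₁ (ρ.odd K a))
          (ρ.even y₂ ((ρ.parity^[K.card]) (ρ.odd K b)))) := by
      intro y₁ y₂
      rw [kappa_smul_berezin hθ hα₀ hα₁, map_sum]
      refine Finset.sum_congr rfl fun K _ => ?_
      rw [map_smul, smul_eq_mul, ← parity_iterate_even, even_odd, even_odd]
      rfl
    simp only [h1]
    rw [(oscIntegral_sum hθ Finset.univ (fun K : Finset (Fin n) => C * oddCoeff θ α K.card)
      fun K => ρ.bb_tens ℓ (ρ.odd K a) ((ρ.parity^[K.card]) (ρ.odd K b))).2, hF', map_sum]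
    refine Finset.sum_congr rfl fun K _ => ?_
    rw [map_smul, smul_eq_mul, hdual]
  · have h1 := hdual a b (ℓ.comp μ₀)
    simp only [ContinuousLinearMap.comp_apply, hμ₀] at h1
    rw [← h1, LinearMap.smul_apply, LinearMap.smul_apply, map_smul, smul_eq_mul]
    rfl
  · rw [hF', map_sum, oddDeform]
    refine Finset.sum_congr rfl fun K _ => ?_
    rw [map_smul, mul_comm, ← smul_smul]
    rfl

end SuperAction

end TwistedComoduleAlgebra

end

end SuperUDF

theorem mainTheorem2 {A V : Type*}
    [NonUnitalRing A] [Module ℂ A] [IsScalarTower ℂ A A] [SMulCommClass ℂ A A]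
    [UniformSpace A] [IsUniformAddGroup A] [ContinuousSMul ℂ A] [ContinuousMul A]
    [CompleteSpace A] [T2Space A]
    [AddCommGroup V] [Module ℝ V] (hV : ¬ FiniteDimensional ℝ V)
    (d n : ℕ) (θ α : ℝ) (hθ : θ ≠ 0) (hα₀ : α ≠ 0) (hα₁ : α ≠ -1)
    (p : ℕ → Seminorm ℂ A) (hp : WithSeminorms p)
    (γ : A →L[ℂ] A) (hγ : SuperUDF.IsParity γ)
    (ρ : SuperUDF.SuperAction (Fin d ⊕ Fin d) n V p γ) :
    ∃ (P : ρ.SmoothVec →L[ℂ] ρ.SmoothVec)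
      (χ : ρ.SmoothVec →L[ℂ] SuperUDF.BSuper (Fin d ⊕ Fin d) n ρ.SmoothVec)
      (μ₀ : SuperUDF.ProjCompl ρ.SmoothVec ρ.SmoothVec →L[ℂ] ρ.SmoothVec)
      (F : SuperUDF.ProjCompl ρ.SmoothVec ρ.SmoothVec →L[ℂ]
        SuperUDF.ProjCompl ρ.SmoothVec ρ.SmoothVec),
      -- `P` is the grading of the smooth vectors
      (∀ a, ρ.incl (P a) = γ (ρ.incl a)) ∧
      -- `χ(a)(z) = ρ_z(a)`
      (∀ a z, SuperUDF.superEval (fun I y => ρ.incl ((χ a).coeff I y)) z =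
        ρ.act z (ρ.incl a ⊗ₜ[ℝ] 1)) ∧
      -- `μ₀` is the undeformed product
      (∀ a b, ρ.incl (μ₀ (SuperUDF.tens a b)) = ρ.incl a * ρ.incl b) ∧
      -- `F = κ ∫ dz₁ dz₂ exp(-(2i/θ) ω̃(z₁, z₂)) ρ_{z₁} ⊗ ρ_{z₂}`
      (∀ a b, SuperUDF.IsTwistIntegral θ α
        (SuperUDF.sigma23 P (χ a).coeff (χ b).coeff) (F (SuperUDF.tens a b))) ∧
      -- a unit of `A` is a unit of the deformed product
      (∀ e : A, (∀ a : A, e * a = a ∧ a * e = a) → ∃ e' : ρ.SmoothVec, ρ.incl e' = e ∧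
        ∀ a, (μ₀.comp F) (SuperUDF.tens e' a) = a ∧ (μ₀.comp F) (SuperUDF.tens a e') = a) ∧
      -- the smooth vectors with the deformed product are a comodule algebra
      SuperUDF.IsFrechetComoduleAlgebra P (μ₀.comp F) χ := by
  have := Fact.mk hV
  have := Fact.mk hp
  have := Fact.mk hγ
  have : PolynormableSpace ℂ A := hp.toPolynormableSpace
  have : FirstCountableTopology A := hp.firstCountableTopology
  have : (uniformity A).IsCountablyGenerated := IsUniformAddGroup.uniformity_countably_generated
  obtain ⟨μ₀, hμ₀⟩ := SuperUDF.exists_projLift ρ.mul ρ.bilinBound_mul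
  obtain ⟨F, hF, S, hS, hμF⟩ := ρ.exists_twist hθ hα₀ hα₁ μ₀ hμ₀
  have hμF' : ∀ a b, (μ₀.comp F) (SuperUDF.tens a b) = ρ.oddDeform θ α S a b := hμF
  refine ⟨ρ.parity, ⟨ρ.coact, ρ.continuous_coact⟩, μ₀, F, ρ.incl_parity, fun a z => ?_,
    fun a b => ?_, hF, fun e he => ?_, ?_⟩
  · exact (ρ.act_expand z (ρ.incl a)).symm
  · rw [hμ₀, ρ.incl_mul]
  · obtain ⟨e', rfl, hinv⟩ := ρ.exists_smooth_unit he
    refine ⟨e', rfl, fun a => ?_⟩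
    rw [hμF', hμF']
    exact hS.oddDeform_unit hθ
      (fun a => ⟨ρ.incl_injective (he _).1, ρ.incl_injective (he _).2⟩) hinv a
  · refine ⟨⟨ρ.isFrechetSpace_smoothVec, fun a b c => ?_, ρ.parity_parity, fun a b => ?_⟩,
      fun a => ?_, ρ.der_nil_empty_zero, fun a b => ?_, fun e he => ?_⟩
    · simp only [hμF']
      exact hS.oddDeform_assoc hθ α a b c
    · simp only [hμF']
      exact hS.oddDeform_parity hθ α a b
    · funext q y₁ y₂
      exact (ρ.der_der [] [] q.1 q.2 y₁ y₂ a).symm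
    · funext L y
      change _ = ρ.der [] L y ((μ₀.comp F) (SuperUDF.tens a b))
      rw [hμF', hS.oddDeform_der hθ]
      refine Finset.sum_congr rfl fun I _ => ?_
      rw [Int.cast_smul_eq_zsmul, ← hμF']
      rfl
    · funext L y
      refine hS.der_unit (α := α) hθ (fun a => ?_) L y
      rw [← hμF', ← hμF']
      exact he a
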